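/- **Theorem.** Let $(M,\omega)$ be a $2n$-dimensional symplectic manifold, $\omega=\frac12\omega_{ij}dx^i\wedge dx^j$, $(\omega^{ij})=(\omega_{ij})^{-1}$, and let $\nabla$ be a symplectic connection (smooth, torsion-free, $\nabla\omega=0$) with curvature $\frac12R^i_{jkl}dx^k\wedge dx^l$. Put $R_{ijkl}=\omega_{im}R^m_{jkl}$ and $R_\nabla=\frac14R_{ijkl}y^iy^jdx^k\wedge dx^l$, where $y^i$ are the linear coordinates on the fibres of $TM$ induced by the local coordinates $x^i$. Let $\mathcal W=\prod_k\mathrm{Sym}^k(T^*M)[[\hbar]]$ be the Weyl bundle, with the Moyal product $$(a\star b)(y)=\exp\Big(\tfrac{\hbar}{2}\omega^{ij}\partial_{y^i}\partial_{z^j}\Big)a(y)b(z)\Big|_{z=y},$$ extended to the $\mathcal W$-valued forms $\mathcal A^\bullet_M(\mathcal W)$, and let $\widehat\Omega^{-\bullet}_{TM}=\widehat{\mathrm{Sym}}(T^*M)\otimes\wedge^{-\bullet}(T^*M)$ be the BV bundle (formal power series in $y^i$ times exterior powers in $dy^i$), with fibrewise de Rham differential $d_{TM}=dy^i\,\partial_{y^i}$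 and BV operator $\Delta=\omega^{ij}\mathcal L_{\partial_{y^i}}\iota_{\partial_{y^j}}$. In $\mathcal A^\bullet_M(\widehat\Omega^{-\bullet}_{TM})$ the $dx^i$ have degree $1$, the $dy^i$ degree $-1$, all the $dx^i$ and $dy^i$ anticommute, and $d_{TM}$, $\iota_{\partial_{y^i}}$, $\Delta$ are extended as odd operators (they anticommute with multiplication by $dx^i$); $\nabla$ also denotes the induced exterior covariant derivative. Let $\omega_k$ $(k\ge1)$ be closed 2-forms, $\omega_\hbar=-\omega+\sum_{k\ge1}\hbar^k\omega_k$, and let $\gamma\in\mathcal A^1_M(\mathcal W)$ be a solution of Fedosov's equation $$\nabla\gamma+\frac1{2\hbar}[\gamma,\gamma]_\star+R_\nabla=\omega_\hbar .$$ Let $S^1[k]$ be the compactified configuration space of $k$ ordered points on $S^1=\mathbb R/\mathbb Z$ (a compact manifold with corners whose interior is the space of $k$-tuples of distinct points). $S^1[2]$ is the cylinder $S^1\times[0,1]\ni(\theta,u)$ lying over $(\theta+u,\theta)\in(S^1)^2$, and the propagator is $P(\theta,u)=u-\frac12$. On forms on $S^1[k]$ with values in $\mathcal A^\bullet_M((\widehat\Omega^{-\bullet}_{TM})^{\otimes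 k})$ (completed tensor product over $M$) put $$\partial_P=\frac12\sum_{\alpha\ne\beta}\pi_{\alpha\beta}^*(P)\,\omega^{ij}\mathcal L_{\partial_{y^i_\alpha}}\mathcal L_{\partial_{y^j_\beta}},\qquad D=\sum_\alpha d_{TM,\alpha}\circ(d\theta^\alpha\wedge),$$ where the subscript $\alpha$ denotes the action on the $\alpha$-th tensor factor, $\pi_{\alpha\beta}:S^1[k]\to S^1[2]$ is the forgetful map, and the odd operators $d\theta^\alpha\wedge$ and $d_{TM,\alpha}$ anticommute. Let $\int_{S^1[k]}$ be the integration with $\int_{S^1[k]}f\,d\theta^1\wedge\dots\wedge d\theta^k\wedge b=\big(\int f\,d\theta^1\cdots d\theta^k\big)\,b$ (forms of degree $<k$ on $S^1[k]$ integrate to $0$), let $\mathrm{Mult}$ be the multiplication of the tensor factors, $e^{\otimes\gamma/\hbar}=\sum_{k\ge0}\frac1{k!\hbar^k}\gamma^{\otimes k}$, and $$\gamma_\infty:=\hbar\log\ \mathrm{Mult}\int_{S^1[*]}e^{\hbar\partial_P+D}e^{\otimes\gamma/\hbar},\qquad\text{i.e.}\qquad e^{\gamma_\infty/\hbar}=\sum_{k\ge0}\mathrm{Mult}\int_{S^1[k]}e^{\hbar\partial_P+D}\,\frac{\gamma^{\otimes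 k}}{k!\,\hbar^k}.$$ Then $\gamma_\infty$ is a (smooth) element of degree $0$ of $\mathcal A^\bullet_M(\widehat\Omega^{-\bullet}_{TM})[[\hbar]]$, it is nilpotent ($\gamma_\infty^K=0$ for $K\gg0$), and it solves the quantum master equation $$\big(\nabla+\hbar\Delta+\hbar^{-1}d_{TM}(R_\nabla)\big)e^{\gamma_\infty/\hbar}=0 .$$ -/

import Mathlib

open Bundle Module
open scoped Manifold ContDiff

noncomputable section

namespace FedosovBV

/-! ### The fibres

`N` is the dimension of the manifold, `T` the number of points on the circle whose differentials
`dθ` are available, and `k` the number of tensor factors.  An element of `Fib N T k` is a Laurent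
series in `ħ` whose coefficients are formal power series in the even variables `y a i`
(`a : Fin k`, `i : Fin N`) with coefficients in the exterior algebra on the odd generators
`dθ t`, `dx i`, `dy a i`.  So all the odd generators anticommute with each other.

In particular `BV N = Fib N 0 1` is the fibre of `Λ T*M ⊗ Sym^ T*M ⊗ Λ T*M ((ħ))`, written in the
coordinates `x i` of `M`, with `y i` the induced linear coordinates of the tangent space, and
`Fib N 0 k` is the fibre for the `k`-th (completed) tensor power of `Sym^ T*M ⊗ Λ T*M`. -/

/-- The space on which an `N`-dimensional manifold is modelled. -/
abbrev Model (N : ℕ) := EuclideanSpace ℝ (Fin N)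

/-- Indices of the odd generators: `dθ t`, `dx i` and `dy a i`. -/
abbrev OddIdx (N T k : ℕ) := Fin T ⊕ (Fin N ⊕ (Fin k × Fin N))

/-- The exterior algebra on the odd generators. -/
abbrev Grassmann (N T k : ℕ) := ExteriorAlgebra ℝ (OddIdx N T k → ℝ)

/-- Formal power series in the `y a i` with coefficients in the exterior algebra. -/
abbrev Formal (N T k : ℕ) := MvPowerSeries (Fin k × Fin N) (Grassmann N T k)

/-- Laurent series in `ħ` of such formal power series. -/
abbrev Fib (N T k : ℕ) := LaurentSeries (Formal N T k)

/-- The fibre of the bundle `Λ T*M ⊗ Sym^ T*M ⊗ Λ T*M ((ħ))`. -/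
abbrev BV (N : ℕ) := Fib N 0 1

section Generators

variable {N T k : ℕ}

/-- A power `ħ ^ m`, `m ∈ ℤ`. -/
def hbarPow (m : ℤ) : Fib N T k := HahnSeries.single m 1

/-- The odd generator with index `g`. -/
def oddGen (g : OddIdx N T k) : Grassmann N T k := ExteriorAlgebra.ι ℝ (Pi.single g 1)

/-- The odd generator with index `g` as an element of the fibre. -/
def odd (g : OddIdx N T k) : Fib N T k := HahnSeries.C (MvPowerSeries.C (oddGen g))

/-- The generator `dθ t`. -/
def dtheta (t : Fin T) : Fib N T k := odd (Sum.inl t)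

/-- The generator `dx i`. -/
def dx (i : Fin N) : Fib N T k := odd (Sum.inr (Sum.inl i))

/-- The generator `dy i` of the `a`-th tensor factor. -/
def dy (a : Fin k) (i : Fin N) : Fib N T k := odd (Sum.inr (Sum.inr (a, i)))

/-- The variable `y i` of the `a`-th tensor factor. -/
def yvar (a : Fin k) (i : Fin N) : Fib N T k := HahnSeries.C (MvPowerSeries.X (a, i))

/-- The coefficient of `ħ ^ m y ^ β`. -/
def cf (s : Fib N T k) (m : ℤ) (β : (Fin k × Fin N) →₀ ℕ) : Grassmann N T k :=
  MvPowerSeries.coeff β (s.coeff m)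

end Generators

/-! ### Linear operations on the fibres -/

/-- The Laurent series with prescribed coefficients (`0` if infinitely many coefficients of
negative powers are nonzero). -/
def mkLaurent {R : Type*} [Zero R] (f : ℤ → R) : LaurentSeries R := by
  classical
  exact if h : BddBelow (Function.support f) then HahnSeries.ofSuppBddBelow f h else 0

/-- Apply an additive map to all the coefficients of a Laurent series. -/
def mapCoeff {R S : Type*} [AddMonoid R] [AddMonoid S] (f : R →+ S) (s : LaurentSeries R) :
    LaurentSeries S :=
  HahnSeries.map s f

/-- `∂/∂y_v` on formal power series. -/
def pderivHom {σ R : Type*} [Semiring R] (v : σ) : MvPowerSeries σ R →+ MvPowerSeries σ R where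
  toFun := MvPowerSeries.pderivFun v
  map_zero' := by
    ext d
    simp [MvPowerSeries.coeff_pderivFun]
  map_add' f g := MvPowerSeries.pderivFun_add f g

/-- The linear change of variables `y_s ↦ ∑ t, A s t y_t`, `e_g ↦ ∑ h, B g h e_h`, where the `y`
are the even variables and the `e` the odd generators. -/
def linSubst {σ τ g h : Type*} [Fintype σ] [Fintype τ] [Fintype g] [DecidableEq σ]
    (A : Matrix σ τ ℝ) (B : Matrix g h ℝ) :
    MvPowerSeries σ (ExteriorAlgebra ℝ (g → ℝ)) →+ MvPowerSeries τ (ExteriorAlgebra ℝ (h → ℝ)) where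
  toFun f := fun β =>
    ∑ α ∈ Finset.univ.finsuppAntidiag β.degree,
      MvPolynomial.coeff β
          (∏ s, (∑ t, MvPolynomial.C (A s t) * MvPolynomial.X t) ^ α s : MvPolynomial τ ℝ) •
        ExteriorAlgebra.map (Matrix.vecMulLinear B) (MvPowerSeries.coeff α f)
  map_zero' := by
    funext β
    simp only [map_zero, smul_zero, Finset.sum_const_zero]
    rfl
  map_add' f f' := by
    funext β
    simp only [map_add, smul_add, Finset.sum_add_distrib]
    rfl

section Operators

variable {N T k : ℕ}

/-- `L_{∂_{y^i}}` on the `a`-th tensor factor: the derivative of the coefficient functions. -/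
def partialY (a : Fin k) (i : Fin N) (s : Fib N T k) : Fib N T k :=
  mapCoeff (pderivHom (a, i)) s

/-- Left contraction with the odd generator `g` on formal power series, coefficient by
coefficient. -/
def contractHom (g : OddIdx N T k) : Formal N T k →+ Formal N T k where
  toFun f := fun β => CliffordAlgebra.contractLeft
    (LinearMap.proj g : Dual ℝ (OddIdx N T k → ℝ)) (MvPowerSeries.coeff β f)
  map_zero' := by
    funext β
    simp only [map_zero]
    rfl
  map_add' f f' := by
    funext β
    simp only [map_add]
    rfl

/-- Left contraction with the odd generator `g`: the odd derivation that sends the generator `g`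
to `1` and all the other generators and variables to `0`. -/
def contract (g : OddIdx N T k) (s : Fib N T k) : Fib N T k := mapCoeff (contractHom g) s

/-- `ι_{∂_{y^i}}` on the `a`-th tensor factor. -/
def iotaY (a : Fin k) (i : Fin N) (s : Fib N T k) : Fib N T k :=
  contract (Sum.inr (Sum.inr (a, i))) s

/-- The fibrewise de Rham differential on the `a`-th tensor factor. -/
def dTM (a : Fin k) (s : Fib N T k) : Fib N T k := ∑ i, dy a i * partialY a i s

/-- The inclusion of `BV N` as the `a`-th tensor factor: `y i ↦ y a i`, `dy i ↦ dy a i`,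
`dx i ↦ dx i`. -/
def incl (a : Fin k) (s : BV N) : Fib N T k :=
  mapCoeff (linSubst
    (Matrix.of fun p => Pi.single (a, p.2) 1)
    (Matrix.of (Sum.elim (fun t => t.elim0)
      (Sum.elim (fun i => Pi.single (Sum.inr (Sum.inl i)) 1)
        (fun p => Pi.single (Sum.inr (Sum.inr (a, p.2))) 1))))) s

/-- The multiplication map `Mult`: `y a i ↦ y i`, `dy a i ↦ dy i`, `dx i ↦ dx i`. -/
def mult (s : Fib N 0 k) : BV N :=
  mapCoeff (linSubst
    (Matrix.of fun p => Pi.single (0, p.2) 1)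
    (Matrix.of (Sum.elim (fun t => t.elim0)
      (Sum.elim (fun i => Pi.single (Sum.inr (Sum.inl i)) 1)
        (fun p => Pi.single (Sum.inr (Sum.inr (0, p.2))) 1))))) s

/-- The linear change of coordinates `z i ↦ ∑ j, A i j z j`, for `z = y`, `dx`, `dy`. -/
def frameChange (A : Matrix (Fin N) (Fin N) ℝ) (s : BV N) : BV N :=
  mapCoeff (linSubst
    (Matrix.of fun p => fun q => A p.2 q.2)
    (Matrix.of (Sum.elim (fun t => t.elim0)
      (Sum.elim (fun i => Sum.elim 0 (Sum.elim (fun j => A i j) 0))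
        (fun p => Sum.elim 0 (Sum.elim 0 (fun q => A p.2 q.2))))))) s

/-- The exponential `e ^ D = ∑ j, D ^ j / j!` of an operator; the sum is taken in every coefficient
of a power of `ħ`. -/
def opExp (D : Fib N T k → Fib N T k) (s : Fib N T k) : Fib N T k :=
  mkLaurent fun m => ∑ᶠ j : ℕ, ((j.factorial : ℝ)⁻¹) • (D^[j] s).coeff m

end Operators

/-! ### The Moyal product and the BV operator

Here `pois` is the matrix `(ω^{ij})`, the inverse of `(ω_{ij})`. -/

section Algebra

variable {N : ℕ}

/-- The Moyal product
`exp (ħ/2 ω^{ij} ∂_{y^i} ∂_{z^j}) a(y) b(z)` restricted to `y = z`. -/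
def moyal (pois : Matrix (Fin N) (Fin N) ℝ) (a b : BV N) : BV N :=
  mult (opExp
    (fun ψ : Fib N 0 2 =>
      hbarPow 1 * ((1 / 2 : ℝ) • ∑ i, ∑ j, pois i j • partialY 0 i (partialY 1 j ψ)))
    (incl 0 a * incl 1 b))

/-- The commutator `a ⋆ b - (-1)^{pq} b ⋆ a` of a `p`-form and a `q`-form. -/
def starComm (pois : Matrix (Fin N) (Fin N) ℝ) (p q : ℕ) (a b : BV N) : BV N :=
  moyal pois a b - ((-1 : ℝ) ^ (p * q)) • moyal pois b a

/-- The BV operator `Δ = ω^{ij} L_{∂_{y^i}} ι_{∂_{y^j}}`. -/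
def bvDelta (pois : Matrix (Fin N) (Fin N) ℝ) (s : BV N) : BV N :=
  ∑ i, ∑ j, pois i j • partialY 0 i (iotaY 0 j s)

end Algebra

/-! ### Configuration spaces of the circle and the definition of `γ_∞` -/

section Circle

variable {N k : ℕ}

/-- The propagator `P(θ, u) = u - 1/2` on the cylinder `S¹[2] = S¹ × [0, 1]`. -/
def propagator (p : UnitAddCircle × ℝ) : ℝ := p.2 - 1 / 2

/-- The point of the cylinder `S¹[2] = S¹ × [0, 1]` over a pair `(a, b)` of points of the circle,
`a ≠ b`, for the blow down map `(θ, u) ↦ (θ + u, θ)`. -/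
def toCylinder (a b : UnitAddCircle) : UnitAddCircle × ℝ :=
  (b, (AddCircle.equivIco 1 0 (a - b) : ℝ))

/-- The configurations of `k` distinct ordered points on the circle.  This is the interior of the
compact manifold with corners `S¹[k]`, whose boundary is irrelevant for integrals over `S¹[k]`. -/
def conf (k : ℕ) : Set (Fin k → UnitAddCircle) := {θ | Function.Injective θ}

/-- The operator `∂_P` at the point `θ` of the configuration space. -/
def partialP (pois : Matrix (Fin N) (Fin N) ℝ) (θ : Fin k → UnitAddCircle) (s : Fib N k k) :
    Fib N k k :=
  (1 / 2 : ℝ) • ∑ a, ∑ b ∈ Finset.univ.filter (fun b => b ≠ a),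
    propagator (toCylinder (θ a) (θ b)) • ∑ i, ∑ j, pois i j • partialY a i (partialY b j s)

/-- The operator `D`: multiplication with `dθ a` followed by `d_TM` on the `a`-th factor, summed
over `a`.  As these odd operators anticommute, this fixes the Koszul sign in
`D = ∑ ± dθ a ⊗ d_TM`: it is `- ∑ a, dθ a * dTM a s`. -/
def opD (s : Fib N k k) : Fib N k k := ∑ a, dTM a (dtheta a * s)

/-- The term `(γ / ħ)^{⊗ k} / k!` of `e^{⊗ γ / ħ}`. -/
def expTensor (k : ℕ) (γ : BV N) : Fib N k k :=
  ((k.factorial : ℝ)⁻¹) • (hbarPow (-(k : ℤ)) * (List.ofFn fun a : Fin k => incl a γ).prod)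

/-- The coefficient `b` of `dθ_1 ∧ ⋯ ∧ dθ_T` in `dθ_1 ∧ ⋯ ∧ dθ_T ∧ b + (terms of lower degree in the
dθ's)`. -/
def topTheta {T : ℕ} : Grassmann N T k →ₗ[ℝ] Grassmann N 0 k :=
  (ExteriorAlgebra.map (Matrix.vecMulLinear (Matrix.of (Sum.elim (fun _ => 0)
      fun g => Pi.single (Sum.inr g) 1)) :
    (OddIdx N T k → ℝ) →ₗ[ℝ] (OddIdx N 0 k → ℝ))).toLinearMap ∘ₗ
  (List.finRange T).foldl
    (fun f t => CliffordAlgebra.contractLeft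
      (LinearMap.proj (Sum.inl t) : Dual ℝ (OddIdx N T k → ℝ)) ∘ₗ f) LinearMap.id

/-- A basis of the exterior algebra, used to differentiate and to integrate functions with values
in it coordinate by coordinate. -/
def grBasis (N T k : ℕ) :
    Basis (Finset (Fin (Fintype.card (OddIdx N T k)))) ℝ (Grassmann N T k) :=
  ((Pi.basisFun ℝ (OddIdx N T k)).reindex (Fintype.equivFin _)).ExteriorAlgebra

/-- The integral over `S¹[k]` of a differential form with values in the `k`-th tensor power. -/
def confIntegral (ψ : (Fin k → UnitAddCircle) → Fib N k k) : Fib N 0 k :=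
  mkLaurent fun m => fun β =>
    ∑ b, (∫ θ in conf k, (grBasis N 0 k).repr (topTheta (cf (ψ θ) m β)) b) • grBasis N 0 k b

/-- `Mult ∫_{S¹[*]} e^{ħ ∂_P + D} e^{⊗ γ / ħ}`. -/
def feynmanIntegral (pois : Matrix (Fin N) (Fin N) ℝ) (γ : BV N) : BV N :=
  ∑ᶠ k : ℕ, mult (confIntegral fun θ : Fin k → UnitAddCircle =>
    opExp (fun s => hbarPow 1 * partialP pois θ s + opD s) (expTensor k γ))

/-- The logarithm `∑_{j ≥ 1} (-1)^{j+1} (u - 1)^j / j` of an element `u` such that `u - 1` is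
nilpotent. -/
def nilLog (u : BV N) : BV N :=
  ∑ j ∈ Finset.range (nilpotencyClass (u - 1)),
    (((-1 : ℝ) ^ j) / ((j : ℝ) + 1)) • (u - 1) ^ (j + 1)

/-- `γ_∞ = ħ log Mult ∫_{S¹[*]} e^{ħ ∂_P + D} e^{⊗ γ / ħ}`. -/
def gammaInfty (pois : Matrix (Fin N) (Fin N) ℝ) (γ : BV N) : BV N :=
  hbarPow 1 * nilLog (feynmanIntegral pois γ)

end Circle

/-! ### Geometry

The tangent space at `x` is `Model N`, identified with it through the preferred chart at `x`; its
standard basis is the coordinate frame of that chart.  Accordingly a section `s` of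
`Λ T*M ⊗ Sym^ T*M ⊗ Λ T*M ((ħ))` is a function `s : M → BV N`, where `s x` is written in the
coordinates of the preferred chart at `x`. -/

section Geometry

variable {N : ℕ} {M : Type*} [TopologicalSpace M] [ChartedSpace (Model N) M]
  [IsManifold 𝓘(ℝ, Model N) ∞ M]

/-- The vector `∂_{x^i}` at the point `x`, for the preferred chart at `x`. -/
def frameVec (x : M) (i : Fin N) : TangentSpace 𝓘(ℝ, Model N) x :=
  (EuclideanSpace.single i 1 : Model N)

/-- The coordinates of a tangent vector at `x` in the frame `frameVec x`. -/
def coords {x : M} (v : TangentSpace 𝓘(ℝ, Model N) x) (i : Fin N) : ℝ := (show Model N from v) i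

/-- The coordinate vector field `∂_{x^i}` of the preferred chart at `x₀`, on the domain of this
chart. -/
def coordField (x₀ : M) (i : Fin N) : Π x : M, TangentSpace 𝓘(ℝ, Model N) x :=
  (trivializationAt (Model N) (TangentSpace 𝓘(ℝ, Model N)) x₀).localFrame
    (EuclideanSpace.basisFun (Fin N) ℝ).toBasis i

/-- The partial derivative `∂f/∂x^j` at `x₀` of a real function, in the preferred chart. -/
def partialX (x₀ : M) (j : Fin N) (f : M → ℝ) : ℝ :=
  mvfderiv 𝓘(ℝ, Model N) f x₀ (frameVec x₀ j)

variable (N M) in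
/-- Smooth closed 2-forms. -/
structure ClosedTwoForm where
  toFun (x : M) : TangentSpace 𝓘(ℝ, Model N) x →L[ℝ] TangentSpace 𝓘(ℝ, Model N) x →L[ℝ] ℝ
  alternating (x : M) (v : TangentSpace 𝓘(ℝ, Model N) x) : toFun x v v = 0
  smooth : ContMDiff 𝓘(ℝ, Model N) (𝓘(ℝ, Model N).prod 𝓘(ℝ, Model N →L[ℝ] Model N →L[ℝ] ℝ)) ∞
    (fun x => TotalSpace.mk' (Model N →L[ℝ] Model N →L[ℝ] ℝ) x (toFun x))
  closed (x₀ : M) (i j k : Fin N) :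
    partialX x₀ i (fun x => toFun x (coordField x₀ j x) (coordField x₀ k x)) +
    partialX x₀ j (fun x => toFun x (coordField x₀ k x) (coordField x₀ i x)) +
    partialX x₀ k (fun x => toFun x (coordField x₀ i x) (coordField x₀ j x)) = 0

variable (N M) in
/-- Symplectic forms. -/
structure SymplecticForm extends ClosedTwoForm N M where
  nondegenerate (x : M) (v : TangentSpace 𝓘(ℝ, Model N) x) (h : ∀ w, toFun x v w = 0) : v = 0

/-- The components `η_{ij}` of a 2-form `η = 1/2 η_{ij} dx^i dx^j` at `x`. -/
def ClosedTwoForm.comp (η : ClosedTwoForm N M) (x : M) : Matrix (Fin N) (Fin N) ℝ :=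
  Matrix.of fun i j => η.toFun x (frameVec x i) (frameVec x j)

/-- The 2-form `η = 1/2 η_{ij} dx^i dx^j` as a section. -/
def ClosedTwoForm.toSection (η : ClosedTwoForm N M) (x : M) : Formal N 0 1 :=
  (1 / 2 : ℝ) • ∑ i, ∑ j, η.comp x i j •
    MvPowerSeries.C (oddGen (Sum.inr (Sum.inl i)) * oddGen (Sum.inr (Sum.inl j)))

/-- The matrix `(ω^{ij})`, inverse to `(ω_{ij})`. -/
def SymplecticForm.poisson (Ω : SymplecticForm N M) (x : M) : Matrix (Fin N) (Fin N) ℝ :=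
  (Ω.comp x)⁻¹

/-- Affine connections on `M`. -/
abbrev Connection (N : ℕ) (M : Type*) [TopologicalSpace M] [ChartedSpace (Model N) M]
    [IsManifold 𝓘(ℝ, Model N) ∞ M] :=
  CovariantDerivative 𝓘(ℝ, Model N) (Model N) (TangentSpace 𝓘(ℝ, Model N) : M → Type _)

/-- A smooth connection is symplectic if it is torsion-free and `∇ω = 0`. -/
structure IsSymplecticConnection (Ω : SymplecticForm N M) (cov : Connection N M) : Prop where
  smooth : CovariantDerivative.ContMDiffCovariantDerivative cov ∞
  torsion_free : cov.torsion = 0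
  compatible (X Y : Π x : M, TangentSpace 𝓘(ℝ, Model N) x) (x : M)
    (hX : MDifferentiableAt 𝓘(ℝ, Model N) 𝓘(ℝ, Model N).tangent
      (fun x' => (⟨x', X x'⟩ : TangentBundle 𝓘(ℝ, Model N) M)) x)
    (hY : MDifferentiableAt 𝓘(ℝ, Model N) 𝓘(ℝ, Model N).tangent
      (fun x' => (⟨x', Y x'⟩ : TangentBundle 𝓘(ℝ, Model N) M)) x)
    (Z : TangentSpace 𝓘(ℝ, Model N) x) :
    mvfderiv 𝓘(ℝ, Model N) (fun x' => Ω.toFun x' (X x') (Y x')) x Z =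
      Ω.toFun x (cov X x Z) (Y x) + Ω.toFun x (X x) (cov Y x Z)

/-- The Christoffel symbols at `x`: `∇_{∂_j} ∂_k = Γ^i_{jk} ∂_i`. -/
def christoffel (cov : Connection N M) (x : M) (i j k : Fin N) : ℝ :=
  coords (cov (coordField x k) x (frameVec x j)) i

/-- The components of the curvature at `x`: `R(∂_k, ∂_l) ∂_j = R^i_{jkl} ∂_i`, that is
`∇_{∂_k} ∇_{∂_l} ∂_j - ∇_{∂_l} ∇_{∂_k} ∂_j = R^i_{jkl} ∂_i`. -/
def curvature (cov : Connection N M) (x : M) (i j k l : Fin N) : ℝ :=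
  coords (cov (fun x' => cov (coordField x j) x' (coordField x l x')) x (frameVec x k)) i -
  coords (cov (fun x' => cov (coordField x j) x' (coordField x k x')) x (frameVec x l)) i

/-- `R_∇ = 1/4 R_{ijkl} y^i y^j dx^k dx^l` with `R_{ijkl} = ω_{im} R^m_{jkl}`. -/
def curvatureForm (Ω : SymplecticForm N M) (cov : Connection N M) (x : M) : BV N :=
  (1 / 4 : ℝ) • ∑ i, ∑ j, ∑ k, ∑ l, (∑ m, Ω.comp x i m * curvature cov x m j k l) •
    (yvar 0 i * yvar 0 j * dx k * dx l)

/-- The section `s` at `x`, written in the coordinates of the preferred chart at `x₀` (for `x` in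
the domain of that chart). -/
def localRep (x₀ : M) (s : M → BV N) (x : M) : BV N :=
  frameChange (Matrix.of fun i j => coords (coordField x₀ j x) i) (s x)

/-- The section `s` is smooth: all its coefficients in local coordinates are smooth functions. -/
def IsSmoothSection (s : M → BV N) : Prop :=
  ∀ (x₀ : M) (m : ℤ) (β : (Fin 1 × Fin N) →₀ ℕ) (ℓ : Dual ℝ (Grassmann N 0 1)),
    ContMDiffAt 𝓘(ℝ, Model N) 𝓘(ℝ, ℝ) ∞ (fun x => ℓ (cf (localRep x₀ s x) m β)) x₀

/-- The partial derivative with respect to `x^j` at `x₀` of the coefficients of a section, in the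
preferred chart at `x₀`. -/
def partialXSection (x₀ : M) (j : Fin N) (s : M → BV N) : BV N :=
  mkLaurent fun m => fun β =>
    ∑ b, partialX x₀ j (fun x => (grBasis N 0 1).repr (cf (localRep x₀ s x) m β) b) • grBasis N 0 1 b

/-- The operator `∇` on forms on `M` with values in the Weyl bundle and in the BV bundle: the
exterior covariant derivative, where `∇_{∂_j} y^i = - Γ^i_{jk} y^k` and
`∇_{∂_j} dy^i = - Γ^i_{jk} dy^k`. -/
def nabla (cov : Connection N M) (s : M → BV N) (x : M) : BV N :=
  ∑ j, dx j * (partialXSection x j s -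
    ∑ i, ∑ k, christoffel cov x i j k •
      (yvar 0 k * partialY 0 i (s x) + dy 0 k * iotaY 0 i (s x)))

/-- The elements of the exterior algebra of degree `p` in the `dx i` and `q` in the `dy i`. -/
def bidegree (N p q : ℕ) : Submodule ℝ (Grassmann N 0 1) :=
  (Submodule.span ℝ (Set.range fun i : Fin N => oddGen (Sum.inr (Sum.inl i)))) ^ p *
  (Submodule.span ℝ (Set.range fun i : Fin N => oddGen (Sum.inr (Sum.inr (0, i))))) ^ q

/-- `s` is a smooth `p`-form on `M` with values in the Weyl bundle `Sym^ T*M [[ħ]]`. -/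
structure IsWeylForm (p : ℕ) (s : M → BV N) : Prop where
  smooth : IsSmoothSection s
  hbar_nonneg (x : M) (m : ℤ) (hm : m < 0) : (s x).coeff m = 0
  degree (x : M) (m : ℤ) (β : (Fin 1 × Fin N) →₀ ℕ) : cf (s x) m β ∈ bidegree N p 0

/-- `ω_ħ = - ω + ∑_{k ≥ 1} ħ^k ω_k`. -/
def omegaHbar (Ω : SymplecticForm N M) (ηs : ℕ+ → ClosedTwoForm N M) (x : M) : BV N :=
  HahnSeries.ofPowerSeries ℤ (Formal N 0 1) (PowerSeries.mk fun m =>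
    if h : 0 < m then (ηs ⟨m, h⟩).toSection x else - Ω.toSection x)

/-- Fedosov's equation `∇γ + (1 / 2ħ) [γ, γ]_⋆ + R_∇ = ω_ħ` for a 1-form `γ` with values in the
Weyl bundle. -/
def FedosovEquation (Ω : SymplecticForm N M) (cov : Connection N M)
    (ηs : ℕ+ → ClosedTwoForm N M) (γ : M → BV N) : Prop :=
  ∀ x, nabla cov γ x + (1 / 2 : ℝ) • (hbarPow (-1) * starComm (Ω.poisson x) 1 1 (γ x) (γ x)) +
    curvatureForm Ω cov x = omegaHbar Ω ηs x

/-- `Γ` is a nilpotent solution of the quantum master equation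
`(∇ + ħ Δ + ħ⁻¹ d_TM R_∇) e^{Γ / ħ} = 0`: a smooth section of the BV bundle with coefficients in
forms and in power series in `ħ`, of total degree `0` (`dx i` has degree `1` and `dy i` has degree
`-1`), with `Γ ^ K = 0` for some `K`. -/
structure IsNilpotentSolutionQME (Ω : SymplecticForm N M) (cov : Connection N M)
    (Γ : M → BV N) : Prop where
  smooth : IsSmoothSection Γ
  hbar_nonneg (x : M) (m : ℤ) (hm : m < 0) : (Γ x).coeff m = 0
  degree_zero (x : M) (m : ℤ) (β : (Fin 1 × Fin N) →₀ ℕ) :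
    cf (Γ x) m β ∈ ⨆ p : ℕ, bidegree N p p
  nilpotent : ∃ K : ℕ, ∀ x, Γ x ^ K = 0
  qme (x : M) :
    nabla cov (fun x' => IsNilpotent.exp (hbarPow (-1) * Γ x')) x +
      hbarPow 1 * bvDelta (Ω.poisson x) (IsNilpotent.exp (hbarPow (-1) * Γ x)) +
      hbarPow (-1) * dTM 0 (curvatureForm Ω cov x) * IsNilpotent.exp (hbarPow (-1) * Γ x) = 0

end Geometry

end FedosovBV

end

open FedosovBV

/-!
The theorem reduces the Feynman integral to a finite algebraic expression in every fibre.

*Reduction.* Integration over the configuration space picks one `dθ`, hence one `d_TM`, for every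
argument. So the part with `k` arguments is a mean value over the torus of all the contractions of
`k` copies of `b = -d_TM γ` (`wick`, `mult_confIntegral_eq`). Since `b` has degree one in the `dx`
and in the `dy`, it is central, and the terms with `k > N` vanish: the integral is the finite sum
`wickSum`.

*Logarithm.* The weight of a set of points is a product over the pairs of its points, so the
integral is the exponential of its connected parts (`clusterPart`, `connectedWick`,
`exists_wickSum_eq_expSum`). A connected graph on `k + 1` points has at least `k` edges, each with a
factor `ħ` (`coeff_connectedWick`); therefore `γ_∞` has no negative powers of `ħ`. It is nilpotent
because the exterior algebra is.

*Master equation.* As `ι_j b = -∂_j γ`, the operator `Δ` replaces an argument `b` by `-∂_j γ`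
and contracts it with `∂_i` of the whole integrand. Contracting one point with all the others is the
derivative of the propagators with respect to its position, so by Stokes' theorem on the circle
(`circleMean_edgeDer`) only collisions contribute. There the propagator jumps between `1/2` and
`-1/2`, and the collision produces the star commutator of `γ` and `b` (`X_mul_hs_contr_wick`,
`bv_wick`). On the other hand, `d_TM` of Fedosov's equation expresses `∇ b` by the same commutator
and by `d_TM R_∇` (`X_mul_negDTMSer_of_fedosov`). The latter is linear in `y`: at most one propagator
ends at it, and a single propagator has mean zero, so that it can be taken out of the integral
(`wick_of_d_d_eq_zero`). The terms cancel (`masterEquation_of_fedosov`).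

*Covariant derivative.* The contractions are natural under changes of the frame (`frameSer_wick`) and
`∇ω = 0`; hence `∇` acts on the Feynman integral by acting on its arguments (`hasSmoothDerivS_wick`,
`IsWeylForm.nabla_wickSum`).
-/

open Finset.HasAntidiagonal (antidiagonal)
open Finset (sum_congr range mul_sum sum_comm smul_sum sum_eq_zero sum_add_distrib sum_mul mem_univ sum_eq_single prod_insert sum_const_zero sum_neg_distrib sum_insert sum_range_succ' sum_range_succ sum_sub_distrib sum_empty mem_range mem_powerset mem_sigma add_sum_erase prod_congr sum_subset mem_powerset_self card_univ sum_smul mem_filter prod_mul_distrib mem_ssubsets univ)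
open MvPolynomial (X C eval aeval_X rename map_X rename_X aeval aeval_C)
open PowerSeries (coeff coeff_map coeff_mk)
open CliffordAlgebra (involute contractLeft involute_ι contractLeft_ι_mul)
open scoped PowerSeries
open Function (update update_of_ne update_self update_idem update_comm)

noncomputable section

set_option linter.unusedSectionVars false
set_option linter.unusedSimpArgs false

namespace FedosovBV

/-- The center of a real algebra. -/
local notation "𝒵" => Subalgebra.center ℝ

/-- The real square matrices. -/
local notation "𝕄" n:max => Matrix (Fin n) (Fin n) ℝ

/-- The symbols of differential operators with constant coefficients on a product. -/
local notation "𝒫[" U ", " n "]" => MvPolynomial (U × Fin n) ℝ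

/-- The exterior generator `dy i` of a one-slot series. -/
local notation:max "𝕪" i:max => Sum.inr (Sum.inr (0, i))

/-- The exterior generator `dx i`. -/
local notation:max "𝕩" i:max => Sum.inr (Sum.inl i)

/-- The tangent spaces of a manifold modelled on `Model n`. -/
local notation:max "𝒯" n:max => TangentSpace 𝓘(ℝ, Model n)

/-- Smoothness of real functions at a point. -/
local notation:max "CMD" n:max => ContMDiffAt 𝓘(ℝ, Model n) 𝓘(ℝ, ℝ) ∞

/-- The trivialization of the tangent bundle by a chart. -/
local notation:max "chartTriv" n:max x:max => trivializationAt (Model n) (TangentSpace 𝓘(ℝ, Model n)) x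

/-! ### Exterior algebras -/

section Exterior

variable {V W : Type*} [AddCommGroup V] [Module ℝ V] [AddCommGroup W] [Module ℝ W]

lemma contractLeft_mul (d : Dual ℝ V) (x y : ExteriorAlgebra ℝ V) :
    contractLeft d (x * y) = contractLeft d x * y + involute x * contractLeft d y := by
  induction x using CliffordAlgebra.left_induction generalizing y with
  | algebraMap r =>
    rw [CliffordAlgebra.contractLeft_algebraMap_mul, CliffordAlgebra.contractLeft_algebraMap]
    simp
  | add x₁ x₂ h₁ h₂ => simp only [add_mul, map_add, h₁, h₂]; abel
  | ι_mul m x h =>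
    rw [mul_assoc, contractLeft_ι_mul, contractLeft_ι_mul, h]
    simp only [map_mul, involute_ι]
    noncomm_ring

lemma contractLeft_map (d : Dual ℝ W) (f : V →ₗ[ℝ] W) (x : ExteriorAlgebra ℝ V) :
    contractLeft d (ExteriorAlgebra.map f x) = ExteriorAlgebra.map f (contractLeft (d ∘ₗ f) x) := by
  induction x using CliffordAlgebra.left_induction with
  | algebraMap r =>
    rw [AlgHom.commutes]
    simp
  | add x₁ x₂ h₁ h₂ => simp only [map_add, h₁, h₂]
  | ι_mul m x h =>
    rw [map_mul, contractLeft_ι_mul]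
    have : ExteriorAlgebra.map f (CliffordAlgebra.ι 0 x) = CliffordAlgebra.ι 0 (f x) :=
      ExteriorAlgebra.map_apply_ι f x
    rw [this, contractLeft_ι_mul, h, map_sub, map_mul, this, map_smul]
    rfl

lemma involute_map (f : V →ₗ[ℝ] W) (x : ExteriorAlgebra ℝ V) : involute (ExteriorAlgebra.map f x) =
      ExteriorAlgebra.map f (involute x) := by
  have : (involute (Q := (0 : QuadraticForm ℝ W))).comp (ExteriorAlgebra.map f) =
      (ExteriorAlgebra.map f).comp (involute (Q := (0 : QuadraticForm ℝ V))) := by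
    apply ExteriorAlgebra.hom_ext
    ext v
    simp [ExteriorAlgebra.ι]
  exact DFunLike.congr_fun this x

lemma ι_mul_ι_mem_center (v w : V) : ExteriorAlgebra.ι ℝ v * ExteriorAlgebra.ι ℝ w ∈
      𝒵 (ExteriorAlgebra ℝ V) := by
  rw [Subalgebra.mem_center_iff]
  intro x
  have anti (a b : V) : ExteriorAlgebra.ι ℝ a * ExteriorAlgebra.ι ℝ b =
      -(ExteriorAlgebra.ι ℝ b * ExteriorAlgebra.ι ℝ a) :=
    eq_neg_of_add_eq_zero_left (ExteriorAlgebra.ι_add_mul_swap a b)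
  induction x using ExteriorAlgebra.induction with
  | algebraMap r => exact Algebra.commutes r _
  | ι u =>
    rw [← mul_assoc, anti u v, neg_mul, mul_assoc, anti u w, mul_neg, neg_neg, mul_assoc]
  | add x y hx hy => rw [mul_add, add_mul, hx, hy]
  | mul x y hx hy => rw [mul_assoc, hy, ← mul_assoc, hx, mul_assoc]

end Exterior

/-! ### Maps of power series determined by finitely many coefficients -/

section FinitelyDependent

variable {σ τ υ R S T : Type*} [Ring R] [Ring S] [Ring T]

/-- An additive map between rings of formal power series is finitely dependent if every
coefficient of the image depends on finitely many coefficients only (that is, the map is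
continuous for the product of the discrete topologies). -/
def FinDep (f : MvPowerSeries σ R →+ MvPowerSeries τ S) : Prop :=
  ∀ β, ∃ K : Finset (σ →₀ ℕ), ∀ x, (∀ α ∈ K, MvPowerSeries.coeff α x = 0) →
    MvPowerSeries.coeff β (f x) = 0

lemma FinDep.comp {g : MvPowerSeries τ S →+ MvPowerSeries υ T}
    {f : MvPowerSeries σ R →+ MvPowerSeries τ S} (hg : FinDep g) (hf : FinDep f) :
    FinDep (g.comp f) := by
  classical
  intro β
  obtain ⟨K, hK⟩ := hg β
  choose L hL using hf
  exact ⟨K.biUnion L, fun x hx => hK _ fun γ hγ => hL γ x fun α hα =>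
    hx α (Finset.mem_biUnion.2 ⟨γ, hγ, hα⟩)⟩

lemma FinDep.add {f g : MvPowerSeries σ R →+ MvPowerSeries τ S} (hf : FinDep f) (hg : FinDep g) :
    FinDep (f + g) := by
  classical
  intro β
  obtain ⟨K, hK⟩ := hf β
  obtain ⟨L, hL⟩ := hg β
  refine ⟨K ∪ L, fun x hx => ?_⟩
  rw [AddMonoidHom.add_apply, map_add, hK x fun α h => hx α (Finset.mem_union_left _ h),
    hL x fun α h => hx α (Finset.mem_union_right _ h), add_zero]

lemma FinDep.zero : FinDep (0 : MvPowerSeries σ R →+ MvPowerSeries τ S) :=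
  fun _ => ⟨∅, fun _ _ => by simp⟩

lemma FinDep.sum {ι : Type*} (s : Finset ι) {f : ι → MvPowerSeries σ R →+ MvPowerSeries τ S}
    (hf : ∀ i ∈ s, FinDep (f i)) : FinDep (∑ i ∈ s, f i) := by
  classical
  induction s using Finset.induction with
  | empty => simpa using FinDep.zero
  | insert a s ha ih =>
    rw [sum_insert ha]
    exact (hf a (by simp)).add (ih fun i hi => hf i (by simp [hi]))

lemma FinDep.of_coeff {f : MvPowerSeries σ R →+ MvPowerSeries σ S}
    (φ : (σ →₀ ℕ) → R →+ S) (h : ∀ x β, MvPowerSeries.coeff β (f x) =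
      φ β (MvPowerSeries.coeff β x)) : FinDep f := fun β =>
  ⟨{β}, fun x hx => by rw [h, hx β (by simp), map_zero]⟩

lemma FinDep.mulLeft (a : MvPowerSeries σ R) : FinDep (AddMonoidHom.mulLeft a) := by
  classical
  intro β
  refine ⟨(Finset.HasAntidiagonal.antidiagonal β).image Prod.snd, fun x hx => ?_⟩
  rw [AddMonoidHom.coe_mulLeft, MvPowerSeries.coeff_mul]
  exact sum_eq_zero fun p hp => by
    rw [hx p.2 (Finset.mem_image_of_mem _ hp), mul_zero]

lemma FinDep.mulRight (a : MvPowerSeries σ R) : FinDep (AddMonoidHom.mulRight a) := by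
  classical
  intro β
  refine ⟨(Finset.HasAntidiagonal.antidiagonal β).image Prod.fst, fun x hx => ?_⟩
  rw [AddMonoidHom.coe_mulRight, MvPowerSeries.coeff_mul]
  exact sum_eq_zero fun p hp => by
    rw [hx p.1 (Finset.mem_image_of_mem _ hp), zero_mul]

lemma FinDep.ext_monomial {f g : MvPowerSeries σ R →+ MvPowerSeries τ S} (hf : FinDep f)
    (hg : FinDep g) (h : ∀ α c, f (MvPowerSeries.monomial α c) = g (MvPowerSeries.monomial α c)) :
    f = g := by
  classical
  ext x β
  obtain ⟨K, hK⟩ := hf β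
  obtain ⟨L, hL⟩ := hg β
  set y : MvPowerSeries σ R :=
    ∑ α ∈ K ∪ L, MvPowerSeries.monomial α (MvPowerSeries.coeff α x) with hy
  have hxy : ∀ α ∈ K ∪ L, MvPowerSeries.coeff α (x - y) = 0 := by
    intro α hα
    rw [hy, map_sub, map_sum, sum_eq_single α]
    · simp
    · intro b _ hb
      rw [MvPowerSeries.coeff_monomial_ne hb.symm]
    · exact fun h => absurd hα h
  have h1 := hK (x - y) fun α h => hxy α (Finset.mem_union_left _ h)
  have h2 := hL (x - y) fun α h => hxy α (Finset.mem_union_right _ h)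
  have h3 : f y = g y := by simp only [hy, map_sum, h]
  rw [map_sub, map_sub, sub_eq_zero] at h1 h2
  rw [h1, h2, h3]

/-- A monomial with one more factor of a variable. -/
lemma monomial_add_single (α : σ →₀ ℕ) (s : σ) (c : R) :
    MvPowerSeries.monomial (α + Finsupp.single s 1) c =
      MvPowerSeries.monomial α c * MvPowerSeries.X s := by
  rw [MvPowerSeries.X, MvPowerSeries.monomial_mul_monomial, mul_one]

lemma monomial_induction {p : MvPowerSeries σ R → Prop} (hC : ∀ c, p (MvPowerSeries.C c))
    (hX : ∀ f s, p f → p (f * MvPowerSeries.X s)) (α : σ →₀ ℕ) (c : R) :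
    p (MvPowerSeries.monomial α c) := by
  classical
  induction hd : α.degree generalizing α with
  | zero =>
    rw [(Finsupp.degree_eq_zero_iff α).1 hd]
    simpa [MvPowerSeries.monomial_zero_eq_C] using hC c
  | succ d ih =>
    have hne : α ≠ 0 := by rintro rfl; simp at hd
    obtain ⟨s, hs⟩ := Finsupp.ne_iff.1 hne
    have hle : Finsupp.single s 1 ≤ α := by
      rw [Finsupp.single_le_iff]; exact Nat.one_le_iff_ne_zero.2 hs
    obtain ⟨α', rfl⟩ := exists_add_of_le hle
    rw [add_comm, monomial_add_single]
    refine hX _ _ (ih α' ?_)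
    simp only [map_add, Finsupp.degree_single] at hd
    omega

end FinitelyDependent

/-! ### Linear changes of variables -/

section LinSubst

variable {σ τ g h : Type*} [Fintype σ] [Fintype τ] [Fintype g] [DecidableEq σ]
  (A : Matrix σ τ ℝ) (B : Matrix g h ℝ)

/-- A real polynomial as a power series with coefficients in an algebra. -/
def polyToSeries (τ R : Type*) [Ring R] [Algebra ℝ R] : MvPolynomial τ ℝ →+* MvPowerSeries τ R :=
  (MvPowerSeries.map (algebraMap ℝ R)).comp MvPolynomial.coeToMvPowerSeries.ringHom

lemma coeff_polyToSeries {R : Type*} [Ring R] [Algebra ℝ R] (p : MvPolynomial τ ℝ)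
    (β : τ →₀ ℕ) : MvPowerSeries.coeff β (polyToSeries τ R p) =
      algebraMap ℝ R (MvPolynomial.coeff β p) := by
  simp [polyToSeries]

lemma polyToSeries_comm {R : Type*} [Ring R] [Algebra ℝ R] (p : MvPolynomial τ ℝ)
    (x : MvPowerSeries τ R) : polyToSeries τ R p * x = x * polyToSeries τ R p := by
  classical
  ext β
  rw [MvPowerSeries.coeff_mul, MvPowerSeries.coeff_mul, ← Finset.sum_equiv
    (Equiv.prodComm _ _) (s := Finset.HasAntidiagonal.antidiagonal β) (g := fun q =>
      MvPowerSeries.coeff q.1 x * MvPowerSeries.coeff q.2 (polyToSeries τ R p))]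
  · simp [add_comm]
  · intro q _
    simp only [Equiv.prodComm_apply, Prod.fst_swap, Prod.snd_swap, coeff_polyToSeries]
    exact Algebra.commutes _ _

lemma coeff_real_smul {R : Type*} [Ring R] [Algebra ℝ R] (c : ℝ) (f : MvPowerSeries τ R)
    (β : τ →₀ ℕ) : MvPowerSeries.coeff β (c • f) = c • MvPowerSeries.coeff β f := rfl

lemma coeff_linSubst (f : MvPowerSeries σ (ExteriorAlgebra ℝ (g → ℝ))) (β : τ →₀ ℕ) :
    MvPowerSeries.coeff β (linSubst A B f) = ∑ α ∈ univ.finsuppAntidiag β.degree,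
      MvPolynomial.coeff β (∏ s, (∑ t, C (A s t) * X t) ^ α s : MvPolynomial τ ℝ) •
        ExteriorAlgebra.map (Matrix.vecMulLinear B) (MvPowerSeries.coeff α f) := rfl

lemma finDep_linSubst : FinDep (linSubst A B) := fun β =>
  ⟨univ.finsuppAntidiag β.degree, fun x hx => by
    rw [coeff_linSubst]
    exact sum_eq_zero fun α hα => by rw [hx α hα, map_zero, smul_zero]⟩

/-- The linear form that replaces the variable `s`, to the power `α s`, multiplied over `s`. -/
def substMonomial (α : σ →₀ ℕ) : MvPolynomial τ ℝ := ∏ s, (∑ t, C (A s t) * X t) ^ α s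

lemma isHomogeneous_substMonomial (α : σ →₀ ℕ) : (substMonomial A α).IsHomogeneous α.degree := by
  rw [substMonomial, Finsupp.degree_eq_sum]
  refine MvPolynomial.IsHomogeneous.prod _ _ _ fun s _ => ?_
  have : (∑ t, C (A s t) * X t : MvPolynomial τ ℝ).IsHomogeneous 1 :=
    MvPolynomial.IsHomogeneous.sum _ _ _ fun t _ => (MvPolynomial.isHomogeneous_C_mul_X _ _)
  simpa using this.pow (α s)

lemma linSubst_monomial (α : σ →₀ ℕ) (c : ExteriorAlgebra ℝ (g → ℝ)) :
    linSubst A B (MvPowerSeries.monomial α c) =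
      MvPowerSeries.C (ExteriorAlgebra.map (Matrix.vecMulLinear B) c) *
        polyToSeries τ _ (substMonomial A α) := by
  ext β
  rw [coeff_linSubst, MvPowerSeries.coeff_C_mul, coeff_polyToSeries, ← Algebra.commutes,
    ← Algebra.smul_def]
  by_cases hβ : α.degree = β.degree
  · rw [sum_eq_single α]
    · rw [MvPowerSeries.coeff_monomial_same]; rfl
    · intro α' _ h
      rw [MvPowerSeries.coeff_monomial_ne h, map_zero, smul_zero]
    · intro h
      refine absurd ?_ h
      rw [Finset.mem_finsuppAntidiag, ← hβ, Finsupp.degree_eq_sum]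
      simp
  · rw [(isHomogeneous_substMonomial A α).coeff_eq_zero (by exact fun h => hβ h.symm), zero_smul]
    refine sum_eq_zero fun α' hα' => ?_
    have : α' ≠ α := by
      rintro rfl
      rw [Finset.mem_finsuppAntidiag, ← Finsupp.degree_eq_sum] at hα'
      exact hβ hα'.1
    rw [MvPowerSeries.coeff_monomial_ne this, map_zero, smul_zero]

lemma substMonomial_zero : substMonomial A 0 = 1 := by simp [substMonomial]

lemma substMonomial_add (α α' : σ →₀ ℕ) :
    substMonomial A (α + α') = substMonomial A α * substMonomial A α' := by
  simp [substMonomial, pow_add, prod_mul_distrib]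

lemma substMonomial_single (s : σ) : substMonomial A (Finsupp.single s 1) =
      ∑ t, C (A s t) * X t := by
  rw [substMonomial, Finset.prod_eq_single s]
  · simp
  · intro b _ hb; simp [Finsupp.single_eq_of_ne hb]
  · simp

lemma linSubst_C (c : ExteriorAlgebra ℝ (g → ℝ)) : linSubst A B (MvPowerSeries.C c) =
      MvPowerSeries.C (ExteriorAlgebra.map (Matrix.vecMulLinear B) c) := by
  rw [← MvPowerSeries.monomial_zero_eq_C_apply, linSubst_monomial, substMonomial_zero, map_one,
    mul_one]

lemma linSubst_X (s : σ) : linSubst A B (MvPowerSeries.X s) = ∑ t, A s t • MvPowerSeries.X t := by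
  rw [MvPowerSeries.X, linSubst_monomial, substMonomial_single, map_one, map_one, one_mul, map_sum]
  classical
  refine sum_congr rfl fun t _ => ?_
  ext β
  rw [coeff_polyToSeries, coeff_real_smul, MvPolynomial.coeff_C_mul,
    MvPolynomial.coeff_X, MvPowerSeries.coeff_X]
  by_cases hβ : β = Finsupp.single t 1
  · simp [hβ, Algebra.algebraMap_eq_smul_one]
  · simp [hβ, Ne.symm hβ]

lemma linSubst_one : linSubst A B 1 = 1 := by
  rw [← map_one MvPowerSeries.C, linSubst_C, map_one, map_one]

lemma linSubst_mul (x y : MvPowerSeries σ (ExteriorAlgebra ℝ (g → ℝ))) :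
    linSubst A B (x * y) = linSubst A B x * linSubst A B y := by
  have key (α : σ →₀ ℕ) (c : ExteriorAlgebra ℝ (g → ℝ)) (y) :
      linSubst A B (MvPowerSeries.monomial α c * y) =
        linSubst A B (MvPowerSeries.monomial α c) * linSubst A B y := by
    refine DFunLike.congr_fun (FinDep.ext_monomial
      (f := (linSubst A B).comp (AddMonoidHom.mulLeft (MvPowerSeries.monomial α c)))
      (g := (AddMonoidHom.mulLeft (linSubst A B (MvPowerSeries.monomial α c))).comp (linSubst A B))
      ((finDep_linSubst A B).comp (FinDep.mulLeft _)) ((FinDep.mulLeft _).comp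
      (finDep_linSubst A B)) fun α' c' => ?_) y
    simp only [AddMonoidHom.comp_apply, AddMonoidHom.coe_mulLeft,
      MvPowerSeries.monomial_mul_monomial, linSubst_monomial, substMonomial_add, map_mul]
    rw [mul_assoc, mul_assoc, polyToSeries_comm (substMonomial A α)
      (MvPowerSeries.C _ * _), mul_assoc, polyToSeries_comm (substMonomial A α)]
  refine DFunLike.congr_fun (FinDep.ext_monomial
      (f := (linSubst A B).comp (AddMonoidHom.mulRight y))
      (g := (AddMonoidHom.mulRight (linSubst A B y)).comp (linSubst A B))
      ((finDep_linSubst A B).comp (FinDep.mulRight _)) ((FinDep.mulRight _).comp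
      (finDep_linSubst A B)) fun α c => ?_) x
  exact key α c y

/-- `linSubst` as a homomorphism of rings. -/
def linSubstHom : MvPowerSeries σ (ExteriorAlgebra ℝ (g → ℝ)) →+*
    MvPowerSeries τ (ExteriorAlgebra ℝ (h → ℝ)) where
  __ := linSubst A B
  map_one' := linSubst_one A B
  map_mul' := linSubst_mul A B

end LinSubst

/-! ### Derivatives of power series -/

section Pderiv

variable {σ τ R : Type*} [Ring R]

lemma coeff_pderivHom (v : σ) (f : MvPowerSeries σ R) (d : σ →₀ ℕ) :
    MvPowerSeries.coeff d (pderivHom v f) =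
      MvPowerSeries.coeff (d + Finsupp.single v 1) f * (d v + 1) := rfl

lemma finDep_pderivHom (v : σ) : FinDep (pderivHom (R := R) v) := fun β =>
  ⟨{β + Finsupp.single v 1}, fun x hx => by rw [coeff_pderivHom, hx _ (by simp), zero_mul]⟩

lemma pderivHom_monomial [DecidableEq σ] (v : σ) (α : σ →₀ ℕ) (c : R) :
    pderivHom v (MvPowerSeries.monomial α c) =
      MvPowerSeries.monomial (α - Finsupp.single v 1) (c * α v) := by
  ext β
  rw [coeff_pderivHom, MvPowerSeries.coeff_monomial, MvPowerSeries.coeff_monomial]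
  by_cases h : β + Finsupp.single v 1 = α
  · subst h; simp
  · rw [if_neg h, zero_mul]
    split_ifs with h'
    · subst h'
      have : α v = 0 := by
        by_contra h0
        exact h (tsub_add_cancel_of_le (by
          rw [Finsupp.single_le_iff]; exact Nat.one_le_iff_ne_zero.2 h0))
      simp [this]
    · rfl

lemma pderivHom_mul (v : σ) (x y : MvPowerSeries σ R) :
    pderivHom v (x * y) = pderivHom v x * y + x * pderivHom v y := by
  classical
  have key (α : σ →₀ ℕ) (c : R) (y) : pderivHom v (MvPowerSeries.monomial α c * y) =
      pderivHom v (MvPowerSeries.monomial α c) * y + MvPowerSeries.monomial α c * pderivHom v y := by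
    refine DFunLike.congr_fun (FinDep.ext_monomial
      (f := (pderivHom v).comp (AddMonoidHom.mulLeft (MvPowerSeries.monomial α c)))
      (g := AddMonoidHom.mulLeft (pderivHom v (MvPowerSeries.monomial α c)) +
        (AddMonoidHom.mulLeft (MvPowerSeries.monomial α c)).comp (pderivHom v))
      ((finDep_pderivHom v).comp (FinDep.mulLeft _)) ((FinDep.mulLeft _).add
      ((FinDep.mulLeft _).comp (finDep_pderivHom v))) fun α' c' => ?_) y
    simp only [AddMonoidHom.comp_apply, AddMonoidHom.add_apply, AddMonoidHom.coe_mulLeft,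
      MvPowerSeries.monomial_mul_monomial, pderivHom_monomial]
    have h1 : MvPowerSeries.monomial (α - Finsupp.single v 1 + α') (c * α v * c') =
        MvPowerSeries.monomial (α + α' - Finsupp.single v 1) (c * α v * c') := by
      by_cases h0 : α v = 0
      · simp [h0]
      · congr 2
        rw [tsub_add_eq_add_tsub (by
          rw [Finsupp.single_le_iff]; exact Nat.one_le_iff_ne_zero.2 h0)]
    have h2 : MvPowerSeries.monomial (α + (α' - Finsupp.single v 1)) (c * (c' * α' v)) =
        MvPowerSeries.monomial (α + α' - Finsupp.single v 1) (c * (c' * α' v)) := by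
      by_cases h0 : α' v = 0
      · simp [h0]
      · congr 2
        rw [add_tsub_assoc_of_le (by
          rw [Finsupp.single_le_iff]; exact Nat.one_le_iff_ne_zero.2 h0)]
    rw [h1, h2, ← map_add]
    congr 1
    rw [Finsupp.add_apply, Nat.cast_add, mul_add, mul_assoc c (α v : R), (Nat.cast_commute _ c').eq]
    simp only [mul_assoc]
  refine DFunLike.congr_fun (FinDep.ext_monomial (f := (pderivHom v).comp (AddMonoidHom.mulRight y))
      (g := (AddMonoidHom.mulRight y).comp (pderivHom v) + AddMonoidHom.mulRight (pderivHom v y))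
      ((finDep_pderivHom v).comp (FinDep.mulRight _)) (((FinDep.mulRight _).comp
      (finDep_pderivHom v)).add (FinDep.mulRight _)) fun α c => ?_) x
  exact key α c y

lemma pderivHom_comm (v w : σ) (x : MvPowerSeries σ R) :
    pderivHom v (pderivHom w x) = pderivHom w (pderivHom v x) := by
  classical
  ext d
  simp only [coeff_pderivHom]
  rw [add_right_comm]
  by_cases h : v = w
  · subst h; simp
  · simp only [Finsupp.add_apply, Finsupp.single_apply, h, Ne.symm h, if_false, add_zero, mul_assoc]
    congr 1
    exact_mod_cast (Nat.cast_commute (d w + 1) ((d v + 1 : ℕ) : R)).eq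

lemma pderivHom_C (v : σ) (c : R) : pderivHom v (MvPowerSeries.C c) = 0 :=
  MvPowerSeries.pderivFun_C c

lemma pderivHom_X [DecidableEq σ] (v w : σ) :
    pderivHom v (MvPowerSeries.X w : MvPowerSeries σ R) = if v = w then 1 else 0 := by
  rw [MvPowerSeries.X, pderivHom_monomial]
  split_ifs with h
  · subst h; simp [MvPowerSeries.monomial_zero_eq_C]
  · simp [Finsupp.single_apply, Ne.symm h]

end Pderiv

section Chain

variable {σ τ g h : Type*} [Fintype σ] [Fintype τ] [Fintype g] [DecidableEq σ]
  (A : Matrix σ τ ℝ) (B : Matrix g h ℝ)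

/-- Two finitely dependent maps that satisfy the Leibniz rule over the same homomorphism of rings
are equal if they agree on constants and on variables. -/
lemma FinDep.ext_derivation {R S : Type*} [Ring R] [Ring S] (φ : MvPowerSeries σ R →
    MvPowerSeries τ S) {D E : MvPowerSeries σ R →+ MvPowerSeries τ S} (hD : FinDep D)
    (hE : FinDep E) (hDm : ∀ x s, D (x * MvPowerSeries.X s) =
      D x * φ (MvPowerSeries.X s) + φ x * D (MvPowerSeries.X s))
    (hEm : ∀ x s, E (x * MvPowerSeries.X s) =
      E x * φ (MvPowerSeries.X s) + φ x * E (MvPowerSeries.X s))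
    (hC : ∀ c, D (MvPowerSeries.C c) = E (MvPowerSeries.C c))
    (hX : ∀ s, D (MvPowerSeries.X s) = E (MvPowerSeries.X s)) : D = E := by
  refine hD.ext_monomial hE fun α c => ?_
  refine monomial_induction (p := fun x => D x = E x) hC (fun f s hf => ?_) α c
  rw [hDm, hEm, hf, hX]

lemma pderivHom_linSubst [DecidableEq τ] (t : τ) (x : MvPowerSeries σ (ExteriorAlgebra ℝ (g → ℝ))) :
    pderivHom t (linSubst A B x) = ∑ s, A s t • linSubst A B (pderivHom s x) := by
  have hsm (c : ℝ) (z : MvPowerSeries τ (ExteriorAlgebra ℝ (h → ℝ))) :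
      c • z = MvPowerSeries.C (algebraMap ℝ _ c) * z := by
    ext β; rw [MvPowerSeries.coeff_C_mul, coeff_real_smul, Algebra.smul_def]
  have := FinDep.ext_derivation (linSubst A B) (D := (pderivHom t).comp (linSubst A B))
    (E := ∑ s, (AddMonoidHom.mulLeft (MvPowerSeries.C (algebraMap ℝ _ (A s t)))).comp
      ((linSubst A B).comp (pderivHom s)))
    ((finDep_pderivHom t).comp (finDep_linSubst A B))
    (FinDep.sum _ fun s _ => (FinDep.mulLeft _).comp
      ((finDep_linSubst A B).comp (finDep_pderivHom s)))
    (fun x s => by simp [linSubst_mul, pderivHom_mul])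
    (fun x s => by
      simp only [AddMonoidHom.finsetSum_apply, AddMonoidHom.comp_apply, AddMonoidHom.coe_mulLeft,
        pderivHom_mul, map_add, linSubst_mul, mul_add, sum_add_distrib, sum_mul,
        mul_sum, mul_assoc, ← hsm, mul_smul_comm, smul_mul_assoc, smul_add])
    (fun c => by simp [linSubst_C, pderivHom_C])
    (fun s => by
      simp only [AddMonoidHom.finsetSum_apply, AddMonoidHom.comp_apply, AddMonoidHom.coe_mulLeft,
        pderivHom_X, linSubst_X, ← hsm, map_sum]
      rw [sum_eq_single s, if_pos rfl, linSubst_one, sum_eq_single t]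
      · rw [hsm, pderivHom_mul, pderivHom_C, pderivHom_X, if_pos rfl, hsm]; simp
      · intro b _ hb
        rw [hsm, pderivHom_mul, pderivHom_C, pderivHom_X, if_neg hb.symm]; simp
      · simp
      · intro b _ hb; simp [hb]
      · simp)
  have := DFunLike.congr_fun this x
  simpa [hsm] using this

end Chain

/-! ### Coefficientwise maps -/

section Coefficientwise

variable {σ R S T : Type*} [Ring R] [Ring S] [Ring T]

/-- Apply an additive map to all the coefficients of a formal power series. -/
def cmap (f : R →+ S) : MvPowerSeries σ R →+ MvPowerSeries σ S where
  toFun x := fun β => f (MvPowerSeries.coeff β x)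
  map_zero' := by funext β; simp only [map_zero]; rfl
  map_add' x y := by funext β; simp only [map_add]; rfl

lemma coeff_cmap (f : R →+ S) (x : MvPowerSeries σ R) (β : σ →₀ ℕ) :
    MvPowerSeries.coeff β (cmap f x) = f (MvPowerSeries.coeff β x) := rfl

lemma cmap_smul [Algebra ℝ R] [Algebra ℝ S] {f : R →+ S} (hf : ∀ (c : ℝ) x, f (c • x) = c • f x)
    (c : ℝ) (x : MvPowerSeries σ R) : cmap f (c • x) = c • cmap f x := by
  ext β
  exact hf c _

lemma cmap_C (f : R →+ S) (r : R) :
    cmap f (MvPowerSeries.C r : MvPowerSeries σ R) = MvPowerSeries.C (f r) := by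
  classical
  ext β
  rw [coeff_cmap, MvPowerSeries.coeff_C, MvPowerSeries.coeff_C]
  split_ifs <;> simp

/-- A bilinear rule for the value of an additive map on products, such as multiplicativity or the
Leibniz rule, is inherited by the coefficientwise map. -/
lemma cmap_mul {h f₁ g₁ f₂ g₂ : R →+ S} (H : ∀ x y, h (x * y) = f₁ x * g₁ y + f₂ x * g₂ y)
    (x y : MvPowerSeries σ R) :
    cmap h (x * y) = cmap f₁ x * cmap g₁ y + cmap f₂ x * cmap g₂ y := by
  classical
  ext β
  simp only [coeff_cmap, MvPowerSeries.coeff_mul, map_add, map_sum, H, sum_add_distrib]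

lemma cmap_mul_hom {h : R →+ S} (H : ∀ x y, h (x * y) = h x * h y)
    (x y : MvPowerSeries σ R) : cmap h (x * y) = cmap h x * cmap h y := by
  have := cmap_mul (h := h) (f₁ := h) (g₁ := h) (f₂ := 0) (g₂ := 0) (by simpa using H) x y
  rw [this]
  have : cmap (0 : R →+ S) x = 0 := by ext β; rfl
  rw [this, zero_mul, add_zero]

lemma mem_center_mvPowerSeries {x : MvPowerSeries σ R}
    (hx : ∀ β, MvPowerSeries.coeff β x ∈ Set.center R) (y : MvPowerSeries σ R) : x * y = y * x := by
  classical
  ext β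
  rw [MvPowerSeries.coeff_mul, MvPowerSeries.coeff_mul, ← Finset.sum_equiv
    (Equiv.prodComm _ _) (s := Finset.HasAntidiagonal.antidiagonal β) (g := fun q =>
      MvPowerSeries.coeff q.1 y * MvPowerSeries.coeff q.2 x)]
  · simp [add_comm]
  · intro q _
    exact ((Set.mem_center_iff.1 (hx q.1)).comm _).eq

end Coefficientwise

/-! ### Further operations on the exterior algebra bundle -/

section Formal

variable {σ τ g h : Type*} [Fintype σ] [Fintype τ] [Fintype g] [DecidableEq σ]

lemma finDep_id {R : Type*} [Ring R] : FinDep (AddMonoidHom.id (MvPowerSeries σ R)) :=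
  FinDep.of_coeff (fun _ => AddMonoidHom.id R) fun _ _ => rfl

lemma linSubst_comp {υ l : Type*} [Fintype υ] [Fintype h] [DecidableEq τ] (A : Matrix σ τ ℝ)
    (B : Matrix g h ℝ) (A' : Matrix τ υ ℝ) (B' : Matrix h l ℝ)
    (x : MvPowerSeries σ (ExteriorAlgebra ℝ (g → ℝ))) :
    linSubst A' B' (linSubst A B x) = linSubst (A * A') (B * B') x := by
  have hsm (c : ℝ) (z : MvPowerSeries τ (ExteriorAlgebra ℝ (h → ℝ))) :
      linSubst A' B' (c • z) = c • linSubst A' B' z := by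
    ext β
    simp only [coeff_linSubst, coeff_real_smul, map_smul, smul_sum]
    exact sum_congr rfl fun _ _ => smul_comm _ _ _
  refine DFunLike.congr_fun (FinDep.ext_monomial
    (f := (linSubst A' B').comp (linSubst A B)) (g := linSubst (A * A') (B * B'))
    ((finDep_linSubst _ _).comp (finDep_linSubst _ _)) (finDep_linSubst _ _) fun α c => ?_) x
  refine monomial_induction (p := fun x => (linSubst A' B').comp (linSubst A B) x =
    linSubst (A * A') (B * B') x) (fun c => ?_) (fun f s hf => ?_) α c
  · rw [AddMonoidHom.comp_apply, linSubst_C, linSubst_C, linSubst_C]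
    congr 1
    have : (ExteriorAlgebra.map (Matrix.vecMulLinear B')).comp
        (ExteriorAlgebra.map (Matrix.vecMulLinear B)) =
        ExteriorAlgebra.map (Matrix.vecMulLinear (B * B')) := by
      rw [ExteriorAlgebra.map_comp_map]
      congr 1
      refine LinearMap.ext fun v => ?_
      simp [Matrix.vecMul_vecMul]
    exact DFunLike.congr_fun this c
  · rw [AddMonoidHom.comp_apply] at hf ⊢
    rw [linSubst_mul, linSubst_mul, linSubst_mul, hf, linSubst_X, linSubst_X, map_sum]
    congr 1
    simp only [hsm, linSubst_X, smul_sum, smul_smul, Matrix.mul_apply, sum_smul]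
    exact sum_comm

lemma linSubst_id [DecidableEq g] (x : MvPowerSeries σ (ExteriorAlgebra ℝ (g → ℝ))) :
    linSubst (1 : Matrix σ σ ℝ) (1 : Matrix g g ℝ) x = x := by
  refine DFunLike.congr_fun (FinDep.ext_monomial
    (f := linSubst (1 : Matrix σ σ ℝ) (1 : Matrix g g ℝ)) (g := AddMonoidHom.id _)
    (finDep_linSubst _ _) finDep_id fun α c => ?_) x
  refine monomial_induction (p := fun x => linSubst (1 : Matrix σ σ ℝ) (1 : Matrix g g ℝ) x = x)
    (fun c => ?_) (fun f s hf => ?_) α c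
  · rw [linSubst_C]
    have : Matrix.vecMulLinear (1 : Matrix g g ℝ) = LinearMap.id := by
      refine LinearMap.ext fun v => ?_
      simp
    rw [this, ExteriorAlgebra.map_id]
    rfl
  · rw [linSubst_mul, hf, linSubst_X, sum_eq_single s]
    · simp
    · intro b _ hb; simp [Matrix.one_apply_ne hb.symm]
    · simp

lemma linSubst_smul (A : Matrix σ τ ℝ) (B : Matrix g h ℝ) (c : ℝ)
    (x : MvPowerSeries σ (ExteriorAlgebra ℝ (g → ℝ))) :
    linSubst A B (c • x) = c • linSubst A B x := by
  ext β
  simp only [coeff_linSubst, coeff_real_smul, map_smul, smul_sum]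
  exact sum_congr rfl fun _ _ => smul_comm _ _ _

/-- Left contraction with a generator, as an additive map. -/
def contractGen {g : Type*} (e : g) : ExteriorAlgebra ℝ (g → ℝ) →+ ExteriorAlgebra ℝ (g → ℝ) :=
  (contractLeft (LinearMap.proj e : Dual ℝ (g → ℝ))).toAddMonoidHom

/-- The parity involution, as an additive map. -/
def parityGen (g : Type*) : ExteriorAlgebra ℝ (g → ℝ) →+ ExteriorAlgebra ℝ (g → ℝ) :=
  (involute (Q := (0 : QuadraticForm ℝ (g → ℝ)))).toRingHom.toAddMonoidHom

lemma contractGen_mul (e : g) (x y : ExteriorAlgebra ℝ (g → ℝ)) :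
    contractGen e (x * y) = contractGen e x * y + parityGen g x * contractGen e y :=
  contractLeft_mul _ x y

lemma parityGen_mul (x y : ExteriorAlgebra ℝ (g → ℝ)) :
    parityGen g (x * y) = parityGen g x * parityGen g y :=
  map_mul (involute (Q := (0 : QuadraticForm ℝ (g → ℝ)))) x y

lemma contractGen_smul {g : Type*} (e : g) (c : ℝ) (y : ExteriorAlgebra ℝ (g → ℝ)) :
    contractGen e (c • y) = c • contractGen e y := map_smul (CliffordAlgebra.contractLeft _) c y

lemma contractGen_linSubst [DecidableEq g] (A : Matrix σ τ ℝ) (B : Matrix g h ℝ) (e : h)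
    (x : MvPowerSeries σ (ExteriorAlgebra ℝ (g → ℝ))) :
    cmap (contractGen e) (linSubst A B x) = ∑ e', B e' e • linSubst A B (cmap (contractGen e') x) := by
  have key (y : ExteriorAlgebra ℝ (g → ℝ)) :
      contractGen e (ExteriorAlgebra.map (Matrix.vecMulLinear B) y) =
        ∑ e', B e' e • ExteriorAlgebra.map (Matrix.vecMulLinear B) (contractGen e' y) := by
    have hd : (LinearMap.proj e : Dual ℝ (h → ℝ)) ∘ₗ Matrix.vecMulLinear B =
        ∑ e', B e' e • (LinearMap.proj e' : Dual ℝ (g → ℝ)) := by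
      refine LinearMap.ext fun v => ?_
      simp [Matrix.vecMul, dotProduct, LinearMap.sum_apply, mul_comm]
    change CliffordAlgebra.contractLeft _ _ = _
    rw [contractLeft_map, hd]
    simp only [map_sum, map_smul, LinearMap.sum_apply, LinearMap.smul_apply]
    rfl
  ext β
  simp only [coeff_cmap, map_sum, coeff_real_smul, coeff_linSubst, key, smul_sum]
  rw [sum_comm]
  refine sum_congr rfl fun α _ => ?_
  rw [contractGen_smul, key, smul_sum]
  exact sum_congr rfl fun _ _ => smul_comm _ _ _

lemma parityGen_linSubst (A : Matrix σ τ ℝ) (B : Matrix g h ℝ)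
    (x : MvPowerSeries σ (ExteriorAlgebra ℝ (g → ℝ))) :
    cmap (parityGen h) (linSubst A B x) = linSubst A B (cmap (parityGen g) x) := by
  have key (y : ExteriorAlgebra ℝ (g → ℝ)) :
      parityGen h (ExteriorAlgebra.map (Matrix.vecMulLinear B) y) =
        ExteriorAlgebra.map (Matrix.vecMulLinear B) (parityGen g y) := involute_map _ _
  have hs (c : ℝ) (y : ExteriorAlgebra ℝ (h → ℝ)) : parityGen h (c • y) = c • parityGen h y :=
    map_smul (involute (Q := (0 : QuadraticForm ℝ (h → ℝ)))) c y
  ext β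
  simp only [coeff_cmap, map_sum, coeff_linSubst, hs, key]

lemma cmap_pderivHom {R S : Type*} [Ring R] [Ring S] (f : R →+ S) (s : σ)
    (x : MvPowerSeries σ R) : cmap f (pderivHom s x) = pderivHom s (cmap f x) := by
  ext β
  rw [coeff_cmap, coeff_pderivHom, coeff_pderivHom, coeff_cmap]
  have (r : R) (n : ℕ) : f (r * (n + 1)) = f r * (n + 1) := by
    have e1 : r * ((n : R) + 1) = (n + 1) • r := by rw [nsmul_eq_mul']; push_cast; rfl
    have e2 : f r * ((n : S) + 1) = (n + 1) • f r := by rw [nsmul_eq_mul']; push_cast; rfl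
    rw [e1, e2, map_nsmul]
  exact this _ _

end Formal

/-! ### Sums of series weighted with powers of the variable -/

section HSum

variable {B : Type*} [Ring B]

lemma sum_antidiagonal_assoc {M : Type*} [AddCommMonoid M] (m : ℕ) (f : ℕ → ℕ → ℕ → M) :
    ∑ p ∈ antidiagonal m, ∑ q ∈ antidiagonal p.1, f q.1 q.2 p.2 =
      ∑ p ∈ antidiagonal m, ∑ q ∈ antidiagonal p.2, f p.1 q.1 q.2 := by
  simp only [Finset.sum_sigma']
  apply Finset.sum_nbij' (fun ⟨⟨_i, j⟩, ⟨k, l⟩⟩ ↦ ⟨(k, l + j), (l, j)⟩)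
    (fun ⟨⟨i, _j⟩, ⟨k, l⟩⟩ ↦ ⟨(i + k, l), (i, k)⟩) <;>
  · rintro ⟨⟨a, b⟩, c, d⟩ h
    simp only [mem_sigma, Finset.HasAntidiagonal.mem_antidiagonal] at h
    obtain ⟨h1, rfl⟩ := h
    simp [← h1, add_assoc]

lemma sum_antidiagonal_swap {M : Type*} [AddCommMonoid M] (m : ℕ) (f : ℕ → ℕ → M) :
    ∑ p ∈ antidiagonal m, f p.1 p.2 = ∑ p ∈ antidiagonal m, f p.2 p.1 := by
  rw [← Finset.Nat.sum_antidiagonal_swap]; rfl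

/-- The sum `∑ r, X ^ r * ψ r`. -/
def hs (ψ : ℕ → B⟦X⟧) : B⟦X⟧ := PowerSeries.mk fun m => ∑ p ∈ antidiagonal m, coeff p.2 (ψ p.1)

lemma coeff_hs (ψ : ℕ → B⟦X⟧) (m : ℕ) : coeff m (hs ψ) =
    ∑ p ∈ antidiagonal m, coeff p.2 (ψ p.1) := coeff_mk _ _

lemma hs_add (ψ φ : ℕ → B⟦X⟧) : hs (fun r => ψ r + φ r) = hs ψ + hs φ := by
  ext m; simp only [coeff_hs, map_add, sum_add_distrib]

lemma hs_sub (ψ φ : ℕ → B⟦X⟧) : hs (fun r => ψ r - φ r) = hs ψ - hs φ := by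
  ext m; simp only [coeff_hs, map_sub, sum_sub_distrib]

lemma hs_sum {ι : Type*} (s : Finset ι) (ψ : ι → ℕ → B⟦X⟧) :
    hs (fun r => ∑ i ∈ s, ψ i r) = ∑ i ∈ s, hs (ψ i) := by
  ext m
  simp only [coeff_hs, map_sum]
  exact sum_comm

lemma hs_smul [Algebra ℝ B] (c : ℝ) (ψ : ℕ → B⟦X⟧) : hs (fun r => c • ψ r) = c • hs ψ := by
  ext m
  have (z : B⟦X⟧) (n : ℕ) : coeff n (c • z) = c • coeff n z := rfl
  simp only [coeff_hs, this, smul_sum]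

lemma hs_cmap {B' : Type*} [Ring B'] (f : B →+ B') (ψ : ℕ → B⟦X⟧) :
    cmap f (hs ψ) = hs fun r => (cmap f (ψ r) : PowerSeries B') := by
  ext m
  have (z : B⟦X⟧) (n : ℕ) : coeff n (cmap f z : PowerSeries B') = f (coeff n z) := rfl
  rw [this, coeff_hs, coeff_hs, map_sum]
  rfl

lemma hs_mul (ψ : ℕ → B⟦X⟧) (z : B⟦X⟧) : hs ψ * z = hs fun r => ψ r * z := by
  ext m
  simp only [coeff_hs, PowerSeries.coeff_mul, sum_mul]
  exact sum_antidiagonal_assoc m fun a b c => coeff b (ψ a) * coeff c z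

lemma mul_hs (ψ : ℕ → B⟦X⟧) (z : B⟦X⟧) : z * hs ψ = hs fun r => z * ψ r := by
  ext m
  simp only [coeff_hs, PowerSeries.coeff_mul, mul_sum]
  rw [← sum_antidiagonal_assoc m fun a b c => coeff a z * coeff c (ψ b),
    ← sum_antidiagonal_assoc m fun a b c => coeff b z * coeff c (ψ a)]
  refine sum_congr rfl fun p _ => ?_
  exact sum_antidiagonal_swap p.1 fun a b => coeff a z * coeff p.2 (ψ b)

lemma hs_hs (ψ : ℕ → ℕ → B⟦X⟧) :
    hs (fun r => hs (ψ r)) = hs fun n => ∑ p ∈ antidiagonal n, ψ p.1 p.2 := by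
  ext m
  simp only [coeff_hs, map_sum]
  exact (sum_antidiagonal_assoc m fun a b c => coeff c (ψ a b)).symm

lemma hs_mul_hs (ψ φ : ℕ → B⟦X⟧) :
    hs ψ * hs φ = hs fun n => ∑ p ∈ antidiagonal n, ψ p.1 * φ p.2 := by
  rw [hs_mul, ← hs_hs fun r s => ψ r * φ s]
  simp only [mul_hs]

lemma hs_single (z : B⟦X⟧) : hs (fun r => if r = 0 then z else 0) = z := by
  ext m
  rw [coeff_hs, sum_eq_single (0, m)]
  · simp
  · rintro ⟨a, b⟩ h hne
    rw [if_neg, map_zero]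
    rintro rfl
    exact hne (by simpa using h)
  · simp

lemma X_mul_hs (ψ : ℕ → B⟦X⟧) :
    PowerSeries.X * hs ψ = hs fun r => if r = 0 then 0 else ψ (r - 1) := by
  ext m
  rw [coeff_hs]
  cases m with
  | zero => simp
  | succ m =>
    rw [PowerSeries.coeff_succ_X_mul, coeff_hs, Finset.Nat.sum_antidiagonal_succ]
    simp

end HSum

/-! ### Differential operators with constant coefficients on products -/

/-- A commuting family of derivations. -/
structure CommDer (N : ℕ) (A : Type*) [Ring A] [Algebra ℝ A] where
  d : Fin N → A →ₗ[ℝ] A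
  leibniz (i : Fin N) (x y : A) : d i (x * y) = d i x * y + x * d i y
  comm (i j : Fin N) (x : A) : d i (d j x) = d j (d i x)

section EvalEnd

variable {σ E : Type*} [AddCommGroup E] [Module ℝ E] (T : σ → End ℝ E)
  (hT : ∀ s t, T s * T t = T t * T s)

/-- The action of polynomials by means of a commuting family of endomorphisms. -/
def evalEnd : MvPolynomial σ ℝ →ₐ[ℝ] End ℝ E := letI : CommRing (Algebra.adjoin ℝ (Set.range T)) :=
    { (inferInstance : Ring (Algebra.adjoin ℝ (Set.range T))) with
      mul_comm := (Algebra.isMulCommutative_adjoin ℝ (s := Set.range T)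
        (by rintro _ ⟨s, rfl⟩ _ ⟨t, rfl⟩; exact hT s t)).is_comm.comm }
  (Algebra.adjoin ℝ (Set.range T)).val.comp (aeval fun s => ⟨T s, Algebra.subset_adjoin ⟨s, rfl⟩⟩)

lemma evalEnd_X (s : σ) : evalEnd T hT (X s) = T s := by
  simp [evalEnd]

lemma evalEnd_X_mul (s : σ) (g : MvPolynomial σ ℝ) (x : E) :
    evalEnd T hT (X s * g) x = T s (evalEnd T hT g x) := by
  rw [map_mul, evalEnd_X]; rfl

end EvalEnd

section Slots

variable {N : ℕ} {A : Type*} [Ring A] [Algebra ℝ A] (D : CommDer N A)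
  {V : Type*} [Fintype V] [DecidableEq V]

namespace CommDer

lemma d_one (i : Fin N) : D.d i 1 = 0 := by
  have := D.leibniz i 1 1
  simp only [mul_one, one_mul] at this
  simpa using this

/-- A derivation preserves the center. -/
lemma d_mem_center (i : Fin N) {x : A} (hx : x ∈ 𝒵 A) : D.d i x ∈ 𝒵 A := by
  rw [Subalgebra.mem_center_iff] at hx ⊢
  intro b
  have h1 := D.leibniz i b x
  rw [hx b, D.leibniz i x b, hx (D.d i b), add_comm] at h1
  exact (add_left_cancel h1).symm

/-- The derivations of the center. -/
def dZ (i : Fin N) (z : 𝒵 A) : 𝒵 A := ⟨D.d i z, D.d_mem_center i z.2⟩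

lemma dZ_comm (i j : Fin N) (z : 𝒵 A) :
    D.dZ i (D.dZ j z) = D.dZ j (D.dZ i z) := Subtype.ext (D.comm i j z)

lemma dZ_one (i : Fin N) : D.dZ i 1 = 0 := Subtype.ext (D.d_one i)

lemma dZ_mul (i : Fin N) (x y : 𝒵 A) :
    D.dZ i (x * y) = D.dZ i x * y + x * D.dZ i y := Subtype.ext (D.leibniz i x y)

/-- The functions of an element and of central elements in the slots `V`. -/
abbrev SlotFun (A V : Type*) [Ring A] [Algebra ℝ A] := A → (V → 𝒵 A) → A

/-- The action of a derivation on the argument in a slot. -/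
def slotOp (p : Option V × Fin N) : End ℝ (SlotFun A V) := match p with
  | (none, i) => { toFun := fun φ x a => φ (D.d i x) a
                   map_add' := fun _ _ => rfl
                   map_smul' := fun _ _ => rfl }
  | (some v, i) => { toFun := fun φ x a => φ x (update a v (D.dZ i (a v)))
                     map_add' := fun _ _ => rfl
                     map_smul' := fun _ _ => rfl }

lemma slotOp_comm (p q : Option V × Fin N) : D.slotOp p * D.slotOp q = D.slotOp q * D.slotOp p := by
  obtain ⟨u, i⟩ := p
  obtain ⟨v, j⟩ := q
  refine LinearMap.ext fun φ => ?_
  funext x a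
  cases u with
  | none =>
    cases v with
    | none => simp [slotOp, D.comm i j]
    | some v => rfl
  | some u =>
    cases v with
    | none => rfl
    | some v =>
      simp only [slotOp, End.mul_apply, LinearMap.coe_mk, AddHom.coe_mk]
      congr 1
      by_cases h : u = v
      · subst h; simp [D.dZ_comm i j]
      · rw [update_of_ne h, update_of_ne (Ne.symm h), update_comm h]

/-- The polydifferential operator with constant coefficients of symbol `g`, applied to `x` and to
the central elements `a v`: a monomial `ξ ^ α` gives the product of the derivatives of the
arguments of orders prescribed by `α`. -/
def polyDiff (g : 𝒫[Option V, N]) : SlotFun A V :=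
  evalEnd D.slotOp D.slotOp_comm g fun x a => x * (∏ v, a v : 𝒵 A)

lemma polyDiff_add (g h : 𝒫[Option V, N]) (x : A) (a : V → 𝒵 A) :
    D.polyDiff (g + h) x a = D.polyDiff g x a + D.polyDiff h x a := by
  rw [polyDiff, map_add]; rfl

lemma polyDiff_smul (c : ℝ) (g : 𝒫[Option V, N]) (x : A)
    (a : V → 𝒵 A) : D.polyDiff (c • g) x a = c • D.polyDiff g x a := by
  rw [polyDiff, map_smul]; rfl

/-- `polyDiff` as a linear map of the symbol. -/
def polyDiffLin (x : A) (a : V → 𝒵 A) : 𝒫[Option V, N] →ₗ[ℝ] A where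
  toFun g := D.polyDiff g x a
  map_add' g h := D.polyDiff_add g h x a
  map_smul' c g := D.polyDiff_smul c g x a

lemma polyDiff_zero (x : A) (a : V → 𝒵 A) : D.polyDiff 0 x a = 0 := map_zero (D.polyDiffLin x a)

lemma polyDiff_sub (g h : 𝒫[Option V, N]) (x : A) (a : V → 𝒵 A) :
    D.polyDiff (g - h) x a = D.polyDiff g x a - D.polyDiff h x a :=
  map_sub (D.polyDiffLin x a) g h

lemma polyDiff_sum {ι : Type*} (s : Finset ι) (g : ι → 𝒫[Option V, N]) (x : A) (a : V → 𝒵 A) :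
    D.polyDiff (∑ i ∈ s, g i) x a = ∑ i ∈ s, D.polyDiff (g i) x a :=
  map_sum (D.polyDiffLin x a) g s

lemma polyDiff_one (x : A) (a : V → 𝒵 A) : D.polyDiff 1 x a = x * (∏ v, a v : 𝒵 A) := by
  rw [polyDiff, map_one]; rfl

lemma polyDiff_X_none (i : Fin N) (g : 𝒫[Option V, N]) (x : A) (a : V → 𝒵 A) :
    D.polyDiff (X (none, i) * g) x a = D.polyDiff g (D.d i x) a := by
  rw [polyDiff, evalEnd_X_mul]; rfl

lemma polyDiff_X_some (v : V) (i : Fin N) (g : 𝒫[Option V, N]) (x : A) (a : V → 𝒵 A) :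
    D.polyDiff (X (some v, i) * g) x a = D.polyDiff g x (update a v (D.dZ i (a v))) := by
  rw [polyDiff, evalEnd_X_mul]; rfl

/-- Induction on the symbol of a polydifferential operator. -/
lemma symbol_induction {σ : Type*} {p : MvPolynomial σ ℝ → Prop}
    (one : p 1) (add : ∀ g h, p g → p h → p (g + h)) (smul : ∀ (c : ℝ) g, p g → p (c • g))
    (X_mul : ∀ s g, p g → p (X s * g)) (g : MvPolynomial σ ℝ) : p g := by
  induction g using MvPolynomial.induction_on with
  | C c =>
    rw [← mul_one (C c), ← MvPolynomial.smul_eq_C_mul]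
    exact smul c _ one
  | add g h hg hh => exact add g h hg hh
  | mul_X g s hg => rw [mul_comm]; exact X_mul s g hg

variable {D}

/-- `polyDiff g` is linear in the first argument. -/
lemma polyDiff_add_left (g : 𝒫[Option V, N]) (x y : A) (a : V → 𝒵 A) :
    D.polyDiff g (x + y) a = D.polyDiff g x a + D.polyDiff g y a := by
  induction g using symbol_induction generalizing x y a with
  | one => simp only [polyDiff_one, add_mul]
  | add g h hg hh => simp only [polyDiff_add, hg, hh]; abel
  | smul c g hg => simp only [polyDiff_smul, hg, smul_add]
  | X_mul s g hg =>
    obtain ⟨u, i⟩ := s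
    cases u with
    | none => simp only [polyDiff_X_none, map_add, hg]
    | some v => simp only [polyDiff_X_some, hg]

lemma polyDiff_const_mul_left (g : 𝒫[Option V, N]) {c : A}
    (hc : ∀ i, D.d i c = 0) (x : A) (a : V → 𝒵 A) :
    D.polyDiff g (c * x) a = c * D.polyDiff g x a := by
  induction g using symbol_induction generalizing x a with
  | one => simp only [polyDiff_one, mul_assoc]
  | add g h hg hh => simp only [polyDiff_add, hg, hh, mul_add]
  | smul r g hg => simp only [polyDiff_smul, hg, mul_smul_comm]
  | X_mul s g hg =>
    obtain ⟨u, i⟩ := s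
    cases u with
    | none => simp only [polyDiff_X_none, D.leibniz, hc, zero_mul, zero_add, hg]
    | some v => simp only [polyDiff_X_some, hg]

/-- `polyDiff g` in the first argument, as an additive map. -/
def polyDiffLeft (D : CommDer N A) (g : 𝒫[Option V, N]) (a : V → 𝒵 A) : A →+ A :=
  AddMonoidHom.mk' (fun x => D.polyDiff g x a) fun x y => polyDiff_add_left g x y a

lemma polyDiff_zero_left (g : 𝒫[Option V, N])
    (a : V → 𝒵 A) : D.polyDiff g 0 a = 0 := map_zero (D.polyDiffLeft g a)

lemma polyDiff_eq_zero_of_slot (g : 𝒫[Option V, N]) (x : A)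
    (a : V → 𝒵 A) (v : V) (hv : a v = 0) : D.polyDiff g x a = 0 := by
  induction g using symbol_induction generalizing x a with
  | one => rw [polyDiff_one, Finset.prod_eq_zero (mem_univ v) hv]; simp
  | add g h hg hh => simp only [polyDiff_add, hg _ _ hv, hh _ _ hv, add_zero]
  | smul r g hg => simp only [polyDiff_smul, hg _ _ hv, smul_zero]
  | X_mul s g hg =>
    obtain ⟨u, i⟩ := s
    cases u with
    | none => rw [polyDiff_X_none, hg _ _ hv]
    | some w =>
      rw [polyDiff_X_some, hg]
      by_cases h : v = w
      · subst h; rw [update_self, hv]; exact Subtype.ext (map_zero _)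
      · rw [update_of_ne h, hv]

lemma polyDiff_X_of_one (g : 𝒫[Option V, N]) (x : A)
    (a : V → 𝒵 A) (v : V) (i : Fin N) (hv : a v = 1) :
    D.polyDiff (X (some v, i) * g) x a = 0 := by
  rw [polyDiff_X_some, hv, dZ_one]
  exact polyDiff_eq_zero_of_slot _ _ _ v (update_self _ _ _)

/-- The derivative of a polydifferential operator (Leibniz rule). -/
lemma d_polyDiff (g : 𝒫[Option V, N]) (i : Fin N) (x : A) (a : V → 𝒵 A) :
    D.d i (D.polyDiff g x a) = D.polyDiff ((∑ u, X (u, i)) * g) x a := by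
  induction g using symbol_induction generalizing x a with
  | one =>
    have hprod (s : Finset V) : D.dZ i (∏ v ∈ s, a v) =
        ∑ v ∈ s, ∏ w ∈ s, update a v (D.dZ i (a v)) w := by
      induction s using Finset.induction with
      | empty => simp [dZ_one]
      | insert v s hv ih =>
        rw [prod_insert hv, dZ_mul, ih, sum_insert hv, prod_insert hv, update_self, mul_sum]
        congr 1
        · congr 1
          refine prod_congr rfl fun w hw => ?_
          rw [update_of_ne (by rintro rfl; exact hv hw)]
        · refine sum_congr rfl fun w hw => ?_
          rw [prod_insert hv, update_of_ne (by rintro rfl; exact hv hw)]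
    simp only [Fintype.sum_option, add_mul, sum_mul, polyDiff_add, polyDiff_sum,
      polyDiff_X_none, polyDiff_X_some,
      polyDiff_one, D.leibniz]
    congr 1
    have : D.d i (∏ v, a v : 𝒵 A) = (D.dZ i (∏ v, a v) : 𝒵 A) := rfl
    rw [this, hprod, ← mul_sum]
    congr 1
    exact map_sum (𝒵 A).val _ _
  | add g h hg hh => simp only [polyDiff_add, map_add, hg, hh, mul_add]
  | smul r g hg => simp only [polyDiff_smul, map_smul, hg, mul_smul_comm]
  | X_mul s g hg =>
    obtain ⟨u, j⟩ := s
    rw [mul_left_comm]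
    cases u with
    | none => rw [polyDiff_X_none, polyDiff_X_none, hg]
    | some w => rw [polyDiff_X_some, polyDiff_X_some, hg]

end CommDer

end Slots

section Slots

variable {N : ℕ} {A : Type*} [Ring A] [Algebra ℝ A] {D : CommDer N A}
  {V : Type*} [Fintype V] [DecidableEq V]

namespace CommDer

lemma dZ_add (i : Fin N) (x y : 𝒵 A) :
    D.dZ i (x + y) = D.dZ i x + D.dZ i y := Subtype.ext (map_add _ _ _)

lemma dZ_smul (i : Fin N) (c : ℝ) (x : 𝒵 A) :
    D.dZ i (c • x) = c • D.dZ i x := Subtype.ext (map_smul _ _ _)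

lemma prod_update (a : V → 𝒵 A) (v : V) (z : 𝒵 A) :
    ∏ w, update a v z w = z * ∏ w ∈ univ.erase v, a w := by
  rw [← Finset.mul_prod_erase _ _ (mem_univ v), update_self]
  congr 1
  exact prod_congr rfl fun w hw => update_of_ne (Finset.ne_of_mem_erase hw) _ _

/-- Moving a derivation through the update of a slot. -/
lemma update_update_dZ (a : V → 𝒵 A) (v w : V) (z : 𝒵 A) (i : Fin N) (h : w ≠ v) :
    update (update a v z) w (D.dZ i (update a v z w)) = update (update a w (D.dZ i (a w))) v z := by
  rw [update_of_ne h, update_comm h.symm]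

lemma polyDiff_slot_add (g : 𝒫[Option V, N]) (x : A) (a : V → 𝒵 A) (v : V) (z z' : 𝒵 A) :
    D.polyDiff g x (update a v (z + z')) =
      D.polyDiff g x (update a v z) + D.polyDiff g x (update a v z') := by
  induction g using symbol_induction generalizing x a z z' with
  | one => simp only [polyDiff_one, prod_update, add_mul, mul_add, AddMemClass.coe_add]
  | add g h hg hh => simp only [polyDiff_add, hg, hh]; abel
  | smul r g hg => simp only [polyDiff_smul, hg, smul_add]
  | X_mul s g hg =>
    obtain ⟨u, i⟩ := s
    cases u with
    | none => simp only [polyDiff_X_none, hg]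
    | some w =>
      simp only [polyDiff_X_some]
      by_cases h : w = v
      · subst h; simp only [update_self, update_idem, dZ_add, hg]
      · simp only [update_update_dZ _ _ _ _ _ h, hg]

lemma polyDiff_slot_smul (g : 𝒫[Option V, N]) (x : A) (a : V → 𝒵 A) (v : V) (c : ℝ) (z : 𝒵 A) :
    D.polyDiff g x (update a v (c • z)) = c • D.polyDiff g x (update a v z) := by
  induction g using symbol_induction generalizing x a z with
  | one =>
    simp only [polyDiff_one, prod_update, smul_mul_assoc]
    exact mul_smul_comm _ _ _
  | add g h hg hh => simp only [polyDiff_add, hg, hh, smul_add]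
  | smul r g hg => simp only [polyDiff_smul, hg]; exact smul_comm _ _ _
  | X_mul s g hg =>
    obtain ⟨u, i⟩ := s
    cases u with
    | none => simp only [polyDiff_X_none, hg]
    | some w =>
      simp only [polyDiff_X_some]
      by_cases h : w = v
      · subst h; simp only [update_self, update_idem, dZ_smul, hg]
      · simp only [update_update_dZ _ _ _ _ _ h, hg]

/-- `polyDiff g` as a linear map of the argument in the slot `v`. -/
def polyDiffSlot (D : CommDer N A) (g : 𝒫[Option V, N]) (x : A)
    (a : V → 𝒵 A) (v : V) : 𝒵 A →ₗ[ℝ] A where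
  toFun z := D.polyDiff g x (update a v z)
  map_add' z z' := polyDiff_slot_add g x a v z z'
  map_smul' c z := polyDiff_slot_smul g x a v c z

/-- Exchanging the first argument with the one in the slot `v`. -/
lemma polyDiff_swap (g : 𝒫[Option V, N]) (v : V) (x z : 𝒵 A) (a : V → 𝒵 A) :
    D.polyDiff g x (update a v z) = D.polyDiff (rename (Prod.map (Equiv.swap none (some v)) id) g) z
        (update a v x) := by
  induction g using symbol_induction generalizing x z a with
  | one =>
    simp only [map_one, polyDiff_one, prod_update, ← Subalgebra.coe_mul]
    congr 1; ring
  | add g h hg hh => simp only [map_add, polyDiff_add, hg, hh]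
  | smul r g hg => simp only [map_smul, polyDiff_smul, hg]
  | X_mul s g hg =>
    obtain ⟨u, i⟩ := s
    rw [map_mul, rename_X, Prod.map_apply, id]
    cases u with
    | none =>
      rw [Equiv.swap_apply_left, polyDiff_X_none, polyDiff_X_some, update_self, update_idem]
      exact hg (D.dZ i x) z a
    | some w =>
      by_cases h : w = v
      · subst h
        rw [Equiv.swap_apply_right, polyDiff_X_none, polyDiff_X_some, update_self, update_idem]
        exact hg x (D.dZ i z) a
      · rw [Equiv.swap_apply_of_ne_of_ne (by simp) (by simpa using h), polyDiff_X_some,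
          polyDiff_X_some, update_update_dZ _ _ _ _ _ h, hg, update_update_dZ _ _ _ _ _ h]

/-- Slots with argument `1` can be dropped. -/
lemma polyDiff_rename {W : Type*} [Fintype W] [DecidableEq W] (i : W ↪ V)
    (g : 𝒫[Option W, N]) (x : A) (a : V → 𝒵 A)
    (ha : ∀ v, v ∉ Set.range i → a v = 1) :
    D.polyDiff (rename (Prod.map (Option.map i) id) g) x a = D.polyDiff g x (a ∘ i) := by
  induction g using symbol_induction generalizing x a with
  | one =>
    simp only [map_one, polyDiff_one]
    congr 2
    refine (Finset.prod_of_injOn i i.injective.injOn (by simp) ?_ (by simp)).symm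
    intro v _ hv
    exact ha v (by simpa using hv)
  | add g h hg hh => simp only [map_add, polyDiff_add, hg _ _ ha, hh _ _ ha]
  | smul r g hg => simp only [map_smul, polyDiff_smul, hg _ _ ha]
  | X_mul s g hg =>
    obtain ⟨u, j⟩ := s
    rw [map_mul, rename_X, Prod.map_apply, id]
    cases u with
    | none => rw [Option.map_none, polyDiff_X_none, polyDiff_X_none, hg _ _ ha]
    | some w =>
      rw [Option.map_some, polyDiff_X_some, polyDiff_X_some, hg]
      · rw [Function.update_comp_eq_of_injective _ i.injective, Function.comp_apply]
      · intro v hv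
        rw [update_of_ne (by rintro rfl; exact hv ⟨w, rfl⟩), ha v hv]

/-- The substitution `ξ_none ↦ ξ_none + ξ_w`, `ξ_w ↦ 0` of symbols, which corresponds to the
multiplication of the first argument by the one in the slot `w`. -/
def mergeSymbol (N : ℕ) (w : V) : 𝒫[Option V, N] →ₐ[ℝ] 𝒫[Option V, N] :=
  aeval fun p => if p.1 = none then X (none, p.2) + X (some w, p.2)
    else if p.1 = some w then 0 else X p

lemma polyDiff_merge (g : 𝒫[Option V, N]) (w : V) (x : A) (a : V → 𝒵 A) :
    D.polyDiff (mergeSymbol N w g) x a = D.polyDiff g (x * a w) (update a w 1) := by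
  induction g using symbol_induction generalizing x a with
  | one =>
    rw [map_one, polyDiff_one, polyDiff_one, prod_update, one_mul, mul_assoc, ← Subalgebra.coe_mul,
      Finset.mul_prod_erase _ _ (mem_univ w)]
  | add g h hg hh => simp only [map_add, polyDiff_add, hg, hh]
  | smul r g hg => simp only [map_smul, polyDiff_smul, hg]
  | X_mul s g hg =>
    obtain ⟨u, j⟩ := s
    rw [map_mul]
    cases u with
    | none =>
      rw [mergeSymbol, aeval_X, if_pos rfl, ← mergeSymbol, add_mul, polyDiff_add,
        polyDiff_X_none, polyDiff_X_some, polyDiff_X_none, hg, hg, D.leibniz, polyDiff_add_left,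
        update_self, update_idem]
      rfl
    | some v =>
      rw [mergeSymbol, aeval_X, if_neg (by simp), ← mergeSymbol]
      by_cases h : v = w
      · subst h
        rw [if_pos rfl, zero_mul, polyDiff_zero, polyDiff_X_of_one _ _ _ _ _ (by simp)]
      · rw [if_neg (by simpa using h), polyDiff_X_some, polyDiff_X_some, hg,
          update_of_ne (Ne.symm h), update_update_dZ _ _ _ _ _ h]

/-- The symbol `∑ ϖ^{ij} ξ_{u,i} ξ_{v,j}` of the contraction of two slots. -/
def contrSymbol {U : Type*} (ϖ : 𝕄 N) (u v : U) : 𝒫[U, N] := ∑ i, ∑ j, ϖ i j • (X (u, i) * X (v, j))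

/-- The bidifferential operators `(c ϖ^{ij} ∂_i ⊗ ∂_j) ^ r` followed by multiplication. -/
def bidiff (D : CommDer N A) (ϖ : 𝕄 N) (c : ℝ) : ℕ → A → A → A
  | 0, x, z => x * z
  | r + 1, x, z => c • ∑ i, ∑ j, ϖ i j • bidiff D ϖ c r (D.d i x) (D.d j z)

lemma polyDiff_merge_mul_contr_pow (ϖ : 𝕄 N) (c : ℝ) (r : ℕ)
    (g : 𝒫[Option V, N]) (w : V) (x : A) (a : V → 𝒵 A) :
    D.polyDiff (mergeSymbol N w g * (c • contrSymbol ϖ none (some w)) ^ r) x a =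
      D.polyDiff g (D.bidiff ϖ c r x (a w)) (update a w 1) := by
  induction r generalizing x a with
  | zero => rw [pow_zero, mul_one, polyDiff_merge]; rfl
  | succ r ih =>
    have hs (c : ℝ) (z : A) (b) : D.polyDiff g (c • z) b = c • D.polyDiff g z b := by
      rw [Algebra.smul_def, polyDiff_const_mul_left, ← Algebra.smul_def]
      intro i
      rw [Algebra.algebraMap_eq_smul_one, map_smul, d_one, smul_zero]
    have hsum {ι : Type} (s : Finset ι) (f : ι → A) (b) :
        D.polyDiff g (∑ i ∈ s, f i) b = ∑ i ∈ s, D.polyDiff g (f i) b :=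
      map_sum (D.polyDiffLeft g b) f s
    rw [pow_succ', mul_left_comm, bidiff, smul_mul_assoc, polyDiff_smul, hs]
    congr 1
    generalize (c • contrSymbol ϖ none (some w) : 𝒫[Option V, N]) ^ r = e at ih ⊢
    rw [contrSymbol]
    simp only [sum_mul, polyDiff_sum, hsum, smul_mul_assoc, polyDiff_smul, hs, mul_assoc,
      polyDiff_X_none, polyDiff_X_some, ih, update_self, update_idem]
    rfl

/-- The substitution that sets the variables of the slots outside `S` to zero. -/
def restrictSymbol (N : ℕ) (S : Finset V) : 𝒫[Option V, N] →ₐ[ℝ] 𝒫[Option V, N] :=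
  aeval fun p => if p.1 ∈ S.image some then X p else 0

lemma polyDiff_restrict_mul (S T : Finset V) (hST : Disjoint S T)
    (g h : 𝒫[Option V, N]) (a c : V → 𝒵 A)
    (ha : ∀ v, v ∉ S → a v = 1) (hc : ∀ v, v ∉ T → c v = 1) :
    D.polyDiff (restrictSymbol N S g * restrictSymbol N T h) 1 (a * c) =
      D.polyDiff g 1 a * D.polyDiff h 1 c := by
  have hr (S : Finset V) (v : V) (i : Fin N) : restrictSymbol N S (X (some v, i)) =
      if v ∈ S then X (some v, i) else 0 := by
    simp [restrictSymbol]
  have hr0 (S : Finset V) (i : Fin N) : restrictSymbol N S (X (none, i)) = 0 := by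
    simp [restrictSymbol]
  induction g using symbol_induction generalizing a with
  | one =>
    rw [map_one, one_mul]
    induction h using symbol_induction generalizing c with
    | one => simp [polyDiff_one, prod_mul_distrib]
    | add g h hg hh => simp only [map_add, polyDiff_add, hg _ hc, hh _ hc, mul_add]
    | smul r g hg => simp only [map_smul, polyDiff_smul, hg _ hc, mul_smul_comm]
    | X_mul s g hg =>
      obtain ⟨u, i⟩ := s
      rw [map_mul]
      cases u with
      | none => rw [hr0, polyDiff_X_none, d_one, zero_mul, polyDiff_zero, polyDiff_zero_left,
          mul_zero]
      | some v =>
        rw [hr]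
        split_ifs with hv
        · have hav : a v = 1 := ha v (Finset.disjoint_right.1 hST hv)
          rw [polyDiff_X_some, polyDiff_X_some, ← hg]
          · congr 1
            funext w
            by_cases hw : w = v
            · subst hw; simp [hav]
            · simp [update_of_ne hw]
          · intro w hw
            rw [update_of_ne (by rintro rfl; exact hw hv), hc w hw]
        · rw [zero_mul, polyDiff_zero, polyDiff_X_of_one _ _ _ _ _ (hc v hv), mul_zero]
  | add g g' hg hg' => simp only [map_add, polyDiff_add, hg _ ha, hg' _ ha, add_mul]
  | smul r g hg => simp only [map_smul, smul_mul_assoc, polyDiff_smul, hg _ ha]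
  | X_mul s g hg =>
    obtain ⟨u, i⟩ := s
    rw [map_mul, mul_assoc]
    cases u with
    | none => rw [hr0, polyDiff_X_none, d_one, zero_mul, polyDiff_zero, polyDiff_zero_left,
        zero_mul]
    | some v =>
      rw [hr]
      split_ifs with hv
      · have hcv : c v = 1 := hc v (Finset.disjoint_left.1 hST hv)
        rw [polyDiff_X_some, polyDiff_X_some, ← hg]
        · congr 1
          funext w
          by_cases hw : w = v
          · subst hw; simp [hcv]
          · simp [update_of_ne hw]
        · intro w hw
          rw [update_of_ne (by rintro rfl; exact hw hv), ha w hw]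
      · rw [zero_mul, polyDiff_zero, polyDiff_X_of_one _ _ _ _ _ (ha v hv), zero_mul]

/-- Restriction of the symbol to the slots with an argument different from `1`. -/
lemma polyDiff_restrict (S : Finset V) (g : 𝒫[Option V, N])
    (a : V → 𝒵 A) (ha : ∀ v, v ∉ S → a v = 1) :
    D.polyDiff (restrictSymbol N S g) 1 a = D.polyDiff g 1 a := by
  have := D.polyDiff_restrict_mul S ∅ (Finset.disjoint_empty_right S) g 1 a 1 ha (by simp)
  rw [map_one, mul_one, mul_one] at this
  rw [this, polyDiff_one]
  simp

/-- An odd derivation `ι` that commutes with the derivations `∂_i`, applied to a polydifferential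
operator with even arguments. -/
lemma oddDerivation_polyDiff (σ : A →+* A) (hσ : ∀ i x, σ (D.d i x) = D.d i (σ x))
    (ι : A →ₗ[ℝ] A) (hι : ∀ x y, ι (x * y) = ι x * y + σ x * ι y)
    (hd : ∀ i x, ι (D.d i x) = D.d i (ι x))
    (g : 𝒫[Option V, N]) (a : V → 𝒵 A)
    (ha : ∀ v, σ (a v) = a v) :
    ι (D.polyDiff g 1 a) = ∑ v, D.polyDiff
      (rename (Prod.map (Equiv.swap none (some v)) id) g) (ι (a v)) (update a v 1) := by
  have h1 : ι 1 = 0 := by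
    have := hι 1 1
    simpa using this
  induction g using symbol_induction generalizing a with
  | one =>
    have hprod (s : Finset V) : ι ((∏ v ∈ s, a v : 𝒵 A) : A) =
        ∑ v ∈ s, ι (a v) * (∏ w ∈ s, update a v 1 w : 𝒵 A) := by
      induction s using Finset.induction with
      | empty => simp [h1]
      | insert v s hv ih =>
        rw [prod_insert hv, Subalgebra.coe_mul, hι, ih, sum_insert hv,
          prod_insert hv, update_self, one_mul, ha, mul_sum]
        congr 1
        · congr 2
          refine prod_congr rfl fun w hw => ?_
          rw [update_of_ne (by rintro rfl; exact hv hw)]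
        · refine sum_congr rfl fun w hw => ?_
          rw [prod_insert hv, update_of_ne (by rintro rfl; exact hv hw),
            Subalgebra.coe_mul, ← mul_assoc, ← mul_assoc,
            (Subalgebra.mem_center_iff.1 (a v).2 (ι (a w)))]
    simp only [map_one, polyDiff_one, one_mul, hprod]
  | add g h hg hh => simp only [map_add, polyDiff_add, hg _ ha, hh _ ha, sum_add_distrib]
  | smul r g hg => simp only [map_smul, polyDiff_smul, hg _ ha, smul_sum]
  | X_mul s g hg =>
    obtain ⟨u, i⟩ := s
    cases u with
    | none =>
      rw [polyDiff_X_none, d_one, polyDiff_zero_left, map_zero]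
      refine (sum_eq_zero fun v _ => ?_).symm
      rw [map_mul, rename_X, Prod.map_apply, Equiv.swap_apply_left, id,
        polyDiff_X_of_one _ _ _ _ _ (by simp)]
    | some w =>
      rw [polyDiff_X_some, hg]
      · refine sum_congr rfl fun v _ => ?_
        rw [map_mul, rename_X, Prod.map_apply, id]
        by_cases h : w = v
        · subst h
          rw [Equiv.swap_apply_right, polyDiff_X_none, update_self, update_idem, ← hd]
          rfl
        · rw [Equiv.swap_apply_of_ne_of_ne (by simp) (by simpa using h), polyDiff_X_some,
            update_update_dZ _ _ _ _ _ h, update_of_ne (Ne.symm h)]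
      · intro v
        by_cases h : v = w
        · subst h
          rw [update_self]
          exact (hσ i _).trans (congrArg _ (ha v))
        · rw [update_of_ne h, ha]

end CommDer

end Slots

/-! ### Integrals of polynomials in the propagators over a torus -/

section Mean

open MeasureTheory ProbabilityTheory

variable {U : Type*} [Fintype U] [DecidableEq U]

instance isProbabilityMeasure_unitAddCircle :
    IsProbabilityMeasure (volume : Measure UnitAddCircle) := ⟨UnitAddCircle.measure_univ⟩

/-- The value of the propagator between two of the points `θ`. -/
def edgeVal (θ : U → UnitAddCircle) (e : U × U) : ℝ := propagator (toCylinder (θ e.1) (θ e.2))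

lemma edgeVal_eq (θ : U → UnitAddCircle) (e : U × U) :
    edgeVal θ e = (AddCircle.equivIco 1 0 (θ e.1 - θ e.2) : ℝ) - 1 / 2 := rfl

lemma measurable_edgeVal (e : U × U) : Measurable fun θ : U → UnitAddCircle => edgeVal θ e := by
  have h : Measurable fun x : UnitAddCircle => (AddCircle.equivIco 1 0 x : ℝ) :=
    measurable_subtype_coe.comp (AddCircle.measurableEquivIco 1 0).measurable
  have h2 : Measurable fun θ : U → UnitAddCircle => θ e.1 - θ e.2 :=
    (measurable_pi_apply _).sub (measurable_pi_apply _)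
  exact (h.comp h2).sub_const _

lemma abs_edgeVal_le (θ : U → UnitAddCircle) (e : U × U) : |edgeVal θ e| ≤ 1 := by
  have := (AddCircle.equivIco (1 : ℝ) 0 (θ e.1 - θ e.2)).2
  rw [edgeVal_eq, abs_le]
  constructor <;> linarith [this.1, this.2]

lemma measurable_eval_edgeVal (f : MvPolynomial (U × U) ℝ) :
    Measurable fun θ : U → UnitAddCircle => eval (edgeVal θ) f := by
  induction f using MvPolynomial.induction_on with
  | C c => simp
  | add f g hf hg => simp only [map_add]; exact hf.add hg
  | mul_X f e hf =>
    simp only [map_mul, MvPolynomial.eval_X]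
    exact hf.mul (measurable_edgeVal e)

lemma exists_bound_eval_edgeVal (f : MvPolynomial (U × U) ℝ) :
    ∃ C, ∀ θ : U → UnitAddCircle, |eval (edgeVal θ) f| ≤ C := by
  induction f using MvPolynomial.induction_on with
  | C c => exact ⟨|c|, by simp⟩
  | add f g hf hg =>
    obtain ⟨a, ha⟩ := hf
    obtain ⟨b, hb⟩ := hg
    refine ⟨a + b, fun θ => ?_⟩
    rw [map_add]
    exact (abs_add_le _ _).trans (add_le_add (ha θ) (hb θ))
  | mul_X f e hf =>
    obtain ⟨a, ha⟩ := hf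
    refine ⟨a, fun θ => ?_⟩
    rw [map_mul, MvPolynomial.eval_X, abs_mul]
    exact (mul_le_of_le_one_right (abs_nonneg _) (abs_edgeVal_le θ e)).trans (ha θ)

lemma integrable_eval_edgeVal (f : MvPolynomial (U × U) ℝ) :
    Integrable fun θ : U → UnitAddCircle => eval (edgeVal θ) f := by
  obtain ⟨C, hC⟩ := exists_bound_eval_edgeVal f
  exact Integrable.of_bound (measurable_eval_edgeVal f).aestronglyMeasurable C
    (Filter.Eventually.of_forall hC)

/-- The mean value of a polynomial in the propagators over the configurations of points on the
circle. -/
def circleMean (U : Type*) [Fintype U] : MvPolynomial (U × U) ℝ →ₗ[ℝ] ℝ := by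
  classical
  exact
  { toFun := fun f => ∫ θ : U → UnitAddCircle, eval (edgeVal θ) f
    map_add' := fun f g => by
      simp only [map_add]
      exact integral_add (integrable_eval_edgeVal f) (integrable_eval_edgeVal g)
    map_smul' := fun c f => by
      simp only [MvPolynomial.smul_eval, RingHom.id_apply, smul_eq_mul]
      exact integral_const_mul _ _ }

lemma circleMean_apply (f : MvPolynomial (U × U) ℝ) :
    circleMean U f = ∫ θ : U → UnitAddCircle, eval (edgeVal θ) f := rfl

lemma circleMean_one : circleMean U 1 = 1 := by simp [circleMean_apply]

/-- The marginals of the uniform distribution. -/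
lemma measurePreserving_comp_embedding {W : Type*} [Fintype W] (i : W ↪ U) :
    MeasurePreserving (fun (θ : U → UnitAddCircle) w => θ (i w)) := by
  have h0 : iIndepFun (fun (u : U) (θ : U → UnitAddCircle) => θ u) volume :=
    iIndepFun_pi (X := fun _ => id) fun _ => aemeasurable_id
  have h1 := h0.precomp i.injective
  rw [iIndepFun_iff_map_fun_eq_pi_map (fun w => (measurable_pi_apply _).aemeasurable)] at h1
  refine ⟨measurable_pi_lambda _ fun w => measurable_pi_apply _, ?_⟩
  rw [h1, volume_pi]
  congr 1
  funext w
  exact (measurePreserving_eval (fun _ : U => (volume : Measure UnitAddCircle)) (i w)).map_eq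

lemma circleMean_rename {W : Type*} [Fintype W] [DecidableEq W] (i : W ↪ U)
    (f : MvPolynomial (W × W) ℝ) :
    circleMean U (rename (Prod.map i i) f) = circleMean W f := by
  rw [circleMean_apply, circleMean_apply, ← (measurePreserving_comp_embedding i).map_eq,
    integral_map (measurePreserving_comp_embedding i).measurable.aemeasurable
      (measurable_eval_edgeVal f).aestronglyMeasurable]
  simp only [MvPolynomial.eval_rename]
  rfl

/-- The substitution that sets the propagators between points not both in `S` to zero. -/
def restrictEdges (S : Finset U) : MvPolynomial (U × U) ℝ →ₐ[ℝ] MvPolynomial (U × U) ℝ :=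
  aeval fun e => if e ∈ S ×ˢ S then X e else 0

lemma circleMean_mul_of_disjoint {S T : Finset U} (hST : Disjoint S T)
    (f g : MvPolynomial (U × U) ℝ) :
    circleMean U (restrictEdges S f * restrictEdges T g) =
      circleMean U (restrictEdges S f) * circleMean U (restrictEdges T g) := by
  -- the two factors are functions of disjoint sets of independent coordinates
  have hfac (S : Finset U) (f : MvPolynomial (U × U) ℝ) : ∃ F : (S → UnitAddCircle) → ℝ,
      Measurable F ∧ ∀ θ, eval (edgeVal θ) (restrictEdges S f) = F fun i => θ i := by
    let ext (η : S → UnitAddCircle) (u : U) : UnitAddCircle := if h : u ∈ S then η ⟨u, h⟩ else 0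
    refine ⟨fun η => eval (edgeVal (ext η)) (restrictEdges S f), ?_, fun θ => ?_⟩
    · refine (measurable_eval_edgeVal _).comp (measurable_pi_lambda _ fun u => ?_)
      by_cases h : u ∈ S
      · simpa [ext, h] using measurable_pi_apply _
      · simp [ext, h]
    · induction f using MvPolynomial.induction_on with
      | C c => simp
      | add f g hf hg => simp only [map_add, hf, hg]
      | mul_X f e hf =>
        simp only [map_mul, hf]
        congr 1
        rw [restrictEdges, aeval_X]
        split_ifs with h
        · rw [Finset.mem_product] at h
          simp [edgeVal, ext, h.1, h.2]
        · simp
  obtain ⟨F, hF, hF'⟩ := hfac S f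
  obtain ⟨G, hG, hG'⟩ := hfac T g
  have h0 : iIndepFun (fun (u : U) (θ : U → UnitAddCircle) => θ u) volume :=
    iIndepFun_pi (X := fun _ => id) fun _ => aemeasurable_id
  have h1 := (h0.indepFun_finset S T hST fun u => measurable_pi_apply u).comp hF hG
  have h2 := h1.integral_fun_mul_eq_mul_integral
    (hF.comp (measurable_pi_lambda (fun (θ : U → UnitAddCircle) (i : S) => θ i)
      fun i => measurable_pi_apply (i : U))).aestronglyMeasurable
    (hG.comp (measurable_pi_lambda (fun (θ : U → UnitAddCircle) (i : T) => θ i)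
      fun i => measurable_pi_apply (i : U))).aestronglyMeasurable
  simp only [circleMean_apply, map_mul, hF', hG']
  exact h2

end Mean

/-! ### Integration by parts with jumps -/

section Jump

/-- The fundamental theorem of calculus for a function with jumps: `G t s` is differentiable in
`t`, and `s` is the set of those jumps `c v` that are still ahead of `t`. -/
lemma integral_deriv_with_jumps {V : Type*} [DecidableEq V] (c : V → ℝ) (S : Finset V)
    (hinj : Set.InjOn c S) (h0 : ∀ v ∈ S, 0 ≤ c v) (b : ℝ) (hb : 0 ≤ b) (hS : ∀ v ∈ S, c v ≤ b)
    (G G' : ℝ → Finset V → ℝ) (hG : ∀ t s, HasDerivAt (fun t => G t s) (G' t s) t)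
    (hG' : ∀ s, Continuous fun t => G' t s) :
    IntervalIntegrable (fun t => G' t (S.filter fun v => t < c v)) MeasureTheory.volume 0 b ∧
    ∫ t in (0 : ℝ)..b, G' t (S.filter fun v => t < c v) = G b ∅ - G 0 S -
      ∑ w ∈ S, (G (c w) (S.filter fun v => c w < c v) -
        G (c w) (insert w (S.filter fun v => c w < c v))) := by
  induction S using Finset.induction_on_max_value c generalizing b G G' with
  | empty =>
    simp only [Finset.filter_empty, sum_empty, sub_zero]
    exact ⟨(hG' ∅).intervalIntegrable _ _,
      intervalIntegral.integral_eq_sub_of_hasDerivAt (fun t _ => hG t ∅)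
        ((hG' ∅).intervalIntegrable _ _)⟩
  | insert w S hw hmax ih =>
    have hlt : ∀ v ∈ S, c v < c w := fun v hv => lt_of_le_of_ne (hmax v hv) fun h => by
      have := hinj (by simp [hv]) (by simp) h
      exact hw (this ▸ hv)
    have hcw := h0 w (by simp)
    obtain ⟨i1, e1⟩ := ih (hinj.mono (by simp)) (fun v hv => h0 v (by simp [hv])) (c w) hcw hmax
      (fun t s => G t (insert w s)) (fun t s => G' t (insert w s)) (fun t s => hG t _)
      (fun s => hG' _)
    have a1 : Set.EqOn (fun t => G' t (insert w (S.filter fun v => t < c v)))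
        (fun t => G' t ((insert w S).filter fun v => t < c v)) (Set.uIoo 0 (c w)) := by
      intro t ht
      rw [Set.uIoo_of_le hcw] at ht
      simp only [Finset.filter_insert, if_pos ht.2]
    have a2 : Set.EqOn (fun t => G' t ∅)
        (fun t => G' t ((insert w S).filter fun v => t < c v)) (Set.uIoo (c w) b) := by
      intro t ht
      rw [Set.uIoo_of_le (hS w (by simp))] at ht
      have : (insert w S).filter (fun v => t < c v) = ∅ := by
        refine Finset.filter_eq_empty_iff.2 fun v hv => not_lt.2 ?_
        rcases Finset.mem_insert.1 hv with rfl | hv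
        · exact ht.1.le
        · exact ((hlt v hv).trans ht.1).le
      simp only [this]
    have i2 : IntervalIntegrable (fun t => G' t ∅) MeasureTheory.volume (c w) b :=
      (hG' ∅).intervalIntegrable _ _
    have e2 : ∫ t in (c w)..b, G' t ∅ = G b ∅ - G (c w) ∅ :=
      intervalIntegral.integral_eq_sub_of_hasDerivAt (fun t _ => hG t ∅) i2
    have j1 := i1.congr_uIoo a1
    have j2 := i2.congr_uIoo a2
    refine ⟨j1.trans j2, ?_⟩
    rw [← intervalIntegral.integral_add_adjacent_intervals j1 j2,
      ← intervalIntegral.integral_congr_uIoo a1, ← intervalIntegral.integral_congr_uIoo a2, e1, e2,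
      sum_insert hw]
    have b1 : (insert w S).filter (fun v => c w < c v) = ∅ := by
      refine Finset.filter_eq_empty_iff.2 fun v hv => not_lt.2 ?_
      rcases Finset.mem_insert.1 hv with rfl | hv
      · exact le_rfl
      · exact (hlt v hv).le
    have b2 : ∑ x ∈ S, (G (c x) ((insert w S).filter fun v => c x < c v) -
        G (c x) (insert x ((insert w S).filter fun v => c x < c v))) =
        ∑ x ∈ S, (G (c x) (insert w (S.filter fun v => c x < c v)) -
        G (c x) (insert w (insert x (S.filter fun v => c x < c v)))) := by
      refine sum_congr rfl fun x hx => ?_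
      rw [Finset.filter_insert, if_pos (hlt x hx), Finset.insert_comm x w]
    rw [b1, b2, insert_empty_eq]
    ring

end Jump

/-! ### Stokes' theorem for the configuration spaces of the circle -/

section Stokes

open MeasureTheory ProbabilityTheory

variable {V : Type*} [Fintype V] [DecidableEq V]

/-- The derivative of polynomials in the propagators with respect to the position of the point
`none`, away from the diagonals. -/
def edgeDer (R V : Type*) [CommRing R] :
    Derivation R (MvPolynomial (Option V × Option V) R) (MvPolynomial (Option V × Option V) R) :=
  MvPolynomial.mkDerivation R fun e => match e with
    | (none, some _) => 1
    | (some _, none) => -1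
    | _ => 0

/-- Restriction of polynomials in the propagators to one side of the diagonal on which the point
`some w` collides with the point `none`: the propagator between the two points becomes `s`. -/
def edgeTau {R : Type*} [CommRing R] (w : V) (s : R) :
    MvPolynomial (Option V × Option V) R →ₐ[R] MvPolynomial (Option V × Option V) R :=
  aeval fun e => if e = (none, some w) then C s else if e = (some w, none) then C (-s) else
    X (if e.1 = some w then none else e.1, if e.2 = some w then none else e.2)

lemma equivIco_eq_of_coe {z : UnitAddCircle} {r : ℝ} (h0 : 0 ≤ r) (h1 : r < 1)
    (hz : z = (r : UnitAddCircle)) : (AddCircle.equivIco 1 0 z : ℝ) = r := by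
  subst hz
  rw [AddCircle.equivIco_coe_eq (show r ∈ Set.Ico (0 : ℝ) (0 + 1) from ⟨h0, by simpa using h1⟩)]

/-- Two points on the circle are almost surely distinct. -/
lemma ae_injective (U : Type*) [Fintype U] : ∀ᵐ θ : U → UnitAddCircle, Function.Injective θ := by
  have h (u v : U) (huv : u ≠ v) : ∀ᵐ θ : U → UnitAddCircle, θ u ≠ θ v := by
    have h0 : iIndepFun (fun (u : U) (θ : U → UnitAddCircle) => θ u) volume :=
      iIndepFun_pi (X := fun _ => id) fun _ => aemeasurable_id
    have h1 := (indepFun_iff_map_prod_eq_prod_map_map (measurable_pi_apply u).aemeasurable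
      (measurable_pi_apply v).aemeasurable).1 (h0.indepFun huv)
    have hm (u : U) : Measure.map (fun θ : U → UnitAddCircle => θ u) volume = volume :=
      (measurePreserving_eval (fun _ : U => (volume : Measure UnitAddCircle)) u).map_eq
    rw [hm, hm] at h1
    have hd : MeasurableSet {p : UnitAddCircle × UnitAddCircle | p.1 = p.2} :=
      (isClosed_eq continuous_fst continuous_snd).measurableSet
    have h2 : ((volume : Measure UnitAddCircle).prod volume) {p | p.1 = p.2} = 0 := by
      rw [Measure.measure_prod_null hd]
      refine Filter.Eventually.of_forall fun x => ?_
      have : Prod.mk x ⁻¹' {p : UnitAddCircle × UnitAddCircle | p.1 = p.2} = {x} := by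
        ext y; simp [eq_comm]
      refine (congrArg volume this).trans ?_
      simpa using AddCircle.volume_closedBall (T := 1) (x := x) 0
    rw [← h1, Measure.map_apply ((measurable_pi_apply u).prodMk (measurable_pi_apply v)) hd] at h2
    rw [ae_iff]
    simpa using h2
  classical
  have h' := ae_all_iff.2 fun u => ae_all_iff.2 fun v =>
    (if hh : u = v then Filter.Eventually.of_forall fun θ h => (h hh).elim else
      (h u v hh).mono fun θ h _ => h : ∀ᵐ θ : U → UnitAddCircle, u ≠ v → θ u ≠ θ v)
  filter_upwards [h'] with θ hθ u v huv
  by_contra hne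
  exact hθ u v hne huv

/-- The propagators as functions of the position `t` of the point `none`; `s` is the set of the
points ahead of it. -/
def movingEdge (p : Option V × Option V → ℝ) (c : V → ℝ) (t : ℝ) (s : Finset V)
    (e : Option V × Option V) : ℝ :=
  match e with
  | (none, some w) => t - c w + (if w ∈ s then 1 else 0) - 1 / 2
  | (some w, none) => c w - t + (if w ∈ s then 0 else 1) - 1 / 2
  | e => p e

lemma hasDerivAt_eval_movingEdge (p : Option V × Option V → ℝ) (c : V → ℝ) (s : Finset V)
    (f : MvPolynomial (Option V × Option V) ℝ) (t : ℝ) :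
    HasDerivAt (fun t => eval (movingEdge p c t s) f)
      (eval (movingEdge p c t s) (edgeDer ℝ V f)) t := by
  induction f using MvPolynomial.induction_on with
  | C r => simpa [edgeDer] using hasDerivAt_const t r
  | add f g hf hg => simp only [map_add]; exact hf.add hg
  | mul_X f e hf =>
    have he : HasDerivAt (fun t => movingEdge p c t s e)
        (eval (movingEdge p c t s) (edgeDer ℝ V (X e))) t := by
      rw [edgeDer, MvPolynomial.mkDerivation_X]
      rcases e with ⟨_ | u, _ | v⟩
      · simpa [movingEdge] using hasDerivAt_const t _
      · simp only [movingEdge, map_one]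
        exact ((((hasDerivAt_id t).sub_const _).add_const _).sub_const _)
      · simp only [movingEdge, map_one, map_neg]
        exact ((((hasDerivAt_id t).const_sub _).add_const _).sub_const _)
      · simpa [movingEdge] using hasDerivAt_const t _
    simp only [map_mul, MvPolynomial.eval_X, Derivation.leibniz, smul_eq_mul, map_add]
    refine (hf.mul he).congr_deriv ?_
    ring

lemma continuous_eval_movingEdge (p : Option V × Option V → ℝ) (c : V → ℝ) (s : Finset V)
    (f : MvPolynomial (Option V × Option V) ℝ) :
    Continuous fun t => eval (movingEdge p c t s) f :=
  continuous_iff_continuousAt.2 fun t => (hasDerivAt_eval_movingEdge p c s f t).continuousAt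

lemma edgeVal_translate (θ : Option V → UnitAddCircle) {c : V → ℝ}
    (hc : ∀ w, 0 ≤ c w ∧ c w < 1) (hθ : ∀ w, θ (some w) = θ none + (c w : UnitAddCircle))
    {t : ℝ} (h0 : 0 ≤ t) (h1 : t ≤ 1) (ht : ∀ w, t ≠ c w) (ht' : t < 1) :
    edgeVal (θ + Pi.single none (t : UnitAddCircle)) =
      movingEdge (edgeVal θ) c t (univ.filter fun v => t < c v) := by
  funext e
  rcases e with ⟨_ | u, _ | v⟩
  · simp [movingEdge, edgeVal_eq]
  · simp only [movingEdge, edgeVal_eq, mem_filter, mem_univ, true_and, Pi.add_apply,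
      Pi.single_eq_same]
    congr 1
    refine equivIco_eq_of_coe ?_ ?_ ?_
    · split_ifs with h <;> linarith [hc v]
    · split_ifs with h <;> linarith [hc v]
    · rw [Pi.single_eq_of_ne (by simp), hθ]
      have : (((if t < c v then 1 else 0 : ℝ)) : UnitAddCircle) = 0 := by
        split_ifs
        · exact AddCircle.coe_period 1
        · rfl
      simp [this]
  · simp only [movingEdge, edgeVal_eq, mem_filter, mem_univ, true_and, Pi.add_apply,
      Pi.single_eq_same]
    congr 1
    have := ht u
    refine equivIco_eq_of_coe ?_ ?_ ?_
    · split_ifs with h <;> linarith [hc u]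
    · split_ifs with h
      · linarith [hc u]
      · have := lt_of_le_of_ne (not_lt.1 h) (Ne.symm this)
        linarith [hc u]
    · rw [Pi.single_eq_of_ne (by simp), hθ]
      have : (((if t < c u then 0 else 1 : ℝ)) : UnitAddCircle) = 0 := by
        split_ifs
        · rfl
        · exact AddCircle.coe_period 1
      simp [this]
  · simp [movingEdge, edgeVal_eq]

lemma eval_edgeTau (η : Option V → UnitAddCircle) (w : V) (s : ℝ)
    (f : MvPolynomial (Option V × Option V) ℝ) :
    eval (edgeVal η) (edgeTau w s f) =
      eval (fun e => if e = (none, some w) then s else if e = (some w, none) then -s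
        else edgeVal η (if e.1 = some w then none else e.1, if e.2 = some w then none else e.2))
        f := by
  induction f using MvPolynomial.induction_on with
  | C r => simp
  | add f g hf hg => simp only [map_add, hf, hg]
  | mul_X f e hf =>
    rw [map_mul, map_mul, map_mul, hf, MvPolynomial.eval_X, edgeTau, aeval_X]
    congr 1
    split_ifs <;> simp

lemma movingEdge_collision (θ : Option V → UnitAddCircle) {c : V → ℝ}
    (hc : ∀ w, 0 ≤ c w ∧ c w < 1) (hcinj : Function.Injective c)
    (hθ : ∀ w, θ (some w) = θ none + (c w : UnitAddCircle)) (w : V) (s : Finset V)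
    (hs : ∀ v, v ≠ w → (v ∈ s ↔ c w < c v)) :
    movingEdge (edgeVal θ) c (c w) s =
      fun e => if e = (none, some w) then (if w ∈ s then 1 / 2 else - (1 / 2)) else
        if e = (some w, none) then - (if w ∈ s then 1 / 2 else - (1 / 2))
        else edgeVal (θ ∘ Equiv.swap none (some w))
          (if e.1 = some w then none else e.1, if e.2 = some w then none else e.2) := by
  funext e
  have hlt (v : V) (hv : v ≠ w) : ¬ c w < c v → c v < c w := fun h =>
    lt_of_le_of_ne (not_lt.1 h) fun h' => hv (hcinj h')
  have hsw (u : Option V) : (θ ∘ Equiv.swap none (some w)) (if u = some w then none else u) =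
      if u = none then θ (some w) else θ u := by
    by_cases h1 : u = some w
    · subst h1; simp
    · by_cases h2 : u = none
      · subst h2; simp
      · simp [h1, h2, Equiv.swap_apply_of_ne_of_ne h2 h1]
  have hE (a b : Option V) : edgeVal (θ ∘ Equiv.swap none (some w))
      (if a = some w then none else a, if b = some w then none else b) =
      (AddCircle.equivIco 1 0 ((if a = none then θ (some w) else θ a) -
        (if b = none then θ (some w) else θ b)) : ℝ) - 1 / 2 := by
    rw [edgeVal_eq, ← hsw, ← hsw]
  simp only [hE]
  rcases e with ⟨_ | u, _ | v⟩
  · simp [movingEdge, edgeVal_eq]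
  · by_cases h : v = w
    · subst h
      simp only [movingEdge, if_pos]
      split_ifs <;> norm_num
    · have := hlt v h
      rw [if_neg (by simpa using h), if_neg (by simp)]
      simp only [movingEdge, hs v h, if_true, if_neg (Option.some_ne_none v)]
      congr 1
      refine (equivIco_eq_of_coe ?_ ?_ ?_).symm
      · split_ifs <;> linarith [hc v, hc w]
      · split_ifs with h' <;> linarith [hc v, hc w]
      · rw [hθ, hθ]
        have : (((if c w < c v then 1 else 0 : ℝ)) : UnitAddCircle) = 0 := by
          split_ifs
          · exact AddCircle.coe_period 1
          · rfl
        simp [this]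
  · by_cases h : u = w
    · subst h
      rw [if_neg (by simp), if_pos rfl]
      simp only [movingEdge]
      split_ifs <;> norm_num
    · have := hlt u h
      rw [if_neg (by simp), if_neg (by simpa using h)]
      simp only [movingEdge, hs u h, if_true, if_neg (Option.some_ne_none u)]
      congr 1
      refine (equivIco_eq_of_coe ?_ ?_ ?_).symm
      · split_ifs <;> linarith [hc u, hc w]
      · split_ifs with h'
        · linarith [hc u, hc w]
        · linarith [hc u, hc w, this h']
      · rw [hθ, hθ]
        have : (((if c w < c u then 0 else 1 : ℝ)) : UnitAddCircle) = 0 := by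
          split_ifs
          · rfl
          · exact AddCircle.coe_period 1
        simp [this]
  · simp [movingEdge, edgeVal_eq]

/-- The integral over the positions of the point `none`. -/
lemma integral_translate (θ : Option V → UnitAddCircle) (hinj : Function.Injective θ)
    (f : MvPolynomial (Option V × Option V) ℝ) :
    ∫ t in (0 : ℝ)..1, eval (edgeVal (θ + Pi.single none (t : UnitAddCircle))) (edgeDer ℝ V f) =
      ∑ w, (eval (edgeVal (θ ∘ Equiv.swap none (some w))) (edgeTau w (1 / 2) f) -
        eval (edgeVal (θ ∘ Equiv.swap none (some w))) (edgeTau w (-(1 / 2)) f)) := by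
  set c : V → ℝ := fun w => AddCircle.equivIco 1 0 (θ (some w) - θ none) with hcdef
  have hc (w : V) : 0 ≤ c w ∧ c w < 1 := by
    have := (AddCircle.equivIco (1 : ℝ) 0 (θ (some w) - θ none)).2
    simpa using this
  have hθ (w : V) : θ (some w) = θ none + (c w : UnitAddCircle) := by
    rw [hcdef, AddCircle.coe_equivIco]; abel
  have hcinj : Function.Injective c := fun v w h => by
    have := hθ v
    rw [h, ← hθ w] at this
    exact Option.some_injective _ (hinj this)
  have key := (integral_deriv_with_jumps c univ hcinj.injOn (fun v _ => (hc v).1) 1 zero_le_one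
    (fun v _ => (hc v).2.le) (fun t s => eval (movingEdge (edgeVal θ) c t s) f)
    (fun t s => eval (movingEdge (edgeVal θ) c t s) (edgeDer ℝ V f))
    (fun t s => hasDerivAt_eval_movingEdge _ c s f t)
    (fun s => continuous_eval_movingEdge _ c s _)).2
  have e1 : movingEdge (edgeVal θ) c 1 ∅ = movingEdge (edgeVal θ) c 0 univ := by
    funext e
    rcases e with ⟨_ | u, _ | v⟩ <;> simp [movingEdge]; ring
  have e2 : ∫ t in (0 : ℝ)..1, eval (edgeVal (θ + Pi.single none (t : UnitAddCircle)))
        (edgeDer ℝ V f) = ∫ t in (0 : ℝ)..1, eval (movingEdge (edgeVal θ) c t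
          (univ.filter fun v => t < c v)) (edgeDer ℝ V f) := by
    refine intervalIntegral.integral_congr_ae ?_
    filter_upwards [(Set.finite_range c).countable.ae_notMem volume,
      (Set.countable_singleton (1 : ℝ)).ae_notMem volume] with t ht ht1 hmem
    rw [Set.uIoc_of_le zero_le_one] at hmem
    rw [edgeVal_translate θ hc hθ hmem.1.le hmem.2 (fun w h => ht ⟨w, h.symm⟩)
      (lt_of_le_of_ne hmem.2 ht1)]
  rw [e2, key, e1, sub_self, zero_sub, ← sum_neg_distrib]
  refine sum_congr rfl fun w _ => ?_
  rw [neg_sub, movingEdge_collision θ hc hcinj hθ w, movingEdge_collision θ hc hcinj hθ w,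
    eval_edgeTau, eval_edgeTau]
  · simp
  · intro v hv; simp
  · intro v hv; simp [hv]

/-- Stokes' theorem: the mean of a derivative with respect to the position of a point is the sum of
the jumps at the collisions with the other points. -/
lemma circleMean_edgeDer (f : MvPolynomial (Option V × Option V) ℝ) :
    circleMean (Option V) (edgeDer ℝ V f) = ∑ w, (circleMean (Option V) (edgeTau w (1 / 2) f) -
        circleMean (Option V) (edgeTau w (-(1 / 2)) f)) := by
  have hsw (w : V) (g : MvPolynomial (Option V × Option V) ℝ) : circleMean (Option V) g =
      ∫ θ : Option V → UnitAddCircle, eval (edgeVal (θ ∘ Equiv.swap none (some w))) g := by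
    have h := measurePreserving_comp_embedding (Equiv.swap none (some w) : Option V ≃ Option V).toEmbedding
    rw [circleMean_apply]
    conv_lhs => rw [← h.map_eq]
    rw [integral_map h.measurable.aemeasurable (measurable_eval_edgeVal g).aestronglyMeasurable]
    rfl
  have hint (w : V) (g : MvPolynomial (Option V × Option V) ℝ) :
      Integrable fun θ : Option V → UnitAddCircle =>
        eval (edgeVal (θ ∘ Equiv.swap none (some w))) g :=
    (measurePreserving_comp_embedding
      (Equiv.swap none (some w) : Option V ≃ Option V).toEmbedding).integrable_comp_of_integrable
        (integrable_eval_edgeVal g)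
  have h1 (t : ℝ) : ∫ θ : Option V → UnitAddCircle, eval
      (edgeVal (θ + Pi.single none (t : UnitAddCircle))) (edgeDer ℝ V f) =
      circleMean (Option V) (edgeDer ℝ V f) :=
    integral_add_right_eq_self (fun θ : Option V → UnitAddCircle => eval (edgeVal θ)
      (edgeDer ℝ V f)) _
  have hmeas : Measurable (Function.uncurry fun (t : ℝ) (θ : Option V → UnitAddCircle) =>
      eval (edgeVal (θ + Pi.single none (t : UnitAddCircle))) (edgeDer ℝ V f)) := by
    refine (measurable_eval_edgeVal _).comp ?_
    refine measurable_snd.add ?_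
    refine Measurable.comp
      (g := fun t : ℝ => (Pi.single none (t : UnitAddCircle) : Option V → UnitAddCircle)) ?_ measurable_fst
    refine measurable_pi_lambda _ fun u => ?_
    by_cases h : u = none
    · subst h
      simpa using AddCircle.measurable_mk'
    · simp [Pi.single_eq_of_ne h]
  obtain ⟨C, hC⟩ := exists_bound_eval_edgeVal (edgeDer ℝ V f)
  have : IsFiniteMeasure ((volume : Measure ℝ).restrict (Set.uIoc 0 1)) := ⟨by simp⟩
  have h2 := intervalIntegral_integral_swap (a := 0) (b := 1) (μ := volume)
    (Integrable.of_bound hmeas.aestronglyMeasurable C (Filter.Eventually.of_forall fun p => hC _))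
  simp only [h1, intervalIntegral.integral_const, sub_zero, one_smul] at h2
  rw [h2]
  have h3 : ∀ᵐ θ : Option V → UnitAddCircle,
      ∫ t in (0 : ℝ)..1, eval (edgeVal (θ + Pi.single none (t : UnitAddCircle)))
        (edgeDer ℝ V f) = _ := (ae_injective (Option V)).mono fun θ hθ => integral_translate θ hθ f
  rw [integral_congr_ae h3, integral_finsetSum]
  · refine sum_congr rfl fun w _ => ?_
    rw [integral_sub (hint w _) (hint w _), ← hsw, ← hsw]
  · exact fun w _ => (hint w _).sub (hint w _)

end Stokes

/-! ### Mean values with coefficients in an algebra -/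

section MeanAlgebra

variable {U : Type*} [Fintype U] [DecidableEq U] {S S' : Type*} [CommRing S] [Algebra ℝ S]
  [CommRing S'] [Algebra ℝ S']

/-- The extension of scalars of `circleMean`. -/
def meanOver (U S : Type*) [Fintype U] [CommRing S] [Algebra ℝ S] :
    MvPolynomial (U × U) S →ₗ[S] S :=
  (MvPolynomial.basisMonomials (U × U) S).constr S fun n =>
    algebraMap ℝ S (circleMean U (MvPolynomial.monomial n 1))

/-- Polynomials are sums of products of scalars and real polynomials. -/
lemma real_coeff_induction {σ : Type*} {p : MvPolynomial σ S → Prop}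
    (add : ∀ f g, p f → p g → p (f + g))
    (mul : ∀ (s : S) (f : MvPolynomial σ ℝ),
      p (C s * MvPolynomial.map (algebraMap ℝ S) f)) (f : MvPolynomial σ S) : p f := by
  induction f using MvPolynomial.induction_on' with
  | monomial n s =>
    have := mul s (MvPolynomial.monomial n 1)
    rwa [MvPolynomial.map_monomial, map_one, MvPolynomial.C_mul_monomial, mul_one] at this
  | add f g hf hg => exact add f g hf hg

lemma meanOver_C_mul (s : S) (f : MvPolynomial (U × U) S) :
    meanOver U S (C s * f) = s * meanOver U S f := by
  rw [← MvPolynomial.smul_eq_C_mul, map_smul, smul_eq_mul]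

lemma meanOver_map_algebraMap (f : MvPolynomial (U × U) ℝ) :
    meanOver U S (MvPolynomial.map (algebraMap ℝ S) f) = algebraMap ℝ S (circleMean U f) := by
  induction f using MvPolynomial.induction_on' with
  | monomial n r =>
    have h : (MvPolynomial.monomial n r : MvPolynomial (U × U) ℝ) =
        r • MvPolynomial.monomial n 1 := by simp [MvPolynomial.smul_monomial]
    have h2 : MvPolynomial.map (algebraMap ℝ S) (MvPolynomial.monomial n r) =
        C (algebraMap ℝ S r) * MvPolynomial.monomial n 1 := by
      rw [MvPolynomial.map_monomial, MvPolynomial.C_mul_monomial, mul_one]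
    have h1 : (MvPolynomial.monomial n (1 : S)) = MvPolynomial.basisMonomials (U × U) S n := by
      simp
    rw [h2, h, map_smul, meanOver_C_mul, smul_eq_mul, map_mul, h1, meanOver, Basis.constr_basis]
  | add f g hf hg => simp only [map_add, hf, hg]

lemma meanOver_one : meanOver U S 1 = 1 := by
  have := meanOver_map_algebraMap (U := U) (S := S) 1
  rwa [map_one (MvPolynomial.map _), circleMean_one, map_one (algebraMap ℝ S)] at this

lemma meanOver_map (ψ : S →ₐ[ℝ] S') (f : MvPolynomial (U × U) S) :
    meanOver U S' (MvPolynomial.map (ψ : S →+* S') f) = ψ (meanOver U S f) := by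
  induction f using real_coeff_induction with
  | add f g hf hg => simp only [map_add, hf, hg]
  | mul s f =>
    rw [map_mul, MvPolynomial.map_C, MvPolynomial.map_map, meanOver_C_mul, meanOver_C_mul,
      show (ψ : S →+* S').comp (algebraMap ℝ S) = algebraMap ℝ S' from ψ.comp_algebraMap,
      meanOver_map_algebraMap, meanOver_map_algebraMap, map_mul]
    simp

lemma meanOver_rename {W : Type*} [Fintype W] [DecidableEq W] (i : W ↪ U)
    (f : MvPolynomial (W × W) S) :
    meanOver U S (rename (Prod.map i i) f) = meanOver W S f := by
  induction f using real_coeff_induction with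
  | add f g hf hg => simp only [map_add, hf, hg]
  | mul s f =>
    rw [map_mul, MvPolynomial.rename_C, ← MvPolynomial.map_rename, meanOver_C_mul, meanOver_C_mul,
      meanOver_map_algebraMap, meanOver_map_algebraMap, circleMean_rename]

/-- The substitution that sets the propagators between points not both in `Y` to zero. -/
def restrictEdgesOver (S : Type*) [CommRing S] (Y : Finset U) :
    MvPolynomial (U × U) S →ₐ[S] MvPolynomial (U × U) S :=
  aeval fun e => if e ∈ Y ×ˢ Y then X e else 0

lemma restrictEdgesOver_map (Y : Finset U) (ψ : S →+* S') (f : MvPolynomial (U × U) S) :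
    restrictEdgesOver S' Y (MvPolynomial.map ψ f) =
      MvPolynomial.map ψ (restrictEdgesOver S Y f) := by
  induction f using MvPolynomial.induction_on with
  | C r => simp [restrictEdgesOver]
  | add f g hf hg => simp only [map_add, hf, hg]
  | mul_X f e hf =>
    simp only [map_mul, hf, map_X]
    congr 1
    simp only [restrictEdgesOver, aeval_X]
    split_ifs <;> simp

lemma meanOver_mul_of_disjoint {Y Z : Finset U} (hYZ : Disjoint Y Z)
    (f g : MvPolynomial (U × U) S) :
    meanOver U S (restrictEdgesOver S Y f * restrictEdgesOver S Z g) =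
      meanOver U S (restrictEdgesOver S Y f) * meanOver U S (restrictEdgesOver S Z g) := by
  have hr (Y : Finset U) (f : MvPolynomial (U × U) ℝ) :
      restrictEdgesOver ℝ Y f = restrictEdges Y f := rfl
  induction f using real_coeff_induction with
  | add f f' hf hf' => simp only [map_add, add_mul, hf, hf']
  | mul s f =>
    induction g using real_coeff_induction with
    | add g g' hg hg' => simp only [map_add, mul_add, hg, hg']
    | mul t g =>
      have hC (Y : Finset U) (s : S) : restrictEdgesOver S Y (C s) = C s := aeval_C _ _
      rw [map_mul (restrictEdgesOver S Y), map_mul (restrictEdgesOver S Z), hC, hC,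
        restrictEdgesOver_map, restrictEdgesOver_map, mul_mul_mul_comm,
        ← map_mul C, ← map_mul (MvPolynomial.map _), meanOver_C_mul, meanOver_C_mul, meanOver_C_mul,
        meanOver_map_algebraMap, meanOver_map_algebraMap, meanOver_map_algebraMap, hr, hr,
        circleMean_mul_of_disjoint hYZ, map_mul]
      ring

variable {V : Type*} [Fintype V] [DecidableEq V]

lemma edgeDer_map (ψ : S →+* S') (f : MvPolynomial (Option V × Option V) S) :
    edgeDer S' V (MvPolynomial.map ψ f) = MvPolynomial.map ψ (edgeDer S V f) := by
  induction f using MvPolynomial.induction_on with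
  | C r => simp [edgeDer]
  | add f g hf hg => simp only [map_add, hf, hg]
  | mul_X f e hf =>
    simp only [map_mul, Derivation.leibniz, hf, map_X, smul_eq_mul, map_add]
    congr 2
    simp only [edgeDer, MvPolynomial.mkDerivation_X]
    rcases e with ⟨_ | u, _ | v⟩ <;> simp

lemma edgeTau_map (ψ : S →+* S') (w : V) (s : S) (f : MvPolynomial (Option V × Option V) S) :
    edgeTau w (ψ s) (MvPolynomial.map ψ f) = MvPolynomial.map ψ (edgeTau w s f) := by
  induction f using MvPolynomial.induction_on with
  | C r => simp [edgeTau]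
  | add f g hf hg => simp only [map_add, hf, hg]
  | mul_X f e hf =>
    simp only [map_mul, hf, map_X]
    congr 1
    simp only [edgeTau, aeval_X]
    split_ifs <;> simp

lemma meanOver_edgeDer (f : MvPolynomial (Option V × Option V) S) :
    meanOver (Option V) S (edgeDer S V f) =
      ∑ w, (meanOver (Option V) S (edgeTau w (algebraMap ℝ S (1 / 2)) f) -
        meanOver (Option V) S (edgeTau w (algebraMap ℝ S (-(1 / 2))) f)) := by
  induction f using real_coeff_induction with
  | add f g hf hg => simp only [map_add, hf, hg, ← sum_add_distrib]; congr 1; ext w; ring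
  | mul s f =>
    have hC (w : V) (t s : S) : edgeTau w t (C s) = C s := aeval_C _ _
    have hD (s : S) : edgeDer S V (C s) = 0 := by simp [edgeDer]
    simp only [Derivation.leibniz, hD, smul_zero, mul_zero, add_zero, smul_eq_mul, edgeDer_map, map_mul, hC,
      edgeTau_map, meanOver_C_mul, meanOver_map_algebraMap, circleMean_edgeDer, map_sum,
      mul_sum, map_sub, mul_sub]

/-- The mean value over the position of the point `none` of a propagator that ends there is zero. -/
lemma meanOver_X_mul_eq_zero (v : V) (g : MvPolynomial (Option V × Option V) S)
    (hD : edgeDer S V g = 0) (hT : ∀ w s s', edgeTau w s g = edgeTau w s' g)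
    (e : Option V × Option V) (he : e = (none, some v) ∨ e = (some v, none)) :
    meanOver (Option V) S (X e * g) = 0 := by
  -- `X e` is half the derivative of its square, which has the same limits on both sides
  have h := meanOver_edgeDer (X e ^ 2 * g)
  have hR : ∑ w, (meanOver (Option V) S (edgeTau w (algebraMap ℝ S (1 / 2))
      (X e ^ 2 * g)) - meanOver (Option V) S (edgeTau w (algebraMap ℝ S (-(1 / 2)))
      (X e ^ 2 * g))) = 0 := by
    refine sum_eq_zero fun w _ => ?_
    have hX : edgeTau w (algebraMap ℝ S (1 / 2)) (X e) ^ 2 =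
        edgeTau w (algebraMap ℝ S (-(1 / 2))) (X e) ^ 2 := by
      simp only [edgeTau, aeval_X]
      split_ifs
      all_goals simp only [map_neg, neg_sq]
    rw [map_mul (edgeTau w _), map_mul (edgeTau w _), map_pow (edgeTau w _), map_pow (edgeTau w _), hX, hT w _ (algebraMap ℝ S (-(1 / 2))), sub_self]
  rw [hR, Derivation.leibniz, hD, smul_zero, zero_add, Derivation.leibniz_pow, pow_one] at h
  have hX : edgeDer S V (X e) = 1 ∨ edgeDer S V (X e) = -1 := by
    simp only [edgeDer, MvPolynomial.mkDerivation_X]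
    rcases he with rfl | rfl <;> simp
  have h2 : (2 : S) * meanOver (Option V) S (X e * g) = 0 := by
    have h3 : (2 : S) * meanOver (Option V) S (X e * g) =
        meanOver (Option V) S (2 * (X e * g)) := by
      rw [show (2 : MvPolynomial (Option V × Option V) S) = C 2 from (map_ofNat C 2).symm,
        meanOver_C_mul]
    rw [h3]
    rcases hX with hX | hX <;> rw [hX] at h
    · rw [← h]; congr 1; simp only [smul_eq_mul, nsmul_eq_mul]; push_cast; ring
    · rw [← neg_eq_zero, ← map_neg, ← h]; congr 1; simp only [smul_eq_mul, nsmul_eq_mul]; push_cast; ring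
  have h4 : algebraMap ℝ S (1 / 2) * (2 * meanOver (Option V) S (X e * g)) = 0 := by
    rw [h2, mul_zero]
  rwa [← mul_assoc, show (2 : S) = algebraMap ℝ S 2 from (map_ofNat (algebraMap ℝ S) 2).symm, ← map_mul,
    show (1 / 2 : ℝ) * 2 = 1 by norm_num, map_one, one_mul] at h4

end MeanAlgebra

/-! ### Divided powers -/

section DivPow

variable {R R' : Type*} [CommRing R] [Algebra ℝ R] [CommRing R'] [Algebra ℝ R']

/-- The divided power `x ^ n / n!`. -/
def divPow (x : R) (n : ℕ) : R := ((n.factorial : ℝ)⁻¹) • x ^ n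

lemma divPow_zero (x : R) : divPow x 0 = 1 := by simp [divPow]

lemma divPow_one (x : R) : divPow x 1 = x := by simp [divPow]

lemma zero_divPow_succ (n : ℕ) : divPow (0 : R) (n + 1) = 0 := by simp [divPow]

lemma map_divPow (φ : R →ₐ[ℝ] R') (x : R) (n : ℕ) : φ (divPow x n) = divPow (φ x) n := by
  simp [divPow]

lemma divPow_add (x y : R) (n : ℕ) :
    divPow (x + y) n = ∑ p ∈ antidiagonal n, divPow x p.1 * divPow y p.2 := by
  rw [divPow, (Commute.all x y).add_pow', smul_sum]
  refine sum_congr rfl fun p hp => ?_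
  have hp' : p.1 + p.2 = n := Finset.HasAntidiagonal.mem_antidiagonal.1 hp
  rw [divPow, divPow, smul_mul_smul_comm, ← Nat.cast_smul_eq_nsmul ℝ, smul_smul]
  congr 1
  rw [← hp', Nat.cast_add_choose]
  have := Nat.factorial_ne_zero p.1
  have := Nat.factorial_ne_zero p.2
  have := Nat.factorial_ne_zero (p.1 + p.2)
  field_simp

lemma derivation_divPow (δ : R → R) (hδ : ∀ x (n : ℕ), δ (x ^ (n + 1)) = ((n : ℝ) + 1) • (x ^ n * δ x))
    (hs : ∀ (c : ℝ) x, δ (c • x) = c • δ x) (x : R) (n : ℕ) :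
    δ (divPow x (n + 1)) = divPow x n * δ x := by
  rw [divPow, divPow, hs, hδ, smul_smul, smul_mul_assoc]
  congr 1
  rw [Nat.factorial_succ]
  push_cast
  have := Nat.factorial_ne_zero n
  field_simp

end DivPow

/-! ### The symbols of the Feynman integrals -/

section Wick

open CommDer

variable {N : ℕ} (ϖ : 𝕄 N)

lemma contrSymbol_comm {ϖ : 𝕄 N} (hϖ : ∀ i j, ϖ j i = -ϖ i j) {U : Type*}
    (u v : U) : contrSymbol ϖ v u = - contrSymbol ϖ u v := by
  rw [contrSymbol, sum_comm, contrSymbol]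
  simp only [← sum_neg_distrib]
  refine sum_congr rfl fun i _ => sum_congr rfl fun j _ => ?_
  rw [hϖ, neg_smul, mul_comm]

lemma contrSymbol_self {ϖ : 𝕄 N} (hϖ : ∀ i j, ϖ j i = -ϖ i j) {U : Type*}
    (u : U) : contrSymbol ϖ u u = 0 := by
  have h := contrSymbol_comm hϖ u u
  have h2 : (2 : ℝ) • contrSymbol ϖ u u = 0 := by
    rw [two_smul]; nth_rewrite 1 [h]; exact neg_add_cancel _
  exact (smul_eq_zero.1 h2).resolve_left two_ne_zero

/-- Naturality of the contractions with respect to linear substitutions of the slots. -/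
lemma map_contrSymbol {U U' : Type*}
    (ψ : 𝒫[U, N] →ₐ[ℝ] MvPolynomial (U' × Fin N) ℝ) (s : U → Finset U')
    (hψ : ∀ u i, ψ (X (u, i)) = ∑ u' ∈ s u, X (u', i)) (u v : U) :
    ψ (contrSymbol ϖ u v) = ∑ u' ∈ s u, ∑ v' ∈ s v, contrSymbol ϖ u' v' := by
  simp only [contrSymbol, map_sum, map_smul, map_mul, hψ, Finset.sum_mul_sum, smul_sum]
  rw [sum_congr rfl fun i _ => sum_comm, sum_comm]
  refine sum_congr rfl fun u' _ => ?_
  rw [sum_congr rfl fun i _ => sum_comm, sum_comm]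

/-- The element `∑ P_{ab} q_{ab}` with `q_{ab} = 1/2 ϖ^{ij} ξ_{a,i} ξ_{b,j}`, the propagators `P_{ab}`
being formal variables. -/
def edgeSum (U : Type*) [Fintype U] : MvPolynomial (U × U) (𝒫[U, N]) :=
  ∑ a, ∑ b, X (a, b) * C ((1 / 2 : ℝ) • contrSymbol ϖ a b)

/-- The symbol of the part of order `r` of the Feynman integral: the mean of
`(∑ P_{ab} q_{ab}) ^ r / r!`. -/
def wickSymbol (U : Type*) [Fintype U] (r : ℕ) : 𝒫[U, N] := meanOver U _ (divPow (edgeSum ϖ U) r)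

variable {U : Type*} [Fintype U] [DecidableEq U]

lemma map_divPow_map {σ S S' : Type*} [CommRing S] [Algebra ℝ S] [CommRing S'] [Algebra ℝ S']
    (ψ : S →ₐ[ℝ] S') (f : MvPolynomial σ S) (r : ℕ) :
    MvPolynomial.map (ψ : S →+* S') (divPow f r) = divPow (MvPolynomial.map (ψ : S →+* S') f) r :=
  map_divPow (MvPolynomial.mapAlgHom ψ) f r

/-- The image of the symbol under a substitution. -/
lemma map_wickSymbol {S : Type*} [CommRing S] [Algebra ℝ S] (ψ : 𝒫[U, N] →ₐ[ℝ] S) (r : ℕ) :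
    ψ (wickSymbol ϖ U r) = meanOver U S (divPow
      (∑ a, ∑ b, X (a, b) * C ((1 / 2 : ℝ) • ψ (contrSymbol ϖ a b))) r) := by
  rw [wickSymbol, ← meanOver_map, map_divPow_map, edgeSum]
  simp only [map_sum, map_mul, map_X, MvPolynomial.map_C, AlgHom.coe_toRingHom, map_smul]

lemma wickSymbol_zero : wickSymbol ϖ U 0 = 1 := by
  rw [wickSymbol, divPow_zero, meanOver_one]

lemma rename_contrSymbol {U' : Type*} (i : U → U') (a b : U) :
    rename (Prod.map i id) (contrSymbol ϖ a b) = contrSymbol ϖ (i a) (i b) := by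
  simp only [contrSymbol, map_sum, map_smul, map_mul, rename_X, Prod.map_apply, id]

/-- The symbol of an embedded set of slots. -/
lemma rename_wickSymbol {W : Type*} [Fintype W] [DecidableEq W] (i : W ↪ U) (r : ℕ) :
    rename (Prod.map i id) (wickSymbol ϖ W r) =
      meanOver U _ (divPow (∑ a ∈ univ.map i, ∑ b ∈ univ.map i,
        X (a, b) * C ((1 / 2 : ℝ) • contrSymbol ϖ a b)) r) := by
  rw [map_wickSymbol, ← meanOver_rename i]
  congr 1
  have h := map_divPow ((rename (Prod.map i i) :
    MvPolynomial (W × W) (𝒫[U, N]) →ₐ[_] _).restrictScalars ℝ)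
  simp only [AlgHom.restrictScalars_apply] at h
  rw [h]
  simp only [map_sum, map_mul, rename_X, MvPolynomial.rename_C, Prod.map_apply,
    rename_contrSymbol, Finset.sum_map]

lemma rename_wickSymbol_equiv (σ : Equiv.Perm U) (r : ℕ) :
    rename (Prod.map σ id) (wickSymbol ϖ U r) = wickSymbol ϖ U r := by
  have := rename_wickSymbol ϖ σ.toEmbedding r
  rwa [Finset.map_univ_equiv] at this

/-- The substitution that sets the variables of the slots outside `Y` to zero. -/
def keepSlots (N : ℕ) (Y : Finset U) : 𝒫[U, N] →ₐ[ℝ] 𝒫[U, N] :=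
  aeval fun p => if p.1 ∈ Y then X p else 0

lemma keepSlots_contrSymbol (Y : Finset U) (a b : U) :
    keepSlots N Y (contrSymbol ϖ a b) = if a ∈ Y ∧ b ∈ Y then contrSymbol ϖ a b else 0 := by
  rw [map_contrSymbol ϖ (keepSlots N Y) (fun u => if u ∈ Y then {u} else ∅)]
  · split_ifs <;> simp_all
  · intro u i
    rw [keepSlots, aeval_X]
    split_ifs <;> simp

lemma keepSlots_wickSymbol (Y : Finset U) (r : ℕ) :
    keepSlots N Y (wickSymbol ϖ U r) = meanOver U _ (divPow (∑ a ∈ Y, ∑ b ∈ Y,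
        X (a, b) * C ((1 / 2 : ℝ) • contrSymbol ϖ a b)) r) := by
  rw [map_wickSymbol]
  suffices h : ∑ a, ∑ b, X (a, b) *
      C ((1 / 2 : ℝ) • keepSlots N Y (contrSymbol ϖ a b)) = ∑ a ∈ Y, ∑ b ∈ Y,
        X (a, b) * C ((1 / 2 : ℝ) • contrSymbol ϖ a b) by rw [h]
  rw [← sum_subset (Finset.subset_univ Y)]
  · refine sum_congr rfl fun a ha => ?_
    rw [← sum_subset (Finset.subset_univ Y)]
    · refine sum_congr rfl fun b hb => ?_
      rw [keepSlots_contrSymbol, if_pos ⟨ha, hb⟩]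
    · intro b _ hb
      rw [keepSlots_contrSymbol, if_neg (by simp [hb]), smul_zero, map_zero, mul_zero]
  · intro a _ ha
    refine sum_eq_zero fun b _ => ?_
    rw [keepSlots_contrSymbol, if_neg (by simp [ha]), smul_zero, map_zero, mul_zero]

end Wick

section WickPointed

open CommDer

variable {N : ℕ} {ϖ : 𝕄 N} {V : Type*} [Fintype V] [DecidableEq V]

lemma mergeSymbol_contrSymbol (w : V) (a b : Option V) : mergeSymbol N w (contrSymbol ϖ a b) =
      ∑ u ∈ univ.filter (fun u => (if u = some w then none else u) = a),
        ∑ v ∈ univ.filter (fun v => (if v = some w then none else v) = b), contrSymbol ϖ u v := by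
  refine map_contrSymbol ϖ (mergeSymbol N w) (fun a => univ.filter
    fun u => (if u = some w then none else u) = a) (fun u i => ?_) a b
  rw [mergeSymbol, aeval_X]
  dsimp only
  split_ifs with h1 h2
  · subst h1
    have : univ.filter (fun u : Option V => (if u = some w then none else u) = none) =
        {none, some w} := by
      ext u
      by_cases h : u = some w <;> simp [h]
    rw [this, Finset.sum_pair (by simp)]
  · subst h2
    rw [Finset.filter_eq_empty_iff.2, sum_empty]
    intro u _ hu
    split_ifs at hu with h
    exact h hu
  · have : univ.filter (fun u' : Option V => (if u' = some w then none else u') = u) = {u} := by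
      ext u'
      by_cases h : u' = some w
      · subst h; simp [Ne.symm h1, Ne.symm h2]
      · simp [h]
    rw [this, Finset.sum_singleton]

/-- When the points `none` and `some w` collide, the edges between them contribute `s` times the
contraction, and the remaining edges are those of the configuration with the two points merged. -/
lemma edgeTau_edgeSum (hϖ : ∀ i j, ϖ j i = -ϖ i j) (w : V) (s : ℝ) :
    edgeTau w (algebraMap ℝ _ s) (edgeSum ϖ (Option V)) = C (s • contrSymbol ϖ none (some w)) +
        MvPolynomial.map (mergeSymbol N w : _ →+* _) (edgeSum ϖ (Option V)) := by
  set φ : Option V → Option V := fun u => if u = some w then none else u with hφ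
  have hm : MvPolynomial.map (mergeSymbol N w : _ →+* _) (edgeSum ϖ (Option V)) =
      ∑ u, ∑ v, X (φ u, φ v) * C ((1 / 2 : ℝ) • contrSymbol ϖ u v) := by
    have hfib (F : Option V → Option V → Option V → Option V →
        MvPolynomial (Option V × Option V) (𝒫[Option V, N])) :
        ∑ a, ∑ b, ∑ u ∈ univ.filter (fun u => φ u = a),
          ∑ v ∈ univ.filter (fun v => φ v = b), F a b u v =
        ∑ u, ∑ v, F (φ u) (φ v) u v := by
      have h1 (G : Option V → Option V → MvPolynomial (Option V × Option V) (𝒫[Option V, N])) :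
          ∑ a, ∑ u ∈ univ.filter (fun u => φ u = a), G a u = ∑ u, G (φ u) u := by
        rw [← Finset.sum_fiberwise univ φ fun u => G (φ u) u]
        refine sum_congr rfl fun a _ => sum_congr rfl fun u hu => ?_
        rw [(mem_filter.1 hu).2]
      rw [sum_congr rfl fun a _ => sum_comm]
      rw [h1 fun a u => ∑ b, ∑ v ∈ univ.filter (fun v => φ v = b), F a b u v]
      exact sum_congr rfl fun u _ => h1 fun b v => F (φ u) b u v
    rw [← hfib fun a b u v => X (a, b) * C ((1 / 2 : ℝ) • contrSymbol ϖ u v)]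
    simp only [edgeSum, map_sum, map_mul, map_X, MvPolynomial.map_C,
      AlgHom.coe_toRingHom, map_smul, mergeSymbol_contrSymbol, smul_sum, mul_sum]
    rfl
  have he (a b : Option V) : edgeTau w (algebraMap ℝ (𝒫[Option V, N]) s)
      (X (a, b) * C ((1 / 2 : ℝ) • contrSymbol ϖ a b)) =
      X (φ a, φ b) * C ((1 / 2 : ℝ) • contrSymbol ϖ a b) +
      ((if (a, b) = (none, some w) then (C (algebraMap ℝ _ s) - X (none, none)) *
          C ((1 / 2 : ℝ) • contrSymbol ϖ none (some w)) else 0) +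
      (if (a, b) = (some w, none) then (C (- algebraMap ℝ _ s) - X (none, none)) *
          C ((1 / 2 : ℝ) • contrSymbol ϖ (some w) none) else 0)) := by
    rw [map_mul, edgeTau, aeval_X, ← edgeTau, show edgeTau w (algebraMap ℝ (𝒫[Option V, N]) s)
        (C ((1 / 2 : ℝ) • contrSymbol ϖ a b)) =
        C ((1 / 2 : ℝ) • contrSymbol ϖ a b) from aeval_C _ _]
    by_cases h1 : (a, b) = (none, some w)
    · obtain ⟨rfl, rfl⟩ := Prod.mk.inj h1
      simp [hφ]
      ring
    · by_cases h2 : (a, b) = (some w, none)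
      · obtain ⟨rfl, rfl⟩ := Prod.mk.inj h2
        simp [hφ]
        ring
      · rw [if_neg h1, if_neg h2, if_neg h1, if_neg h2, add_zero, add_zero]
  have hsingle (e : Option V × Option V) (z : MvPolynomial (Option V × Option V) (𝒫[Option V, N])) :
      ∑ a, ∑ b, (if (a, b) = e then z else 0) = z := by
    rw [← Fintype.sum_prod_type']
    simp
  rw [hm, edgeSum]
  simp only [map_sum, he, sum_add_distrib, hsingle]
  rw [contrSymbol_comm hϖ none (some w), add_comm]
  congr 1
  have : (s • contrSymbol ϖ none (some w) : 𝒫[Option V, N]) =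
      algebraMap ℝ _ s * ((1 / 2 : ℝ) • contrSymbol ϖ none (some w)) +
      algebraMap ℝ _ s * ((1 / 2 : ℝ) • contrSymbol ϖ none (some w)) := by
    simp only [← Algebra.smul_def, smul_smul, ← add_smul]
    congr 1; ring
  rw [this, smul_neg, map_neg, map_neg, map_add, map_mul]
  ring

/-- Moving the point `none` contracts it with all the other points. -/
lemma edgeDer_edgeSum (hϖ : ∀ i j, ϖ j i = -ϖ i j) :
    edgeDer _ V (edgeSum ϖ (Option V)) = C (∑ v, contrSymbol ϖ none (some v)) := by
  have hC (s : 𝒫[Option V, N]) : edgeDer _ V (C s) = 0 := by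
    simp [edgeDer]
  have hX (e : Option V × Option V) : edgeDer (𝒫[Option V, N]) V (X e) = match e with
        | (none, some _) => 1
        | (some _, none) => -1
        | _ => 0 := by
    rw [edgeDer, MvPolynomial.mkDerivation_X]
  simp only [edgeSum, map_sum, Derivation.leibniz, hC, smul_zero, zero_add, smul_eq_mul, hX]
  simp only [Fintype.sum_option, mul_zero, mul_one, mul_neg, sum_const_zero, add_zero, zero_add]
  rw [← sum_add_distrib]
  refine sum_congr rfl fun v _ => ?_
  rw [contrSymbol_comm hϖ none (some v), smul_neg, map_neg, neg_neg, ← map_add, ← add_smul]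
  norm_num

/-- Stokes' theorem for the symbols. -/
lemma sum_contrSymbol_mul_wickSymbol (hϖ : ∀ i j, ϖ j i = -ϖ i j) (r : ℕ) :
    (∑ v, contrSymbol ϖ none (some v)) * wickSymbol ϖ (Option V) r =
      ∑ w, ∑ p ∈ antidiagonal (r + 1), (divPow ((1 / 2 : ℝ) • contrSymbol ϖ none (some w)) p.1 -
          divPow ((-(1 / 2) : ℝ) • contrSymbol ϖ none (some w)) p.1) *
            mergeSymbol N w (wickSymbol ϖ (Option V) p.2) := by
  have h := meanOver_edgeDer (divPow (edgeSum ϖ (Option V)) (r + 1))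
  rw [derivation_divPow (edgeDer _ V) _ _, edgeDer_edgeSum hϖ, mul_comm, meanOver_C_mul] at h
  · rw [wickSymbol, h]
    refine sum_congr rfl fun w _ => ?_
    have ht (s : ℝ) : meanOver (Option V) _ (edgeTau w (algebraMap ℝ _ s)
        (divPow (edgeSum ϖ (Option V)) (r + 1))) = ∑ p ∈ antidiagonal (r + 1),
          divPow (s • contrSymbol ϖ none (some w)) p.1 *
            mergeSymbol N w (wickSymbol ϖ (Option V) p.2) := by
      have h1 := map_divPow ((edgeTau w (algebraMap ℝ (𝒫[Option V, N]) s)).restrictScalars ℝ)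
      simp only [AlgHom.restrictScalars_apply] at h1
      rw [h1, edgeTau_edgeSum hϖ, divPow_add, map_sum]
      refine sum_congr rfl fun p _ => ?_
      have h2 : divPow (C (s • contrSymbol ϖ none (some w)) :
          MvPolynomial (Option V × Option V) (𝒫[Option V, N])) p.1 =
          C (divPow (s • contrSymbol ϖ none (some w)) p.1) :=
        (map_divPow (IsScalarTower.toAlgHom ℝ (𝒫[Option V, N])
          (MvPolynomial (Option V × Option V) (𝒫[Option V, N]))) _ _).symm
      rw [h2, meanOver_C_mul, ← map_divPow_map, meanOver_map]
      rfl
    rw [ht, ht, ← sum_sub_distrib]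
    refine sum_congr rfl fun p _ => ?_
    rw [sub_mul]
  · intro x n
    rw [Derivation.leibniz_pow, Nat.add_sub_cancel, smul_eq_mul, ← Nat.cast_smul_eq_nsmul ℝ]
    push_cast
    rfl
  · intro c x
    exact (edgeDer (𝒫[Option V, N]) V).toLinearMap.map_smul_of_tower c x

end WickPointed

/-! ### Feynman integrals with even arguments -/

section WickOp

open CommDer

variable {N : ℕ} {B : Type*} [Ring B] [Algebra ℝ B] (D : CommDer N B⟦X⟧)
  (ϖ : 𝕄 N) {V : Type*} [Fintype V] [DecidableEq V]

/-- The product of `x` and the `a v` with all the contractions `∑ P_{ab} q_{ab}`, weighted with powers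
of the variable and averaged over the positions of the arguments on the circle. -/
def wick (x : B⟦X⟧) (a : V → 𝒵 B⟦X⟧) : B⟦X⟧ :=
  hs fun r => D.polyDiff (wickSymbol ϖ (Option V) r) x a

/-- The star product of Moyal. -/
def starProd (x z : B⟦X⟧) : B⟦X⟧ := hs fun p => ((p.factorial : ℝ)⁻¹) • D.bidiff ϖ (1 / 2) p x z

variable {D ϖ}

lemma wick_add (x y : B⟦X⟧) (a : V → 𝒵 B⟦X⟧) :
    wick D ϖ (x + y) a = wick D ϖ x a + wick D ϖ y a := by
  simp only [wick, polyDiff_add_left, hs_add]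

variable (D ϖ) in
/-- `wick` as an additive map of the first argument. -/
def wickLeft (a : V → 𝒵 B⟦X⟧) : B⟦X⟧ →+ B⟦X⟧ :=
  AddMonoidHom.mk' (fun x => wick D ϖ x a) fun x y => wick_add x y a

lemma wick_zero (a : V → 𝒵 B⟦X⟧) : wick D ϖ 0 a = 0 := map_zero (wickLeft D ϖ a)

lemma wick_neg (x : B⟦X⟧) (a : V → 𝒵 B⟦X⟧) :
    wick D ϖ (-x) a = - wick D ϖ x a := map_neg (wickLeft D ϖ a) x

lemma wick_const_mul {c : B⟦X⟧} (hc : ∀ i, D.d i c = 0) (x : B⟦X⟧) (a : V → 𝒵 B⟦X⟧) :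
    wick D ϖ (c * x) a = c * wick D ϖ x a := by
  simp only [wick, polyDiff_const_mul_left _ hc, mul_hs]

lemma polyDiff_hs (hD : ∀ i (ψ : ℕ → B⟦X⟧), D.d i (hs ψ) = hs fun r => D.d i (ψ r))
    (g : 𝒫[Option V, N]) (ψ : ℕ → B⟦X⟧)
    (a : V → 𝒵 B⟦X⟧) :
    D.polyDiff g (hs ψ) a = hs fun r => D.polyDiff g (ψ r) a := by
  induction g using symbol_induction generalizing ψ a with
  | one => simp only [polyDiff_one, hs_mul]
  | add g h hg hh => simp only [polyDiff_add, hg, hh, hs_add]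
  | smul c g hg => simp only [polyDiff_smul, hg, hs_smul]
  | X_mul s g hg =>
    obtain ⟨u, i⟩ := s
    cases u with
    | none => simp only [polyDiff_X_none, hD, hg]
    | some v => simp only [polyDiff_X_some, hg]

lemma bidiff_neg_swap (hϖ : ∀ i j, ϖ j i = -ϖ i j) {A : Type*} [Ring A] [Algebra ℝ A]
    (D : CommDer N A) (c : ℝ) (r : ℕ) (x : A) (z : 𝒵 A) :
    D.bidiff ϖ (-c) r x z = D.bidiff ϖ c r z x := by
  induction r generalizing x z with
  | zero => exact Subalgebra.mem_center_iff.1 z.2 x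
  | succ r ih =>
    rw [bidiff, bidiff, sum_comm, neg_smul, ← smul_neg, ← sum_neg_distrib]
    congr 1
    refine sum_congr rfl fun i _ => ?_
    rw [← sum_neg_distrib]
    refine sum_congr rfl fun j _ => ?_
    rw [hϖ, neg_smul, neg_neg]
    exact congrArg _ (ih (D.d j x) (D.dZ i z))

/-- The effect of Stokes' theorem: the collisions produce star commutators. -/
lemma X_mul_hs_contr_wick (hD : ∀ i (ψ : ℕ → B⟦X⟧), D.d i (hs ψ) = hs fun r => D.d i (ψ r))
    (hϖ : ∀ i j, ϖ j i = -ϖ i j) (x : B⟦X⟧)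
    (a : V → 𝒵 B⟦X⟧) :
    PowerSeries.X * hs (fun r => D.polyDiff ((∑ v, contrSymbol ϖ none (some v)) *
        wickSymbol ϖ (Option V) r) x a) =
      ∑ w, wick D ϖ (starProd D ϖ x (a w) - starProd D ϖ (a w) x) (update a w 1) := by
  have hsm (g : 𝒫[Option V, N]) (c : ℝ) (z : B⟦X⟧) (b) :
      D.polyDiff g (c • z) b = c • D.polyDiff g z b := by
    rw [Algebra.smul_def, polyDiff_const_mul_left, ← Algebra.smul_def]
    intro i
    rw [Algebra.algebraMap_eq_smul_one, map_smul, d_one, smul_zero]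
  have hterm (c : ℝ) (w : V) (p : ℕ × ℕ) : D.polyDiff (divPow (c • contrSymbol ϖ none (some w)) p.1 *
      mergeSymbol N w (wickSymbol ϖ (Option V) p.2)) x a =
      D.polyDiff (wickSymbol ϖ (Option V) p.2)
        (((p.1.factorial : ℝ)⁻¹) • D.bidiff ϖ c p.1 x (a w)) (update a w 1) := by
    rw [divPow, smul_mul_assoc, polyDiff_smul, mul_comm, polyDiff_merge_mul_contr_pow, hsm]
  have hL (r : ℕ) : (if r = 0 then 0 else D.polyDiff ((∑ v, contrSymbol ϖ none (some v)) *
        wickSymbol ϖ (Option V) (r - 1)) x a) = ∑ w, ∑ p ∈ antidiagonal r,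
      D.polyDiff (wickSymbol ϖ (Option V) p.1)
        (((p.2.factorial : ℝ)⁻¹) • D.bidiff ϖ (1 / 2) p.2 x (a w) -
         ((p.2.factorial : ℝ)⁻¹) • D.bidiff ϖ (1 / 2) p.2 (a w) x) (update a w 1) := by
    have hsub (g : 𝒫[Option V, N]) (y z : B⟦X⟧) (b) :
        D.polyDiff g (y - z) b = D.polyDiff g y b - D.polyDiff g z b :=
      map_sub (D.polyDiffLeft g b) y z
    cases r with
    | zero =>
      rw [if_pos rfl]
      refine (sum_eq_zero fun w _ => sum_eq_zero fun p hp => ?_).symm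
      have hp' : p.1 + p.2 = 0 := Finset.HasAntidiagonal.mem_antidiagonal.1 hp
      rw [(Nat.add_eq_zero_iff.1 hp').2, bidiff, bidiff, Subalgebra.mem_center_iff.1 (a w).2 x,
        sub_self, polyDiff_zero_left]
    | succ r =>
      rw [if_neg (Nat.succ_ne_zero r), Nat.add_sub_cancel, sum_contrSymbol_mul_wickSymbol hϖ,
        polyDiff_sum]
      refine sum_congr rfl fun w _ => ?_
      rw [polyDiff_sum]
      refine Eq.trans ?_ (sum_antidiagonal_swap (r + 1) fun p q =>
        D.polyDiff (wickSymbol ϖ (Option V) q)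
        (((p.factorial : ℝ)⁻¹) • D.bidiff ϖ (1 / 2) p x (a w) -
         ((p.factorial : ℝ)⁻¹) • D.bidiff ϖ (1 / 2) p (a w) x) (update a w 1))
      refine sum_congr rfl fun p _ => ?_
      rw [sub_mul, polyDiff_sub, hterm, hterm, bidiff_neg_swap hϖ, ← hsub]
  rw [X_mul_hs]
  simp only [hL, hs_sum]
  refine sum_congr rfl fun w _ => ?_
  rw [wick, starProd, starProd, ← hs_sub]
  simp only [polyDiff_hs hD]
  rw [hs_hs fun r p => D.polyDiff (wickSymbol ϖ (Option V) r)
        (((p.factorial : ℝ)⁻¹) • D.bidiff ϖ (1 / 2) p x (a w) -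
         ((p.factorial : ℝ)⁻¹) • D.bidiff ϖ (1 / 2) p (a w) x) (update a w 1)]

/-- The slots with an argument `1` do not contribute. -/
lemma polyDiff_keepSlots (Y : Finset (Option V)) (hY : none ∈ Y) (g : 𝒫[Option V, N]) (x : B⟦X⟧)
    (a : V → 𝒵 B⟦X⟧) (ha : ∀ v, some v ∉ Y → a v = 1) :
    D.polyDiff (keepSlots N Y g) x a = D.polyDiff g x a := by
  induction g using symbol_induction generalizing x a with
  | one => rw [map_one]
  | add g h hg hh => simp only [map_add, polyDiff_add, hg _ _ ha, hh _ _ ha]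
  | smul c g hg => simp only [map_smul, polyDiff_smul, hg _ _ ha]
  | X_mul s g hg =>
    obtain ⟨u, i⟩ := s
    rw [map_mul, keepSlots, aeval_X, ← keepSlots]
    cases u with
    | none => rw [if_pos hY, polyDiff_X_none, polyDiff_X_none, hg _ _ ha]
    | some v =>
      dsimp only
      split_ifs with h
      · rw [polyDiff_X_some, polyDiff_X_some, hg]
        intro w hw
        rw [update_of_ne (by rintro rfl; exact hw h), ha w hw]
      · rw [zero_mul, polyDiff_zero, polyDiff_X_of_one _ _ _ _ _ (ha v h)]

lemma wick_comp_embedding {W : Type*} [Fintype W] [DecidableEq W] (i : W ↪ V)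
    (x : B⟦X⟧) (a : V → 𝒵 B⟦X⟧)
    (ha : ∀ v, v ∉ Set.range i → a v = 1) : wick D ϖ x a = wick D ϖ x (a ∘ i) := by
  rw [wick, wick]
  congr 1
  funext r
  rw [← polyDiff_rename i _ x a ha,
    ← polyDiff_keepSlots (univ.map i.optionMap) (by simp) _ x a, keepSlots_wickSymbol]
  · rw [← rename_wickSymbol]
    rfl
  · intro v hv
    refine ha v fun ⟨w, hw⟩ => hv ?_
    rw [Finset.mem_map]
    exact ⟨some w, mem_univ _, by simp [hw]⟩

/-- An odd derivation applied to a Feynman integral. -/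
lemma oddDerivation_wick (σ : B⟦X⟧ →+* B⟦X⟧) (hσ : ∀ i x, σ (D.d i x) = D.d i (σ x))
    (ι : B⟦X⟧ →ₗ[ℝ] B⟦X⟧) (hι : ∀ x y, ι (x * y) = ι x * y + σ x * ι y)
    (hd : ∀ i x, ι (D.d i x) = D.d i (ι x))
    (hhs : ∀ ψ : ℕ → B⟦X⟧, ι (hs ψ) = hs fun r => ι (ψ r))
    (a : V → 𝒵 B⟦X⟧) (ha : ∀ v, σ (a v) = a v) :
    ι (wick D ϖ 1 a) = ∑ v, wick D ϖ (ι (a v)) (update a v 1) := by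
  rw [wick, hhs]
  simp only [oddDerivation_polyDiff σ hσ ι hι hd _ a ha, rename_wickSymbol_equiv, hs_sum]
  rfl

/-- A derivation applied to a Feynman integral. -/
lemma d_wick (hD : ∀ i (ψ : ℕ → B⟦X⟧), D.d i (hs ψ) = hs fun r => D.d i (ψ r))
    (i : Fin N) (x : B⟦X⟧) (a : V → 𝒵 B⟦X⟧) :
    D.d i (wick D ϖ x a) = hs fun r => D.polyDiff ((∑ u, X (u, i)) *
      wickSymbol ϖ (Option V) r) x a := by
  rw [wick, hD]
  simp only [d_polyDiff]

/-- The BV operator on a Feynman integral with arguments `a v` such that `ι_j (a v) = ∂_j (β v)`. -/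
lemma bv_wick (hD : ∀ i (ψ : ℕ → B⟦X⟧), D.d i (hs ψ) = hs fun r => D.d i (ψ r))
    (hϖ : ∀ i j, ϖ j i = -ϖ i j) (σ : B⟦X⟧ →+* B⟦X⟧)
    (hσ : ∀ i x, σ (D.d i x) = D.d i (σ x))
    (ι : Fin N → B⟦X⟧ →ₗ[ℝ] B⟦X⟧)
    (hι : ∀ j x y, ι j (x * y) = ι j x * y + σ x * ι j y)
    (hd : ∀ j i x, ι j (D.d i x) = D.d i (ι j x))
    (hhs : ∀ j (ψ : ℕ → B⟦X⟧), ι j (hs ψ) = hs fun r => ι j (ψ r))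
    (a : V → 𝒵 B⟦X⟧) (ha : ∀ v, σ (a v) = a v)
    (β : V → B⟦X⟧) (hβ : ∀ j v, ι j (a v) = D.d j (β v)) :
    PowerSeries.X * ∑ i, ∑ j, ϖ i j • D.d i (ι j (wick D ϖ 1 a)) =
      ∑ v, ∑ w, wick D ϖ (starProd D ϖ (update a v 1 w : 𝒵 _) (β v) -
        starProd D ϖ (β v) (update a v 1 w : 𝒵 _)) (update (update a v 1) w 1) := by
  have h1 (v : V) : ∑ i, ∑ j, ϖ i j • D.d i (wick D ϖ (D.d j (β v)) (update a v 1)) =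
      - hs (fun r => D.polyDiff ((∑ v, contrSymbol ϖ none (some v)) *
        wickSymbol ϖ (Option V) r) (β v) (update a v 1)) := by
    have h2 (i j : Fin N) (r : ℕ) : D.polyDiff ((∑ u, X (u, i)) *
        wickSymbol ϖ (Option V) r) (D.d j (β v)) (update a v 1) =
        D.polyDiff ((∑ u, X (u, i) * X (none, j)) *
        wickSymbol ϖ (Option V) r) (β v) (update a v 1) := by
      rw [← polyDiff_X_none, ← sum_mul]
      congr 1; ring
    simp only [d_wick hD, h2, ← hs_smul, ← hs_sum]
    rw [← zero_sub, ← hs_single (0 : B⟦X⟧), ← hs_sub]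
    congr 1
    funext r
    rw [ite_self, zero_sub]
    simp only [← polyDiff_smul, ← polyDiff_sum]
    have h3 : ∑ i, ∑ j, ϖ i j • ((∑ u, X (u, i) * X (none, j)) * wickSymbol ϖ (Option V) r) =
        (-1 : ℝ) • ((∑ v, contrSymbol ϖ none (some v)) * wickSymbol ϖ (Option V) r) := by
      have h4 : ∑ i, ∑ j, ϖ i j • (∑ u : Option V, (X (u, i) * X (none, j) : 𝒫[Option V, N])) =
          - ∑ v, contrSymbol ϖ none (some v) := by
        simp only [smul_sum]
        rw [sum_congr rfl fun i _ => sum_comm, sum_comm]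
        change ∑ u : Option V, contrSymbol ϖ u none = _
        rw [Fintype.sum_option, contrSymbol_self hϖ, zero_add, ← sum_neg_distrib]
        exact sum_congr rfl fun v _ => contrSymbol_comm hϖ _ _
      rw [neg_smul, one_smul, ← neg_mul, ← h4]
      simp only [sum_mul, smul_mul_assoc]
    rw [h3, polyDiff_smul, neg_smul, one_smul]
  simp only [oddDerivation_wick σ hσ (ι _) (hι _) (hd _) (hhs _) a ha, hβ, map_sum, smul_sum]
  rw [sum_congr rfl fun i _ => sum_comm, sum_comm, mul_sum]
  refine sum_congr rfl fun v _ => ?_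
  rw [h1, mul_neg, X_mul_hs_contr_wick hD hϖ, ← sum_neg_distrib]
  refine sum_congr rfl fun w _ => ?_
  rw [← wick_neg, neg_sub]

end WickOp

/-! ### Arguments of degree one -/

section ZeroMode

open CommDer

variable {N : ℕ} {ϖ : 𝕄 N} {V : Type*} [Fintype V] [DecidableEq V]

/-- The ideal of the symbols that differentiate the first argument. -/
def noneIdeal (N : ℕ) (V : Type*) : Ideal (𝒫[Option V, N]) :=
  Ideal.span (Set.range fun i : Fin N => X (none, i))

/-- The slots different from the first argument. -/
def someSlots (V : Type*) [Fintype V] : Finset (Option V) := univ.map Function.Embedding.some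

/-- Up to symbols of order at least two in the first argument, the first slot can be dropped: a single
propagator that ends there has mean zero. -/
lemma wickSymbol_sub_keepSlots_mem (hϖ : ∀ i j, ϖ j i = -ϖ i j) (r : ℕ) :
    wickSymbol ϖ (Option V) r - keepSlots N (someSlots V) (wickSymbol ϖ (Option V) r) ∈
      noneIdeal N V ^ 2 := by
  set J := noneIdeal N V ^ 2 with hJ
  let mk := Ideal.Quotient.mkₐ ℝ J
  have hmk (g) : mk g = Ideal.Quotient.mk J g := rfl
  rw [← Ideal.Quotient.mk_eq_mk_iff_sub_mem, ← hmk, ← hmk, ← AlgHom.comp_apply]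
  rw [map_wickSymbol, map_wickSymbol]
  have hX (i : Fin N) : X (none, i) ∈ noneIdeal N V := Ideal.subset_span ⟨i, rfl⟩
  have hc (v : V) : contrSymbol ϖ none (some v) ∈ noneIdeal N V :=
    Ideal.sum_mem _ fun i _ => Ideal.sum_mem _ fun j _ => by
      rw [← MvPolynomial.C_mul']
      exact Ideal.mul_mem_left _ _ (Ideal.mul_mem_right _ _ (hX i))
  have hcc (v w : V) : mk (contrSymbol ϖ none (some v)) * mk (contrSymbol ϖ none (some w)) = 0 := by
    rw [← map_mul, hmk, Ideal.Quotient.eq_zero_iff_mem, hJ, pow_two]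
    exact Ideal.mul_mem_mul (hc v) (hc w)
  set Q : MvPolynomial (Option V × Option V) (𝒫[Option V, N] ⧸ J) :=
    ∑ u : V, ∑ v : V, X (some u, some v) *
      C ((1 / 2 : ℝ) • mk (contrSymbol ϖ (some u) (some v))) with hQ
  set L : MvPolynomial (Option V × Option V) (𝒫[Option V, N] ⧸ J) :=
    ∑ v : V, (X (none, some v) - X (some v, none)) *
      C ((1 / 2 : ℝ) • mk (contrSymbol ϖ none (some v))) with hL
  have h1 : ∑ a, ∑ b, X (a, b) * C ((1 / 2 : ℝ) • mk (contrSymbol ϖ a b)) = L + Q := by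
    simp only [Fintype.sum_option, contrSymbol_self hϖ, map_zero, smul_zero, mul_zero, zero_add,
      sum_add_distrib]
    rw [← add_assoc, ← sum_add_distrib, hL]
    congr 1
    refine sum_congr rfl fun v _ => ?_
    rw [contrSymbol_comm hϖ none (some v), map_neg, smul_neg, map_neg]
    ring
  have h2 : ∑ a, ∑ b, X (a, b) * C
      ((1 / 2 : ℝ) • (mk.comp (keepSlots N (someSlots V))) (contrSymbol ϖ a b)) = Q := by
    simp only [Fintype.sum_option, AlgHom.comp_apply, keepSlots_contrSymbol, someSlots]
    simp [hQ]
  -- Modulo `J` the edge sum is `L + Q` with `L ^ 2 = 0`, and the terms linear in `L` have mean zero.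
  have hLL : L * L = 0 := by
    rw [hL, Finset.sum_mul_sum]
    refine sum_eq_zero fun v _ => sum_eq_zero fun w _ => ?_
    rw [mul_mul_mul_comm, ← map_mul, smul_mul_smul_comm, hcc, smul_zero, map_zero, mul_zero]
  have hdQ : edgeDer _ V Q = 0 := by
    have hC (s : 𝒫[Option V, N] ⧸ J) : edgeDer _ V (C s) = 0 := by simp [edgeDer]
    have hX (u v : V) : edgeDer (𝒫[Option V, N] ⧸ J) V (X (some u, some v)) = 0 := by
      rw [edgeDer, MvPolynomial.mkDerivation_X]
    simp only [hQ, map_sum, Derivation.leibniz, hC, hX, smul_zero, add_zero, sum_const_zero]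
  have htQ (w : V) (s s' : 𝒫[Option V, N] ⧸ J) : edgeTau w s Q = edgeTau w s' Q := by
    simp only [hQ, map_sum, map_mul]
    refine sum_congr rfl fun u _ => sum_congr rfl fun v _ => ?_
    congr 1
    simp only [edgeTau, aeval_X]
    simp
    simp [edgeTau]
  have hLQ (n : ℕ) : meanOver (Option V) _ (L * divPow Q n) = 0 := by
    have hd : edgeDer _ V (divPow Q n) = 0 := by
      rw [divPow]
      refine ((edgeDer _ V).toLinearMap.map_smul_of_tower _ _).trans ?_
      erw [Derivation.leibniz_pow]
      rw [hdQ, smul_zero, smul_zero, smul_zero]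
    have ht (w : V) (s s' : 𝒫[Option V, N] ⧸ J) :
        edgeTau w s (divPow Q n) = edgeTau w s' (divPow Q n) := by
      have h (s) := map_divPow ((edgeTau w s : _ →ₐ[𝒫[Option V, N] ⧸ J] _).restrictScalars ℝ) Q n
      simp only [AlgHom.restrictScalars_apply] at h
      rw [h, h, htQ w s s']
    rw [hL, sum_mul, map_sum]
    refine sum_eq_zero fun v _ => ?_
    rw [mul_right_comm, mul_comm, meanOver_C_mul, sub_mul, map_sub,
      meanOver_X_mul_eq_zero v _ hd ht _ (Or.inl rfl),
      meanOver_X_mul_eq_zero v _ hd ht _ (Or.inr rfl), sub_zero, mul_zero]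
  rw [h1, h2, divPow_add, map_sum, sum_eq_single (0, r)]
  · rw [divPow_zero, one_mul]
  · rintro ⟨m, n⟩ hmn hne
    match m with
    | 0 =>
      have : 0 + n = r := Finset.HasAntidiagonal.mem_antidiagonal.1 hmn
      rw [zero_add] at this
      exact (hne (by rw [this])).elim
    | 1 => rw [divPow_one, hLQ]
    | m + 2 =>
      rw [divPow, pow_add, pow_two, hLL, mul_zero, smul_zero, zero_mul, map_zero]
  · intro h
    exact (h (by simp)).elim

variable {B : Type*} [Ring B] [Algebra ℝ B] {D : CommDer N B⟦X⟧}

/-- A first argument of degree at most one in the coordinates can be taken out. -/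
lemma wick_of_d_d_eq_zero (hϖ : ∀ i j, ϖ j i = -ϖ i j) (x : B⟦X⟧)
    (hx : ∀ i j, D.d i (D.d j x) = 0) (a : V → 𝒵 B⟦X⟧) :
    wick D ϖ x a = x * wick D ϖ 1 a := by
  have h1 (g : 𝒫[Option V, N]) (hg : g ∈ noneIdeal N V ^ 2) : D.polyDiff g x a = 0 := by
    rw [noneIdeal, pow_two, Ideal.span_mul_span'] at hg
    suffices h : ∀ h, D.polyDiff (h * g) x a = 0 by simpa using h 1
    induction hg using Submodule.span_induction with
    | mem g hg =>
      obtain ⟨_, ⟨i, rfl⟩, _, ⟨j, rfl⟩, rfl⟩ := hg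
      intro h
      dsimp only
      rw [mul_comm, mul_assoc, polyDiff_X_none, polyDiff_X_none, hx, polyDiff_zero_left]
    | zero => intro h; rw [mul_zero, polyDiff_zero]
    | add g g' _ _ hg hg' => intro h; rw [mul_add, polyDiff_add, hg, hg', add_zero]
    | smul c g _ hg => intro h; rw [smul_eq_mul, ← mul_assoc, hg]
  have h2 (g : 𝒫[Option V, N]) (a : V → 𝒵 B⟦X⟧) :
      D.polyDiff (keepSlots N (someSlots V) g) x a = x * D.polyDiff g 1 a := by
    clear h1
    induction g using symbol_induction generalizing a with
    | one => rw [map_one, polyDiff_one, polyDiff_one, one_mul]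
    | add g h hg hh => simp only [map_add, polyDiff_add, hg, hh, mul_add]
    | smul c g hg => simp only [map_smul, polyDiff_smul, hg, mul_smul_comm]
    | X_mul s g hg =>
      obtain ⟨u, i⟩ := s
      rw [map_mul, keepSlots, aeval_X, ← keepSlots]
      cases u with
      | none =>
        rw [if_neg (by simp [someSlots]), zero_mul, polyDiff_zero, polyDiff_X_none, d_one,
          polyDiff_zero_left, mul_zero]
      | some v => rw [if_pos (by simp [someSlots]), polyDiff_X_some, polyDiff_X_some, hg]
  rw [wick, wick, mul_hs]
  congr 1
  funext r
  rw [← h2, ← sub_eq_zero, ← polyDiff_sub]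
  exact h1 _ (wickSymbol_sub_keepSlots_mem hϖ r)

end ZeroMode

/-! ### The cluster expansion -/

section Cluster

variable {U R : Type*} [DecidableEq U] [CommRing R]

lemma sum_powerset_powerset {M : Type*} [AddCommMonoid M] (S : Finset U)
    (F : Finset U → Finset U → Finset U → M) :
    ∑ T ∈ S.powerset, ∑ T' ∈ T.powerset, F T' (T \ T') (S \ T) =
      ∑ T ∈ S.powerset, ∑ T' ∈ (S \ T).powerset, F T T' ((S \ T) \ T') := by
  simp only [Finset.sum_sigma']
  refine Finset.sum_nbij' (fun p => ⟨p.2, p.1 \ p.2⟩) (fun p => ⟨p.1 ∪ p.2, p.1⟩) ?_ ?_ ?_ ?_ ?_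
  · rintro ⟨T, T'⟩ h
    simp only [mem_sigma, mem_powerset] at h ⊢
    exact ⟨h.2.trans h.1, Finset.sdiff_subset_sdiff h.1 subset_rfl⟩
  · rintro ⟨T, T'⟩ h
    simp only [mem_sigma, mem_powerset] at h ⊢
    exact ⟨Finset.union_subset h.1 (h.2.trans Finset.sdiff_subset), Finset.subset_union_left⟩
  · rintro ⟨T, T'⟩ h
    simp only [mem_sigma, mem_powerset] at h
    simp [Finset.union_sdiff_of_subset h.2]
  · rintro ⟨T, T'⟩ h
    simp only [mem_sigma, mem_powerset] at h
    have : Disjoint T T' := (Finset.disjoint_sdiff).mono_right h.2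
    simp [Finset.union_sdiff_cancel_left this]
  · rintro ⟨T, T'⟩ h
    simp only [mem_sigma, mem_powerset] at h
    simp only
    congr 1
    ext x
    have := @h.2 x
    simp only [Finset.mem_sdiff]
    tauto

lemma sum_powerset_sdiff_comm {M : Type*} [AddCommMonoid M] (S : Finset U)
    (F : Finset U → Finset U → Finset U → M) :
    ∑ T ∈ S.powerset, ∑ T' ∈ (S \ T).powerset, F T T' ((S \ T) \ T') =
      ∑ T ∈ S.powerset, ∑ T' ∈ (S \ T).powerset, F T' T ((S \ T) \ T') := by
  simp only [Finset.sum_sigma']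
  refine Finset.sum_nbij' (fun p => ⟨p.2, p.1⟩) (fun p => ⟨p.2, p.1⟩) ?_ ?_ ?_ ?_ ?_
  · rintro ⟨T, T'⟩ h
    simp only [mem_sigma, mem_powerset, Finset.subset_sdiff] at h ⊢
    exact ⟨h.2.1, h.1, h.2.2.symm⟩
  · rintro ⟨T, T'⟩ h
    simp only [mem_sigma, mem_powerset, Finset.subset_sdiff] at h ⊢
    exact ⟨h.2.1, h.1, h.2.2.symm⟩
  · rintro ⟨T, T'⟩ h; rfl
  · rintro ⟨T, T'⟩ h; rfl
  · rintro ⟨T, T'⟩ h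
    simp only
    rw [sdiff_right_comm]

variable (X : Finset U → R) (u : U → U → R)

/-- The contribution of the graphs in which the points of `T` are all connected to `s`, for a
weight `X` that is a product of weights `u a b` of edges. -/
def clusterPart (s : U) (T : Finset U) : R :=
  X T * ∏ b ∈ T, u s b - ∑ T' ∈ T.ssubsets.attach, clusterPart s T' * X (T \ T')
termination_by T.card
decreasing_by exact Finset.card_lt_card (mem_ssubsets.1 T'.2)

lemma clusterPart_eq (s : U) (T : Finset U) : clusterPart X u s T =
    X T * ∏ b ∈ T, u s b - ∑ T' ∈ T.ssubsets, clusterPart X u s T' * X (T \ T') := by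
  rw [clusterPart, Finset.sum_attach T.ssubsets fun T' => clusterPart X u s T' * X (T \ T')]

lemma sum_clusterPart_mul (h0 : X ∅ = 1) (s : U) (T : Finset U) :
    ∑ T' ∈ T.powerset, clusterPart X u s T' * X (T \ T') = X T * ∏ b ∈ T, u s b := by
  rw [← add_sum_erase _ _ (mem_powerset_self T), sdiff_self, Finset.bot_eq_empty, h0,
    mul_one, clusterPart_eq]
  exact sub_add_cancel _ _

/-- A recursion for the connected contributions: the point `r` is connected to a cluster `T`, one of
whose points is connected to `s`, and the remaining points are connected to `s` otherwise. -/
lemma clusterPart_insert (h0 : X ∅ = 1)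
    (hX : ∀ r S, r ∉ S → X (insert r S) = X S * ∏ b ∈ S, u r b) (s r : U) (S : Finset U)
    (hr : r ∉ S) : clusterPart X u s (insert r S) = ∑ T ∈ S.powerset,
      clusterPart X u r T * ((∏ b ∈ insert r T, u s b) - 1) * clusterPart X u s (S \ T) := by
  induction S using Finset.strongInduction with
  | H S ih =>
  set E : Finset U → R := fun S => ∑ T ∈ S.powerset,
      clusterPart X u r T * ((∏ b ∈ insert r T, u s b) - 1) * clusterPart X u s (S \ T) with hE
  have h1 := sum_clusterPart_mul X u h0 s (insert r S)
  rw [Finset.sum_powerset_insert hr] at h1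
  have h2 : ∑ T ∈ S.powerset, clusterPart X u s T * X (insert r S \ T) =
      ∑ T ∈ S.powerset, clusterPart X u r T * (X (S \ T) * ∏ b ∈ S \ T, u s b) := by
    have (T) (hT : T ∈ S.powerset) : clusterPart X u s T * X (insert r S \ T) =
        ∑ T' ∈ (S \ T).powerset, clusterPart X u s T * clusterPart X u r T' * X ((S \ T) \ T') := by
      rw [Finset.insert_sdiff_of_notMem _ (fun h => hr (mem_powerset.1 hT h)),
        hX _ _ (fun h => hr (Finset.sdiff_subset h)), ← sum_clusterPart_mul X u h0 r,
        mul_sum]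
      exact sum_congr rfl fun T' _ => (mul_assoc _ _ _).symm
    rw [sum_congr rfl this, sum_powerset_sdiff_comm S fun T T' W =>
      clusterPart X u s T * clusterPart X u r T' * X W]
    refine sum_congr rfl fun T hT => ?_
    rw [← sum_clusterPart_mul X u h0 s, mul_sum]
    exact sum_congr rfl fun T' _ => by ring
  have h3 : ∑ T ∈ S.powerset, E T * X (S \ T) = ∑ T ∈ S.powerset,
      clusterPart X u r T * ((∏ b ∈ insert r T, u s b) - 1) * (X (S \ T) * ∏ b ∈ S \ T, u s b) := by
    simp only [hE, sum_mul]
    rw [sum_powerset_powerset S fun T' T W =>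
      clusterPart X u r T' * ((∏ b ∈ insert r T', u s b) - 1) * clusterPart X u s T * X W]
    refine sum_congr rfl fun T hT => ?_
    rw [← sum_clusterPart_mul X u h0 s, mul_sum]
    exact sum_congr rfl fun T' _ => by ring
  have h4 : ∑ T ∈ S.powerset, clusterPart X u s (insert r T) * X (insert r S \ insert r T) =
      ∑ T ∈ S.powerset, clusterPart X u s (insert r T) * X (S \ T) := by
    refine sum_congr rfl fun T hT => ?_
    congr 2
    rw [Finset.insert_sdiff_insert, Finset.sdiff_insert_of_notMem hr]
  have h5 : X (insert r S) * ∏ b ∈ insert r S, u s b =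
      ∑ T ∈ S.powerset, clusterPart X u r T * (X (S \ T) * ∏ b ∈ S \ T, u s b) +
        ∑ T ∈ S.powerset, E T * X (S \ T) := by
    rw [h3, ← sum_add_distrib, hX r S hr, ← sum_clusterPart_mul X u h0 r, sum_mul]
    refine sum_congr rfl fun T hT => ?_
    have hT' := mem_powerset.1 hT
    have : ∏ b ∈ insert r S, u s b = (∏ b ∈ insert r T, u s b) * ∏ b ∈ S \ T, u s b := by
      rw [prod_insert hr, prod_insert (fun h => hr (hT' h)), mul_assoc,
        mul_comm (∏ b ∈ T, u s b), Finset.prod_sdiff hT']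
    rw [this]
    ring
  rw [h2, h4, h5, add_right_inj, ← add_sum_erase _ _ (mem_powerset_self S),
    ← add_sum_erase S.powerset (fun T => E T * X (S \ T)) (mem_powerset_self S),
    sdiff_self, Finset.bot_eq_empty, h0, mul_one, mul_one] at h1
  have h6 : ∑ T ∈ S.powerset.erase S, clusterPart X u s (insert r T) * X (S \ T) =
      ∑ T ∈ S.powerset.erase S, E T * X (S \ T) := by
    refine sum_congr rfl fun T hT => ?_
    have hT' : T ⊂ S := mem_ssubsets.1 hT
    rw [ih T hT' (fun h => hr (hT'.1 h))]
  rw [h6] at h1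
  exact add_right_cancel h1

/-- A connected graph with `n` points besides `s` has at least `n` edges, each of which contributes an
element `u a b - 1` of `I`. -/
lemma clusterPart_mem_pow (h0 : X ∅ = 1)
    (hX : ∀ r S, r ∉ S → X (insert r S) = X S * ∏ b ∈ S, u r b) (I : Ideal R)
    (hu : ∀ a b, u a b - 1 ∈ I) (s : U) (T : Finset U) :
    clusterPart X u s T ∈ I ^ T.card := by
  have hprod (s : U) (T : Finset U) : (∏ b ∈ T, u s b) - 1 ∈ I := by
    rw [← Ideal.Quotient.mk_eq_mk_iff_sub_mem, map_prod, map_one]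
    refine Finset.prod_eq_one fun b _ => ?_
    rw [← map_one (Ideal.Quotient.mk I), Ideal.Quotient.mk_eq_mk_iff_sub_mem]
    exact hu s b
  induction hn : T.card using Nat.strong_induction_on generalizing s T with
  | h n ih =>
  subst hn
  rcases T.eq_empty_or_nonempty with rfl | ⟨r, hr⟩
  · simp
  · obtain ⟨S, hrS, rfl⟩ : ∃ S, r ∉ S ∧ insert r S = T :=
      ⟨T.erase r, Finset.notMem_erase r T, Finset.insert_erase hr⟩
    rw [clusterPart_insert X u h0 hX s r S hrS, Finset.card_insert_of_notMem hrS] at *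
    refine Ideal.sum_mem _ fun T' hT' => ?_
    have hsub := mem_powerset.1 hT'
    have hle := Finset.card_le_card hsub
    have h1 := ih T'.card (by omega) r T' rfl
    have h2 := ih (S \ T').card (by rw [Finset.card_sdiff_of_subset hsub]; omega) s (S \ T') rfl
    have h3 := Ideal.mul_mem_mul (Ideal.mul_mem_mul h1 (hprod s (insert r T'))) h2
    rwa [← pow_succ, ← pow_add, Finset.card_sdiff_of_subset hsub,
      show T'.card + 1 + (S.card - T'.card) = S.card + 1 by omega] at h3

lemma map_clusterPart (φ : R →+* R) (Y : Finset U) (hX : ∀ T ⊆ Y, φ (X T) = X T)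
    (hu : ∀ a ∈ Y, ∀ b ∈ Y, φ (u a b) = u a b) (s : U) (hs : s ∈ Y) (T : Finset U) (hT : T ⊆ Y) :
    φ (clusterPart X u s T) = clusterPart X u s T := by
  induction T using Finset.strongInduction with
  | H T ih =>
  rw [clusterPart_eq, map_sub, map_mul, map_sum, map_prod, hX T hT,
    prod_congr rfl fun b hb => hu s hs b (hT hb)]
  congr 1
  refine sum_congr rfl fun T' hT' => ?_
  have h := mem_ssubsets.1 hT'
  rw [map_mul, ih T' h (h.1.trans hT), hX _ (Finset.sdiff_subset.trans hT)]

end Cluster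

/-! ### Connected Feynman integrals -/

section ExpSeries

variable {R R' : Type*} [CommRing R] [Algebra ℝ R] [CommRing R'] [Algebra ℝ R']

/-- The series `e ^ (X * q)`. -/
def expSeries (q : R) : R⟦X⟧ := PowerSeries.mk (divPow q)

lemma coeff_expSeries (q : R) (r : ℕ) : coeff r (expSeries q) = divPow q r := coeff_mk _ _

lemma expSeries_zero : expSeries (0 : R) = 1 := by
  ext r
  rw [coeff_expSeries, PowerSeries.coeff_one]
  cases r with
  | zero => simp [divPow_zero]
  | succ r => simp [zero_divPow_succ]

lemma expSeries_add (p q : R) : expSeries (p + q) = expSeries p * expSeries q := by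
  ext r
  rw [coeff_expSeries, divPow_add, PowerSeries.coeff_mul]
  simp only [coeff_expSeries]

lemma expSeries_sum {ι : Type*} (s : Finset ι) (q : ι → R) :
    expSeries (∑ i ∈ s, q i) = ∏ i ∈ s, expSeries (q i) := by
  classical
  induction s using Finset.induction with
  | empty => simp [expSeries_zero]
  | insert i s hi ih => rw [sum_insert hi, expSeries_add, ih, prod_insert hi]

lemma map_expSeries (φ : R →ₐ[ℝ] R') (q : R) :
    PowerSeries.map (φ : R →+* R') (expSeries q) = expSeries (φ q) := by
  ext r
  rw [coeff_map, coeff_expSeries, coeff_expSeries, ← map_divPow]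
  rfl

lemma X_dvd_expSeries_sub_one (q : R) : PowerSeries.X ∣ expSeries q - 1 := by
  rw [PowerSeries.X_dvd_iff, map_sub, ← PowerSeries.coeff_zero_eq_constantCoeff_apply,
    coeff_expSeries, divPow_zero]
  simp

end ExpSeries

section Regularity

open CommDer

variable {N : ℕ} (ϖ : 𝕄 N) {V : Type*} [Fintype V] [DecidableEq V]

/-- Polynomials in the propagators with symbols as coefficients. -/
abbrev EdgePoly (N : ℕ) (V : Type*) := MvPolynomial (Option V × Option V) (𝒫[Option V, N])

/-- The contribution of an edge. -/
def edgeTerm (a b : Option V) : EdgePoly N V := X (a, b) * C ((1 / 2 : ℝ) • contrSymbol ϖ a b)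

/-- The contribution of all the edges with end points in `S`. -/
def edgeSumOn (S : Finset V) : EdgePoly N V :=
  ∑ a ∈ S.image some, ∑ b ∈ S.image some, edgeTerm ϖ a b

/-- The weight of the graphs on `S`. -/
def graphWeight (S : Finset V) : PowerSeries (EdgePoly N V) := expSeries (edgeSumOn ϖ S)

/-- The weight of the edges between two points. -/
def pairWeight (a b : V) : PowerSeries (EdgePoly N V) :=
  expSeries (edgeTerm ϖ (some a) (some b) + edgeTerm ϖ (some b) (some a))

lemma graphWeight_empty : graphWeight ϖ (∅ : Finset V) = 1 := by
  simp [graphWeight, edgeSumOn, expSeries_zero]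

variable {ϖ}

lemma graphWeight_insert (hϖ : ∀ i j, ϖ j i = -ϖ i j) (r : V) (S : Finset V) (hr : r ∉ S) :
    graphWeight ϖ (insert r S) = graphWeight ϖ S * ∏ b ∈ S, pairWeight ϖ r b := by
  simp only [graphWeight, pairWeight]
  rw [← expSeries_sum, ← expSeries_add]
  congr 1
  have hr' : some r ∉ S.image some := by simpa using hr
  have h0 : edgeTerm ϖ (some r) (some r) = 0 := by
    rw [edgeTerm, contrSymbol_self hϖ, smul_zero, map_zero, mul_zero]
  have him (f : Option V → EdgePoly N V) : ∑ a ∈ S.image some, f a = ∑ a ∈ S, f (some a) :=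
    Finset.sum_image (by simp)
  simp only [edgeSumOn, Finset.image_insert, sum_insert hr', sum_add_distrib, h0, him]
  ring

/-- The substitution that removes the edges and the variables outside `S`. -/
def restrictGraph (N : ℕ) (S : Finset V) : EdgePoly N V →ₐ[ℝ] EdgePoly N V :=
  ((restrictEdgesOver (𝒫[Option V, N]) (S.image some)).restrictScalars ℝ).comp
    (MvPolynomial.mapAlgHom (restrictSymbol N S))

lemma restrictGraph_apply (S : Finset V) (f : EdgePoly N V) :
    restrictGraph N S f = restrictEdgesOver (𝒫[Option V, N]) (S.image some)
      (MvPolynomial.map (restrictSymbol N S : _ →+* 𝒫[Option V, N]) f) := rfl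

lemma restrictGraph_edgeTerm (S : Finset V) {a b : V} (ha : a ∈ S) (hb : b ∈ S) :
    restrictGraph N S (edgeTerm ϖ (some a) (some b)) = edgeTerm ϖ (some a) (some b) := by
  have h1 : restrictSymbol N S (contrSymbol ϖ (some a) (some b)) =
      contrSymbol ϖ (some a) (some b) := by
    refine (keepSlots_contrSymbol ϖ (S.image some) (some a) (some b)).trans ?_
    rw [if_pos (by simp [ha, hb])]
  have h2 : restrictEdgesOver (𝒫[Option V, N]) (S.image some)
      (X (some a, some b)) = X (some a, some b) := by
    rw [restrictEdgesOver, aeval_X, if_pos (by simp [ha, hb])]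
  have h3 (s) : restrictEdgesOver (𝒫[Option V, N]) (S.image some) (C s) = C s := aeval_C _ _
  rw [restrictGraph_apply, edgeTerm, map_mul (MvPolynomial.map _), map_X,
    MvPolynomial.map_C, AlgHom.coe_toRingHom, map_smul (restrictSymbol N S), h1,
    map_mul (restrictEdgesOver _ _), h2, h3]

lemma restrictGraph_graphWeight {S Y : Finset V} (hS : S ⊆ Y) :
    PowerSeries.map (restrictGraph N Y : EdgePoly N V →+* EdgePoly N V) (graphWeight ϖ S) =
      graphWeight ϖ S := by
  rw [graphWeight, map_expSeries]
  congr 1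
  simp only [edgeSumOn, map_sum]
  refine sum_congr rfl fun a ha => sum_congr rfl fun b hb => ?_
  obtain ⟨a, ha', rfl⟩ := Finset.mem_image.1 ha
  obtain ⟨b, hb', rfl⟩ := Finset.mem_image.1 hb
  exact restrictGraph_edgeTerm Y (hS ha') (hS hb')

lemma restrictGraph_pairWeight {Y : Finset V} {a b : V} (ha : a ∈ Y) (hb : b ∈ Y) :
    PowerSeries.map (restrictGraph N Y : EdgePoly N V →+* EdgePoly N V) (pairWeight ϖ a b) =
      pairWeight ϖ a b := by
  rw [pairWeight, map_expSeries, map_add, restrictGraph_edgeTerm Y ha hb,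
    restrictGraph_edgeTerm Y hb ha]

variable {B : Type*} [Ring B] [Algebra ℝ B] (D : CommDer N B⟦X⟧)

/-- The operator given by the mean of a series of symbols. -/
def meanDiff (G : PowerSeries (EdgePoly N V)) (a : V → 𝒵 B⟦X⟧) : B⟦X⟧ :=
  hs fun r => D.polyDiff (meanOver (Option V) _ (coeff r G)) 1 a

lemma meanDiff_sum {ι : Type*} (s : Finset ι) (G : ι → PowerSeries (EdgePoly N V))
    (a : V → 𝒵 B⟦X⟧) :
    meanDiff D (∑ i ∈ s, G i) a = ∑ i ∈ s, meanDiff D (G i) a := by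
  simp only [meanDiff, map_sum, polyDiff_sum, hs_sum]

lemma X_pow_dvd_meanDiff {G : PowerSeries (EdgePoly N V)} {n : ℕ} (hG : PowerSeries.X ^ n ∣ G)
    (a : V → 𝒵 B⟦X⟧) :
    ∀ m < n, coeff m (meanDiff D G a) = 0 := by
  intro m hm
  rw [meanDiff, coeff_hs]
  refine sum_eq_zero fun p hp => ?_
  have hp' : p.1 + p.2 = m := Finset.HasAntidiagonal.mem_antidiagonal.1 hp
  rw [PowerSeries.X_pow_dvd_iff.1 hG p.1 (by omega), map_zero, polyDiff_zero, map_zero]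

/-- Factorization over disjoint sets of points. -/
lemma meanDiff_mul {S T : Finset V} (hST : Disjoint S T) {G H : PowerSeries (EdgePoly N V)}
    (hG : PowerSeries.map (restrictGraph N S : EdgePoly N V →+* EdgePoly N V) G = G)
    (hH : PowerSeries.map (restrictGraph N T : EdgePoly N V →+* EdgePoly N V) H = H)
    (a c : V → 𝒵 B⟦X⟧) (ha : ∀ v, v ∉ S → a v = 1)
    (hc : ∀ v, v ∉ T → c v = 1) :
    meanDiff D (G * H) (a * c) = meanDiff D G a * meanDiff D H c := by
  have hST' : Disjoint (S.image some) (T.image some) :=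
    (Finset.disjoint_image (Option.some_injective _)).2 hST
  have hcoeff {S : Finset V} {G : PowerSeries (EdgePoly N V)}
      (hG : PowerSeries.map (restrictGraph N S : EdgePoly N V →+* EdgePoly N V) G = G) (r : ℕ) :
      restrictEdgesOver _ (S.image some) (MvPolynomial.map (restrictSymbol N S : _ →+* _)
        (coeff r G)) = coeff r G := by
    conv_rhs => rw [← hG, coeff_map]
    rfl
  have hmean {S : Finset V} {G : PowerSeries (EdgePoly N V)}
      (hG : PowerSeries.map (restrictGraph N S : EdgePoly N V →+* EdgePoly N V) G = G) (r : ℕ) :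
      meanOver (Option V) _ (coeff r G) =
        restrictSymbol N S (meanOver (Option V) _ (restrictEdgesOver _ (S.image some)
          (coeff r G))) := by
    conv_lhs => rw [← hcoeff hG, restrictEdgesOver_map, meanOver_map]
  have hres (S : Finset V) (g : 𝒫[Option V, N]) (a : V → 𝒵 B⟦X⟧) (ha : ∀ v, v ∉ S → a v = 1) :=
    polyDiff_restrict (D := D) S g a ha
  rw [meanDiff, meanDiff, meanDiff, hs_mul_hs]
  congr 1
  funext r
  rw [PowerSeries.coeff_mul, map_sum, polyDiff_sum]
  refine sum_congr rfl fun p _ => ?_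
  have h1 : meanOver (Option V) _ (coeff p.1 G * coeff p.2 H) =
      meanOver (Option V) _ (coeff p.1 G) * meanOver (Option V) _ (coeff p.2 H) := by
    rw [← hcoeff hG, ← hcoeff hH]
    exact meanOver_mul_of_disjoint hST' _ _
  rw [h1, hmean hG, hmean hH, polyDiff_restrict_mul S T hST _ _ a c ha hc, hres S _ a ha,
    hres T _ c hc]

/-- The argument `b` in the slots of `S`. -/
def constOn (S : Finset V) (b : 𝒵 B⟦X⟧) : V → 𝒵 B⟦X⟧ := fun v => if v ∈ S then b else 1

lemma constOn_of_notMem (S : Finset V) (b : 𝒵 B⟦X⟧) (v : V)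
    (hv : v ∉ S) : constOn S b v = 1 := if_neg hv

lemma meanDiff_graphWeight (S : Finset V) (b : 𝒵 B⟦X⟧) :
    meanDiff D (graphWeight ϖ S) (constOn S b) = wick D ϖ 1 (fun _ : Fin S.card => b) := by
  have h1 : meanDiff D (graphWeight ϖ S) (constOn S b) = wick D ϖ 1 (constOn S b) := by
    rw [meanDiff, wick]
    congr 1
    funext r
    have h2 := polyDiff_restrict (D := D) S (wickSymbol ϖ (Option V) r) (constOn S b)
      (constOn_of_notMem S b)
    rw [← h2, graphWeight, coeff_expSeries]
    have h3 : restrictSymbol N S = keepSlots N (S.image some) := rfl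
    rw [h3, keepSlots_wickSymbol]
    rfl
  rw [h1, wick_comp_embedding (S.equivFin.symm.toEmbedding.trans (Function.Embedding.subtype _))]
  · congr 1
    funext w
    simp [constOn]
  · intro v hv
    refine constOn_of_notMem S b v fun h => hv ⟨S.equivFin ⟨v, h⟩, by simp⟩

variable (ϖ) in
/-- The connected part of the Feynman integral with `k + 1` arguments `b`, defined by subtracting the
contributions in which the connected component of a fixed point has only `j + 1` points, `j < k`. -/
def connectedWick (b : 𝒵 B⟦X⟧) (k : ℕ) : B⟦X⟧ :=
  wick D ϖ 1 (fun _ : Fin (k + 1) => b) - ∑ j ∈ (range k).attach,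
    k.choose j • (connectedWick b j * wick D ϖ 1 (fun _ : Fin (k - j) => b))
termination_by k
decreasing_by exact mem_range.1 j.2

lemma connectedWick_eq (b : 𝒵 B⟦X⟧) (k : ℕ) :
    connectedWick ϖ D b k = wick D ϖ 1 (fun _ : Fin (k + 1) => b) - ∑ j ∈ range k,
      k.choose j • (connectedWick ϖ D b j * wick D ϖ 1 (fun _ : Fin (k - j) => b)) := by
  rw [connectedWick, Finset.sum_attach (range k) fun j =>
    k.choose j • (connectedWick ϖ D b j * wick D ϖ 1 (fun _ : Fin (k - j) => b))]

lemma wick_isEmpty (hϖ : ∀ i j, ϖ j i = -ϖ i j) (a : Fin 0 → 𝒵 B⟦X⟧) : wick D ϖ 1 a = 1 := by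
  rw [wick]
  conv_rhs => rw [← hs_single (1 : B⟦X⟧)]
  congr 1
  funext r
  have : edgeSum ϖ (Option (Fin 0)) = 0 := by
    simp [edgeSum, Fintype.sum_option, contrSymbol_self hϖ]
  cases r with
  | zero => rw [wickSymbol_zero, polyDiff_one]; simp
  | succ r => rw [wickSymbol, this, zero_divPow_succ, map_zero, polyDiff_zero, if_neg (by simp)]

/-- The recursion between the Feynman integrals and their connected parts. -/
lemma wick_succ (hϖ : ∀ i j, ϖ j i = -ϖ i j) (b : 𝒵 B⟦X⟧) (k : ℕ) :
    wick D ϖ 1 (fun _ : Fin (k + 1) => b) = ∑ j ∈ range (k + 1),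
      k.choose j • (connectedWick ϖ D b j * wick D ϖ 1 (fun _ : Fin (k - j) => b)) := by
  rw [sum_range_succ, Nat.choose_self, one_smul, connectedWick_eq D b k, tsub_self,
    wick_isEmpty D hϖ, mul_one]
  abel

/-- The mean of the weight of the connected graphs on `insert s T` is the connected part. -/
lemma meanDiff_clusterPart (hϖ : ∀ i j, ϖ j i = -ϖ i j)
    (b : 𝒵 B⟦X⟧) (s : V) (T : Finset V) (hs : s ∉ T) :
    meanDiff D (clusterPart (graphWeight ϖ) (pairWeight ϖ) s T) (constOn (insert s T) b) =
      connectedWick ϖ D b T.card := by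
  induction T using Finset.strongInduction with
  | H T ih =>
  have h1 : graphWeight ϖ (insert s T) = ∑ T' ∈ T.powerset,
      clusterPart (graphWeight ϖ) (pairWeight ϖ) s T' * graphWeight ϖ (T \ T') := by
    rw [sum_clusterPart_mul _ _ (graphWeight_empty ϖ), graphWeight_insert hϖ s T hs]
  have h2 := congrArg (fun G => meanDiff D G (constOn (insert s T) b)) h1
  simp only [meanDiff_graphWeight, meanDiff_sum] at h2
  have h3 (T') (hT' : T' ∈ T.powerset) :
      meanDiff D (clusterPart (graphWeight ϖ) (pairWeight ϖ) s T' * graphWeight ϖ (T \ T'))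
        (constOn (insert s T) b) =
      meanDiff D (clusterPart (graphWeight ϖ) (pairWeight ϖ) s T') (constOn (insert s T') b) *
        wick D ϖ 1 (fun _ : Fin (T.card - T'.card) => b) := by
    have hsub := mem_powerset.1 hT'
    have hdisj : Disjoint (insert s T') (T \ T') := by
      rw [Finset.disjoint_insert_left]
      exact ⟨fun h => hs (Finset.sdiff_subset h), Finset.disjoint_sdiff⟩
    have hab : constOn (insert s T) b = constOn (insert s T') b * constOn (T \ T') b := by
      funext v
      by_cases hv : v = s
      · subst hv; simp [constOn, hs]
      · by_cases h1 : v ∈ T'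
        · simp [constOn, h1, hsub h1]
        · simp [constOn, hv, h1]
    rw [hab, meanDiff_mul D hdisj _ (restrictGraph_graphWeight subset_rfl) _ _
      (constOn_of_notMem _ b) (constOn_of_notMem _ b), meanDiff_graphWeight,
      Finset.card_sdiff_of_subset hsub]
    exact map_clusterPart _ _ _ (insert s T') (fun S hS => restrictGraph_graphWeight hS)
      (fun a ha b hb => restrictGraph_pairWeight ha hb) s (Finset.mem_insert_self s T') T'
      (Finset.subset_insert s T')
  rw [sum_congr rfl h3, ← add_sum_erase _ _ (mem_powerset_self T), tsub_self,
    wick_isEmpty D hϖ, mul_one] at h2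
  have h4 : ∑ T' ∈ T.powerset.erase T,
      meanDiff D (clusterPart (graphWeight ϖ) (pairWeight ϖ) s T') (constOn (insert s T') b) *
        wick D ϖ 1 (fun _ : Fin (T.card - T'.card) => b) =
      ∑ T' ∈ T.powerset.erase T,
        connectedWick ϖ D b T'.card * wick D ϖ 1 (fun _ : Fin (T.card - T'.card) => b) := by
    refine sum_congr rfl fun T' hT' => ?_
    have h := mem_ssubsets.1 hT'
    rw [ih T' h fun h' => hs (h.1 h')]
  have h5 := Finset.sum_powerset_apply_card (x := T) (fun j => connectedWick ϖ D b j *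
    wick D ϖ 1 (fun _ : Fin (T.card - j) => b))
  rw [← add_sum_erase _ _ (mem_powerset_self T), ← wick_succ D hϖ] at h5
  rw [h4, Finset.card_insert_of_notMem hs, ← h5, tsub_self, wick_isEmpty D hϖ, mul_one] at h2
  exact (add_right_cancel h2).symm

/-- The connected part with `k + 1` arguments is divisible by the `k`-th power of the variable. -/
lemma coeff_connectedWick (hϖ : ∀ i j, ϖ j i = -ϖ i j) (b : 𝒵 B⟦X⟧) (k m : ℕ) (hm : m < k) :
    coeff m (connectedWick ϖ D b k) = 0 := by
  have h := meanDiff_clusterPart D hϖ b (0 : Fin (k + 1)) (univ.erase 0) (Finset.notMem_erase _ _)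
  rw [Finset.card_erase_of_mem (mem_univ _), card_univ, Fintype.card_fin, Nat.add_sub_cancel] at h
  rw [← h]
  refine X_pow_dvd_meanDiff D ?_ _ m hm
  have h1 := clusterPart_mem_pow (graphWeight ϖ) (pairWeight ϖ) (graphWeight_empty ϖ)
    (graphWeight_insert hϖ) (Ideal.span {PowerSeries.X})
    (fun a b => Ideal.mem_span_singleton.2 (X_dvd_expSeries_sub_one _)) (0 : Fin (k + 1))
    (univ.erase 0)
  rwa [Ideal.span_singleton_pow, Ideal.mem_span_singleton,
    Finset.card_erase_of_mem (mem_univ _), card_univ, Fintype.card_fin,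
    Nat.add_sub_cancel] at h1

/-- Feynman integrals of central elements are central. -/
lemma wick_one_mem_center (a : V → 𝒵 B⟦X⟧) : wick D ϖ 1 a ∈ 𝒵 B⟦X⟧ := by
  have h (g : 𝒫[Option V, N]) (x : 𝒵 B⟦X⟧) (a : V → 𝒵 B⟦X⟧) : D.polyDiff g x a ∈ 𝒵 B⟦X⟧ := by
    induction g using symbol_induction generalizing x a with
    | one => rw [polyDiff_one]; exact mul_mem x.2 (Subtype.prop _)
    | add g h hg hh => rw [polyDiff_add]; exact add_mem (hg _ _) (hh _ _)
    | smul c g hg => rw [polyDiff_smul]; exact Subalgebra.smul_mem _ (hg _ _) c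
    | X_mul s g hg =>
      obtain ⟨u, i⟩ := s
      cases u with
      | none => rw [polyDiff_X_none]; exact hg (D.dZ i x) a
      | some v => rw [polyDiff_X_some]; exact hg _ _
  rw [Subalgebra.mem_center_iff]
  intro z
  rw [wick, mul_hs, hs_mul]
  congr 1
  funext r
  exact Subalgebra.mem_center_iff.1 (h _ 1 a) z

end Regularity

/-! ### Power series in `ħ` inside the fibres -/

section Embedding

variable {N T k : ℕ}

/-- Power series in `ħ` with coefficients in `Formal N T k`. -/
abbrev Ser (N T k : ℕ) := PowerSeries (Formal N T k)

/-- Power series in `ħ` as Laurent series. -/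
def emb : Ser N T k →+* Fib N T k := HahnSeries.ofPowerSeries ℤ (Formal N T k)

lemma emb_injective : Function.Injective (emb : Ser N T k →+* Fib N T k) :=
  HahnSeries.ofPowerSeries_injective

lemma coeff_emb_natCast (x : Ser N T k) (n : ℕ) : (emb x).coeff (n : ℤ) = coeff n x :=
  HahnSeries.ofPowerSeries_apply_coeff x n

lemma coeff_emb_of_neg (x : Ser N T k) {m : ℤ} (hm : m < 0) : (emb x).coeff m = 0 := by
  rw [emb, HahnSeries.ofPowerSeries_apply]
  refine HahnSeries.embDomain_of_notMem_range fun ⟨n, hn⟩ => ?_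
  have : (n : ℤ) = m := hn
  omega

lemma coeff_hbarPow_mul (m n : ℤ) (s : Fib N T k) : (hbarPow m * s).coeff n = s.coeff (n - m) := by
  have := HahnSeries.coeff_single_mul_add (r := (1 : Formal N T k)) (x := s) (a := n - m) (b := m)
  rw [sub_add_cancel, one_mul] at this
  exact this

lemma hbarPow_mul_hbarPow (m n : ℤ) : (hbarPow m * hbarPow n : Fib N T k) = hbarPow (m + n) := by
  simp [hbarPow, HahnSeries.single_mul_single]

lemma hbarPow_zero : (hbarPow 0 : Fib N T k) = 1 := rfl

lemma hbarPow_mul_comm (m : ℤ) (s : Fib N T k) : hbarPow m * s = s * hbarPow m := by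
  ext1; funext n
  have := HahnSeries.coeff_mul_single_add (r := (1 : Formal N T k)) (x := s) (a := n - m) (b := m)
  rw [sub_add_cancel, mul_one] at this
  rw [coeff_hbarPow_mul]
  exact this.symm

lemma coeff_real_smul_fib (c : ℝ) (s : Fib N T k) (n : ℤ) : (c • s).coeff n = c • s.coeff n := rfl

lemma emb_smul (c : ℝ) (x : Ser N T k) : emb (c • x) = c • emb x := by
  ext1; funext n
  rcases lt_or_ge n 0 with hn | hn
  · rw [coeff_real_smul_fib, coeff_emb_of_neg _ hn, coeff_emb_of_neg _ hn, smul_zero]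
  · obtain ⟨n, rfl⟩ := Int.eq_ofNat_of_zero_le hn
    rw [coeff_real_smul_fib, coeff_emb_natCast, coeff_emb_natCast]; rfl

lemma emb_X : (emb PowerSeries.X : Fib N T k) = hbarPow 1 := HahnSeries.ofPowerSeries_X

lemma emb_X_pow (n : ℕ) : (emb (PowerSeries.X ^ n) : Fib N T k) = hbarPow n :=
  HahnSeries.ofPowerSeries_X_pow n

lemma emb_C (c : Formal N T k) : emb (PowerSeries.C c) = HahnSeries.C c :=
  HahnSeries.ofPowerSeries_C c

variable {T' k' : ℕ}

lemma mapCoeff_emb (f : Formal N T k →+ Formal N T' k') (x : Ser N T k) :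
    mapCoeff f (emb x) = emb (cmap f x : Ser N T' k') := by
  ext1; funext n
  rcases lt_or_ge n 0 with hn | hn
  · rw [coeff_emb_of_neg _ hn]
    change f ((emb x).coeff n) = 0
    rw [coeff_emb_of_neg _ hn, map_zero]
  · obtain ⟨n, rfl⟩ := Int.eq_ofNat_of_zero_le hn
    change f ((emb x).coeff n) = _
    rw [coeff_emb_natCast, coeff_emb_natCast]; rfl

lemma coeff_mapCoeff (f : Formal N T k →+ Formal N T' k') (s : Fib N T k) (n : ℤ) :
    (mapCoeff f s).coeff n = f (s.coeff n) := rfl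

lemma mapCoeff_hbarPow_mul (f : Formal N T k →+ Formal N T' k') (m : ℤ) (s : Fib N T k) :
    mapCoeff f (hbarPow m * s) = hbarPow m * mapCoeff f s := by
  ext1; funext n
  rw [coeff_mapCoeff, coeff_hbarPow_mul, coeff_hbarPow_mul, coeff_mapCoeff]

lemma mapCoeff_add (f : Formal N T k →+ Formal N T' k') (s t : Fib N T k) :
    mapCoeff f (s + t) = mapCoeff f s + mapCoeff f t := by
  ext1; funext n
  simp only [coeff_mapCoeff, HahnSeries.coeff_add, map_add, Pi.add_apply]

lemma mapCoeff_sum {ι : Type*} (f : Formal N T k →+ Formal N T' k') (t : Finset ι)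
    (s : ι → Fib N T k) : mapCoeff f (∑ i ∈ t, s i) = ∑ i ∈ t, mapCoeff f (s i) :=
  map_sum (AddMonoidHom.mk' (mapCoeff f) (mapCoeff_add f)) _ _

lemma coeff_mkLaurent {R : Type*} [Zero R] {f : ℤ → R} {m : ℤ} (hf : ∀ n < m, f n = 0) (n : ℤ) :
    (mkLaurent f).coeff n = f n := by
  have h : BddBelow (Function.support f) := ⟨m, fun n hn => not_lt.1 fun h => hn (hf n h)⟩
  rw [mkLaurent, dif_pos h]; rfl

end Embedding

/-! ### Exponentials of operators -/

section OpExp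

lemma finsum_antidiagonal {M : Type*} [AddCommMonoid M] (f : ℕ → ℕ → M) (a b : ℕ)
    (h : ∀ p i, f p i ≠ 0 → p < a ∧ i < b) :
    ∑ᶠ j : ℕ, ∑ p ∈ antidiagonal j, f p.1 p.2 = ∑ p ∈ range a, ∑ i ∈ range b, f p i := by
  rw [finsum_eq_sum_of_support_subset (s := range (a + b))]
  · rw [← Finset.sum_product', ← Finset.sum_fiberwise_of_maps_to (s := range a ×ˢ range b)
      (t := range (a + b)) (g := fun p => p.1 + p.2)]
    · refine sum_congr rfl fun j _ => ?_
      symm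
      refine sum_subset ?_ ?_
      · intro p hp
        exact Finset.HasAntidiagonal.mem_antidiagonal.2 (mem_filter.1 hp).2
      · intro p hp hp'
        by_contra hne
        refine hp' (mem_filter.2 ⟨?_, Finset.HasAntidiagonal.mem_antidiagonal.1 hp⟩)
        have := h _ _ hne
        simpa using this
    · intro p hp
      simp only [Finset.mem_product, mem_range] at hp ⊢
      omega
  · intro j hj
    rw [Function.mem_support] at hj
    obtain ⟨p, hp, hne⟩ := Finset.exists_ne_zero_of_sum_ne_zero hj
    have h1 := h _ _ hne
    have h2 := Finset.HasAntidiagonal.mem_antidiagonal.1 hp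
    simp only [Finset.coe_range, Set.mem_Iio]
    omega

variable {F : Type*} [AddCommGroup F] [Module ℝ F]

/-- The shift of a family by one in the power of `ħ`, followed by an endomorphism. -/
def shiftEnd (P : End ℝ F) : End ℝ (ℤ → F) where
  toFun g n := P (g (n - 1))
  map_add' g h := by funext n; simp
  map_smul' c g := by funext n; simp

/-- An endomorphism applied to every member of a family. -/
def constEnd (E : End ℝ F) : End ℝ (ℤ → F) where
  toFun g n := E (g n)
  map_add' g h := by funext n; simp
  map_smul' c g := by funext n; simp

lemma shiftEnd_pow_apply (P : End ℝ F) (p : ℕ) (g : ℤ → F) (n : ℤ) :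
    (shiftEnd P ^ p) g n = (P ^ p) (g (n - p)) := by
  induction p generalizing n with
  | zero => simp
  | succ p ih =>
    rw [pow_succ', pow_succ', End.mul_apply, End.mul_apply]
    change P ((shiftEnd P ^ p) g (n - 1)) = _
    rw [ih]
    congr 3
    push_cast
    ring

lemma constEnd_pow_apply (E : End ℝ F) (p : ℕ) (g : ℤ → F) (n : ℤ) :
    (constEnd E ^ p) g n = (E ^ p) (g n) := by
  induction p generalizing n with
  | zero => simp
  | succ p ih =>
    rw [pow_succ', pow_succ', End.mul_apply, End.mul_apply]
    change E ((constEnd E ^ p) g n) = _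
    rw [ih]

lemma commute_shiftEnd_constEnd {P E : End ℝ F} (h : Commute P E) :
    Commute (shiftEnd P) (constEnd E) := by
  refine LinearMap.ext fun g => funext fun n => ?_
  exact LinearMap.congr_fun h.eq (g (n - 1))

lemma inv_factorial_smul_add_pow (P E : End ℝ F) (h : Commute P E) (j : ℕ) (g : ℤ → F) (n : ℤ) :
    ((j.factorial : ℝ)⁻¹) • ((shiftEnd P + constEnd E) ^ j) g n =
      ∑ p ∈ antidiagonal j, ((p.1.factorial : ℝ)⁻¹) •
        (P ^ p.1) (((p.2.factorial : ℝ)⁻¹) • (E ^ p.2) (g (n - p.1))) := by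
  rw [(commute_shiftEnd_constEnd h).add_pow', LinearMap.sum_apply, Finset.sum_apply, smul_sum]
  refine sum_congr rfl fun p hp => ?_
  have hp' : p.1 + p.2 = j := Finset.HasAntidiagonal.mem_antidiagonal.1 hp
  subst hp'
  rw [LinearMap.smul_apply, End.mul_apply, Pi.smul_apply, shiftEnd_pow_apply,
    constEnd_pow_apply, map_smul, smul_smul, ← Nat.cast_smul_eq_nsmul ℝ, smul_smul]
  congr 1
  have h1 := p.1.factorial_ne_zero
  have h2 := p.2.factorial_ne_zero
  have h3 := (p.1 + p.2).factorial_ne_zero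
  have h4 : (((p.1 + p.2).choose p.1 : ℕ) : ℝ) * p.1.factorial * p.2.factorial =
      (p.1 + p.2).factorial := by
    rw [Nat.choose_symm_add]
    exact_mod_cast Nat.add_choose_mul_factorial_mul_factorial p.1 p.2
  field_simp
  linarith

variable {N T k : ℕ}

lemma opExp_hbarPow_mul_emb {Θ : Fib N T k → Fib N T k} {P E : End ℝ (Formal N T k)}
    (hPE : Commute P E) (hE : IsNilpotent E)
    (hΘ : ∀ s n, (Θ s).coeff n = P (s.coeff (n - 1)) + E (s.coeff n)) (m : ℤ) (x : Ser N T k) :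
    opExp Θ (hbarPow m * emb x) = hbarPow m * emb (hs fun p => ((p.factorial : ℝ)⁻¹) •
      (cmap ((P ^ p).toAddMonoidHom)
        (cmap (IsNilpotent.exp E).toAddMonoidHom x : Ser N T k) : Ser N T k)) := by
  obtain ⟨K, hK⟩ := hE
  have hit : ∀ j n, (Θ^[j] (hbarPow m * emb x)).coeff n =
      ((shiftEnd P + constEnd E) ^ j) (hbarPow m * emb x : Fib N T k).coeff n := by
    intro j
    induction j with
    | zero => intro n; rfl
    | succ j ih =>
      intro n
      rw [Function.iterate_succ_apply', hΘ, ih, ih, pow_succ', End.mul_apply]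
      rfl
  have hcf : ∀ n, ∑ᶠ j : ℕ, ((j.factorial : ℝ)⁻¹) • (Θ^[j] (hbarPow m * emb x)).coeff n =
      ∑ p ∈ range (n - m + 1).toNat, ∑ i ∈ range K, ((p.factorial : ℝ)⁻¹) •
        (P ^ p) (((i.factorial : ℝ)⁻¹) • (E ^ i) ((hbarPow m * emb x : Fib N T k).coeff (n - p))) := by
    intro n
    rw [← finsum_antidiagonal]
    · refine finsum_congr fun j => ?_
      rw [hit, inv_factorial_smul_add_pow P E hPE]
    · intro p i hne
      constructor
      · by_contra hp
        apply hne
        rw [coeff_hbarPow_mul, coeff_emb_of_neg _ (by omega)]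
        simp
      · by_contra hi
        apply hne
        rw [pow_eq_zero_of_le (not_lt.1 hi) hK]
        simp
  ext1; funext n
  rw [opExp, coeff_mkLaurent (m := m), hcf, coeff_hbarPow_mul]
  · rcases lt_or_ge (n - m) 0 with hn | hn
    · rw [coeff_emb_of_neg _ hn]
      have : (n - m + 1).toNat = 0 := by omega
      rw [this]; rfl
    · obtain ⟨q, hq⟩ := Int.eq_ofNat_of_zero_le hn
      have hq' : ((q : ℤ) + 1).toNat = q + 1 := by omega
      rw [hq, coeff_emb_natCast, coeff_hs, hq', Finset.Nat.sum_antidiagonal_eq_sum_range_succ_mk]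
      refine sum_congr rfl fun p hp => ?_
      have hpq : p ≤ q := by simpa [Nat.lt_succ_iff] using hp
      rw [← smul_sum, ← map_sum]
      have h1 : (hbarPow m * emb x : Fib N T k).coeff (n - p) = coeff (q - p) x := by
        rw [coeff_hbarPow_mul, ← coeff_emb_natCast]
        congr 1
        push_cast [hpq]
        omega
      rw [h1]
      change _ = ((p.factorial : ℝ)⁻¹) • (P ^ p) (IsNilpotent.exp E (coeff (q - p) x))
      rw [IsNilpotent.exp_eq_sum hK, LinearMap.sum_apply]
      congr 2
      refine sum_congr rfl fun i _ => ?_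
      rw [LinearMap.smul_apply]
      rw [← Rat.cast_smul_eq_qsmul ℝ]
      push_cast
      rfl
  · intro n hn
    rw [hcf]
    have : (n - m + 1).toNat = 0 := by omega
    rw [this]; rfl

end OpExp

/-! ### Coefficientwise linear maps on power series in `ħ` -/

section CoefficientwiseLinear

variable {B B' B'' : Type*} [Ring B] [Algebra ℝ B] [Ring B'] [Algebra ℝ B'] [Ring B'']
  [Algebra ℝ B'']

/-- A linear map applied to every coefficient of a power series. -/
def cmapLin (f : B →ₗ[ℝ] B') : B⟦X⟧ →ₗ[ℝ] PowerSeries B' where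
  toFun := cmap f.toAddMonoidHom
  map_add' := map_add _
  map_smul' c x := cmap_smul (fun c x => map_smul f c x) c x

lemma coeff_cmapLin (f : B →ₗ[ℝ] B') (x : B⟦X⟧) (n : ℕ) :
    coeff n (cmapLin f x) = f (coeff n x) := rfl

lemma hs_cmapLin (f : B →ₗ[ℝ] B') (ψ : ℕ → B⟦X⟧) :
    cmapLin f (hs ψ) = hs fun r => cmapLin f (ψ r) := hs_cmap f.toAddMonoidHom ψ

lemma cmapLin_mul {h f₁ g₁ f₂ g₂ : B →ₗ[ℝ] B'} (H : ∀ x y, h (x * y) = f₁ x * g₁ y + f₂ x * g₂ y)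
    (x y : B⟦X⟧) :
    cmapLin h (x * y) = cmapLin f₁ x * cmapLin g₁ y + cmapLin f₂ x * cmapLin g₂ y :=
  cmap_mul (h := h.toAddMonoidHom) (f₁ := f₁.toAddMonoidHom) (g₁ := g₁.toAddMonoidHom)
    (f₂ := f₂.toAddMonoidHom) (g₂ := g₂.toAddMonoidHom) H x y

lemma cmapLin_comm {f g : End ℝ B} (h : ∀ x, f (g x) = g (f x)) (x : B⟦X⟧) :
    cmapLin f (cmapLin g x) = cmapLin g (cmapLin f x) :=
  PowerSeries.ext fun n => by simp only [coeff_cmapLin, h]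

lemma cmapLin_id (x : B⟦X⟧) : cmapLin (1 : End ℝ B) x = x :=
  PowerSeries.ext fun n => by simp only [coeff_cmapLin, End.one_apply]

lemma cmap_ringHom (f : B →+* B') (x : B⟦X⟧) : cmap f.toAddMonoidHom x = PowerSeries.map f x :=
  PowerSeries.ext fun n => by rw [coeff_map]; rfl

lemma hs_map (f : B →+* B') (ψ : ℕ → B⟦X⟧) :
    PowerSeries.map f (hs ψ) = hs fun r => PowerSeries.map f (ψ r) := by
  simp only [← cmap_ringHom]
  exact hs_cmap _ _

lemma map_real_smul {f : B →+* B'} (hf : ∀ (c : ℝ) x, f (c • x) = c • f x) (c : ℝ)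
    (x : B⟦X⟧) : PowerSeries.map f (c • x) = c • PowerSeries.map f x :=
  PowerSeries.ext fun n => by
    rw [coeff_map]
    exact (hf c _).trans (congrArg (c • ·) (coeff_map f n x).symm)

variable (B) in
/-- Endomorphisms applied to every coefficient of a power series. -/
def cmapEnd : End ℝ B →ₐ[ℝ] End ℝ B⟦X⟧ where
  toFun f := cmapLin f
  map_one' := rfl
  map_mul' _ _ := rfl
  map_zero' := rfl
  map_add' _ _ := rfl
  commutes' c := by
    refine LinearMap.ext fun x => ?_
    ext n
    rw [coeff_cmapLin]
    rfl

end CoefficientwiseLinear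

section Concrete

variable {N T k : ℕ}

/-- `∂/∂y_v` as a linear map. -/
def pderivLin (v : Fin k × Fin N) : End ℝ (Formal N T k) where
  toFun := pderivHom v
  map_add' := map_add _
  map_smul' c x := by
    ext β
    simp only [coeff_pderivHom, coeff_real_smul, RingHom.id_apply, smul_mul_assoc]

lemma pderivLin_mul_comm (v w : Fin k × Fin N) :
    (pderivLin v * pderivLin w : End ℝ (Formal N T k)) = pderivLin w * pderivLin v :=
  LinearMap.ext fun x => pderivHom_comm v w x

/-- `∂/∂y_v` on power series in `ħ`. -/
def pderivSer (v : Fin k × Fin N) : End ℝ (Ser N T k) := cmapLin (pderivLin v)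

lemma pderivSer_mul (v : Fin k × Fin N) (x y : Ser N T k) :
    pderivSer v (x * y) = pderivSer v x * y + x * pderivSer v y := by
  have := cmapLin_mul (h := pderivLin v) (f₁ := pderivLin v) (g₁ := 1) (f₂ := 1)
    (g₂ := (pderivLin v : End ℝ (Formal N T k))) (pderivHom_mul v) x y
  rwa [cmapLin_id, cmapLin_id] at this

lemma pderivSer_comm (v w : Fin k × Fin N) (x : Ser N T k) :
    pderivSer v (pderivSer w x) = pderivSer w (pderivSer v x) :=
  cmapLin_comm (pderivHom_comm v w) x

variable (N) in
/-- The partial derivatives in the fibre coordinates `y i`. -/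
def yDer : CommDer N (Ser N 0 1) where
  d i := pderivSer (0, i)
  leibniz _ := pderivSer_mul _
  comm _ _ := pderivSer_comm _ _

lemma yDer_hs (i : Fin N) (ψ : ℕ → Ser N 0 1) :
    (yDer N).d i (hs ψ) = hs fun r => (yDer N).d i (ψ r) := hs_cmapLin _ _

lemma partialY_emb (a : Fin k) (i : Fin N) (x : Ser N T k) :
    partialY a i (emb x) = emb (pderivSer (a, i) x) := mapCoeff_emb _ _

/-- The inclusion of the `a`-th tensor factor on formal power series. -/
def inclHom (T : ℕ) (a : Fin k) : Formal N 0 1 →+* Formal N T k := linSubstHom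
    (Matrix.of fun p => Pi.single (a, p.2) 1)
    (Matrix.of (Sum.elim (fun t => t.elim0) (Sum.elim (fun i => Pi.single 𝕩 i 1)
        (fun p => Pi.single (Sum.inr (Sum.inr (a, p.2))) 1))))

/-- The multiplication of the tensor factors on formal power series. -/
def multHom : Formal N 0 k →+* Formal N 0 1 := linSubstHom (Matrix.of fun p => Pi.single (0, p.2) 1)
    (Matrix.of (Sum.elim (fun t => t.elim0) (Sum.elim (fun i => Pi.single 𝕩 i 1)
        (fun p => Pi.single (Sum.inr (Sum.inr (0, p.2))) 1))))

lemma multHom_inclHom (a : Fin k) (x : Formal N 0 1) : multHom (inclHom 0 a x) = x := by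
  refine (linSubst_comp _ _ _ _ x).trans ?_
  convert linSubst_id x using 2
  congr 1
  · ext ⟨p, i⟩ ⟨q, j⟩
    rw [Matrix.mul_apply, sum_eq_single (a, i)]
    · simp only [Matrix.of_apply, Pi.single_eq_same, one_mul, Matrix.one_apply, Pi.single_apply,
        Subsingleton.elim p q, Subsingleton.elim q 0, Prod.mk.injEq, true_and, eq_comm]
    · intro r _ hr
      simp [Pi.single_apply, hr]
    · simp
  · ext g h
    rcases g with t | i | ⟨p, i⟩
    · exact t.elim0
    · rw [Matrix.mul_apply, sum_eq_single 𝕩 i]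
      · simp [Matrix.one_apply, Pi.single_apply, eq_comm]
      · intro r _ hr
        simp [Pi.single_apply, hr]
      · simp
    · rw [Matrix.mul_apply, sum_eq_single (Sum.inr (Sum.inr (a, i)))]
      · simp [Matrix.one_apply, Pi.single_apply, Subsingleton.elim p 0, eq_comm]
      · intro r _ hr
        simp [Pi.single_apply, hr]
      · simp

lemma pderivHom_inclHom (T : ℕ) (a b : Fin k) (i : Fin N) (x : Formal N 0 1) :
    pderivHom (a, i) (inclHom T b x) = if a = b then inclHom T b (pderivHom (0, i) x) else 0 := by
  refine (pderivHom_linSubst _ _ _ x).trans ?_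
  rw [Fintype.sum_prod_type, Fin.sum_univ_one]
  simp only [Matrix.of_apply, Pi.single_apply, Prod.mk.injEq]
  by_cases h : a = b
  · simp [h]
    rfl
  · simp [h]

/-- The inclusion of the `a`-th tensor factor on power series in `ħ`. -/
def inclSer (T : ℕ) (a : Fin k) : Ser N 0 1 →+* Ser N T k := PowerSeries.map (inclHom T a)

/-- The multiplication of the tensor factors on power series in `ħ`. -/
def multSer : Ser N 0 k →+* Ser N 0 1 := PowerSeries.map multHom

lemma multSer_smul (c : ℝ) (x : Ser N 0 k) : multSer (c • x) = c • multSer x :=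
  map_real_smul (linSubst_smul _ _) c x

lemma incl_emb (a : Fin k) (x : Ser N 0 1) :
    (incl a (emb x) : Fib N T k) = emb (inclSer T a x) := by
  rw [inclSer, ← cmap_ringHom]
  exact mapCoeff_emb (inclHom T a).toAddMonoidHom x

lemma mult_emb (x : Ser N 0 k) : mult (emb x) = emb (multSer x) := by
  rw [multSer, ← cmap_ringHom]
  exact mapCoeff_emb multHom.toAddMonoidHom x

lemma multSer_inclSer (a : Fin k) (x : Ser N 0 1) : multSer (inclSer 0 a x) = x := by
  refine PowerSeries.ext fun n => ?_
  rw [multSer, inclSer, coeff_map, coeff_map, multHom_inclHom]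

lemma pderivSer_inclSer (a b : Fin k) (i : Fin N) (x : Ser N 0 1) :
    pderivSer (a, i) (inclSer T b x) = if a = b then inclSer T b ((yDer N).d i x) else 0 := by
  refine PowerSeries.ext fun n => ?_
  have h := pderivHom_inclHom T a b i (coeff n x)
  rw [pderivSer, coeff_cmapLin, inclSer, coeff_map]
  refine h.trans ?_
  split_ifs
  · rw [coeff_map]
    rfl
  · rfl

lemma multSer_hs (ψ : ℕ → Ser N 0 k) : multSer (hs ψ) = hs fun r => multSer (ψ r) := hs_map _ _

end Concrete

section Contraction

variable {N T k : ℕ}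

/-- Contraction with an odd generator as a linear map. -/
def contractLin (g : OddIdx N T k) : End ℝ (Formal N T k) where
  toFun := cmap (contractGen g)
  map_add' := map_add _
  map_smul' c x := cmap_smul (contractGen_smul g) c x

/-- Contraction with an odd generator on power series in `ħ`. -/
def contractSer (g : OddIdx N T k) : End ℝ (Ser N T k) := cmapLin (contractLin g)

/-- The parity automorphism of the formal power series. -/
def parityLin (N T k : ℕ) : End ℝ (Formal N T k) where
  toFun := cmap (parityGen _)
  map_add' := map_add _
  map_smul' c x := cmap_smul (fun c x => map_smul (involute) c x) c x

lemma parityLin_mul (x y : Formal N T k) :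
    parityLin N T k (x * y) = parityLin N T k x * parityLin N T k y :=
  cmap_mul_hom parityGen_mul x y

lemma parityLin_one : parityLin N T k 1 = 1 := by
  refine (cmap_C (σ := Fin k × Fin N) (parityGen _) 1).trans ?_
  exact congrArg MvPowerSeries.C (map_one involute)

/-- The parity automorphism of the formal power series as a ring homomorphism. -/
def parityRingHom (N T k : ℕ) : Formal N T k →+* Formal N T k where
  toFun := parityLin N T k
  map_zero' := map_zero _
  map_add' := map_add _
  map_one' := parityLin_one
  map_mul' := parityLin_mul

/-- The parity automorphism on power series in `ħ`. -/
def paritySer (N T k : ℕ) : Ser N T k →+* Ser N T k := PowerSeries.map (parityRingHom N T k)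

lemma paritySer_eq (x : Ser N T k) : paritySer N T k x = cmapLin (parityLin N T k) x :=
  (cmap_ringHom (parityRingHom N T k) x).symm

lemma contractLin_mul (g : OddIdx N T k) (x y : Formal N T k) :
    contractLin g (x * y) = contractLin g x * y + parityLin N T k x * contractLin g y :=
  cmap_mul (h := contractGen g) (f₁ := contractGen g) (g₁ := AddMonoidHom.id _)
      (f₂ := parityGen _) (g₂ := contractGen g) (contractGen_mul g) x y

lemma contractSer_mul (g : OddIdx N T k) (x y : Ser N T k) :
    contractSer g (x * y) = contractSer g x * y + paritySer N T k x * contractSer g y := by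
  have := cmapLin_mul (h := contractLin g) (f₁ := contractLin g) (g₁ := 1)
    (f₂ := parityLin N T k) (g₂ := contractLin g) (contractLin_mul g) x y
  rwa [cmapLin_id, ← paritySer_eq] at this

lemma contract_emb (g : OddIdx N T k) (x : Ser N T k) :
    contract g (emb x) = emb (contractSer g x) := mapCoeff_emb _ _

lemma contractSer_pderivSer (g : OddIdx N T k) (v : Fin k × Fin N) (x : Ser N T k) :
    contractSer g (pderivSer v x) = pderivSer v (contractSer g x) :=
  cmapLin_comm (f := contractLin g) (g := pderivLin v) (cmap_pderivHom (contractGen g) v) x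

lemma paritySer_pderivSer (v : Fin k × Fin N) (x : Ser N T k) :
    paritySer N T k (pderivSer v x) = pderivSer v (paritySer N T k x) := by
  rw [paritySer_eq, paritySer_eq]
  exact cmapLin_comm (f := parityLin N T k) (g := pderivLin v) (cmap_pderivHom (parityGen _) v) x

lemma contractSer_hs (g : OddIdx N T k) (ψ : ℕ → Ser N T k) :
    contractSer g (hs ψ) = hs fun r => contractSer g (ψ r) := hs_cmapLin _ _

end Contraction

section Moyal

variable {N : ℕ} (ϖ : 𝕄 N)

lemma exp_zero_end {T k : ℕ} : IsNilpotent.exp (0 : End ℝ (Formal N T k)) = 1 := by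
  rw [IsNilpotent.exp_eq_sum (k := 1) (pow_one 0)]
  simp

/-- The bidifferential operator `½ ω^{ij} ∂_{y^i} ∂_{z^j}` in the exponent of the Moyal product. -/
def moyalEnd : End ℝ (Formal N 0 2) :=
  (1 / 2 : ℝ) • ∑ i, ∑ j, ϖ i j • (pderivLin (0, i) * pderivLin (1, j))

lemma cmapLin_moyalEnd (w : Ser N 0 2) : cmapLin (moyalEnd ϖ) w =
    (1 / 2 : ℝ) • ∑ i, ∑ j, ϖ i j • pderivSer (0, i) (pderivSer (1, j) w) := by
  change cmapEnd _ (moyalEnd ϖ) w = _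
  rw [moyalEnd, map_smul, LinearMap.smul_apply, map_sum, LinearMap.sum_apply]
  simp only [map_smul, map_sum, LinearMap.smul_apply, LinearMap.sum_apply]
  rfl

lemma pderivSer_pderivSer_inclSer_mul (i j : Fin N) (x z : Ser N 0 1) :
    pderivSer (0, i) (pderivSer (1, j) (inclSer 0 (0 : Fin 2) x * inclSer 0 1 z)) =
      inclSer 0 0 ((yDer N).d i x) * inclSer 0 1 ((yDer N).d j z) := by
  rw [pderivSer_mul, pderivSer_inclSer, if_neg (by decide), pderivSer_inclSer, if_pos rfl,
    zero_mul, zero_add, pderivSer_mul, pderivSer_inclSer, if_pos rfl, pderivSer_inclSer,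
    if_neg (by decide), mul_zero, add_zero]

lemma multSer_moyalEnd_pow (p : ℕ) (x z : Ser N 0 1) :
    multSer (cmapLin (moyalEnd ϖ ^ p) (inclSer 0 0 x * inclSer 0 1 z)) =
      (yDer N).bidiff ϖ (1 / 2) p x z := by
  induction p generalizing x z with
  | zero =>
    rw [pow_zero, cmapLin_id, map_mul, multSer_inclSer, multSer_inclSer]
    rfl
  | succ p ih =>
    have h : cmapLin (moyalEnd ϖ ^ (p + 1)) (inclSer 0 0 x * inclSer 0 1 z) =
        cmapLin (moyalEnd ϖ ^ p) (cmapLin (moyalEnd ϖ) (inclSer 0 0 x * inclSer 0 1 z)) := by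
      rw [pow_succ]; rfl
    rw [h, cmapLin_moyalEnd]
    simp only [map_smul, map_sum, multSer_smul, pderivSer_pderivSer_inclSer_mul, ih]
    rfl

lemma coeff_moyal_operator (s : Fib N 0 2) (n : ℤ) :
    (hbarPow 1 * ((1 / 2 : ℝ) • ∑ i, ∑ j, ϖ i j • partialY 0 i (partialY 1 j s))).coeff n =
      moyalEnd ϖ (s.coeff (n - 1)) := by
  rw [coeff_hbarPow_mul, coeff_real_smul_fib, moyalEnd]
  simp only [LinearMap.smul_apply, LinearMap.sum_apply, HahnSeries.coeff_sum]
  rfl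

lemma moyal_emb (x z : Ser N 0 1) : moyal ϖ (emb x) (emb z) = emb (starProd (yDer N) ϖ x z) := by
  have h0 := opExp_hbarPow_mul_emb (Θ := fun s : Fib N 0 2 =>
      hbarPow 1 * ((1 / 2 : ℝ) • ∑ i, ∑ j, ϖ i j • partialY 0 i (partialY 1 j s)))
      (P := moyalEnd ϖ) (E := 0) (Commute.zero_right _) ⟨1, pow_one 0⟩
      (fun s n => by rw [coeff_moyal_operator, LinearMap.zero_apply, add_zero])
      0 (inclSer 0 0 x * inclSer 0 1 z)
  rw [hbarPow_zero, one_mul, one_mul, exp_zero_end] at h0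
  rw [moyal, incl_emb, incl_emb, ← map_mul, h0, mult_emb, multSer_hs, starProd]
  refine congrArg _ (congrArg _ (funext fun p => ?_))
  rw [multSer_smul, ← multSer_moyalEnd_pow]
  congr 3

end Moyal

/-! ### The exponential of `D` -/

section OddGenerators

variable {N T k : ℕ}

lemma oddGen_mul_self (g : OddIdx N T k) : oddGen g * oddGen g = 0 := ExteriorAlgebra.ι_sq_zero _

lemma oddGen_mul_comm (g h : OddIdx N T k) : oddGen g * oddGen h = -(oddGen h * oddGen g) :=
  eq_neg_of_add_eq_zero_left (ExteriorAlgebra.ι_add_mul_swap _ _)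

lemma oddGen_mul_mem_center (g h : OddIdx N T k) (x : Grassmann N T k) :
    oddGen g * oddGen h * x = x * (oddGen g * oddGen h) :=
  ((Subalgebra.mem_center_iff.1 (ι_mul_ι_mem_center _ _)) x).symm

/-- An odd generator as a formal power series. -/
def oddFormal (g : OddIdx N T k) : Formal N T k := MvPowerSeries.C (oddGen g)

lemma oddFormal_mul_comm (g h : OddIdx N T k) :
    oddFormal g * oddFormal h = -(oddFormal h * oddFormal g) := by
  simp only [oddFormal, ← map_mul, ← map_neg]
  rw [oddGen_mul_comm]

lemma oddFormal_mul_self (g : OddIdx N T k) : oddFormal g * oddFormal g = 0 := by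
  rw [oddFormal, ← map_mul, oddGen_mul_self, map_zero]

lemma oddFormal_mul_mul_comm (g h : OddIdx N T k) (x : Formal N T k) :
    oddFormal g * oddFormal h * x = x * (oddFormal g * oddFormal h) := by
  rw [oddFormal, oddFormal, ← map_mul]
  refine mem_center_mvPowerSeries (fun β => ?_) x
  rw [MvPowerSeries.coeff_C]
  split_ifs
  · exact Semigroup.mem_center_iff.2 fun y => (oddGen_mul_mem_center g h y).symm
  · exact Set.zero_mem_center

lemma pderivLin_mul (v : Fin k × Fin N) (x y : Formal N T k) :
    pderivLin v (x * y) = pderivLin v x * y + x * pderivLin v y := pderivHom_mul v x y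

lemma pderivLin_oddFormal (v : Fin k × Fin N) (g : OddIdx N T k) :
    pderivLin v (oddFormal g) = 0 := pderivHom_C v _

lemma inclHom_oddFormal_dy (T : ℕ) (a : Fin k) (i : Fin N) :
    inclHom T a (oddFormal 𝕪 i) = oddFormal (Sum.inr (Sum.inr (a, i))) := by
  refine (linSubst_C _ _ _).trans ?_
  rw [oddGen, ExteriorAlgebra.map_apply_ι]
  refine congrArg _ (congrArg _ ?_)
  rw [Matrix.vecMulLinear_apply, Matrix.single_one_vecMul]
  rfl

end OddGenerators

section ThetaOperator

variable {N k : ℕ}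

/-- The term of `D` that belongs to the coordinate `y a i`. -/
def thetaTerm (p : Fin k × Fin N) : End ℝ (Formal N k k) :=
  LinearMap.mulLeft ℝ (oddFormal (Sum.inr (Sum.inr p)) * oddFormal (Sum.inl p.1)) * pderivLin p

lemma thetaTerm_apply (p : Fin k × Fin N) (x : Formal N k k) : thetaTerm p x =
    oddFormal (Sum.inr (Sum.inr p)) * oddFormal (Sum.inl p.1) * pderivLin p x := rfl

lemma pderivLin_thetaTerm (v p : Fin k × Fin N) (x : Formal N k k) :
    pderivLin v (thetaTerm p x) = thetaTerm p (pderivLin v x) := by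
  rw [thetaTerm_apply, thetaTerm_apply, pderivLin_mul, pderivLin_mul, pderivLin_oddFormal,
    pderivLin_oddFormal, zero_mul, mul_zero, add_zero, zero_mul, zero_add]
  exact congrArg _ (pderivHom_comm v p x)

lemma thetaTerm_central_mul (p : Fin k × Fin N) (g h : OddIdx N k k) (x : Formal N k k) :
    thetaTerm p (oddFormal g * oddFormal h * x) = oddFormal g * oddFormal h * thetaTerm p x := by
  rw [thetaTerm_apply, thetaTerm_apply, pderivLin_mul, pderivLin_mul, pderivLin_oddFormal,
    pderivLin_oddFormal, zero_mul, mul_zero, add_zero, zero_mul, zero_add, ← mul_assoc,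
    ← mul_assoc (oddFormal g * oddFormal h), ← oddFormal_mul_mul_comm g h]

lemma thetaTerm_comm (p q : Fin k × Fin N) (x : Formal N k k) :
    thetaTerm p (thetaTerm q x) = thetaTerm q (thetaTerm p x) := by
  rw [thetaTerm_apply q, thetaTerm_central_mul, ← pderivLin_thetaTerm, ← thetaTerm_apply]

lemma thetaTerm_leibniz (p : Fin k × Fin N) (x y : Formal N k k) :
    thetaTerm p (x * y) = thetaTerm p x * y + x * thetaTerm p y := by
  rw [thetaTerm_apply, thetaTerm_apply, thetaTerm_apply, pderivLin_mul, mul_add, ← mul_assoc,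
    ← mul_assoc, oddFormal_mul_mul_comm _ _ x, mul_assoc x]

lemma thetaTerm_thetaTerm (a : Fin k) (i j : Fin N) (x : Formal N k k) :
    thetaTerm (a, i) (thetaTerm (a, j) x) = 0 := by
  rw [thetaTerm_apply (a, j), thetaTerm_central_mul, thetaTerm_apply, ← mul_assoc]
  have : oddFormal (Sum.inr (Sum.inr (a, j))) * oddFormal (Sum.inl a) *
      (oddFormal (Sum.inr (Sum.inr (a, i))) * oddFormal (Sum.inl a) : Formal N k k) = 0 := by
    rw [oddFormal_mul_comm (Sum.inr (Sum.inr (a, i))), mul_neg, mul_assoc, ← mul_assoc _ (oddFormal _)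
      (oddFormal _), oddFormal_mul_self, zero_mul, mul_zero, neg_zero]
  rw [this, zero_mul]

/-- The operator `D` on formal power series. -/
def thetaEnd (N k : ℕ) : End ℝ (Formal N k k) := ∑ p, thetaTerm p

lemma thetaEnd_apply (x : Formal N k k) : thetaEnd N k x = ∑ p, thetaTerm p x := by
  rw [thetaEnd, LinearMap.sum_apply]

lemma isNilpotent_thetaEnd : IsNilpotent (thetaEnd N k) := by
  have h1 (p : Fin k × Fin N) : thetaTerm p * thetaTerm p = 0 := LinearMap.ext fun x => by
    rw [End.mul_apply, LinearMap.zero_apply]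
    exact thetaTerm_thetaTerm p.1 p.2 p.2 x
  have h2 (p q : Fin k × Fin N) : thetaTerm p * thetaTerm q = thetaTerm q * thetaTerm p :=
    LinearMap.ext fun x => by
      rw [End.mul_apply, End.mul_apply, thetaTerm_comm]
  exact Commute.isNilpotent_sum (fun p _ => ⟨2, (pow_two (thetaTerm p)).trans (h1 p)⟩)
    fun p q _ _ => h2 p q

lemma thetaEnd_leibniz (x y : Formal N k k) :
    thetaEnd N k (x * y) = x * thetaEnd N k y + thetaEnd N k x * y := by
  simp only [thetaEnd_apply, thetaTerm_leibniz, sum_add_distrib, sum_mul, mul_sum]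
  exact add_comm _ _

lemma pderivLin_thetaEnd (v : Fin k × Fin N) : Commute (pderivLin v) (thetaEnd N k) :=
  LinearMap.ext fun x => by
    change pderivLin v (thetaEnd N k x) = thetaEnd N k (pderivLin v x)
    simp only [thetaEnd_apply, map_sum, pderivLin_thetaTerm]

lemma exp_thetaEnd_mul (x y : Formal N k k) : IsNilpotent.exp (thetaEnd N k) (x * y) =
      IsNilpotent.exp (thetaEnd N k) x * IsNilpotent.exp (thetaEnd N k) y := by
  exact End.exp_mul_of_derivation ℝ _ _ thetaEnd_leibniz isNilpotent_thetaEnd x y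

lemma exp_end_apply_of_sq {T k : ℕ} {E : End ℝ (Formal N T k)} (hE : IsNilpotent E)
    {x : Formal N T k} (hx : E (E x) = 0) : IsNilpotent.exp E x = x + E x := by
  obtain ⟨K, hK⟩ := hE
  have hK' : E ^ (K + 2) = 0 := by rw [pow_add, hK, zero_mul]
  rw [IsNilpotent.exp_eq_sum hK', LinearMap.sum_apply, sum_range_succ',
    sum_range_succ', sum_eq_zero]
  · simp [add_comm]
  · intro i _
    rw [LinearMap.smul_apply, add_assoc, pow_add, End.mul_apply]
    have : (E ^ (1 + 1)) x = 0 := hx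
    rw [this, map_zero, smul_zero]

/-- The operator `- d_TM` on formal power series. -/
def negDTM (N : ℕ) : End ℝ (Formal N 0 1) :=
  -∑ i, LinearMap.mulLeft ℝ (oddFormal 𝕪 i) * pderivLin (0, i)

lemma negDTM_apply (x : Formal N 0 1) : negDTM N x = -∑ i, oddFormal 𝕪 i * pderivLin (0, i) x := by
  rw [negDTM, LinearMap.neg_apply, LinearMap.sum_apply]
  rfl

lemma thetaEnd_inclHom (a : Fin k) (x : Formal N 0 1) :
    thetaEnd N k (inclHom k a x) = oddFormal (Sum.inl a) * inclHom k a (negDTM N x) := by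
  rw [thetaEnd_apply, Fintype.sum_prod_type, sum_eq_single a]
  · rw [negDTM_apply, map_neg, map_sum, ← sum_neg_distrib, mul_sum]
    refine sum_congr rfl fun i _ => ?_
    rw [thetaTerm_apply, map_mul, inclHom_oddFormal_dy, mul_neg, ← mul_assoc,
      oddFormal_mul_comm (Sum.inl a), neg_mul, neg_neg]
    refine congrArg _ ?_
    refine (pderivHom_inclHom k a a i x).trans (if_pos rfl)
  · intro c _ hc
    refine sum_eq_zero fun i _ => ?_
    rw [thetaTerm_apply]
    have : pderivLin (c, i) (inclHom k a x) = 0 := (pderivHom_inclHom k c a i x).trans (if_neg hc)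
    rw [this, mul_zero]
  · intro h
    exact absurd (mem_univ a) h

lemma exp_thetaEnd_inclHom (a : Fin k) (x : Formal N 0 1) :
    IsNilpotent.exp (thetaEnd N k) (inclHom k a x) =
      inclHom k a x + oddFormal (Sum.inl a) * inclHom k a (negDTM N x) := by
  rw [exp_end_apply_of_sq isNilpotent_thetaEnd, thetaEnd_inclHom]
  have h : thetaEnd N k (inclHom k a x) = ∑ i, thetaTerm (a, i) (inclHom k a x) := by
    rw [thetaEnd_apply, Fintype.sum_prod_type, sum_eq_single a]
    · intro c _ hc
      refine sum_eq_zero fun i _ => ?_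
      rw [thetaTerm_apply]
      have : pderivLin (c, i) (inclHom k a x) = 0 := (pderivHom_inclHom k c a i x).trans (if_neg hc)
      rw [this, mul_zero]
    · intro h
      exact absurd (mem_univ a) h
  rw [h, thetaEnd_apply, Fintype.sum_prod_type, sum_eq_single a]
  · simp only [map_sum, thetaTerm_thetaTerm, sum_const_zero]
  · intro c _ hc
    refine sum_eq_zero fun i _ => ?_
    rw [map_sum]
    refine sum_eq_zero fun j _ => ?_
    rw [thetaTerm_comm, thetaTerm_apply (c, i)]
    have : pderivLin (c, i) (inclHom k a x) = 0 := (pderivHom_inclHom k c a i x).trans (if_neg hc)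
    rw [this, mul_zero, map_zero]
  · intro h
    exact absurd (mem_univ a) h

end ThetaOperator

/-! ### The integrand on the configuration space -/

section SymbolOperators

variable {N T k : ℕ}

/-- The constant coefficient operator on formal power series with a given symbol. -/
def symOp (N T k : ℕ) : 𝒫[Fin k, N] →ₐ[ℝ] End ℝ (Formal N T k) :=
  evalEnd pderivLin pderivLin_mul_comm

lemma symOp_X (v : Fin k × Fin N) : symOp N T k (X v) = pderivLin v := evalEnd_X _ _ _

lemma symOp_X_mul (v : Fin k × Fin N) (g : 𝒫[Fin k, N]) (x : Formal N T k) :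
    symOp N T k (X v * g) x = symOp N T k g (pderivLin v x) := by
  rw [mul_comm, map_mul, symOp_X, End.mul_apply]

lemma symOp_add (g h : 𝒫[Fin k, N]) (x : Formal N T k) :
    symOp N T k (g + h) x = symOp N T k g x + symOp N T k h x := by
  rw [map_add, LinearMap.add_apply]

lemma symOp_smul (c : ℝ) (g : 𝒫[Fin k, N]) (x : Formal N T k) :
    symOp N T k (c • g) x = c • symOp N T k g x := by
  rw [map_smul, LinearMap.smul_apply]

lemma symOp_sum {ι : Type*} (s : Finset ι) (g : ι → 𝒫[Fin k, N])
    (x : Formal N T k) : symOp N T k (∑ i ∈ s, g i) x = ∑ i ∈ s, symOp N T k (g i) x := by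
  rw [map_sum, LinearMap.sum_apply]

lemma symOp_one (x : Formal N T k) : symOp N T k 1 x = x := by
  rw [map_one, End.one_apply]

lemma symOp_intertwine {T' : ℕ} {φ : Formal N T k →ₗ[ℝ] Formal N T' k}
    (hφ : ∀ v x, φ (pderivLin v x) = pderivLin v (φ x)) (g : 𝒫[Fin k, N])
    (x : Formal N T k) : φ (symOp N T k g x) = symOp N T' k g (φ x) := by
  induction g using CommDer.symbol_induction generalizing x with
  | one => rw [symOp_one, symOp_one]
  | add g h hg hh => rw [symOp_add, symOp_add, map_add, hg, hh]
  | smul c g hg => rw [symOp_smul, symOp_smul, map_smul, hg]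
  | X_mul s g hg => rw [symOp_X_mul, symOp_X_mul, hg, hφ]

lemma commute_symOp_thetaEnd (g : 𝒫[Fin k, N]) : Commute (symOp N k k g) (thetaEnd N k) :=
  LinearMap.ext fun x => (symOp_intertwine (φ := thetaEnd N k)
    (fun v x => (LinearMap.congr_fun (pderivLin_thetaEnd v).eq x).symm) g x).symm

lemma symOp_contrSymbol (ϖ : 𝕄 N) (a b : Fin k) (x : Formal N T k) :
    symOp N T k (CommDer.contrSymbol ϖ a b) x =
      ∑ i, ∑ j, ϖ i j • pderivLin (a, i) (pderivLin (b, j) x) := by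
  rw [CommDer.contrSymbol, symOp_sum]
  refine sum_congr rfl fun i _ => ?_
  rw [symOp_sum]
  refine sum_congr rfl fun j _ => ?_
  rw [symOp_smul, map_mul, symOp_X, symOp_X, End.mul_apply]

/-- The value of the edge variables at a configuration. -/
def evalEdges {U : Type*} (S : Type*) [CommRing S] [Algebra ℝ S] (θ : U → UnitAddCircle) :
    MvPolynomial (U × U) S →ₐ[S] S :=
  aeval fun e => algebraMap ℝ S (edgeVal θ e)

lemma evalEdges_C_mul_map {U : Type*} {S : Type*} [CommRing S] [Algebra ℝ S]
    (θ : U → UnitAddCircle) (s : S) (f : MvPolynomial (U × U) ℝ) :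
    evalEdges S θ (C s * MvPolynomial.map (algebraMap ℝ S) f) = eval (edgeVal θ) f • s := by
  have h : evalEdges S θ (MvPolynomial.map (algebraMap ℝ S) f) =
      algebraMap ℝ S (eval (edgeVal θ) f) := by
    induction f using MvPolynomial.induction_on with
    | C r => rw [MvPolynomial.map_C, evalEdges, aeval_C, MvPolynomial.eval_C]; rfl
    | add f g hf hg => rw [map_add, map_add, map_add, map_add, hf, hg]
    | mul_X f e hf =>
      rw [map_mul, map_mul, map_mul, map_mul, hf, map_X, MvPolynomial.eval_X, evalEdges, aeval_X]
  rw [map_mul, h, evalEdges, aeval_C, Algebra.smul_def]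
  exact mul_comm _ _

open MeasureTheory in
lemma integral_conf_evalEdges {S : Type*} [CommRing S] [Algebra ℝ S] (ℓ : S →ₗ[ℝ] ℝ)
    (f : MvPolynomial (Fin k × Fin k) S) :
    Integrable (fun θ : Fin k → UnitAddCircle => ℓ (evalEdges S θ f)) (volume.restrict (conf k)) ∧
      ∫ θ in conf k, ℓ (evalEdges S θ f) = ℓ (meanOver (Fin k) S f) := by
  rw [Measure.restrict_eq_self_of_ae_mem (s := conf k) (ae_injective (Fin k))]
  induction f using real_coeff_induction with
  | add f g hf hg =>
    simp only [map_add]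
    exact ⟨hf.1.add hg.1, by rw [integral_add hf.1 hg.1, hf.2, hg.2]⟩
  | mul s f =>
    simp only [evalEdges_C_mul_map, map_smul, smul_eq_mul]
    refine ⟨(integrable_eval_edgeVal f).mul_const _, ?_⟩
    rw [integral_mul_const, meanOver_C_mul, meanOver_map_algebraMap, mul_comm s,
      ← Algebra.smul_def, map_smul, circleMean_apply, smul_eq_mul]

/-- The operator `ħ ∂_P + D` raises the power of `ħ` only through `∂_P`. -/
lemma coeff_feynman_operator {ϖ : 𝕄 N} (hϖ : ∀ i j, ϖ j i = -ϖ i j)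
    (θ : Fin k → UnitAddCircle) (s : Fib N k k) (n : ℤ) :
    (hbarPow 1 * partialP ϖ θ s + opD s).coeff n =
      symOp N k k (evalEdges _ θ (edgeSum ϖ (Fin k))) (s.coeff (n - 1)) +
        thetaEnd N k (s.coeff n) := by
  rw [HahnSeries.coeff_add, coeff_hbarPow_mul]
  congr 1
  · rw [partialP, coeff_real_smul_fib, edgeSum, map_sum, symOp_sum, HahnSeries.coeff_sum, smul_sum]
    refine sum_congr rfl fun a _ => ?_
    rw [map_sum, symOp_sum, HahnSeries.coeff_sum, smul_sum, Finset.sum_filter]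
    refine sum_congr rfl fun b _ => ?_
    rw [map_mul, evalEdges, aeval_X, aeval_C, ← Algebra.smul_def, symOp_smul]
    split_ifs with hab
    · change _ = edgeVal θ (a, b) • symOp N k k ((1 / 2 : ℝ) • CommDer.contrSymbol ϖ a b) _
      rw [symOp_smul, coeff_real_smul_fib, smul_comm, HahnSeries.coeff_sum, symOp_contrSymbol]
      refine congrArg _ (congrArg _ (sum_congr rfl fun i _ => ?_))
      rw [HahnSeries.coeff_sum]
      rfl
    · rw [not_not] at hab
      subst hab
      rw [contrSymbol_self hϖ, smul_zero]
      change _ = _ • symOp N k k 0 _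
      rw [map_zero, LinearMap.zero_apply, smul_zero]
  · rw [opD, HahnSeries.coeff_sum, thetaEnd_apply, Fintype.sum_prod_type]
    refine sum_congr rfl fun a _ => ?_
    rw [dTM, HahnSeries.coeff_sum]
    refine sum_congr rfl fun i _ => ?_
    have h1 (g : OddIdx N k k) (t : Fib N k k) (m : ℤ) :
        (odd g * t).coeff m = oddFormal g * t.coeff m := HahnSeries.coeff_single_zero_mul
    rw [dy, h1, partialY, coeff_mapCoeff, dtheta, h1, thetaTerm_apply, mul_assoc]
    refine congrArg _ ((pderivHom_mul _ _ _).trans ?_)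
    have h2 := pderivLin_oddFormal (a, i) (Sum.inl a : OddIdx N k k)
    change pderivHom _ _ = _ at h2
    rw [h2, zero_mul, zero_add]
    rfl

end SymbolOperators

/-! ### The coefficient of the top form on the configuration space -/

section IteratedContraction

variable {R τ : Type*} [Ring R] [DecidableEq τ]

lemma contract_list_prod_of_notMem (c : τ → R → R) (σ : R →+* R)
    (hc : ∀ t x y, c t (x * y) = c t x * y + σ x * c t y) (f b : τ → R)
    (hf : ∀ t a, c t (f a) = if t = a then b a else 0) (t : τ) (l : List τ) (ht : t ∉ l) :
    c t (l.map f).prod = 0 := by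
  induction l with
  | nil =>
    have := hc t 1 1
    rw [map_one, one_mul, mul_one, one_mul, left_eq_add] at this
    simpa using this
  | cons a l ih =>
    rw [List.map_cons, List.prod_cons, hc, hf, if_neg (List.ne_of_not_mem_cons ht), zero_mul,
      ih (List.not_mem_of_not_mem_cons ht), mul_zero, add_zero]

/-- Contracting a product of `f a` successively with all the generators replaces every factor
`f a` by its contraction `b a`. -/
lemma foldl_contract_list_prod (c : τ → R → R) (σ : R →+* R)
    (hc : ∀ t x y, c t (x * y) = c t x * y + σ x * c t y) (f b : τ → R)
    (hf : ∀ t a, c t (f a) = if t = a then b a else 0) (hb : ∀ t a, c t (b a) = 0) (hσ : ∀ a, σ (b a) = b a)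
    (l : List τ) (hl : l.Nodup) (z : R) (hz : ∀ t, c t z = 0) (hσz : σ z = z) :
    l.foldl (fun y t => c t y) (z * (l.map f).prod) = z * (l.map b).prod := by
  induction l generalizing z with
  | nil => rfl
  | cons a l ih =>
    have hl' := List.nodup_cons.1 hl
    rw [List.foldl_cons, List.map_cons, List.prod_cons, hc, hz, zero_mul, zero_add, hc, hf,
      if_pos rfl, contract_list_prod_of_notMem c σ hc f b hf a l hl'.1, mul_zero, add_zero, hσz,
      ← mul_assoc, ih hl'.2 (z * b a), List.map_cons, List.prod_cons, mul_assoc]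
    · intro t
      rw [hc, hz, hb, zero_mul, mul_zero, add_zero]
    · rw [map_mul, hσz, hσ]

end IteratedContraction

section TopTheta

variable {N T k : ℕ}

lemma contractLin_oddFormal (g h : OddIdx N T k) :
    contractLin g (oddFormal h) = if g = h then 1 else 0 := by
  refine (cmap_C (contractGen g) _).trans ?_
  have : contractGen g (oddGen h) = if g = h then 1 else 0 := by
    change contractLeft _ (CliffordAlgebra.ι _ _) = _
    rw [CliffordAlgebra.contractLeft_ι, LinearMap.proj_apply, Pi.single_apply]
    split_ifs <;> simp
  rw [this]
  split_ifs
  · exact map_one _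
  · exact map_zero _

lemma parityLin_oddFormal (g : OddIdx N T k) : parityLin N T k (oddFormal g) = -oddFormal g := by
  refine (cmap_C (parityGen _) _).trans ?_
  have : parityGen _ (oddGen g) = -oddGen g := involute_ι _
  rw [this, map_neg]
  rfl

lemma contractLin_theta_inclHom (t : Fin T) (a : Fin k) (x : Formal N 0 1) :
    contractLin (Sum.inl t) (inclHom T a x) = 0 := by
  refine (contractGen_linSubst _ _ (Sum.inl t : OddIdx N T k) x).trans (sum_eq_zero fun e _ => ?_)
  have : (Matrix.of (Sum.elim (fun t => t.elim0) (Sum.elim (fun i => Pi.single 𝕩 i 1)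
        (fun p => Pi.single (Sum.inr (Sum.inr (a, p.2))) 1))) :
      Matrix (OddIdx N 0 1) (OddIdx N T k) ℝ) e (Sum.inl t) = 0 := by
    rcases e with e | e | e
    · exact e.elim0
    · simp
    · simp
  rw [this, zero_smul]

lemma parityLin_inclHom (a : Fin k) (x : Formal N 0 1) :
    parityLin N T k (inclHom T a x) = inclHom T a (parityLin N 0 1 x) :=
  parityGen_linSubst _ _ x

lemma parityLin_negDTM {x : Formal N 0 1} (hx : parityLin N 0 1 x = -x) :
    parityLin N 0 1 (negDTM N x) = negDTM N x := by
  rw [negDTM_apply, map_neg, map_sum]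
  refine congrArg _ (sum_congr rfl fun i _ => ?_)
  have : parityLin N 0 1 (pderivLin (0, i) x) = -pderivLin (0, i) x := by
    rw [← map_neg, ← hx]
    exact cmap_pderivHom (parityGen _) _ x
  rw [parityLin_mul, parityLin_oddFormal, this, neg_mul_neg]

/-- The homomorphism of exterior algebras that sets the `dθ t` to zero. -/
def dropTheta (N T k : ℕ) : Grassmann N T k →ₐ[ℝ] Grassmann N 0 k :=
  ExteriorAlgebra.map (Matrix.vecMulLinear (Matrix.of (Sum.elim (fun _ => 0)
      fun g => Pi.single (Sum.inr g) 1)) :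
    (OddIdx N T k → ℝ) →ₗ[ℝ] (OddIdx N 0 k → ℝ))

/-- `dropTheta` on formal power series. -/
def dropThetaHom (N T k : ℕ) : Formal N T k →+* Formal N 0 k :=
  MvPowerSeries.map (dropTheta N T k : Grassmann N T k →+* Grassmann N 0 k)

lemma dropThetaHom_inclHom (a : Fin k) (x : Formal N 0 1) :
    dropThetaHom N T k (inclHom T a x) = inclHom 0 a x := by
  refine MvPowerSeries.ext fun β => ?_
  rw [dropThetaHom, MvPowerSeries.coeff_map]
  change dropTheta N T k (MvPowerSeries.coeff β (linSubst _ _ x)) =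
    MvPowerSeries.coeff β (linSubst _ _ x)
  rw [coeff_linSubst, coeff_linSubst, map_sum]
  refine sum_congr rfl fun α _ => ?_
  rw [map_smul, dropTheta, ← AlgHom.comp_apply, ExteriorAlgebra.map_comp_map]
  refine congrArg _ (congrArg (fun f => ExteriorAlgebra.map f _) ?_)
  refine LinearMap.ext fun v => ?_
  rw [LinearMap.comp_apply, Matrix.vecMulLinear_apply, Matrix.vecMulLinear_apply,
    Matrix.vecMulLinear_apply, Matrix.vecMul_vecMul]
  congr 1
  ext e h
  rw [Matrix.mul_apply]
  rcases e with e | e | e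
  · exact e.elim0
  · rw [sum_eq_single 𝕩 e]
    · simp
    · intro r _ hr
      simp [Pi.single_apply, hr]
    · simp
  · rw [sum_eq_single (Sum.inr (Sum.inr (a, e.2)))]
    · simp
    · intro r _ hr
      simp [Pi.single_apply, hr]
    · simp

lemma topTheta_apply (z : Grassmann N T k) : topTheta z =
    dropTheta N T k ((List.finRange T).foldl (fun y t => contractGen (Sum.inl t) y) z) := by
  have h (l : List (Fin T)) (φ : Grassmann N T k →ₗ[ℝ] Grassmann N T k) :
      l.foldl (fun f t => contractLeft
        (LinearMap.proj (Sum.inl t) : Dual ℝ (OddIdx N T k → ℝ)) ∘ₗ f) φ z =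
      l.foldl (fun y t => contractGen (Sum.inl t) y) (φ z) := by
    induction l generalizing φ with
    | nil => rfl
    | cons t l ih => rw [List.foldl_cons, ih, List.foldl_cons]; rfl
  exact congrArg (dropTheta N T k) (h _ _)

/-- `topTheta` on formal power series. -/
def topThetaLin (N T k : ℕ) : Formal N T k →ₗ[ℝ] Formal N 0 k where
  toFun := cmap (topTheta (N := N) (k := k) (T := T)).toAddMonoidHom
  map_add' := map_add _
  map_smul' c x := cmap_smul (fun c x => map_smul topTheta c x) c x

lemma topThetaLin_pderivLin (v : Fin k × Fin N) (x : Formal N T k) :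
    topThetaLin N T k (pderivLin v x) = pderivLin v (topThetaLin N T k x) :=
  cmap_pderivHom (topTheta (N := N) (k := k) (T := T)).toAddMonoidHom v x

lemma topThetaLin_apply (x : Formal N T k) : topThetaLin N T k x =
    dropThetaHom N T k ((List.finRange T).foldl (fun y t => contractLin (Sum.inl t) y) x) := by
  refine MvPowerSeries.ext fun β => ?_
  have h (l : List (Fin T)) (x : Formal N T k) :
      MvPowerSeries.coeff β (l.foldl (fun y t => contractLin (Sum.inl t) y) x) =
        l.foldl (fun y t => contractGen (Sum.inl t) y) (MvPowerSeries.coeff β x) := by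
    induction l generalizing x with
    | nil => rfl
    | cons t l ih => rw [List.foldl_cons, ih, List.foldl_cons]; rfl
  rw [dropThetaHom, MvPowerSeries.coeff_map, h]
  exact topTheta_apply _

lemma cmapLin_topThetaLin (x : Ser N T k) : cmapLin (topThetaLin N T k) x =
    PowerSeries.map (dropThetaHom N T k)
      ((List.finRange T).foldl (fun y t => contractSer (Sum.inl t) y) x) := by
  refine PowerSeries.ext fun n => ?_
  have h (l : List (Fin T)) (x : Ser N T k) :
      coeff n (l.foldl (fun y t => contractSer (Sum.inl t) y) x) =
        l.foldl (fun y t => contractLin (Sum.inl t) y) (coeff n x) := by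
    induction l generalizing x with
    | nil => rfl
    | cons t l ih => rw [List.foldl_cons, ih, List.foldl_cons, contractSer, coeff_cmapLin]
  rw [coeff_map, h, coeff_cmapLin, topThetaLin_apply]

/-- An odd generator as a power series in `ħ`. -/
def oddSer (g : OddIdx N T k) : Ser N T k := PowerSeries.C (oddFormal g)

lemma contractSer_oddSer (g h : OddIdx N T k) :
    contractSer g (oddSer h) = if g = h then 1 else 0 := by
  refine PowerSeries.ext fun n => ?_
  rw [contractSer, coeff_cmapLin, oddSer, PowerSeries.coeff_C]
  split_ifs with hn hg hg
  · rw [contractLin_oddFormal, if_pos hg, hn, PowerSeries.coeff_zero_one]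
  · rw [contractLin_oddFormal, if_neg hg, map_zero]
  · rw [map_zero, PowerSeries.coeff_one, if_neg hn]
  · rw [map_zero, map_zero]

lemma contractSer_theta_inclSer (t : Fin T) (a : Fin k) (x : Ser N 0 1) :
    contractSer (Sum.inl t) (inclSer T a x) = 0 := by
  refine PowerSeries.ext fun n => ?_
  rw [contractSer, coeff_cmapLin, inclSer, coeff_map, contractLin_theta_inclHom, map_zero]

lemma paritySer_inclSer (a : Fin k) (x : Ser N 0 1) :
    paritySer N T k (inclSer T a x) = inclSer T a (paritySer N 0 1 x) := by
  refine PowerSeries.ext fun n => ?_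
  rw [paritySer_eq, coeff_cmapLin, inclSer, coeff_map, parityLin_inclHom,
    coeff_map, paritySer_eq, coeff_cmapLin]

/-- The series `- d_TM g`. -/
def negDTMSer (g : Ser N 0 1) : Ser N 0 1 := cmapLin (negDTM N) g

lemma paritySer_negDTMSer {g : Ser N 0 1} (hg : paritySer N 0 1 g = -g) :
    paritySer N 0 1 (negDTMSer g) = negDTMSer g := by
  refine PowerSeries.ext fun n => ?_
  rw [paritySer_eq, negDTMSer, coeff_cmapLin, coeff_cmapLin]
  refine parityLin_negDTM ?_
  rw [← coeff_cmapLin, ← paritySer_eq, hg, map_neg]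

/-- `e ^ D` on formal power series, as a ring homomorphism. -/
def expTheta (N k : ℕ) : Formal N k k →+* Formal N k k where
  toFun x := IsNilpotent.exp (thetaEnd N k) x
  map_zero' := map_zero _
  map_add' := map_add _
  map_one' := by
    have h : thetaEnd N k 1 = 0 := by
      have := thetaEnd_leibniz (1 : Formal N k k) 1
      rw [one_mul, one_mul, mul_one, left_eq_add] at this
      exact this
    rw [exp_end_apply_of_sq isNilpotent_thetaEnd (by rw [h, map_zero]), h, add_zero]
  map_mul' := exp_thetaEnd_mul

lemma cmapLin_exp_thetaEnd (x : Ser N k k) :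
    cmapLin (IsNilpotent.exp (thetaEnd N k)) x = PowerSeries.map (expTheta N k) x :=
  cmap_ringHom (expTheta N k) x

lemma map_expTheta_inclSer (a : Fin k) (g : Ser N 0 1) :
    PowerSeries.map (expTheta N k) (inclSer k a g) =
      inclSer k a g + oddSer (Sum.inl a) * inclSer k a (negDTMSer g) := by
  refine PowerSeries.ext fun n => ?_
  rw [coeff_map, map_add, oddSer, PowerSeries.coeff_C_mul, inclSer,
    coeff_map, coeff_map, negDTMSer, coeff_cmapLin]
  exact exp_thetaEnd_inclHom a _

lemma topTheta_exp_prod_inclSer {g : Ser N 0 1} (hg : paritySer N 0 1 g = -g) :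
    cmapLin (topThetaLin N k k) (cmapLin (IsNilpotent.exp (thetaEnd N k))
      (List.ofFn fun a : Fin k => inclSer k a g).prod) =
        (List.ofFn fun a : Fin k => inclSer 0 a (negDTMSer g)).prod := by
  have hz (t : Fin k) : contractSer (Sum.inl t) (1 : Ser N k k) = 0 := by
    have := contractSer_mul (Sum.inl t) (1 : Ser N k k) 1
    rw [map_one (paritySer N k k), one_mul, mul_one, one_mul, left_eq_add] at this
    exact this
  have h := foldl_contract_list_prod (fun t (y : Ser N k k) => contractSer (Sum.inl t) y)
    (paritySer N k k) (fun t => contractSer_mul _)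
    (fun a => inclSer k a g + oddSer (Sum.inl a) * inclSer k a (negDTMSer g))
    (fun a => inclSer k a (negDTMSer g)) (fun t a => by
      rw [map_add, contractSer_theta_inclSer, zero_add, contractSer_mul, contractSer_theta_inclSer,
        mul_zero, add_zero, contractSer_oddSer]
      by_cases h : t = a
      · rw [if_pos (congrArg Sum.inl h), if_pos h, one_mul]
      · rw [if_neg (fun h' => h (Sum.inl_injective h')), if_neg h, zero_mul])
    (fun t a => contractSer_theta_inclSer _ _ _)
    (fun a => by rw [paritySer_inclSer, paritySer_negDTMSer hg])
    (List.finRange k) (List.nodup_finRange k) 1 hz (map_one _)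
  rw [cmapLin_exp_thetaEnd, cmapLin_topThetaLin, map_list_prod, List.ofFn_eq_map, List.map_map,
    List.ofFn_eq_map]
  rw [one_mul, one_mul] at h
  have h' : (PowerSeries.map (expTheta N k)) ∘ (fun a : Fin k => inclSer k a g) =
      fun a => inclSer k a g + oddSer (Sum.inl a) * inclSer k a (negDTMSer g) :=
    funext fun a => map_expTheta_inclSer a g
  rw [h', h, map_list_prod, List.map_map]
  refine congrArg List.prod (List.map_congr_left fun a _ => ?_)
  refine PowerSeries.ext fun n => ?_
  rw [Function.comp_apply, coeff_map, inclSer, coeff_map, dropThetaHom_inclHom, inclSer, coeff_map]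

end TopTheta

/-! ### The Feynman integral as a sum of Wick expansions -/

section ConfigurationIntegral

variable {N k : ℕ} {ϖ : 𝕄 N}

lemma expTensor_emb (g : Ser N 0 1) : expTensor k (emb g) =
    hbarPow (-(k : ℤ)) * emb (((k.factorial : ℝ)⁻¹) •
      (List.ofFn fun a : Fin k => inclSer k a g).prod) := by
  have h : (List.ofFn fun a : Fin k => (incl a (emb g) : Fib N k k)).prod =
      emb (List.ofFn fun a : Fin k => inclSer k a g).prod := by
    rw [map_list_prod, List.map_ofFn]
    refine congrArg List.prod (congrArg List.ofFn (funext fun a => incl_emb a g))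
  rw [expTensor, h, emb_smul]
  ext1; funext n
  rw [coeff_real_smul_fib, coeff_hbarPow_mul, coeff_hbarPow_mul, coeff_real_smul_fib]

/-- The integrand over the configuration space after taking the coefficient of the top form. -/
def topIntegrand (ϖ : 𝕄 N) (z : Ser N 0 k) (θ : Fin k → UnitAddCircle) : Ser N 0 k :=
  hs fun p => cmapLin (symOp N 0 k (evalEdges _ θ (divPow (edgeSum ϖ (Fin k)) p))) z

lemma inv_factorial_smul_symOp_pow {T : ℕ} (g : 𝒫[Fin k, N]) (p : ℕ) (x : Formal N T k) :
    ((p.factorial : ℝ)⁻¹) • (symOp N T k g ^ p) x = symOp N T k (divPow g p) x := by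
  rw [divPow, symOp_smul, map_pow]

lemma topThetaLin_pow (g : 𝒫[Fin k, N]) (p : ℕ) (x : Formal N k k) :
    topThetaLin N k k (((p.factorial : ℝ)⁻¹) • (symOp N k k g ^ p) x) =
      symOp N 0 k (divPow g p) (topThetaLin N k k x) := by
  rw [inv_factorial_smul_symOp_pow, symOp_intertwine topThetaLin_pderivLin]

/-- The coefficient of `dθ¹ ⋯ dθᵏ` in the integrand: every argument `g` is replaced by `-d_TM g`. -/
lemma topTheta_cf_integrand (hϖ : ∀ i j, ϖ j i = -ϖ i j) {g : Ser N 0 1}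
    (hg : paritySer N 0 1 g = -g) (θ : Fin k → UnitAddCircle) (m : ℤ)
    (β : (Fin k × Fin N) →₀ ℕ) :
    topTheta (cf (opExp (fun s => hbarPow 1 * partialP ϖ θ s + opD s) (expTensor k (emb g))) m β) =
      cf (hbarPow (-(k : ℤ)) * emb (((k.factorial : ℝ)⁻¹) • topIntegrand ϖ
        (List.ofFn fun a : Fin k => inclSer 0 a (negDTMSer g)).prod θ)) m β := by
  set w := evalEdges _ θ (edgeSum ϖ (Fin k)) with hw
  set y := (List.ofFn fun a : Fin k => inclSer k a g).prod with hy
  rw [expTensor_emb, opExp_hbarPow_mul_emb (commute_symOp_thetaEnd w) isNilpotent_thetaEnd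
    (coeff_feynman_operator hϖ θ), cf, cf, coeff_hbarPow_mul, coeff_hbarPow_mul]
  rcases lt_or_ge (m - -(k : ℤ)) 0 with hm | hm
  · rw [coeff_emb_of_neg _ hm, coeff_emb_of_neg _ hm, map_zero, map_zero, map_zero]
  obtain ⟨n, hn⟩ := Int.eq_ofNat_of_zero_le hm
  rw [hn, coeff_emb_natCast, coeff_emb_natCast]
  change MvPowerSeries.coeff β (topThetaLin N k k (coeff n (hs _))) = _
  refine congrArg _ ?_
  rw [coeff_hs, map_sum]
  change _ = ((k.factorial : ℝ)⁻¹) • coeff n (topIntegrand ϖ _ θ)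
  rw [topIntegrand, coeff_hs, smul_sum]
  refine sum_congr rfl fun p _ => ?_
  change topThetaLin N k k (((p.1.factorial : ℝ)⁻¹) • (symOp N k k w ^ p.1)
    (IsNilpotent.exp (thetaEnd N k) (((k.factorial : ℝ)⁻¹) • coeff p.2 y))) = _
  have h2 := congrArg (coeff p.2) (topTheta_exp_prod_inclSer (k := k) hg)
  rw [coeff_cmapLin, coeff_cmapLin, ← hy] at h2
  rw [topThetaLin_pow, map_smul, map_smul, map_smul, h2, coeff_cmapLin, hw,
    ← AlgHom.restrictScalars_apply ℝ (evalEdges _ θ), ← AlgHom.restrictScalars_apply ℝ (evalEdges _ θ),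
    ← map_divPow ((evalEdges _ θ).restrictScalars ℝ)]

/-- The functional that reads off a coordinate of the action of a symbol. -/
def symCoord (x : Formal N 0 k) (β : (Fin k × Fin N) →₀ ℕ)
    (b : Finset (Fin (Fintype.card (OddIdx N 0 k)))) :
    𝒫[Fin k, N] →ₗ[ℝ] ℝ where
  toFun s := (grBasis N 0 k).repr (MvPowerSeries.coeff β (symOp N 0 k s x)) b
  map_add' s t := by rw [symOp_add, map_add, map_add, Finsupp.add_apply]
  map_smul' c s := by
    rw [symOp_smul, coeff_real_smul, map_smul, Finsupp.smul_apply, RingHom.id_apply]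

lemma repr_coeff_topIntegrand (z : Ser N 0 k) (θ : Fin k → UnitAddCircle) (n : ℕ)
    (β : (Fin k × Fin N) →₀ ℕ) (b : Finset (Fin (Fintype.card (OddIdx N 0 k)))) :
    (grBasis N 0 k).repr (MvPowerSeries.coeff β (coeff n (topIntegrand ϖ z θ))) b =
      ∑ p ∈ antidiagonal n, symCoord (coeff p.2 z) β b
        (evalEdges _ θ (divPow (edgeSum ϖ (Fin k)) p.1)) := by
  rw [topIntegrand, coeff_hs, map_sum, map_sum, Finsupp.finsetSum_apply]
  rfl

lemma mkLaurent_eq {R : Type*} [Zero R] {f : ℤ → R} {s : LaurentSeries R}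
    (h : ∀ n, f n = s.coeff n) : mkLaurent f = s := by
  ext1; funext n
  rw [coeff_mkLaurent (m := s.order), h]
  intro n hn
  rw [h, HahnSeries.coeff_eq_zero_of_lt_order hn]

open MeasureTheory in
lemma integral_repr_coeff_topIntegrand (z : Ser N 0 k) (n : ℕ)
    (β : (Fin k × Fin N) →₀ ℕ) (b : Finset (Fin (Fintype.card (OddIdx N 0 k)))) :
    ∫ θ in conf k, (grBasis N 0 k).repr (MvPowerSeries.coeff β (coeff n (topIntegrand ϖ z θ))) b =
      (grBasis N 0 k).repr (MvPowerSeries.coeff β (coeff n (hs fun p =>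
        cmapLin (symOp N 0 k (wickSymbol ϖ (Fin k) p)) z))) b := by
  simp only [repr_coeff_topIntegrand]
  rw [integral_finsetSum _ fun p _ => (integral_conf_evalEdges _ _).1, coeff_hs, map_sum, map_sum,
    Finsupp.finsetSum_apply]
  exact sum_congr rfl fun p _ => (integral_conf_evalEdges _ _).2

lemma confIntegral_eq (hϖ : ∀ i j, ϖ j i = -ϖ i j) {g : Ser N 0 1} (hg : paritySer N 0 1 g = -g) :
    confIntegral (fun θ : Fin k → UnitAddCircle =>
      opExp (fun s => hbarPow 1 * partialP ϖ θ s + opD s) (expTensor k (emb g))) =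
      hbarPow (-(k : ℤ)) * emb (((k.factorial : ℝ)⁻¹) • hs fun p =>
        cmapLin (symOp N 0 k (wickSymbol ϖ (Fin k) p))
          (List.ofFn fun a : Fin k => inclSer 0 a (negDTMSer g)).prod) := by
  refine mkLaurent_eq fun m => funext fun β => ?_
  simp only [topTheta_cf_integrand hϖ hg]
  set z := (List.ofFn fun a : Fin k => inclSer 0 a (negDTMSer g)).prod with hz
  refine Eq.trans ?_ ((grBasis N 0 k).sum_repr (cf (hbarPow (-(k : ℤ)) *
    emb (((k.factorial : ℝ)⁻¹) • hs fun p =>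
      cmapLin (symOp N 0 k (wickSymbol ϖ (Fin k) p)) z)) m β))
  refine sum_congr rfl fun b _ => congrArg (· • grBasis N 0 k b) ?_
  simp only [cf, coeff_hbarPow_mul]
  rcases lt_or_ge (m - -(k : ℤ)) 0 with hm | hm
  · simp only [coeff_emb_of_neg _ hm, map_zero, Finsupp.zero_apply, MeasureTheory.integral_zero]
  · obtain ⟨n, hn⟩ := Int.eq_ofNat_of_zero_le hm
    simp only [hn, coeff_emb_natCast]
    have h (x : Ser N 0 k) : (grBasis N 0 k).repr (MvPowerSeries.coeff β
        (coeff n (((k.factorial : ℝ)⁻¹) • x))) b = ((k.factorial : ℝ)⁻¹) *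
          (grBasis N 0 k).repr (MvPowerSeries.coeff β (coeff n x)) b := by
      change (grBasis N 0 k).repr (((k.factorial : ℝ)⁻¹) •
        (MvPowerSeries.coeff β (coeff n x))) b = _
      rw [map_smul, Finsupp.smul_apply, smul_eq_mul]
    simp only [h]
    rw [MeasureTheory.integral_const_mul, integral_repr_coeff_topIntegrand]

end ConfigurationIntegral

section Multiplication

open CommDer

variable {N k : ℕ} {ϖ : 𝕄 N}

lemma derivation_list_prod {R τ : Type*} [Ring R] [DecidableEq τ] (δ : R → R)
    (hδ : ∀ x y, δ (x * y) = δ x * y + x * δ y) (f f' : τ → R) (a : τ)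
    (hf : ∀ c, c ≠ a → δ (f c) = 0) (ha : δ (f a) = f' a) (hf' : ∀ c, c ≠ a → f' c = f c)
    (l : List τ) (hl : l.Nodup) :
    δ (l.map f).prod = if a ∈ l then (l.map f').prod else 0 := by
  induction l with
  | nil =>
    have := hδ 1 1
    rw [one_mul, mul_one, one_mul, left_eq_add] at this
    simpa using this
  | cons c l ih =>
    have hl' := List.nodup_cons.1 hl
    rw [List.map_cons, List.prod_cons, hδ, ih hl'.2, List.map_cons, List.prod_cons]
    by_cases hc : c = a
    · subst hc
      rw [if_neg hl'.1, mul_zero, add_zero, ha, if_pos List.mem_cons_self]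
      congr 2
      exact List.map_congr_left fun d hd => (hf' d fun h => hl'.1 (h ▸ hd)).symm
    · rw [hf c hc, zero_mul, zero_add, hf' c hc]
      have : a ∈ c :: l ↔ a ∈ l := by rw [List.mem_cons, or_iff_right (Ne.symm hc)]
      simp only [this]
      split_ifs
      · rfl
      · rw [mul_zero]

/-- Multiplying the tensor factors after the action of a constant coefficient operator. -/
lemma multSer_symOp (g : 𝒫[Fin k, N]) (b : Fin k → 𝒵 (Ser N 0 1)) :
    multSer (cmapLin (symOp N 0 k g) (List.ofFn fun a => inclSer 0 a (b a : Ser N 0 1)).prod) =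
      (yDer N).polyDiff (rename (Prod.map some id) g) 1 b := by
  induction g using symbol_induction generalizing b with
  | one =>
    rw [map_one, map_one, polyDiff_one, one_mul, cmapLin_id, map_list_prod, List.map_ofFn]
    have : (multSer ∘ fun a => inclSer 0 a (b a : Ser N 0 1)) =
        (𝒵 (Ser N 0 1)).val ∘ b := funext fun a => multSer_inclSer _ _
    rw [this, ← List.map_ofFn, ← map_list_prod, List.prod_ofFn]
    rfl
  | add g h hg hh =>
    have : cmapLin (symOp N 0 k (g + h)) (List.ofFn fun a => inclSer 0 a (b a : Ser N 0 1)).prod =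
        cmapLin (symOp N 0 k g) (List.ofFn fun a => inclSer 0 a (b a : Ser N 0 1)).prod +
        cmapLin (symOp N 0 k h) (List.ofFn fun a => inclSer 0 a (b a : Ser N 0 1)).prod := by
      rw [map_add]; rfl
    rw [this, map_add, map_add, polyDiff_add, hg, hh]
  | smul c g hg =>
    have : cmapLin (symOp N 0 k (c • g)) (List.ofFn fun a => inclSer 0 a (b a : Ser N 0 1)).prod =
        c • cmapLin (symOp N 0 k g) (List.ofFn fun a => inclSer 0 a (b a : Ser N 0 1)).prod := by
      rw [map_smul]; rfl
    rw [this, multSer_smul, map_smul, polyDiff_smul, hg]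
  | X_mul s g hg =>
    obtain ⟨a, i⟩ := s
    have h1 : cmapLin (symOp N 0 k (X (a, i) * g))
        (List.ofFn fun a => inclSer 0 a (b a : Ser N 0 1)).prod = cmapLin (symOp N 0 k g)
          (pderivSer (a, i) (List.ofFn fun a => inclSer 0 a (b a : Ser N 0 1)).prod) := by
      rw [mul_comm, map_mul, symOp_X]; rfl
    have h2 : pderivSer (a, i) (List.ofFn fun a => inclSer 0 a (b a : Ser N 0 1)).prod =
        (List.ofFn fun c => inclSer 0 c (update b a ((yDer N).dZ i (b a)) c : Ser N 0 1)).prod := by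
      rw [List.ofFn_eq_map, List.ofFn_eq_map, derivation_list_prod (pderivSer (a, i))
        (pderivSer_mul _) _ (fun c => inclSer 0 c
          (update b a ((yDer N).dZ i (b a)) c : Ser N 0 1)) a ?_ ?_ ?_ _
            (List.nodup_finRange k), if_pos (List.mem_finRange a)]
      · intro c hc
        rw [pderivSer_inclSer, if_neg (Ne.symm hc)]
      · rw [pderivSer_inclSer, if_pos rfl, update_self]
        rfl
      · intro c hc
        rw [update_of_ne hc]
    rw [h1, h2, hg, map_mul, rename_X, Prod.map_apply, id, polyDiff_X_some]

variable {B : Type*} [Ring B] [Algebra ℝ B] {D : CommDer N B⟦X⟧} {V : Type*} [Fintype V]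
  [DecidableEq V]

lemma polyDiff_wickSymbol_option (ϖ : 𝕄 N) (r : ℕ) (a : V → 𝒵 B⟦X⟧) :
    D.polyDiff (wickSymbol ϖ (Option V) r) 1 a =
      D.polyDiff (rename (Prod.map some id) (wickSymbol ϖ V r)) 1 a := by
  rw [← polyDiff_restrict univ _ a (fun v hv => absurd (mem_univ v) hv)]
  congr 1
  have h := rename_wickSymbol ϖ (Function.Embedding.some : V ↪ Option V) r
  rw [← keepSlots_wickSymbol] at h
  refine Eq.trans ?_ h.symm
  rw [keepSlots, restrictSymbol]
  congr 2
  funext p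
  have : p.1 ∈ univ.image some ↔ p.1 ∈ univ.map (Function.Embedding.some : V ↪ Option V) := by simp
  simp only [this]

/-- The Feynman integral is the sum of the Wick expansions of all orders with `- d_TM g` in every
slot. -/
lemma mult_confIntegral_eq (hϖ : ∀ i j, ϖ j i = -ϖ i j) {g : Ser N 0 1}
    (hg : paritySer N 0 1 g = -g) (b : 𝒵 (Ser N 0 1))
    (hb : (b : Ser N 0 1) = negDTMSer g) :
    mult (confIntegral (fun θ : Fin k → UnitAddCircle =>
      opExp (fun s => hbarPow 1 * partialP ϖ θ s + opD s) (expTensor k (emb g)))) =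
      hbarPow (-(k : ℤ)) * emb (((k.factorial : ℝ)⁻¹) •
        wick (yDer N) ϖ 1 (fun _ : Fin k => b)) := by
  rw [confIntegral_eq hϖ hg]
  refine (mapCoeff_hbarPow_mul _ _ _).trans (congrArg _ ((mult_emb _).trans (congrArg _ ?_)))
  rw [multSer_smul, multSer_hs, wick, ← hb]
  refine congrArg _ (congrArg _ (funext fun p => ?_))
  rw [polyDiff_wickSymbol_option, ← multSer_symOp]

lemma feynmanIntegral_eq_finsum (hϖ : ∀ i j, ϖ j i = -ϖ i j) {g : Ser N 0 1}
    (hg : paritySer N 0 1 g = -g) (b : 𝒵 (Ser N 0 1))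
    (hb : (b : Ser N 0 1) = negDTMSer g) :
    feynmanIntegral ϖ (emb g) = ∑ᶠ k : ℕ, hbarPow (-(k : ℤ)) * emb (((k.factorial : ℝ)⁻¹) •
        wick (yDer N) ϖ 1 (fun _ : Fin k => b)) :=
  finsum_congr fun _ => mult_confIntegral_eq hϖ hg b hb

end Multiplication

/-! ### Exponentials and logarithms of nilpotent elements -/

section ExpLog

open Polynomial

variable {R : Type*} [CommRing R] [Algebra ℝ R]

/-- The truncated exponential series. -/
def expSum (K : ℕ) (x : R) : R := ∑ i ∈ range K, ((i.factorial : ℝ)⁻¹) • x ^ i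

lemma expSum_succ_zero (K : ℕ) : expSum (K + 1) (0 : R) = 1 := by
  rw [expSum, sum_range_succ', sum_eq_zero]
  · simp
  · intro i _
    simp

lemma expSum_succ_of_pow_eq_zero {K : ℕ} {x : R} (h : x ^ K = 0) :
    expSum (K + 1) x = expSum K x := by
  rw [expSum, sum_range_succ, h, smul_zero, add_zero, expSum]

lemma expSum_sub_one_pow {K : ℕ} {x : R} (h : x ^ K = 0) : (expSum (K + 1) x - 1) ^ K = 0 := by
  have : expSum (K + 1) x - 1 = x * ∑ i ∈ range K, (((i + 1).factorial : ℝ)⁻¹) • x ^ i := by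
    rw [expSum, sum_range_succ', mul_sum]
    simp only [Nat.factorial_zero, Nat.cast_one, inv_one, pow_zero, one_smul, add_sub_cancel_right]
    refine sum_congr rfl fun i _ => ?_
    rw [mul_smul_comm, pow_succ']
  rw [this, mul_pow, h, zero_mul]

lemma derivative_expSum {K : ℕ} {g : R[X]} (hg : g ^ K = 0) :
    derivative (expSum (K + 1) g) = derivative g * expSum (K + 1) g := by
  conv_rhs => rw [expSum_succ_of_pow_eq_zero hg]
  rw [expSum, sum_range_succ', derivative_add, derivative_sum, expSum, mul_sum]
  simp only [derivative_smul, pow_zero, derivative_one, smul_zero, add_zero]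
  refine sum_congr rfl fun i _ => ?_
  rw [derivative_pow, Nat.add_sub_cancel, Nat.factorial_succ, mul_smul_comm]
  have h1 : ((i : ℝ) + 1) ≠ 0 := by positivity
  have h2 : (Polynomial.C ((i + 1 : ℕ) : R) : R[X]) = algebraMap ℝ R[X] ((i : ℝ) + 1) := by
    simp only [Polynomial.algebraMap_apply, map_add, map_one, map_natCast, Nat.cast_add, Nat.cast_one]
  rw [h2, mul_assoc, ← Algebra.smul_def, smul_smul, mul_comm (g ^ i)]
  congr 1
  push_cast
  field_simp

/-- The recursion `(k + 1) f (k + 1) = ∑ j, (j + 1) g (j + 1) f (k - j)` says that the generating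
polynomial of `f` solves the differential equation of the exponential of the one of `g`. -/
lemma sum_eq_expSum_of_recursion (f g : ℕ → R) (N K : ℕ) (hf0 : f 0 = 1) (hg0 : g 0 = 0)
    (hfg : ∀ k : ℕ, ((k : ℝ) + 1) • f (k + 1) =
      ∑ j ∈ range (k + 1), (((j : ℝ) + 1) • g (j + 1)) * f (k - j))
    (hf : ∀ k : ℕ, N < k → f k = 0) (hg : ∀ k : ℕ, N < k → g k = 0)
    (hK : (∑ j ∈ range (N + 1), monomial j (g j) : R[X]) ^ K = 0) :
    ∑ k ∈ range (N + 1), f k = expSum (K + 1) (∑ j ∈ range (N + 1), g j) := by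
  set G : R[X] := ∑ j ∈ range (N + 1), monomial j (g j) with hG
  have hGc : ∀ j, G.coeff j = g j := by
    intro j
    rw [hG, finsetSum_coeff]
    simp only [coeff_monomial, Finset.sum_ite_eq', mem_range]
    split_ifs with h
    · rfl
    · rw [hg j (by omega)]
  have hE : ∀ (r : R) (x : R[X]) (K : ℕ), Polynomial.eval r (expSum K x) = expSum K (Polynomial.eval r x) := by
    intro r x K
    simp only [expSum, eval_finsetSum, eval_smul, eval_pow]
  have hP0 : (expSum (K + 1) G).coeff 0 = f 0 := by
    rw [coeff_zero_eq_eval_zero, hE, ← coeff_zero_eq_eval_zero, hGc, hg0, expSum_succ_zero, hf0]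
  have hPk : ∀ k, (expSum (K + 1) G).coeff k = f k := by
    intro k
    induction k using Nat.strong_induction_on with
    | _ k ih =>
      rcases k with _ | k
      · exact hP0
      · have h1 := congrArg (fun p => Polynomial.coeff p k) (derivative_expSum hK)
        simp only [coeff_derivative, coeff_mul, hGc] at h1
        have h2 : ((k : ℝ) + 1) • (expSum (K + 1) G).coeff (k + 1) = ((k : ℝ) + 1) • f (k + 1) := by
          rw [hfg, Algebra.smul_def, map_add, map_natCast, map_one, mul_comm, h1,
            Finset.Nat.sum_antidiagonal_eq_sum_range_succ_mk]
          refine sum_congr rfl fun j _ => ?_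
          rw [ih _ (by omega), Algebra.smul_def, map_add, map_natCast, map_one, mul_comm (g (j + 1))]
        have h3 : ((k : ℝ) + 1) ≠ 0 := by positivity
        exact smul_right_injective R h3 h2
  have h1 : Polynomial.eval 1 G = ∑ j ∈ range (N + 1), g j := by
    rw [hG, eval_finsetSum]
    simp
  rw [← h1, ← hE, eval_eq_sum_range' (n := max (N + 1) ((expSum (K + 1) G).natDegree + 1))
    (by omega)]
  simp only [hPk, one_pow, mul_one]
  refine sum_subset (fun k hk => ?_) fun k _ hk => hf k ?_
  · rw [mem_range] at hk ⊢
    omega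
  · rw [mem_range] at hk
    omega

/-- `log (exp d) = d`: both sides are compared as polynomials in `X` with `d X` in the place of `d`,
which have the same derivative. -/
lemma sum_log_expSum {K : ℕ} {d : R} (hd : d ^ K = 0) :
    ∑ j ∈ range K, (((-1 : ℝ) ^ j) / ((j : ℝ) + 1)) • (expSum (K + 1) d - 1) ^ (j + 1) = d := by
  set Y : R[X] := Polynomial.C d * Polynomial.X with hY
  have hYK : Y ^ K = 0 := by rw [hY, mul_pow, ← C_pow, hd, C_0, zero_mul]
  set Z : R[X] := expSum (K + 1) Y - 1 with hZ
  have hZK : Z ^ K = 0 := expSum_sub_one_pow hYK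
  have hZ' : derivative Z = Polynomial.C d * (1 + Z) := by
    rw [hZ, derivative_sub, derivative_one, sub_zero, derivative_expSum hYK, hY, derivative_C_mul,
      derivative_X, mul_one]
    ring
  set L : R[X] := ∑ j ∈ range K, (((-1 : ℝ) ^ j) / ((j : ℝ) + 1)) • Z ^ (j + 1) with hL
  have hL' : derivative L = Polynomial.C d := by
    have h1 : derivative L = (∑ j ∈ range K, (-Z) ^ j) * (1 - -Z) * Polynomial.C d := by
      rw [hL, derivative_sum, sum_mul, sum_mul]
      refine sum_congr rfl fun j _ => ?_
      rw [derivative_smul, derivative_pow, Nat.add_sub_cancel, hZ']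
      have h3 : ((j : ℝ) + 1) ≠ 0 := by positivity
      have h2 : (Polynomial.C ((j + 1 : ℕ) : R) : R[X]) = algebraMap ℝ R[X] ((j : ℝ) + 1) := by
        simp only [Polynomial.algebraMap_apply, map_add, map_one, map_natCast, Nat.cast_add, Nat.cast_one]
      rw [h2, mul_assoc, ← Algebra.smul_def, smul_smul, div_mul_cancel₀ _ h3, neg_pow Z,
        Algebra.smul_def, map_pow, map_neg, map_one]
      ring
    rw [h1, geom_sum_mul_neg, neg_pow, hZK, mul_zero, sub_zero, one_mul]
  have hLY : L = Y := by
    ext k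
    rcases k with _ | k
    · have h1 : L.coeff 0 = 0 := by
        have hZ0 : Polynomial.eval 0 Z = 0 := by
          rw [hZ, eval_sub, eval_one]
          have : Polynomial.eval 0 (expSum (K + 1) Y) = expSum (K + 1) (Polynomial.eval 0 Y) := by
            simp only [expSum, eval_finsetSum, eval_smul, eval_pow]
          rw [this, hY, eval_mul, eval_X, mul_zero, expSum_succ_zero, sub_self]
        rw [coeff_zero_eq_eval_zero, hL, eval_finsetSum]
        refine sum_eq_zero fun j _ => ?_
        rw [eval_smul, eval_pow, hZ0, zero_pow (Nat.succ_ne_zero j), smul_zero]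
      rw [h1, hY, coeff_C_mul, coeff_X_zero, mul_zero]
    · have h1 : derivative L = derivative Y := by
        rw [hL', hY, derivative_C_mul, derivative_X, mul_one]
      have h2 := congrArg (fun p => Polynomial.coeff p k) h1
      simp only [coeff_derivative] at h2
      have h3 : ((k : ℝ) + 1) ≠ 0 := by positivity
      refine smul_right_injective R h3 ?_
      simp only [Algebra.smul_def, map_add, map_natCast, map_one]
      rw [mul_comm, h2, mul_comm]
  have h1 := congrArg (Polynomial.eval 1) hLY
  have h2 : Polynomial.eval 1 Y = d := by rw [hY, eval_mul, eval_C, eval_X, mul_one]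
  have h3 : Polynomial.eval 1 Z = expSum (K + 1) d - 1 := by
    rw [hZ, eval_sub, eval_one]
    have : Polynomial.eval 1 (expSum (K + 1) Y) = expSum (K + 1) (Polynomial.eval 1 Y) := by
      simp only [expSum, eval_finsetSum, eval_smul, eval_pow]
    rw [this, h2]
  rw [h2, hL, eval_finsetSum] at h1
  simpa only [eval_smul, eval_pow, h3] using h1

end ExpLog

/-! ### Bidegrees -/

section Bidegree

variable {N : ℕ}

lemma span_mul_span_comm_of_anticommute {A : Type*} [Ring A] [Algebra ℝ A] {ι κ : Type*}
    (f : ι → A) (g : κ → A) (h : ∀ i j, f i * g j = -(g j * f i)) :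
    Submodule.span ℝ (Set.range f) * Submodule.span ℝ (Set.range g) ≤
      Submodule.span ℝ (Set.range g) * Submodule.span ℝ (Set.range f) := by
  rw [Submodule.span_mul_span, Submodule.span_mul_span, Submodule.span_le]
  rintro _ ⟨_, ⟨i, rfl⟩, _, ⟨j, rfl⟩, rfl⟩
  change f i * g j ∈ _
  rw [h]
  exact Submodule.neg_mem _ (Submodule.subset_span ⟨_, ⟨j, rfl⟩, _, ⟨i, rfl⟩, rfl⟩)

variable (N) in
lemma commute_dxSpan_dySpan : Commute (Submodule.span ℝ (Set.range fun i : Fin N =>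
        (oddGen 𝕩 i : Grassmann N 0 1)))
      (Submodule.span ℝ (Set.range fun i : Fin N => (oddGen 𝕪 i : Grassmann N 0 1))) :=
  le_antisymm (span_mul_span_comm_of_anticommute _ _ fun _ _ => oddGen_mul_comm _ _)
    (span_mul_span_comm_of_anticommute _ _ fun _ _ => oddGen_mul_comm _ _)

lemma bidegree_mul_bidegree (p q p' q' : ℕ) :
    bidegree N p q * bidegree N p' q' = bidegree N (p + p') (q + q') := by
  simp only [bidegree]
  rw [pow_add, pow_add, mul_assoc, ← mul_assoc (_ ^ q),
    ← ((commute_dxSpan_dySpan N).pow_pow p' q).eq]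
  simp only [mul_assoc]

lemma mul_mem_bidegree {p q p' q' : ℕ} {x y : Grassmann N 0 1} (hx : x ∈ bidegree N p q)
    (hy : y ∈ bidegree N p' q') : x * y ∈ bidegree N (p + p') (q + q') :=
  bidegree_mul_bidegree p q p' q' ▸ Submodule.mul_mem_mul hx hy

lemma one_mem_bidegree : (1 : Grassmann N 0 1) ∈ bidegree N 0 0 := by
  rw [bidegree, pow_zero, pow_zero, one_mul]
  exact Submodule.one_le.1 le_rfl

lemma dy_mem_bidegree (i : Fin N) : oddGen 𝕪 i ∈ bidegree N 0 1 := by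
  rw [bidegree, pow_one, pow_zero, one_mul]
  exact Submodule.subset_span ⟨i, rfl⟩

lemma bidegree_eq_bot {p : ℕ} (hp : N < p) (q : ℕ) : bidegree N p q = ⊥ := by
  have h : (Submodule.span ℝ (Set.range fun i : Fin N =>
      (oddGen 𝕩 i : Grassmann N 0 1))) ^ p = ⊥ := by
    rw [Submodule.span_pow, eq_bot_iff, Submodule.span_le]
    intro x hx
    obtain ⟨f, rfl⟩ := Set.mem_pow.1 hx
    choose i hi using fun a => (f a).2
    obtain ⟨a, b, hab, hi'⟩ : ∃ a b, a ≠ b ∧ i a = i b := by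
      by_contra hne
      push Not at hne
      have := Fintype.card_le_of_injective i fun a b h => by
        by_contra hab
        exact hne a b hab h
      simp only [Fintype.card_fin] at this
      omega
    have h1 : (List.ofFn fun a => (f a : Grassmann N 0 1)).prod =
        ExteriorAlgebra.ιMulti ℝ p fun a => Pi.single (Sum.inr (Sum.inl (i a))) 1 := by
      rw [ExteriorAlgebra.ιMulti_apply]
      exact congrArg List.prod (congrArg List.ofFn (funext fun a => (hi a).symm))
    change (List.ofFn fun a => (f a : Grassmann N 0 1)).prod = 0
    rw [h1]
    exact (ExteriorAlgebra.ιMulti ℝ p).map_eq_zero_of_eq _ (by simp only [hi']) hab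
  rw [bidegree, h, Submodule.bot_mul]

open scoped Pointwise in
lemma bidegree_one_one_le_center {x : Grassmann N 0 1} (hx : x ∈ bidegree N 1 1) :
    x ∈ 𝒵 (Grassmann N 0 1) := by
  rw [bidegree, pow_one, pow_one, Submodule.span_mul_span] at hx
  have : Submodule.span ℝ ((Set.range fun i : Fin N =>
      (oddGen 𝕩 i : Grassmann N 0 1)) * Set.range fun i : Fin N =>
      (oddGen 𝕪 i : Grassmann N 0 1)) ≤
      Subalgebra.toSubmodule (𝒵 (Grassmann N 0 1)) := by
    rw [Submodule.span_le]
    rintro _ ⟨_, ⟨i, rfl⟩, _, ⟨j, rfl⟩, rfl⟩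
    exact ι_mul_ι_mem_center _ _
  exact this hx

lemma parityGen_of_mem_bidegree {x : Grassmann N 0 1} (hx : x ∈ bidegree N 1 0) :
    parityGen _ x = -x := by
  rw [bidegree, pow_one, pow_zero, mul_one] at hx
  induction hx using Submodule.span_induction with
  | mem x hx =>
    obtain ⟨i, rfl⟩ := hx
    exact involute_ι _
  | zero => rw [map_zero, neg_zero]
  | add x y _ _ hx hy => rw [map_add, hx, hy, neg_add]
  | smul c x _ hx =>
    have : parityGen _ (c • x) = c • parityGen (OddIdx N 0 1) x := map_smul involute c x
    rw [this, hx, smul_neg]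

lemma coeff_yDer (i : Fin N) (x : Ser N 0 1) (n : ℕ) :
    coeff n ((yDer N).d i x) = pderivLin (0, i) (coeff n x) :=
  coeff_cmapLin _ _ _

/-- All the coefficients of the series have degree `p` in the `dx i` and `q` in the `dy i`. -/
def HasBidegree (p q : ℕ) (x : Ser N 0 1) : Prop :=
  ∀ n β, MvPowerSeries.coeff β (coeff n x) ∈ bidegree N p q

namespace HasBidegree

variable {p q p' q' : ℕ} {x y : Ser N 0 1}

lemma one : HasBidegree 0 0 (1 : Ser N 0 1) := fun n β => by
  rw [PowerSeries.coeff_one]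
  split_ifs
  · rw [MvPowerSeries.coeff_one]
    split_ifs
    · exact one_mem_bidegree
    · exact zero_mem _
  · rw [map_zero]
    exact zero_mem _

lemma add (hx : HasBidegree p q x) (hy : HasBidegree p q y) : HasBidegree p q (x + y) :=
  fun n β => by
    rw [map_add, map_add]
    exact add_mem (hx n β) (hy n β)

lemma neg (hx : HasBidegree p q x) : HasBidegree p q (-x) := fun n β => by
    rw [map_neg, map_neg]
    exact neg_mem (hx n β)

lemma sub (hx : HasBidegree p q x) (hy : HasBidegree p q y) : HasBidegree p q (x - y) :=
  fun n β => by
    rw [map_sub, map_sub]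
    exact sub_mem (hx n β) (hy n β)

lemma smul (c : ℝ) (hx : HasBidegree p q x) : HasBidegree p q (c • x) :=
  fun n β => Submodule.smul_mem _ c (hx n β)

lemma sum {ι : Type*} {s : Finset ι} {f : ι → Ser N 0 1} (h : ∀ i ∈ s, HasBidegree p q (f i)) :
    HasBidegree p q (∑ i ∈ s, f i) := fun n β => by
  rw [map_sum, map_sum]
  exact sum_mem fun i hi => h i hi n β

lemma mul (hx : HasBidegree p q x) (hy : HasBidegree p' q' y) :
    HasBidegree (p + p') (q + q') (x * y) := fun n β => by
  rw [PowerSeries.coeff_mul, map_sum]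
  refine sum_mem fun a _ => ?_
  classical
  rw [MvPowerSeries.coeff_mul]
  exact sum_mem fun b _ => mul_mem_bidegree (hx _ _) (hy _ _)

lemma d (i : Fin N) (hx : HasBidegree p q x) : HasBidegree p q ((yDer N).d i x) := fun n β => by
  change MvPowerSeries.coeff _ (coeff n x) * _ ∈ _
  have : ∀ m : ℕ, ((m : Grassmann N 0 1) + 1) = algebraMap ℝ _ ((m : ℝ) + 1) := by
    intro m
    rw [map_add, map_natCast, map_one]
  rw [this, ← Algebra.commutes, ← Algebra.smul_def]
  exact Submodule.smul_mem _ _ (hx _ _)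

lemma hs {ψ : ℕ → Ser N 0 1} (h : ∀ r, HasBidegree p q (ψ r)) :
    HasBidegree p q (FedosovBV.hs ψ) := fun n β => by
  rw [coeff_hs, map_sum]
  exact sum_mem fun a _ => h _ _ _

variable {V : Type*} [Fintype V] [DecidableEq V]

lemma prod {s : Finset V} {a : V → 𝒵 (Ser N 0 1)} (ha : ∀ v, HasBidegree 1 1 (a v : Ser N 0 1)) :
    HasBidegree s.card s.card ((∏ v ∈ s, a v : 𝒵 (Ser N 0 1)) : Ser N 0 1) := by
  induction s using Finset.induction_on with
  | empty => exact one
  | insert v s hv ih =>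
    rw [prod_insert hv, Finset.card_insert_of_notMem hv, add_comm]
    exact (ha v).mul ih

lemma polyDiff (g : 𝒫[Option V, N]) (hx : HasBidegree p q x)
    {a : V → 𝒵 (Ser N 0 1)} (ha : ∀ v, HasBidegree 1 1 (a v : Ser N 0 1)) :
    HasBidegree (p + Fintype.card V) (q + Fintype.card V) ((yDer N).polyDiff g x a) := by
  induction g using CommDer.symbol_induction generalizing x a with
  | one =>
    rw [CommDer.polyDiff_one]
    exact hx.mul (prod ha)
  | add g h hg hh =>
    rw [CommDer.polyDiff_add]
    exact (hg hx ha).add (hh hx ha)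
  | smul c g hg =>
    rw [CommDer.polyDiff_smul]
    exact (hg hx ha).smul c
  | X_mul s g hg =>
    obtain ⟨_ | v, i⟩ := s
    · rw [CommDer.polyDiff_X_none]
      exact hg (hx.d i) ha
    · rw [CommDer.polyDiff_X_some]
      refine hg hx fun w => ?_
      by_cases hw : w = v
      · subst hw
        rw [update_self]
        exact (ha w).d i
      · rw [update_of_ne hw]
        exact ha w

lemma wick {ϖ : 𝕄 N} {a : V → 𝒵 (Ser N 0 1)} (ha : ∀ v, HasBidegree 1 1 (a v : Ser N 0 1)) :
    HasBidegree (Fintype.card V) (Fintype.card V) (FedosovBV.wick (yDer N) ϖ 1 a) :=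
  hs fun r => by simpa using polyDiff (wickSymbol ϖ (Option V) r) one ha

lemma connectedWick {ϖ : 𝕄 N} {b : 𝒵 (Ser N 0 1)} (hb : HasBidegree 1 1 (b : Ser N 0 1)) (k : ℕ) :
    HasBidegree (k + 1) (k + 1) (FedosovBV.connectedWick ϖ (yDer N) b k) := by
  induction k using Nat.strong_induction_on with
  | _ k ih =>
    rw [connectedWick_eq]
    have h1 := wick (ϖ := ϖ) (a := fun _ : Fin (k + 1) => b) fun _ => hb
    rw [Fintype.card_fin] at h1
    refine h1.sub (sum fun j hj => ?_)
    have hj' := mem_range.1 hj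
    have h2 := wick (ϖ := ϖ) (a := fun _ : Fin (k - j) => b) fun _ => hb
    rw [Fintype.card_fin] at h2
    have h3 := (ih j hj').mul h2
    rw [show j + 1 + (k - j) = k + 1 by omega] at h3
    rw [← Nat.cast_smul_eq_nsmul ℝ]
    exact h3.smul _

lemma eq_zero (hx : HasBidegree p q x) (hp : N < p) : x = 0 := by
  refine PowerSeries.ext fun n => MvPowerSeries.ext fun β => ?_
  have := hx n β
  rw [bidegree_eq_bot hp, Submodule.mem_bot] at this
  rw [this, map_zero, map_zero]

lemma mem_center (hx : HasBidegree 1 1 x) : x ∈ 𝒵 (Ser N 0 1) := by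
  rw [Subalgebra.mem_center_iff]
  intro y
  refine (mem_center_mvPowerSeries (fun n => ?_) y).symm
  refine Semigroup.mem_center_iff.2 fun z => ?_
  refine (mem_center_mvPowerSeries (fun β => ?_) z).symm
  refine Semigroup.mem_center_iff.2 fun w => ?_
  have h : (MvPowerSeries.coeff β) ((MvPowerSeries.coeff n) x) ∈ bidegree N 1 1 := by
    have h2 : MvPowerSeries.coeff n x = coeff (n ()) x := by
      rw [coeff]
      congr 2
      exact Finsupp.ext fun u => by simp
    rw [h2]
    exact hx _ _
  exact Subalgebra.mem_center_iff.1 (bidegree_one_one_le_center h) w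

lemma negDTMSer (hx : HasBidegree p 0 x) : HasBidegree p 1 (FedosovBV.negDTMSer x) := by
  intro n β
  have h1 (i : Fin N) : MvPowerSeries.coeff β (oddFormal 𝕪 i *
      pderivLin (0, i) (coeff n x)) ∈ bidegree N p 1 := by
    rw [oddFormal, MvPowerSeries.coeff_C_mul, ← coeff_yDer]
    have h := mul_mem_bidegree (dy_mem_bidegree i) (hx.d i n β)
    rw [zero_add, add_zero] at h
    exact h
  have h2 : coeff n (FedosovBV.negDTMSer x) = _ := (coeff_cmapLin _ _ _).trans (negDTM_apply _)
  rw [h2, map_neg, map_sum]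
  exact neg_mem (sum_mem fun i _ => h1 i)

lemma paritySer (hx : HasBidegree 1 0 x) : FedosovBV.paritySer N 0 1 x = -x := by
  refine PowerSeries.ext fun n => MvPowerSeries.ext fun β => ?_
  rw [paritySer_eq, coeff_cmapLin, map_neg, map_neg]
  exact parityGen_of_mem_bidegree (hx n β)

end HasBidegree

end Bidegree

/-! ### The logarithm of the Feynman integral -/

section Center

variable {N T k : ℕ}

lemma emb_mem_center {x : Ser N T k} (hx : x ∈ 𝒵 (Ser N T k)) : emb x ∈ 𝒵 (Fib N T k) := by
  rw [Subalgebra.mem_center_iff] at hx ⊢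
  intro s
  have hs : s = hbarPow s.order * emb (LaurentSeries.powerSeriesPart s) :=
    (LaurentSeries.single_order_mul_powerSeriesPart s).symm
  rw [hs, mul_assoc, ← map_mul, hx, map_mul, ← mul_assoc, ← mul_assoc, hbarPow_mul_comm]

lemma hbarPow_mem_center (m : ℤ) : hbarPow m ∈ 𝒵 (Fib N T k) :=
  Subalgebra.mem_center_iff.2 fun s => (hbarPow_mul_comm m s).symm

lemma hbarPow_mul_emb_mem_center (m : ℤ) {x : Ser N T k} (hx : x ∈ 𝒵 (Ser N T k)) :
    hbarPow m * emb x ∈ 𝒵 (Fib N T k) :=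
  mul_mem (hbarPow_mem_center m) (emb_mem_center hx)

lemma exp_eq_sum_real {x : BV N} {K : ℕ} (hx : x ^ K = 0) :
    IsNilpotent.exp x = ∑ i ∈ range K, ((i.factorial : ℝ)⁻¹) • x ^ i := by
  rw [IsNilpotent.exp_eq_sum hx]
  refine sum_congr rfl fun i _ => ?_
  rw [← Rat.cast_smul_eq_qsmul ℝ]
  push_cast
  rfl

lemma exp_coe_center {x : 𝒵 (BV N)} {K : ℕ} (hx : x ^ K = 0) :
    IsNilpotent.exp (x : BV N) = (expSum K x : 𝒵 (BV N)) := by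
  rw [exp_eq_sum_real (K := K) (by rw [← SubmonoidClass.coe_pow, hx]; rfl), expSum,
    AddSubmonoidClass.coe_finsetSum]
  rfl

lemma nilLog_expSum {d : 𝒵 (BV N)} {K : ℕ} (hd : d ^ K = 0) :
    nilLog ((expSum (K + 1) d : 𝒵 (BV N)) : BV N) = d := by
  set u := expSum (K + 1) d with hu
  have hK : ((u : BV N) - 1) ^ K = 0 := by
    have : (u - 1) ^ K = 0 := expSum_sub_one_pow hd
    exact congrArg (fun z : 𝒵 (BV N) => (z : BV N)) this
  have hL : ((u : BV N) - 1) ^ nilpotencyClass ((u : BV N) - 1) = 0 := pow_nilpotencyClass ⟨K, hK⟩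
  have hLK : nilpotencyClass ((u : BV N) - 1) ≤ K := Nat.sInf_le hK
  rw [nilLog, sum_subset (Finset.range_mono hLK)]
  · have h0 := sum_log_expSum (R := 𝒵 (BV N)) hd
    have h := congrArg (fun z : 𝒵 (BV N) => (z : BV N)) h0
    rw [AddSubmonoidClass.coe_finsetSum] at h
    exact h
  · intro j _ hj
    rw [mem_range, not_lt] at hj
    rw [pow_eq_zero_of_le (Nat.le_succ_of_le hj) hL, smul_zero]

end Center

section Coefficients

variable {N : ℕ}

lemma coeff_pow_mem {S : Submodule ℝ (Grassmann N 0 1)} {x : Ser N 0 1}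
    (hx : ∀ n β, MvPowerSeries.coeff β (coeff n x) ∈ S) (K : ℕ) (n : ℕ)
    (β : (Fin 1 × Fin N) →₀ ℕ) :
    MvPowerSeries.coeff β (coeff n (x ^ K)) ∈ S ^ K := by
  induction K generalizing n β with
  | zero =>
    have h1 : (1 : Grassmann N 0 1) ∈ S ^ 0 := by
      rw [pow_zero]
      exact Submodule.one_le.1 le_rfl
    rw [pow_zero x, PowerSeries.coeff_one]
    split_ifs
    · rw [MvPowerSeries.coeff_one]
      split_ifs
      · exact h1
      · exact zero_mem _
    · rw [map_zero]
      exact zero_mem _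
  | succ K ih =>
    rw [pow_succ, pow_succ, PowerSeries.coeff_mul, map_sum]
    refine sum_mem fun a _ => ?_
    classical
    rw [MvPowerSeries.coeff_mul]
    exact sum_mem fun b _ => Submodule.mul_mem_mul (ih _ _) (hx _ _)

lemma iSup_bidegree_succ_pow_le (K : ℕ) :
    (⨆ r : ℕ, bidegree N (r + 1) (r + 1)) ^ K ≤ ⨆ r : ℕ, bidegree N (r + K) (r + K) := by
  induction K with
  | zero =>
    rw [pow_zero]
    refine le_trans ?_ (le_iSup _ 0)
    exact Submodule.one_le.2 one_mem_bidegree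
  | succ K ih =>
    rw [pow_succ]
    refine (Submodule.mul_le.2 fun a ha b hb => Submodule.mul_mem_mul (ih ha) hb).trans ?_
    rw [Submodule.iSup_mul]
    refine iSup_le fun r => ?_
    rw [Submodule.mul_iSup]
    refine iSup_le fun r' => ?_
    rw [bidegree_mul_bidegree]
    refine le_trans (le_of_eq ?_) (le_iSup _ (r + r'))
    rw [show r + K + (r' + 1) = r + r' + (K + 1) by omega]

lemma pow_eq_zero_of_coeff_mem {x : Ser N 0 1} (hx : ∀ n β, MvPowerSeries.coeff β (coeff n x) ∈
      ⨆ r : ℕ, bidegree N (r + 1) (r + 1)) : x ^ (N + 1) = 0 := by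
  refine PowerSeries.ext fun n => MvPowerSeries.ext fun β => ?_
  have h := iSup_bidegree_succ_pow_le _ (coeff_pow_mem hx (N + 1) n β)
  have h0 : ⨆ r : ℕ, bidegree N (r + (N + 1)) (r + (N + 1)) = ⊥ :=
    iSup_eq_bot.2 fun r => bidegree_eq_bot (by omega) _
  rw [h0, Submodule.mem_bot] at h
  rw [h, map_zero, map_zero]

/-- Division of a power series in `ħ` by `ħ ^ k`. -/
def shiftDown (k : ℕ) (x : Ser N 0 1) : Ser N 0 1 := PowerSeries.mk fun n => coeff (n + k) x

lemma X_pow_mul_shiftDown {k : ℕ} {x : Ser N 0 1} (hx : ∀ m < k, coeff m x = 0) :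
    PowerSeries.X ^ k * shiftDown k x = x := by
  refine PowerSeries.ext fun n => ?_
  rw [PowerSeries.coeff_X_pow_mul']
  split_ifs with h
  · rw [shiftDown, coeff_mk, Nat.sub_add_cancel h]
  · rw [hx n (not_le.1 h)]

lemma hbarPow_mul_emb_of_coeff_eq_zero {k : ℕ} {x : Ser N 0 1}
    (hx : ∀ m < k, coeff m x = 0) (m : ℤ) :
    hbarPow m * emb x = hbarPow (m + k) * emb (shiftDown k x) := by
  conv_lhs => rw [← X_pow_mul_shiftDown hx, map_mul, emb_X_pow, ← mul_assoc, hbarPow_mul_hbarPow]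

end Coefficients

section Logarithm

variable {N : ℕ} {ϖ : 𝕄 N}

lemma hbarPow_mul_emb_mul (m n : ℤ) (x y : Ser N 0 1) :
    hbarPow m * emb x * (hbarPow n * emb y) = hbarPow (m + n) * emb (x * y) := by
  rw [mul_assoc, ← mul_assoc (emb x), ← hbarPow_mul_comm, mul_assoc, ← map_mul, ← mul_assoc,
    hbarPow_mul_hbarPow]

lemma hbarPow_mul_emb_pow (m : ℤ) (x : Ser N 0 1) (K : ℕ) :
    (hbarPow m * emb x) ^ K = hbarPow (m * K) * emb (x ^ K) := by
  induction K with
  | zero => rw [pow_zero, pow_zero, Nat.cast_zero, mul_zero, hbarPow_zero, one_mul, map_one]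
  | succ K ih =>
    rw [pow_succ, ih, hbarPow_mul_emb_mul, pow_succ, Nat.cast_succ, mul_add, mul_one]

lemma smul_hbarPow_mul_emb (c : ℝ) (m : ℤ) (x : Ser N 0 1) :
    c • (hbarPow m * emb x) = hbarPow m * emb (c • x) := by
  ext1; funext n
  rw [emb_smul, coeff_real_smul_fib, coeff_hbarPow_mul, coeff_hbarPow_mul, coeff_real_smul_fib]

/-- The Feynman integral, as a finite sum over the number of arguments. -/
def wickSum (ϖ : 𝕄 N) (b : 𝒵 (Ser N 0 1)) : BV N :=
  ∑ k ∈ range (N + 1), hbarPow (-(k : ℤ)) * emb (((k.factorial : ℝ)⁻¹) •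
    wick (yDer N) ϖ 1 (fun _ : Fin k => b))

/-- The sum of the connected parts of the Feynman integral, multiplied by `ħ`: the part with `j + 1`
arguments carries `ħ⁻ʲ` and is divisible by `ħ ^ j`. -/
def connectedSum (ϖ : 𝕄 N) (b : 𝒵 (Ser N 0 1)) : Ser N 0 1 :=
  ∑ j ∈ range N, (((j + 1).factorial : ℝ)⁻¹) • shiftDown j (connectedWick ϖ (yDer N) b j)

/-- The terms with more than `N` arguments vanish, as their degree in the `dx` exceeds `N`. -/
lemma feynmanIntegral_emb (hϖ : ∀ i j, ϖ j i = -ϖ i j) {g : Ser N 0 1} (hg : HasBidegree 1 0 g)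
    (b : 𝒵 (Ser N 0 1)) (hb : (b : Ser N 0 1) = negDTMSer g) :
    feynmanIntegral ϖ (emb g) = wickSum ϖ b := by
  rw [feynmanIntegral_eq_finsum hϖ hg.paritySer b hb, wickSum]
  refine finsum_eq_sum_of_support_subset _ fun k hk => ?_
  rw [Finset.coe_range, Set.mem_Iio]
  by_contra hkN
  have hb' : HasBidegree 1 1 (b : Ser N 0 1) := hb ▸ hg.negDTMSer
  have h := HasBidegree.wick (ϖ := ϖ) (a := fun _ : Fin k => b) fun _ => hb'
  rw [Fintype.card_fin] at h
  rw [Function.mem_support, h.eq_zero (by omega), smul_zero, map_zero, mul_zero] at hk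
  exact hk rfl

lemma connectedWick_mem_center (b : 𝒵 (Ser N 0 1)) (k : ℕ) :
    connectedWick ϖ (yDer N) b k ∈ 𝒵 (Ser N 0 1) := by
  induction k using Nat.strong_induction_on with
  | _ k ih =>
    rw [connectedWick_eq]
    refine sub_mem (wick_one_mem_center (yDer N) _) (sum_mem fun j hj => ?_)
    exact nsmul_mem (mul_mem (ih j (mem_range.1 hj)) (wick_one_mem_center (yDer N) _)) _

lemma coeff_connectedSum_mem {b : 𝒵 (Ser N 0 1)}
    (hb : HasBidegree 1 1 (b : Ser N 0 1)) (n : ℕ) (β : (Fin 1 × Fin N) →₀ ℕ) :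
    MvPowerSeries.coeff β (coeff n (connectedSum ϖ b)) ∈ ⨆ r : ℕ, bidegree N (r + 1) (r + 1) := by
  rw [connectedSum, map_sum, map_sum]
  refine sum_mem fun j _ => ?_
  have h : MvPowerSeries.coeff β (coeff n ((((j + 1).factorial : ℝ)⁻¹) •
      shiftDown j (connectedWick ϖ (yDer N) b j))) = (((j + 1).factorial : ℝ)⁻¹) •
        MvPowerSeries.coeff β (coeff (n + j) (connectedWick ϖ (yDer N) b j)) := by
    rw [← coeff_mk n fun n => coeff (n + j) (connectedWick ϖ (yDer N) b j)]
    rfl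
  rw [h]
  exact Submodule.smul_mem _ _ (Submodule.mem_iSup_of_mem j (hb.connectedWick j _ _))

lemma connectedSum_pow_eq_zero {b : 𝒵 (Ser N 0 1)}
    (hb : HasBidegree 1 1 (b : Ser N 0 1)) : connectedSum ϖ b ^ (N + 1) = 0 :=
  pow_eq_zero_of_coeff_mem (coeff_connectedSum_mem hb)

/-- The Feynman integral is the exponential of the sum of its connected parts. -/
lemma exists_wickSum_eq_expSum (hϖ : ∀ i j, ϖ j i = -ϖ i j)
    {b : 𝒵 (Ser N 0 1)} (hb : HasBidegree 1 1 (b : Ser N 0 1)) :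
    ∃ (d : 𝒵 (BV N)) (K : ℕ), d ^ K = 0 ∧ (d : BV N) = hbarPow (-1) * emb (connectedSum ϖ b) ∧
      wickSum ϖ b = (expSum (K + 1) d : 𝒵 (BV N)) := by
  set f : ℕ → 𝒵 (BV N) := fun k => ⟨hbarPow (-(k : ℤ)) *
    emb (((k.factorial : ℝ)⁻¹) • wick (yDer N) ϖ 1 (fun _ : Fin k => b)),
      hbarPow_mul_emb_mem_center _ (Subalgebra.smul_mem _ (wick_one_mem_center (yDer N) _) _)⟩ with hf
  set c : ℕ → 𝒵 (BV N) := fun j => ⟨hbarPow (-((j + 1 : ℕ) : ℤ)) *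
    emb ((((j + 1).factorial : ℝ)⁻¹) • connectedWick ϖ (yDer N) b j),
      hbarPow_mul_emb_mem_center _ (Subalgebra.smul_mem _ (connectedWick_mem_center b j) _)⟩ with hc
  -- `g k` is the connected part with `k` arguments; there is none for `k = 0`.
  set g : ℕ → 𝒵 (BV N) := fun j => Nat.casesOn j 0 c with hg
  have hc0 : ∀ j, N ≤ j → c j = 0 := by
    intro j hj
    refine Subtype.ext ?_
    change hbarPow _ * emb _ = 0
    rw [(hb.connectedWick j).eq_zero (by omega), smul_zero, map_zero, mul_zero]
  have hcnil : ∀ j, IsNilpotent (c j) := by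
    intro j
    refine ⟨N + 1, Subtype.ext ?_⟩
    change (hbarPow _ * emb _) ^ (N + 1) = 0
    rw [hbarPow_mul_emb_pow, pow_eq_zero_of_coeff_mem, map_zero, mul_zero]
    intro n β
    exact Submodule.mem_iSup_of_mem j ((hb.connectedWick j).smul _ n β)
  have hgnil : ∀ j, IsNilpotent (g j) := fun j => by
    rcases j with _ | j
    · exact IsNilpotent.zero
    · exact hcnil j
  obtain ⟨K, hK⟩ : IsNilpotent (∑ j ∈ range (N + 1), Polynomial.monomial j (g j)) :=
    isNilpotent_sum fun j _ => (Polynomial.isNilpotent_monomial_iff).2 (hgnil j)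
  have hsum : ∑ j ∈ range (N + 1), g j = ∑ j ∈ range N, c j := by
    rw [sum_range_succ']
    exact add_zero _
  refine ⟨∑ j ∈ range (N + 1), g j, K, ?_, ?_, ?_⟩
  · have h := congrArg (Polynomial.eval 1) hK
    rw [Polynomial.eval_pow, Polynomial.eval_finsetSum, Polynomial.eval_zero] at h
    simp only [Polynomial.eval_monomial, one_pow, mul_one] at h
    exact h
  · rw [hsum, AddSubmonoidClass.coe_finsetSum, connectedSum, map_sum, mul_sum]
    refine sum_congr rfl fun j _ => ?_
    change hbarPow _ * emb _ = _
    rw [← smul_hbarPow_mul_emb, ← smul_hbarPow_mul_emb,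
      hbarPow_mul_emb_of_coeff_eq_zero (coeff_connectedWick (yDer N) hϖ b j)]
    congr 3
    push_cast
    ring
  · have h1 : wickSum ϖ b = ((∑ k ∈ range (N + 1), f k : 𝒵 (BV N)) : BV N) := by
      rw [AddSubmonoidClass.coe_finsetSum]
      rfl
    rw [h1]
    refine congrArg _ (sum_eq_expSum_of_recursion f g N K ?_ rfl ?_ ?_ ?_ hK)
    · refine Subtype.ext ?_
      change hbarPow _ * emb _ = 1
      rw [wick_isEmpty _ hϖ, Nat.factorial_zero, Nat.cast_one, inv_one, one_smul, map_one, mul_one,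
        Nat.cast_zero, neg_zero, hbarPow_zero]
    · intro k
      refine Subtype.ext ?_
      rw [AddSubmonoidClass.coe_finsetSum]
      change ((k : ℝ) + 1) • (hbarPow _ * emb _) = ∑ j ∈ range (k + 1),
        (((j : ℝ) + 1) • (hbarPow _ * emb _)) * (hbarPow _ * emb _)
      rw [wick_succ _ hϖ, smul_hbarPow_mul_emb, smul_sum, smul_sum, map_sum, mul_sum]
      refine sum_congr rfl fun j hj => ?_
      have hjk : j ≤ k := Nat.lt_succ_iff.1 (mem_range.1 hj)
      rw [smul_hbarPow_mul_emb, hbarPow_mul_emb_mul, smul_smul, smul_smul, smul_mul_smul_comm,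
        ← Nat.cast_smul_eq_nsmul ℝ, smul_smul]
      have h2 : (-((k + 1 : ℕ) : ℤ)) = -((j + 1 : ℕ) : ℤ) + -((k - j : ℕ) : ℤ) := by omega
      rw [h2]
      congr 3
      have h3 : ((k.choose j : ℕ) : ℝ) * j.factorial * (k - j).factorial = k.factorial := by
        exact_mod_cast Nat.choose_mul_factorial_mul_factorial hjk
      have h4 := j.factorial_ne_zero
      have h5 := (k - j).factorial_ne_zero
      have h6 := k.factorial_ne_zero
      rw [Nat.factorial_succ, Nat.factorial_succ]
      push_cast
      field_simp
      linarith
    · intro k hk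
      refine Subtype.ext ?_
      change hbarPow _ * emb _ = 0
      have h := HasBidegree.wick (ϖ := ϖ) (a := fun _ : Fin k => b) fun _ => hb
      rw [Fintype.card_fin] at h
      rw [h.eq_zero hk, smul_zero, map_zero, mul_zero]
    · intro k hk
      rcases k with _ | k
      · rfl
      · exact hc0 k (by omega)

lemma exp_connectedSum (hϖ : ∀ i j, ϖ j i = -ϖ i j)
    {b : 𝒵 (Ser N 0 1)} (hb : HasBidegree 1 1 (b : Ser N 0 1)) :
    IsNilpotent.exp (hbarPow (-1) * emb (connectedSum ϖ b)) = wickSum ϖ b := by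
  obtain ⟨d, K, hd, hd', h⟩ := exists_wickSum_eq_expSum hϖ hb
  rw [← hd', exp_coe_center hd, h, expSum_succ_of_pow_eq_zero hd]

lemma gammaInfty_emb (hϖ : ∀ i j, ϖ j i = -ϖ i j) {g : Ser N 0 1} (hg : HasBidegree 1 0 g)
    (b : 𝒵 (Ser N 0 1)) (hb : (b : Ser N 0 1) = negDTMSer g) :
    gammaInfty ϖ (emb g) = emb (connectedSum ϖ b) := by
  obtain ⟨d, K, hd, hd', h⟩ := exists_wickSum_eq_expSum hϖ (hb ▸ hg.negDTMSer : HasBidegree 1 1 _)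
  rw [gammaInfty, feynmanIntegral_emb hϖ hg b hb, h, nilLog_expSum hd, hd', ← mul_assoc,
    hbarPow_mul_hbarPow, add_neg_cancel, hbarPow_zero, one_mul]

end Logarithm

/-! ### The algebraic part of the quantum master equation -/

section OddDerivation

variable {N : ℕ}

lemma oddGen_mul_eq {T k : ℕ} (g : OddIdx N T k) (z : Grassmann N T k) :
    oddGen g * z = parityGen _ z * oddGen g := by
  induction z using ExteriorAlgebra.induction with
  | algebraMap r =>
    rw [show parityGen _ (algebraMap ℝ (Grassmann N T k) r) = algebraMap ℝ _ r from
      involute.commutes r, Algebra.commutes]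
  | ι v =>
    rw [show parityGen _ (ExteriorAlgebra.ι ℝ v : Grassmann N T k) = -ExteriorAlgebra.ι ℝ v from
      involute_ι v, neg_mul, eq_neg_iff_add_eq_zero]
    exact ExteriorAlgebra.ι_add_mul_swap _ _
  | mul x y hx hy => rw [parityGen_mul, ← mul_assoc, hx, mul_assoc, hy, mul_assoc]
  | add x y hx hy => rw [map_add, mul_add, add_mul, hx, hy]

lemma oddSer_mul_eq {T k : ℕ} (g : OddIdx N T k) (z : Ser N T k) :
    oddSer g * z = paritySer N T k z * oddSer g := by
  refine PowerSeries.ext fun n => ?_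
  rw [oddSer, PowerSeries.coeff_C_mul, PowerSeries.coeff_mul_C, paritySer_eq, coeff_cmapLin]
  refine MvPowerSeries.ext fun β => ?_
  rw [oddFormal, MvPowerSeries.coeff_C_mul, MvPowerSeries.coeff_mul_C, oddGen_mul_eq]
  rfl

lemma dy_eq_emb (i : Fin N) : (dy 0 i : BV N) = emb (oddSer 𝕪 i) := (emb_C _).symm

lemma dx_eq_emb (i : Fin N) : (dx i : BV N) = emb (oddSer 𝕩 i) := (emb_C _).symm

lemma negDTMSer_eq (x : Ser N 0 1) : negDTMSer x = -∑ i, oddSer 𝕪 i * (yDer N).d i x := by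
  refine PowerSeries.ext fun n => ?_
  rw [negDTMSer, coeff_cmapLin, negDTM_apply, map_neg, map_sum]
  refine congrArg _ (sum_congr rfl fun i _ => ?_)
  rw [oddSer, PowerSeries.coeff_C_mul, coeff_yDer]

lemma dTM_emb (x : Ser N 0 1) : dTM 0 (emb x) = -emb (negDTMSer x) := by
  rw [negDTMSer_eq, map_neg, neg_neg, map_sum, dTM]
  refine sum_congr rfl fun i _ => ?_
  rw [dy_eq_emb, partialY_emb, ← map_mul]
  rfl

lemma bvDelta_emb (ϖ : 𝕄 N) (x : Ser N 0 1) : bvDelta ϖ (emb x) = emb (∑ i, ∑ j, ϖ i j •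
      (yDer N).d i (contractSer 𝕪 j x)) := by
  simp only [map_sum, emb_smul]
  rw [bvDelta]
  refine sum_congr rfl fun i _ => sum_congr rfl fun j _ => congrArg _ ?_
  rw [iotaY, contract_emb, partialY_emb]
  rfl

lemma bvDelta_hbarPow_mul (ϖ : 𝕄 N) (m : ℤ) (s : BV N) :
    bvDelta ϖ (hbarPow m * s) = hbarPow m * bvDelta ϖ s := by
  rw [bvDelta, bvDelta, mul_sum]
  refine sum_congr rfl fun i _ => ?_
  rw [mul_sum]
  refine sum_congr rfl fun j _ => ?_
  rw [iotaY, iotaY, contract, contract, partialY, partialY, mapCoeff_hbarPow_mul,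
    mapCoeff_hbarPow_mul]
  ext1; funext n
  rw [coeff_real_smul_fib, coeff_hbarPow_mul, coeff_hbarPow_mul, coeff_real_smul_fib]

lemma bvDelta_sum (ϖ : 𝕄 N) {κ : Type*} (t : Finset κ) (s : κ → BV N) :
    bvDelta ϖ (∑ c ∈ t, s c) = ∑ c ∈ t, bvDelta ϖ (s c) := by
  simp only [bvDelta, iotaY, contract, partialY, mapCoeff_sum, smul_sum]
  symm
  rw [sum_comm]
  refine sum_congr rfl fun i _ => ?_
  rw [sum_comm]

lemma yDer_oddSer_mul (g : OddIdx N 0 1) (i : Fin N) (x : Ser N 0 1) :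
    (yDer N).d i (oddSer g * x) = oddSer g * (yDer N).d i x := by
  refine PowerSeries.ext fun n => ?_
  rw [oddSer, PowerSeries.coeff_C_mul, coeff_yDer, coeff_yDer, PowerSeries.coeff_C_mul,
    pderivLin_mul, pderivLin_oddFormal, zero_mul, zero_add]

lemma yDer_oddSer (g : OddIdx N 0 1) (i : Fin N) : (yDer N).d i (oddSer g) = 0 := by
  rw [← mul_one (oddSer g), yDer_oddSer_mul, CommDer.d_one, mul_zero]

lemma negDTMSer_mul (x y : Ser N 0 1) :
    negDTMSer (x * y) = negDTMSer x * y + paritySer N 0 1 x * negDTMSer y := by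
  simp only [negDTMSer_eq, CommDer.leibniz, mul_add, sum_add_distrib, neg_add, neg_mul,
    mul_neg, sum_mul, mul_sum, ← mul_assoc, oddSer_mul_eq _ x]

lemma negDTMSer_d (i : Fin N) (x : Ser N 0 1) :
    negDTMSer ((yDer N).d i x) = (yDer N).d i (negDTMSer x) := by
  simp only [negDTMSer_eq, map_neg, map_sum, yDer_oddSer_mul, (yDer N).comm i]

lemma negDTMSer_hs (ψ : ℕ → Ser N 0 1) :
    negDTMSer (hs ψ) = hs fun r => negDTMSer (ψ r) := hs_cmapLin _ _

/-- An odd derivation which commutes with the partial derivatives is an odd derivation of the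
Moyal product. -/
lemma negDTMSer_starProd (ϖ : 𝕄 N) (x z : Ser N 0 1) :
    negDTMSer (starProd (yDer N) ϖ x z) = starProd (yDer N) ϖ (negDTMSer x) z +
      starProd (yDer N) ϖ (paritySer N 0 1 x) (negDTMSer z) := by
  have h (p : ℕ) (x z : Ser N 0 1) : negDTMSer ((yDer N).bidiff ϖ (1 / 2) p x z) =
      (yDer N).bidiff ϖ (1 / 2) p (negDTMSer x) z +
        (yDer N).bidiff ϖ (1 / 2) p (paritySer N 0 1 x) (negDTMSer z) := by
    induction p generalizing x z with
    | zero => exact negDTMSer_mul x z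
    | succ p ih =>
      have hσ (i : Fin N) : paritySer N 0 1 ((yDer N).d i x) = (yDer N).d i (paritySer N 0 1 x) :=
        paritySer_pderivSer _ _
      have hl : ∀ (c : ℝ) y, negDTMSer (c • y) = c • negDTMSer (N := N) y :=
        map_smul (cmapLin (negDTM N))
      have hsum : ∀ (f : Fin N → Ser N 0 1), negDTMSer (∑ i, f i) = ∑ i, negDTMSer (f i) :=
        fun f => map_sum (cmapLin (negDTM N)) f _
      simp only [CommDer.bidiff, hl, hsum, ih, negDTMSer_d, hσ, smul_add, sum_add_distrib]
  have hl : ∀ (c : ℝ) y, negDTMSer (c • y) = c • negDTMSer (N := N) y :=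
    map_smul (cmapLin (negDTM N))
  simp only [starProd, negDTMSer_hs, hl, h, smul_add]
  exact hs_add _ _

lemma contractGen_dy_of_mem_span (j : Fin N) {z : Grassmann N 0 1}
    (hz : z ∈ Submodule.span ℝ (Set.range fun i : Fin N => oddGen 𝕩 i)) :
    contractGen (𝕪 j : OddIdx N 0 1) z = 0 := by
  induction hz using Submodule.span_induction with
  | mem x hx =>
    obtain ⟨i, rfl⟩ := hx
    change contractLeft _ (CliffordAlgebra.ι _ _) = _
    rw [CliffordAlgebra.contractLeft_ι, LinearMap.proj_apply, Pi.single_apply, if_neg (by simp),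
      map_zero]
  | zero => exact map_zero _
  | add x y _ _ hx hy => rw [map_add, hx, hy, add_zero]
  | smul c x _ hx => rw [contractGen_smul, hx, smul_zero]

lemma contractSer_dy_negDTMSer {g : Ser N 0 1} (hg : HasBidegree 1 0 g) (j : Fin N) :
    contractSer 𝕪 j (negDTMSer g) = (yDer N).d j (-g) := by
  have h0 : contractSer 𝕪 j g = 0 := by
    refine PowerSeries.ext fun n => MvPowerSeries.ext fun β => ?_
    have h := hg n β
    rw [bidegree, pow_one, pow_zero, mul_one] at h
    exact contractGen_dy_of_mem_span j h
  have h1 (i : Fin N) : contractSer 𝕪 j ((yDer N).d i g) = 0 :=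
    (contractSer_pderivSer _ _ _).trans (by rw [h0, map_zero])
  rw [negDTMSer_eq, map_neg, map_sum, map_neg, sum_eq_single j]
  · rw [contractSer_mul, contractSer_oddSer, if_pos rfl, one_mul, h1, mul_zero, add_zero]
  · intro i _ hi
    rw [contractSer_mul, contractSer_oddSer, if_neg, zero_mul, h1, mul_zero, add_zero]
    simpa using fun h => hi h.symm
  · simp

end OddDerivation

section MasterEquation

variable {N : ℕ} {ϖ : 𝕄 N}

lemma wick_update_one (b : 𝒵 (Ser N 0 1)) (z : Ser N 0 1) {k : ℕ} (v : Fin (k + 1)) :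
    wick (yDer N) ϖ z (update (fun _ => b) v 1) = wick (yDer N) ϖ z (fun _ : Fin k => b) := by
  rw [wick_comp_embedding v.succAboveEmb]
  · congr 1
    funext w
    exact update_of_ne (Fin.succAbove_ne v w) _ _
  · intro w hw
    have : w = v := by
      by_contra h
      exact hw (Fin.exists_succAbove_eq h)
    rw [this, update_self]

lemma wick_update_update_one (b : 𝒵 (Ser N 0 1)) (z : Ser N 0 1) {k : ℕ}
    {v w : Fin (k + 2)} (hvw : w ≠ v) :
    wick (yDer N) ϖ z (update (update (fun _ => b) v 1) w 1) =
      wick (yDer N) ϖ z (fun _ : Fin k => b) := by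
  obtain ⟨w, rfl⟩ := Fin.exists_succAbove_eq hvw
  rw [wick_comp_embedding v.succAboveEmb, ← wick_update_one b z w]
  · congr 1
    funext u
    rw [Function.comp_apply, Fin.coe_succAboveEmb]
    by_cases h : u = w
    · subst h; rw [update_self, update_self]
    · rw [update_of_ne h, update_of_ne (fun h' => h (Fin.succAbove_right_injective h')),
        update_of_ne (Fin.succAbove_ne v u)]
  · intro u hu
    have : u = v := by
      by_contra h
      exact hu (Fin.exists_succAbove_eq h)
    rw [this, update_of_ne hvw.symm, update_self]

lemma starProd_one_left (z : Ser N 0 1) : starProd (yDer N) ϖ 1 z = z := by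
  have h0 (p : ℕ) (z : Ser N 0 1) : (yDer N).bidiff ϖ (1 / 2) p 0 z = 0 := by
    induction p generalizing z with
    | zero => exact zero_mul z
    | succ p ih => simp only [CommDer.bidiff, map_zero, ih, smul_zero, sum_const_zero]
  have h : (fun p : ℕ => ((p.factorial : ℝ)⁻¹) • (yDer N).bidiff ϖ (1 / 2) p 1 z) =
      fun p => if p = 0 then z else 0 := by
    funext p
    rcases p with _ | p
    · rw [CommDer.bidiff, one_mul, Nat.factorial_zero, Nat.cast_one, inv_one, one_smul, if_pos rfl]
    · simp only [CommDer.bidiff, CommDer.d_one, h0, smul_zero, sum_const_zero]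
      rw [if_neg (Nat.succ_ne_zero p)]
  rw [starProd, h, hs_single]

lemma starProd_one_right (z : Ser N 0 1) : starProd (yDer N) ϖ z 1 = z := by
  have h0 (p : ℕ) (z : Ser N 0 1) : (yDer N).bidiff ϖ (1 / 2) p z 0 = 0 := by
    induction p generalizing z with
    | zero => exact mul_zero z
    | succ p ih => simp only [CommDer.bidiff, map_zero, ih, smul_zero, sum_const_zero]
  have h : (fun p : ℕ => ((p.factorial : ℝ)⁻¹) • (yDer N).bidiff ϖ (1 / 2) p z 1) =
      fun p => if p = 0 then z else 0 := by
    funext p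
    rcases p with _ | p
    · rw [CommDer.bidiff, mul_one, Nat.factorial_zero, Nat.cast_one, inv_one, one_smul, if_pos rfl]
    · simp only [CommDer.bidiff, CommDer.d_one, h0, smul_zero, sum_const_zero]
      rw [if_neg (Nat.succ_ne_zero p)]
  rw [starProd, h, hs_single]

lemma starProd_neg_left (x z : Ser N 0 1) :
    starProd (yDer N) ϖ (-x) z = -starProd (yDer N) ϖ x z := by
  have h0 (p : ℕ) (x z : Ser N 0 1) :
      (yDer N).bidiff ϖ (1 / 2) p (-x) z = (-1 : ℝ) • (yDer N).bidiff ϖ (1 / 2) p x z := by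
    induction p generalizing x z with
    | zero => rw [CommDer.bidiff, CommDer.bidiff, neg_mul, neg_one_smul]
    | succ p ih =>
      simp only [CommDer.bidiff, map_neg, ih, smul_comm _ (-1 : ℝ), ← smul_sum]
  simp only [starProd, h0, smul_comm _ (-1 : ℝ)]
  rw [hs_smul, neg_one_smul]

lemma starProd_neg_right (x z : Ser N 0 1) :
    starProd (yDer N) ϖ x (-z) = -starProd (yDer N) ϖ x z := by
  have h0 (p : ℕ) (x z : Ser N 0 1) :
      (yDer N).bidiff ϖ (1 / 2) p x (-z) = (-1 : ℝ) • (yDer N).bidiff ϖ (1 / 2) p x z := by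
    induction p generalizing x z with
    | zero => rw [CommDer.bidiff, CommDer.bidiff, mul_neg, neg_one_smul]
    | succ p ih =>
      simp only [CommDer.bidiff, map_neg, ih, smul_comm _ (-1 : ℝ), ← smul_sum]
  simp only [starProd, h0, smul_comm _ (-1 : ℝ)]
  rw [hs_smul, neg_one_smul]

/-- `ħ Δ`, applied to the part of order `k` of the Feynman integral, contracts two of the
arguments to a commutator. -/
lemma X_mul_bv_wick (hϖ : ∀ i j, ϖ j i = -ϖ i j) {g : Ser N 0 1} (hg : HasBidegree 1 0 g)
    (b : 𝒵 (Ser N 0 1)) (hb : (b : Ser N 0 1) = negDTMSer g) (k : ℕ) :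
    PowerSeries.X * ∑ i, ∑ j, ϖ i j • (yDer N).d i (contractSer 𝕪 j
        (wick (yDer N) ϖ 1 (fun _ : Fin k => b))) =
      ∑ v, ∑ w, if w = v then 0 else wick (yDer N) ϖ (starProd (yDer N) ϖ g b -
        starProd (yDer N) ϖ b g) (update (update (fun _ : Fin k => b) v 1) w 1) := by
  rw [bv_wick yDer_hs hϖ (paritySer N 0 1) (fun i x => paritySer_pderivSer _ _)
    (fun j => contractSer 𝕪 j) (fun j => contractSer_mul _)
    (fun j i x => contractSer_pderivSer _ _ _) (fun j => contractSer_hs _) _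
    (fun v => by rw [hb, paritySer_negDTMSer hg.paritySer]) (fun _ => -g)
    (fun j v => by rw [hb]; exact contractSer_dy_negDTMSer hg j)]
  refine sum_congr rfl fun v _ => sum_congr rfl fun w _ => ?_
  split_ifs with h
  · subst h
    rw [update_self, OneMemClass.coe_one, starProd_one_left, starProd_one_right, sub_self,
      wick_zero]
  · rw [update_of_ne h, starProd_neg_left, starProd_neg_right, neg_sub_neg]

lemma X_mul_bv_wick_add_two (hϖ : ∀ i j, ϖ j i = -ϖ i j) {g : Ser N 0 1} (hg : HasBidegree 1 0 g)
    (b : 𝒵 (Ser N 0 1)) (hb : (b : Ser N 0 1) = negDTMSer g) (k : ℕ) :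
    PowerSeries.X * ∑ i, ∑ j, ϖ i j • (yDer N).d i (contractSer 𝕪 j
        (wick (yDer N) ϖ 1 (fun _ : Fin (k + 2) => b))) =
      (((k : ℝ) + 2) * (k + 1)) • wick (yDer N) ϖ (starProd (yDer N) ϖ g b -
        starProd (yDer N) ϖ b g) (fun _ : Fin k => b) := by
  rw [X_mul_bv_wick hϖ hg b hb]
  have h (v : Fin (k + 2)) : (∑ w, if w = v then 0 else wick (yDer N) ϖ (starProd (yDer N) ϖ g b -
      starProd (yDer N) ϖ b g) (update (update (fun _ : Fin (k + 2) => b) v 1) w 1)) =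
      ((k : ℝ) + 1) • wick (yDer N) ϖ (starProd (yDer N) ϖ g b -
        starProd (yDer N) ϖ b g) (fun _ : Fin k => b) := by
    rw [Finset.sum_ite, sum_const_zero, zero_add, sum_congr rfl fun w hw =>
      wick_update_update_one b _ (mem_filter.1 hw).2, Finset.sum_const,
      Finset.filter_ne', Finset.card_erase_of_mem (mem_univ v), card_univ,
      Fintype.card_fin, ← Nat.cast_smul_eq_nsmul ℝ]
    norm_num
  simp only [h]
  rw [Finset.sum_const, card_univ, Fintype.card_fin, ← Nat.cast_smul_eq_nsmul ℝ, smul_smul]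
  norm_num

lemma X_mul_bv_wick_of_le_one (hϖ : ∀ i j, ϖ j i = -ϖ i j) {g : Ser N 0 1} (hg : HasBidegree 1 0 g)
    (b : 𝒵 (Ser N 0 1)) (hb : (b : Ser N 0 1) = negDTMSer g) {k : ℕ}
    (hk : k ≤ 1) :
    PowerSeries.X * ∑ i, ∑ j, ϖ i j • (yDer N).d i (contractSer 𝕪 j
        (wick (yDer N) ϖ 1 (fun _ : Fin k => b))) = 0 := by
  rw [X_mul_bv_wick hϖ hg b hb]
  refine sum_eq_zero fun v _ => sum_eq_zero fun w _ => if_pos ?_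
  exact Fin.ext (by omega)

end MasterEquation

section MasterEquationSum

variable {N : ℕ} {ϖ : 𝕄 N}

lemma HasBidegree.starProd {p q p' q' : ℕ} {x z : Ser N 0 1} (hx : HasBidegree p q x)
    (hz : HasBidegree p' q' z) :
    HasBidegree (p + p') (q + q') (FedosovBV.starProd (yDer N) ϖ x z) := by
  refine HasBidegree.hs fun r => HasBidegree.smul _ ?_
  induction r generalizing x z with
  | zero => exact hx.mul hz
  | succ r ih => exact HasBidegree.smul _ (HasBidegree.sum fun i _ => HasBidegree.sum fun j _ =>
      HasBidegree.smul _ (ih (hx.d i) (hz.d j)))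

lemma HasBidegree.of_eq {p q p' q' : ℕ} {x : Ser N 0 1} (hx : HasBidegree p q x) (hp : p = p')
    (hq : q = q') : HasBidegree p' q' x := by
  subst hp hq
  exact hx

lemma HasBidegree.starProd_sub_starProd {g b : Ser N 0 1} (hg : HasBidegree 1 0 g)
    (hb : HasBidegree 1 1 b) : HasBidegree 2 1 (FedosovBV.starProd (yDer N) ϖ g b -
      FedosovBV.starProd (yDer N) ϖ b g) :=
  HasBidegree.sub ((hg.starProd hb).of_eq (one_add_one_eq_two) (zero_add 1))
    ((hb.starProd hg).of_eq (one_add_one_eq_two) (add_zero 1))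

lemma yDer_X (i : Fin N) : (yDer N).d i PowerSeries.X = 0 := by
  refine PowerSeries.ext fun n => ?_
  rw [coeff_yDer, PowerSeries.coeff_X]
  split_ifs
  · have h : pderivLin (0, i) (1 : Formal N 0 1) + pderivLin (0, i) (1 : Formal N 0 1) =
        pderivLin (0, i) (1 : Formal N 0 1) := by
      have := pderivLin_mul (0, i) (1 : Formal N 0 1) 1
      rwa [mul_one, mul_one, one_mul, eq_comm] at this
    rw [map_zero]
    exact add_eq_left.1 h
  · rw [map_zero, map_zero]

lemma wick_X_mul (b : 𝒵 (Ser N 0 1)) (x : Ser N 0 1) (k : ℕ) :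
    wick (yDer N) ϖ (PowerSeries.X * x) (fun _ : Fin k => b) =
      PowerSeries.X * wick (yDer N) ϖ x (fun _ : Fin k => b) :=
  wick_const_mul yDer_X x _

lemma sum_range_succ_eq_of_shift {M : Type*} [AddCommMonoid M] {f F : ℕ → M} {n : ℕ}
    (h0 : f 0 = 0) (h1 : f 1 = 0) (hf : ∀ k, f (k + 2) = F k) (hF : ∀ k, n < k + 2 → F k = 0) :
    ∑ k ∈ range (n + 1), f k = ∑ k ∈ range n, F k := by
  rcases n with _ | n
  · rw [Finset.sum_range_one, h0, Finset.sum_range_zero]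
  · rw [sum_range_succ', sum_range_succ', h0, h1, add_zero, add_zero,
      sum_range_succ _ n, hF n (Nat.lt_succ_self _), add_zero]
    exact sum_congr rfl fun k _ => hf k

lemma mul_neg_sub_eq {M : Type*} [Ring M] (u v w : M) : u * (-v - w) = -(u * v) - u * w := by
  rw [mul_sub, mul_neg]

section

variable {g x R : Ser N 0 1} {b : 𝒵 (Ser N 0 1)}

/-- The term of order `k` of the Feynman integral with first argument `z`. -/
def wickTerm (ϖ : 𝕄 N) (b : 𝒵 (Ser N 0 1)) (z : Ser N 0 1)
    (k : ℕ) : Ser N 0 1 := ((k.factorial : ℝ)⁻¹) • wick (yDer N) ϖ z (fun _ : Fin k => b)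

lemma wickTerm_eq_zero (hb : HasBidegree 1 1 (b : Ser N 0 1)) {z : Ser N 0 1}
    (hz : HasBidegree 2 1 z) {k : ℕ} (hk : N < k + 2) : wickTerm ϖ b z k = 0 := by
  have h : HasBidegree (2 + Fintype.card (Fin k)) (1 + Fintype.card (Fin k))
      (wick (yDer N) ϖ z (fun _ : Fin k => b)) :=
    HasBidegree.hs fun r => HasBidegree.polyDiff _ hz fun _ => hb
  rw [Fintype.card_fin] at h
  rw [wickTerm, h.eq_zero (by omega), smul_zero]

lemma X_mul_wickTerm (hϖ : ∀ i j, ϖ j i = -ϖ i j) {C : Ser N 0 1}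
    (hRd : ∀ i j, (yDer N).d i ((yDer N).d j R) = 0)
    (hx : PowerSeries.X * x = -(PowerSeries.X * R) - C) (k : ℕ) :
    PowerSeries.X * wickTerm ϖ b x k = -(PowerSeries.X * (R * wickTerm ϖ b 1 k)) -
      wickTerm ϖ b C k := by
  have h := congrArg (fun z => wick (yDer N) ϖ z (fun _ : Fin k => b)) hx
  simp only [sub_eq_add_neg, wick_add, wick_neg, wick_X_mul] at h
  rw [wick_of_d_d_eq_zero hϖ R hRd] at h
  simp only [wickTerm, mul_smul_comm]
  rw [h, smul_add, smul_neg, smul_neg, ← sub_eq_add_neg]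

lemma sum_wick_update_one (z : Ser N 0 1) (k : ℕ) : ((((k + 1).factorial : ℕ) : ℝ)⁻¹) •
      ∑ v : Fin (k + 1), wick (yDer N) ϖ z (update (fun _ => b) v 1) =
    wickTerm ϖ b z k := by
  simp only [wick_update_one]
  rw [Finset.sum_const, card_univ, Fintype.card_fin, ← Nat.cast_smul_eq_nsmul ℝ, smul_smul,
    Nat.factorial_succ, wickTerm]
  have hc : (((k + 1) * k.factorial : ℕ) : ℝ)⁻¹ * ((k + 1 : ℕ) : ℝ) = (k.factorial : ℝ)⁻¹ := by
    have := k.factorial_ne_zero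
    push_cast
    field_simp
  rw [hc]

lemma sum_hbarPow_mul_wick_update (hϖ : ∀ i j, ϖ j i = -ϖ i j) {C : Ser N 0 1}
    (hRd : ∀ i j, (yDer N).d i ((yDer N).d j R) = 0)
    (hx : PowerSeries.X * x = -(PowerSeries.X * R) - C) :
    (∑ k ∈ range (N + 1), hbarPow (-(k : ℤ)) * emb (((k.factorial : ℝ)⁻¹) •
        ∑ v : Fin k, wick (yDer N) ϖ x (update (fun _ => b) v 1))) =
      ∑ k ∈ range N, (-(hbarPow (-((k + 1 : ℕ) : ℤ)) * emb (R * wickTerm ϖ b 1 k)) -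
        hbarPow (-((k + 2 : ℕ) : ℤ)) * emb (wickTerm ϖ b C k)) := by
  rw [sum_range_succ', Finset.univ_eq_empty, sum_empty, smul_zero, map_zero, mul_zero, add_zero]
  refine sum_congr rfl fun k _ => ?_
  have h2 : (-((k + 1 : ℕ) : ℤ)) = -((k + 2 : ℕ) : ℤ) + 1 := by push_cast; ring
  rw [sum_wick_update_one, h2, ← hbarPow_mul_hbarPow, mul_assoc, mul_assoc, ← emb_X, ← map_mul,
    ← map_mul, X_mul_wickTerm hϖ hRd hx, map_sub, map_neg]
  exact mul_neg_sub_eq _ _ _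

lemma hbarPow_mul_bvDelta_wick (k : ℕ) : hbarPow 1 * bvDelta ϖ (hbarPow (-(k : ℤ)) *
      emb (((k.factorial : ℝ)⁻¹) • wick (yDer N) ϖ 1 (fun _ : Fin k => b))) =
    hbarPow (-(k : ℤ)) * emb (((k.factorial : ℝ)⁻¹) • (PowerSeries.X * ∑ i, ∑ j, ϖ i j •
      (yDer N).d i (contractSer 𝕪 j (wick (yDer N) ϖ 1 (fun _ : Fin k => b))))) := by
  rw [bvDelta_hbarPow_mul, bvDelta_emb, ← mul_assoc, hbarPow_mul_hbarPow, add_comm,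
    ← hbarPow_mul_hbarPow, mul_assoc, ← emb_X, ← map_mul]
  congr 2
  rw [← mul_smul_comm, smul_sum]
  congr 1
  refine sum_congr rfl fun i _ => ?_
  rw [smul_sum]
  refine sum_congr rfl fun j _ => ?_
  rw [map_smul, map_smul, smul_comm]

lemma inv_factorial_smul_X_mul_bv_wick (hϖ : ∀ i j, ϖ j i = -ϖ i j) (hg : HasBidegree 1 0 g)
    (hb : (b : Ser N 0 1) = negDTMSer g) (k : ℕ) :
    ((((k + 2).factorial : ℕ) : ℝ)⁻¹) • (PowerSeries.X * ∑ i, ∑ j, ϖ i j •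
      (yDer N).d i (contractSer 𝕪 j (wick (yDer N) ϖ 1 (fun _ : Fin (k + 2) => b)))) =
      wickTerm ϖ b (starProd (yDer N) ϖ g b - starProd (yDer N) ϖ b g) k := by
  rw [X_mul_bv_wick_add_two hϖ hg b hb, smul_smul, wickTerm]
  congr 1
  rw [Nat.factorial_succ, Nat.factorial_succ]
  have := k.factorial_ne_zero
  push_cast
  field_simp
  ring

lemma hbarPow_mul_bvDelta_wick_of_le_one (hϖ : ∀ i j, ϖ j i = -ϖ i j) (hg : HasBidegree 1 0 g)
    (hb : (b : Ser N 0 1) = negDTMSer g) {k : ℕ} (hk : k ≤ 1) :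
    hbarPow 1 * bvDelta ϖ (hbarPow (-(k : ℤ)) *
      emb (((k.factorial : ℝ)⁻¹) • wick (yDer N) ϖ 1 (fun _ : Fin k => b))) = 0 := by
  rw [hbarPow_mul_bvDelta_wick, X_mul_bv_wick_of_le_one hϖ hg b hb hk, smul_zero, map_zero,
    mul_zero]

lemma hbarPow_mul_bvDelta_wick_add_two (hϖ : ∀ i j, ϖ j i = -ϖ i j) (hg : HasBidegree 1 0 g)
    (hb : (b : Ser N 0 1) = negDTMSer g) (k : ℕ) :
    hbarPow 1 * bvDelta ϖ (hbarPow (-((k + 2 : ℕ) : ℤ)) *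
      emb ((((k + 2).factorial : ℝ)⁻¹) • wick (yDer N) ϖ 1 (fun _ : Fin (k + 2) => b))) =
      hbarPow (-((k + 2 : ℕ) : ℤ)) *
        emb (wickTerm ϖ b (starProd (yDer N) ϖ g b - starProd (yDer N) ϖ b g) k) := by
  rw [hbarPow_mul_bvDelta_wick, inv_factorial_smul_X_mul_bv_wick hϖ hg hb]

lemma hbarPow_mul_bvDelta_wickSum (hϖ : ∀ i j, ϖ j i = -ϖ i j) (hg : HasBidegree 1 0 g)
    (hb : (b : Ser N 0 1) = negDTMSer g) :
    hbarPow 1 * bvDelta ϖ (wickSum ϖ b) = ∑ k ∈ range N, hbarPow (-((k + 2 : ℕ) : ℤ)) *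
      emb (wickTerm ϖ b (starProd (yDer N) ϖ g b - starProd (yDer N) ϖ b g) k) := by
  have hb' : HasBidegree 1 1 (b : Ser N 0 1) := hb ▸ hg.negDTMSer
  have hC := hg.starProd_sub_starProd (ϖ := ϖ) hb'
  have h3 (k : ℕ) (hk : N < k + 2) : hbarPow (-((k + 2 : ℕ) : ℤ)) *
      emb (wickTerm ϖ b (starProd (yDer N) ϖ g b - starProd (yDer N) ϖ b g) k) = 0 := by
    rw [wickTerm_eq_zero hb' hC hk, map_zero, mul_zero]
  rw [wickSum, bvDelta_sum, mul_sum]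
  exact sum_range_succ_eq_of_shift (hbarPow_mul_bvDelta_wick_of_le_one hϖ hg hb zero_le_one)
    (hbarPow_mul_bvDelta_wick_of_le_one hϖ hg hb le_rfl)
    (hbarPow_mul_bvDelta_wick_add_two hϖ hg hb) h3

lemma hbarPow_mul_emb_mul_wickSum (hϖ : ∀ i j, ϖ j i = -ϖ i j)
    (hb : HasBidegree 1 1 (b : Ser N 0 1)) (hR : HasBidegree 2 1 R)
    (hRd : ∀ i j, (yDer N).d i ((yDer N).d j R) = 0) :
    hbarPow (-1) * emb R * wickSum ϖ b = ∑ k ∈ range N,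
      hbarPow (-((k + 1 : ℕ) : ℤ)) * emb (R * wickTerm ϖ b 1 k) := by
  rw [wickSum, mul_sum]
  have hterm (k : ℕ) : hbarPow (-1) * emb R * (hbarPow (-(k : ℤ)) *
      emb (((k.factorial : ℝ)⁻¹) • wick (yDer N) ϖ 1 (fun _ : Fin k => b))) =
        hbarPow (-((k + 1 : ℕ) : ℤ)) * emb (R * wickTerm ϖ b 1 k) := by
    rw [hbarPow_mul_emb_mul, wickTerm]
    congr 2
    push_cast
    ring
  rw [sum_congr rfl fun k _ => hterm k, sum_range_succ, add_eq_left]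
  have h : R * wickTerm ϖ b 1 N = wickTerm ϖ b R N := by
    rw [wickTerm, wickTerm, mul_smul_comm, wick_of_d_d_eq_zero hϖ R hRd]
  rw [h, wickTerm_eq_zero hb hR (by omega), map_zero, mul_zero]

end

/-- The quantum master equation at a point; `x` plays the part of the exterior covariant derivative
of the arguments of the Feynman integral. -/
lemma masterEquation_of_fedosov (hϖ : ∀ i j, ϖ j i = -ϖ i j) {g : Ser N 0 1}
    (hg : HasBidegree 1 0 g) (b : 𝒵 (Ser N 0 1))
    (hb : (b : Ser N 0 1) = negDTMSer g) {x R : Ser N 0 1} (hR : HasBidegree 2 1 R)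
    (hRd : ∀ i j, (yDer N).d i ((yDer N).d j R) = 0)
    (hx : PowerSeries.X * x = -(PowerSeries.X * R) - (starProd (yDer N) ϖ g b -
      starProd (yDer N) ϖ b g)) :
    (∑ k ∈ range (N + 1), hbarPow (-(k : ℤ)) * emb (((k.factorial : ℝ)⁻¹) •
        ∑ v : Fin k, wick (yDer N) ϖ x (update (fun _ => b) v 1))) +
      hbarPow 1 * bvDelta ϖ (wickSum ϖ b) + hbarPow (-1) * emb R * wickSum ϖ b = 0 := by
  rw [sum_hbarPow_mul_wick_update hϖ hRd hx, hbarPow_mul_bvDelta_wickSum hϖ hg hb,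
    hbarPow_mul_emb_mul_wickSum hϖ (hb ▸ hg.negDTMSer) hR hRd, sum_sub_distrib,
    sum_neg_distrib]
  abel

/-- The exterior derivative of the arguments of the Feynman integral, by Fedosov's equation. -/
lemma X_mul_negDTMSer_of_fedosov {g y R η b : Ser N 0 1} (hg : HasBidegree 1 0 g)
    (hb : b = negDTMSer g) (hη : negDTMSer η = 0)
    (hF : PowerSeries.X * y + starProd (yDer N) ϖ g g + PowerSeries.X * R = PowerSeries.X * η) :
    PowerSeries.X * -negDTMSer y = -(PowerSeries.X * -negDTMSer R) -
      (starProd (yDer N) ϖ g b - starProd (yDer N) ϖ b g) := by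
  have hX (z : Ser N 0 1) : negDTMSer (PowerSeries.X * z) = PowerSeries.X * negDTMSer z := by
    simp only [negDTMSer_eq, CommDer.leibniz, yDer_X, zero_mul, zero_add, mul_neg, mul_sum]
    refine congrArg _ (sum_congr rfl fun i _ => ?_)
    rw [← mul_assoc, ← mul_assoc, PowerSeries.X_mul]
  have hadd (z z' : Ser N 0 1) : negDTMSer (z + z') = negDTMSer z + negDTMSer z' := map_add _ _ _
  have h := congrArg negDTMSer hF
  rw [hadd, hadd, hX, hX, hX, hη, mul_zero, negDTMSer_starProd, hg.paritySer, starProd_neg_left,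
    ← hb] at h
  rw [mul_neg, mul_neg, neg_neg]
  have h' : PowerSeries.X * negDTMSer y = -(starProd (yDer N) ϖ b g + -starProd (yDer N) ϖ g b +
      PowerSeries.X * negDTMSer R) := by
    rw [eq_neg_iff_add_eq_zero, ← add_assoc]
    exact h
  rw [h']
  abel

end MasterEquationSum

/-! ### Smooth functions with values in the fibres, and their derivatives -/

section Derivatives

variable {N : ℕ} {M : Type*} [TopologicalSpace M] [ChartedSpace (Model N) M]
  [IsManifold 𝓘(ℝ, Model N) ∞ M]

/-- The real function `f` is smooth at `x₀` and its derivative along `v` is `c`. -/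
def HasSmoothDeriv (x₀ : M) (v : 𝒯 N x₀) (f : M → ℝ) (c : ℝ) : Prop :=
  CMD N f x₀ ∧ mvfderiv 𝓘(ℝ, Model N) f x₀ v = c

namespace HasSmoothDeriv

variable {x₀ : M} {v : 𝒯 N x₀} {f g : M → ℝ} {c d : ℝ}

lemma const (r : ℝ) : HasSmoothDeriv x₀ v (fun _ => r) 0 :=
  ⟨contMDiffAt_const, by rw [mvfderiv_const]; rfl⟩

lemma mdifferentiableAt (hf : HasSmoothDeriv x₀ v f c) :
    MDifferentiableAt 𝓘(ℝ, Model N) 𝓘(ℝ, ℝ) f x₀ := hf.1.mdifferentiableAt (by simp)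

lemma add (hf : HasSmoothDeriv x₀ v f c) (hg : HasSmoothDeriv x₀ v g d) :
    HasSmoothDeriv x₀ v (fun x => f x + g x) (c + d) := by
  refine ⟨hf.1.add hg.1, ?_⟩
  have h := mvfderiv_add hf.mdifferentiableAt hg.mdifferentiableAt
  rw [← hf.2, ← hg.2]
  exact DFunLike.congr_fun h v

lemma mul (hf : HasSmoothDeriv x₀ v f c) (hg : HasSmoothDeriv x₀ v g d) :
    HasSmoothDeriv x₀ v (fun x => f x * g x) (c * g x₀ + f x₀ * d) := by
  refine ⟨hf.1.mul hg.1, ?_⟩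
  have h := DFunLike.congr_fun (mvfderiv_mul hf.mdifferentiableAt hg.mdifferentiableAt) v
  rw [← hf.2, ← hg.2]
  refine h.trans ?_
  rw [_root_.add_apply, _root_.smul_apply, _root_.smul_apply, smul_eq_mul, smul_eq_mul]
  ring

lemma const_mul (r : ℝ) (hf : HasSmoothDeriv x₀ v f c) :
    HasSmoothDeriv x₀ v (fun x => r * f x) (r * c) := by
  have h := (const r).mul hf
  rwa [zero_mul, zero_add] at h

lemma sum {ι : Type*} (s : Finset ι) {f : ι → M → ℝ} {c : ι → ℝ}
    (h : ∀ i ∈ s, HasSmoothDeriv x₀ v (f i) (c i)) :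
    HasSmoothDeriv x₀ v (fun x => ∑ i ∈ s, f i x) (∑ i ∈ s, c i) := by
  classical
  induction s using Finset.induction_on with
  | empty => simpa only [sum_empty] using const 0
  | insert i s hi ih =>
    simp only [sum_insert hi]
    exact (h i (Finset.mem_insert_self _ _)).add (ih fun j hj => h j (Finset.mem_insert_of_mem hj))

lemma congr (hf : HasSmoothDeriv x₀ v f c) (h : f =ᶠ[nhds x₀] g) : HasSmoothDeriv x₀ v g c := by
  refine ⟨hf.1.congr_of_eventuallyEq h.symm, ?_⟩
  rw [← hf.2, mvfderiv, mvfderiv, h.mfderiv_eq]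
  rfl

lemma of_eq (hf : HasSmoothDeriv x₀ v f c) (h : c = d) : HasSmoothDeriv x₀ v f d := h ▸ hf

lemma unique (hf : HasSmoothDeriv x₀ v f c) (hg : HasSmoothDeriv x₀ v f d) : c = d :=
  hf.2.symm.trans hg.2

end HasSmoothDeriv

/-- All the components of the vector valued function `f` are smooth at `x₀`, with derivative along
`v` the component of `c`. -/
def HasSmoothDerivV {E : Type*} [AddCommGroup E] [Module ℝ E] (x₀ : M)
    (v : 𝒯 N x₀) (f : M → E) (c : E) : Prop :=
  ∀ ℓ : Dual ℝ E, HasSmoothDeriv x₀ v (fun x => ℓ (f x)) (ℓ c)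

namespace HasSmoothDerivV

variable {E F : Type*} [AddCommGroup E] [Module ℝ E] [AddCommGroup F] [Module ℝ F]
  {x₀ : M} {v : 𝒯 N x₀} {f g : M → E} {c d : E}

lemma const (z : E) : HasSmoothDerivV x₀ v (fun _ => z) 0 := fun ℓ => by
  rw [map_zero]; exact HasSmoothDeriv.const _

lemma add (hf : HasSmoothDerivV x₀ v f c) (hg : HasSmoothDerivV x₀ v g d) :
    HasSmoothDerivV x₀ v (fun x => f x + g x) (c + d) := fun ℓ => by
  simp only [map_add]
  exact (hf ℓ).add (hg ℓ)

lemma sum {ι : Type*} (s : Finset ι) {f : ι → M → E} {c : ι → E}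
    (h : ∀ i ∈ s, HasSmoothDerivV x₀ v (f i) (c i)) :
    HasSmoothDerivV x₀ v (fun x => ∑ i ∈ s, f i x) (∑ i ∈ s, c i) := fun ℓ => by
  simp only [map_sum]
  exact HasSmoothDeriv.sum s fun i hi => h i hi ℓ

lemma map (L : E →ₗ[ℝ] F) (hf : HasSmoothDerivV x₀ v f c) :
    HasSmoothDerivV x₀ v (fun x => L (f x)) (L c) := fun ℓ => hf (ℓ ∘ₗ L)

lemma smul {p : M → ℝ} {p' : ℝ} (hp : HasSmoothDeriv x₀ v p p') (hf : HasSmoothDerivV x₀ v f c) :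
    HasSmoothDerivV x₀ v (fun x => p x • f x) (p' • f x₀ + p x₀ • c) := fun ℓ => by
  simp only [map_smul, map_add, smul_eq_mul]
  exact hp.mul (hf ℓ)

lemma const_smul (r : ℝ) (hf : HasSmoothDerivV x₀ v f c) :
    HasSmoothDerivV x₀ v (fun x => r • f x) (r • c) := hf.map (r • LinearMap.id)

lemma congr (hf : HasSmoothDerivV x₀ v f c) (h : f =ᶠ[nhds x₀] g) :
    HasSmoothDerivV x₀ v g c := fun ℓ => (hf ℓ).congr (h.mono fun x hx => congrArg ℓ hx)

lemma of_basis {ι : Type*} [Fintype ι] (B : Basis ι ℝ E)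
    (h : ∀ i, HasSmoothDeriv x₀ v (fun x => B.repr (f x) i) (B.repr c i)) :
    HasSmoothDerivV x₀ v f c := fun ℓ => by
  have h1 (z : E) : ℓ z = ∑ i, ℓ (B i) * B.repr z i := by
    conv_lhs => rw [← B.sum_repr z]
    simp only [map_sum, map_smul, smul_eq_mul, mul_comm]
  have h2 : (fun x => ℓ (f x)) = fun x => ∑ i, ℓ (B i) * B.repr (f x) i := funext fun x => h1 _
  rw [h1 c, h2]
  exact HasSmoothDeriv.sum _ fun i _ => (h i).const_mul _

/-- The Leibniz rule. -/
lemma mul {A ι : Type*} [Ring A] [Algebra ℝ A] [Fintype ι] (B : Basis ι ℝ A) {f g : M → A}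
    {c d : A} (hf : HasSmoothDerivV x₀ v f c) (hg : HasSmoothDerivV x₀ v g d) :
    HasSmoothDerivV x₀ v (fun x => f x * g x) (c * g x₀ + f x₀ * d) := by
  have h1 (y z : A) : y * z = ∑ i, B.coord i y • (B i * z) := by
    conv_lhs => rw [← B.sum_repr y]
    simp only [sum_mul, smul_mul_assoc, Basis.coord_apply]
  have h (i : ι) : HasSmoothDerivV x₀ v (fun x => B.coord i (f x) • (B i * g x))
      (B.coord i c • (B i * g x₀) + B.coord i (f x₀) • (B i * d)) :=
    HasSmoothDerivV.smul (hf (B.coord i)) (hg.map (LinearMap.mulLeft ℝ (B i)))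
  have h2 : (fun x => f x * g x) = fun x => ∑ i, B.coord i (f x) • (B i * g x) :=
    funext fun x => h1 _ _
  rw [h1 c (g x₀), h1 (f x₀) d, ← sum_add_distrib, h2]
  exact HasSmoothDerivV.sum _ fun i _ => h i

/-- The derivative of a function with values in a subspace belongs to the subspace. -/
lemma mem (S : Submodule ℝ E) (hf : HasSmoothDerivV x₀ v f c) (h : ∀ x, f x ∈ S) : c ∈ S := by
  by_contra hc
  obtain ⟨ℓ, hℓ, hS⟩ := Submodule.exists_dual_map_eq_bot_of_notMem hc inferInstance
  refine hℓ ((hf ℓ).unique ?_)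
  have h0 : (fun x => ℓ (f x)) = fun _ => 0 := funext fun x => by
    have : ℓ (f x) ∈ S.map ℓ := Submodule.mem_map_of_mem (h x)
    rwa [hS, Submodule.mem_bot] at this
  rw [h0]
  exact HasSmoothDeriv.const 0

end HasSmoothDerivV

/-- All the coefficients of the function `f` with values in the power series are smooth at `x₀`,
with derivative along `v` the coefficient of `c`. -/
def HasSmoothDerivS (x₀ : M) (v : 𝒯 N x₀) (f : M → Ser N 0 1) (c : Ser N 0 1) : Prop :=
  ∀ n β, HasSmoothDerivV x₀ v (fun x => MvPowerSeries.coeff β (coeff n (f x)))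
    (MvPowerSeries.coeff β (coeff n c))

namespace HasSmoothDerivS

variable {x₀ : M} {v : 𝒯 N x₀} {f g : M → Ser N 0 1} {c d : Ser N 0 1}

lemma const (z : Ser N 0 1) : HasSmoothDerivS x₀ v (fun _ => z) 0 := fun n β => by
  rw [map_zero, map_zero]; exact HasSmoothDerivV.const _

lemma add (hf : HasSmoothDerivS x₀ v f c) (hg : HasSmoothDerivS x₀ v g d) :
    HasSmoothDerivS x₀ v (fun x => f x + g x) (c + d) := fun n β => by
  simp only [map_add]
  exact (hf n β).add (hg n β)

lemma sum {ι : Type*} (s : Finset ι) {f : ι → M → Ser N 0 1} {c : ι → Ser N 0 1}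
    (h : ∀ i ∈ s, HasSmoothDerivS x₀ v (f i) (c i)) :
    HasSmoothDerivS x₀ v (fun x => ∑ i ∈ s, f i x) (∑ i ∈ s, c i) := fun n β => by
  simp only [map_sum]
  exact HasSmoothDerivV.sum s fun i hi => h i hi n β

lemma coeff_smul (r : ℝ) (z : Ser N 0 1) (n : ℕ) (β : (Fin 1 × Fin N) →₀ ℕ) :
    MvPowerSeries.coeff β (coeff n (r • z)) = r • MvPowerSeries.coeff β (coeff n z) := by
  rw [← coeff_real_smul]
  rfl

lemma smul {p : M → ℝ} {p' : ℝ} (hp : HasSmoothDeriv x₀ v p p') (hf : HasSmoothDerivS x₀ v f c) :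
    HasSmoothDerivS x₀ v (fun x => p x • f x) (p' • f x₀ + p x₀ • c) := fun n β => by
  simp only [map_add, coeff_smul]
  exact (hf n β).smul hp

lemma const_smul (r : ℝ) (hf : HasSmoothDerivS x₀ v f c) :
    HasSmoothDerivS x₀ v (fun x => r • f x) (r • c) := fun n β => by
  simp only [coeff_smul]
  exact (hf n β).const_smul r

lemma congr (hf : HasSmoothDerivS x₀ v f c) (h : f =ᶠ[nhds x₀] g) :
    HasSmoothDerivS x₀ v g c := fun n β =>
  (hf n β).congr (h.mono fun x hx => by dsimp only; rw [hx])

lemma of_eq (hf : HasSmoothDerivS x₀ v f c) (h : c = d) : HasSmoothDerivS x₀ v f d := h ▸ hf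

lemma mul (hf : HasSmoothDerivS x₀ v f c) (hg : HasSmoothDerivS x₀ v g d) :
    HasSmoothDerivS x₀ v (fun x => f x * g x) (c * g x₀ + f x₀ * d) := fun n β => by
  classical
  simp only [map_add, PowerSeries.coeff_mul, map_sum, MvPowerSeries.coeff_mul, ← sum_add_distrib]
  exact HasSmoothDerivV.sum _ fun p _ => HasSmoothDerivV.sum _ fun q _ =>
    HasSmoothDerivV.mul (grBasis N 0 1) (hf _ _) (hg _ _)

lemma hs {ψ : ℕ → M → Ser N 0 1} {φ : ℕ → Ser N 0 1} (h : ∀ r, HasSmoothDerivS x₀ v (ψ r) (φ r)) :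
    HasSmoothDerivS x₀ v (fun x => FedosovBV.hs fun r => ψ r x) (FedosovBV.hs φ) := fun n β => by
  simp only [coeff_hs, map_sum]
  exact HasSmoothDerivV.sum _ fun p _ => h _ _ _

lemma pderiv (i : Fin N) (hf : HasSmoothDerivS x₀ v f c) :
    HasSmoothDerivS x₀ v (fun x => (yDer N).d i (f x)) ((yDer N).d i c) := fun n β => by
  have h (z : Formal N 0 1) : MvPowerSeries.coeff β (pderivLin (0, i) z) =
      ((β (0, i) : ℝ) + 1) • MvPowerSeries.coeff (β + Finsupp.single (0, i) 1) z := by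
    refine (coeff_pderivHom _ _ _).trans ?_
    have h1 : ((β (0, i) : Grassmann N 0 1) + 1) = ((β (0, i) : ℝ) + 1) • 1 := by
      rw [add_smul, one_smul, Nat.cast_smul_eq_nsmul, nsmul_one]
    rw [h1, mul_smul_comm, mul_one]
  simp only [coeff_yDer, h]
  exact (hf n _).const_smul _

lemma shiftDown (k : ℕ) (hf : HasSmoothDerivS x₀ v f c) :
    HasSmoothDerivS x₀ v (fun x => FedosovBV.shiftDown k (f x)) (FedosovBV.shiftDown k c) :=
  fun n β => by
    simp only [FedosovBV.shiftDown, coeff_mk]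
    exact hf _ _

lemma hasBidegree {p q : ℕ} (hf : HasSmoothDerivS x₀ v f c) (h : ∀ x, HasBidegree p q (f x)) :
    HasBidegree p q c := fun n β => (hf n β).mem _ fun x => h x n β

lemma negDTMSer (hf : HasSmoothDerivS x₀ v f c) :
    HasSmoothDerivS x₀ v (fun x => FedosovBV.negDTMSer (f x)) (FedosovBV.negDTMSer c) := by
  have h : HasSmoothDerivS x₀ v (fun x => (-1 : ℝ) • ∑ i, oddSer 𝕪 i *
      (yDer N).d i (f x)) ((-1 : ℝ) • ∑ i, oddSer 𝕪 i *
      (yDer N).d i c) := by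
    refine const_smul _ (sum _ fun i _ => ?_)
    have := (const (oddSer 𝕪 i)).mul (hf.pderiv i)
    rwa [zero_mul, zero_add] at this
  simpa only [neg_one_smul, ← negDTMSer_eq] using h

end HasSmoothDerivS

end Derivatives

/-! ### Infinitesimal changes of the frame -/

section FrameDerivation

variable {N : ℕ}

/-- The fibre coordinate `y k`. -/
def ySer (k : Fin N) : Ser N 0 1 := PowerSeries.C (MvPowerSeries.X (0, k))

lemma yvar_eq_emb (k : Fin N) : (yvar 0 k : BV N) = emb (ySer k) := (emb_C _).symm

lemma ySer_mul_comm (k : Fin N) (x : Ser N 0 1) : ySer k * x = x * ySer k := by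
  refine PowerSeries.ext fun n => ?_
  rw [ySer, PowerSeries.coeff_C_mul, PowerSeries.coeff_mul_C]
  exact MvPowerSeries.X_mul

lemma yDer_ySer (i k : Fin N) : (yDer N).d i (ySer k) = if i = k then 1 else 0 := by
  refine PowerSeries.ext fun n => ?_
  have h : pderivLin (0, i) (MvPowerSeries.X (0, k) : Formal N 0 1) = if i = k then 1 else 0 := by
    refine (pderivHom_X _ _).trans ?_
    simp [eq_comm]
  rw [coeff_yDer, ySer, PowerSeries.coeff_C]
  split_ifs with hn hi hi
  · rw [h, if_pos hi, hn, PowerSeries.coeff_zero_one]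
  · rw [h, if_neg hi, map_zero]
  · rw [map_zero, PowerSeries.coeff_one, if_neg hn]
  · rw [map_zero, map_zero]

lemma hasBidegree_ySer_mul {p q : ℕ} {x : Ser N 0 1} (hx : HasBidegree p q x) (k : Fin N) :
    HasBidegree p q (ySer k * x) := by
  have h : HasBidegree 0 0 (ySer k : Ser N 0 1) := by
    intro n β
    classical
    rw [ySer, PowerSeries.coeff_C]
    split_ifs
    · rw [MvPowerSeries.coeff_X]
      split_ifs
      · exact one_mem_bidegree
      · exact zero_mem _
    · rw [map_zero]
      exact zero_mem _
  exact (h.mul hx).of_eq (zero_add _) (zero_add _)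

lemma contractSer_dy_eq_zero {g : Ser N 0 1} (hg : HasBidegree 1 0 g) (j : Fin N) :
    contractSer 𝕪 j g = 0 := by
  refine PowerSeries.ext fun n => MvPowerSeries.ext fun β => ?_
  have h := hg n β
  rw [bidegree, pow_one, pow_zero, mul_one] at h
  exact contractGen_dy_of_mem_span j h

/-- The even derivation which sends `y i` to `∑ k, Γ i k y k` and `dy i` to `∑ k, Γ i k dy k`. -/
def frameDer (Γ : 𝕄 N) : End ℝ (Ser N 0 1) :=
  ∑ i, ∑ k, Γ i k • (LinearMap.mulLeft ℝ (ySer k) * (yDer N).d i +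
    LinearMap.mulLeft ℝ (oddSer 𝕪 k) * contractSer 𝕪 i)

variable (Γ : 𝕄 N)

lemma frameDer_apply (x : Ser N 0 1) : frameDer Γ x = ∑ i, ∑ k, Γ i k • (ySer k * (yDer N).d i x +
    oddSer 𝕪 k * contractSer 𝕪 i x) := by
  simp only [frameDer, LinearMap.sum_apply, LinearMap.smul_apply, LinearMap.add_apply]
  rfl

lemma paritySer_paritySer (x : Ser N 0 1) : paritySer N 0 1 (paritySer N 0 1 x) = x := by
  refine PowerSeries.ext fun n => MvPowerSeries.ext fun β => ?_
  rw [paritySer_eq, paritySer_eq, coeff_cmapLin, coeff_cmapLin]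
  exact CliffordAlgebra.involute_involute _

lemma frameDer_mul (x z : Ser N 0 1) :
    frameDer Γ (x * z) = frameDer Γ x * z + x * frameDer Γ z := by
  have h (i k : Fin N) : ySer k * (yDer N).d i (x * z) + oddSer 𝕪 k * contractSer 𝕪 i (x * z) =
      (ySer k * (yDer N).d i x + oddSer 𝕪 k * contractSer 𝕪 i x) * z +
      x * (ySer k * (yDer N).d i z + oddSer 𝕪 k * contractSer 𝕪 i z) := by
    rw [CommDer.leibniz, contractSer_mul, mul_add, mul_add, mul_add, add_mul, ← mul_assoc,
      ← mul_assoc (ySer k) x, ySer_mul_comm k x, mul_assoc x, ← mul_assoc _ _ z,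
      ← mul_assoc (oddSer _) (paritySer _ _ _ x), oddSer_mul_eq _ (paritySer _ _ _ x),
      paritySer_paritySer, mul_assoc x]
    abel
  rw [frameDer_apply, frameDer_apply, frameDer_apply, sum_mul, mul_sum, ← sum_add_distrib]
  refine sum_congr rfl fun i _ => ?_
  rw [sum_mul, mul_sum, ← sum_add_distrib]
  refine sum_congr rfl fun k _ => ?_
  rw [h, smul_add, smul_mul_assoc, mul_smul_comm]

lemma frameDer_one : frameDer Γ 1 = 0 := by
  have h := frameDer_mul Γ 1 1
  rwa [mul_one, mul_one, one_mul, left_eq_add] at h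

lemma frameDer_hs (ψ : ℕ → Ser N 0 1) : frameDer Γ (hs ψ) = hs fun r => frameDer Γ (ψ r) := by
  simp only [frameDer_apply, hs_sum, hs_smul, hs_add, ← mul_hs, ← yDer_hs, ← contractSer_hs]

lemma frameDer_d (l : Fin N) (x : Ser N 0 1) :
    frameDer Γ ((yDer N).d l x) = (yDer N).d l (frameDer Γ x) - ∑ i, Γ i l • (yDer N).d i x := by
  have h (i k : Fin N) : (yDer N).d l (ySer k * (yDer N).d i x + oddSer 𝕪 k * contractSer 𝕪 i x) =
      (if l = k then (yDer N).d i x else 0) + (ySer k * (yDer N).d i ((yDer N).d l x) +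
      oddSer 𝕪 k * contractSer 𝕪 i ((yDer N).d l x)) := by
    have h1 : contractSer 𝕪 i ((yDer N).d l x) =
      (yDer N).d l (contractSer 𝕪 i x) := contractSer_pderivSer _ _ _
    rw [map_add, CommDer.leibniz, yDer_ySer, yDer_oddSer_mul, h1, (yDer N).comm l i, ite_mul,
      one_mul, zero_mul, add_assoc]
  rw [eq_sub_iff_add_eq, frameDer_apply, frameDer_apply, map_sum, ← sum_add_distrib]
  refine sum_congr rfl fun i _ => ?_
  rw [map_sum]
  simp only [map_smul, h, smul_add (Γ i _) (ite _ _ _), sum_add_distrib, smul_ite, smul_zero]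
  rw [Finset.sum_ite_eq, if_pos (mem_univ _), add_comm]

lemma frameDer_dy (m : Fin N) : frameDer Γ (oddSer 𝕪 m) = ∑ k, Γ m k • oddSer 𝕪 k := by
  rw [frameDer_apply, sum_eq_single m]
  · refine sum_congr rfl fun k _ => ?_
    rw [yDer_oddSer, mul_zero, zero_add, contractSer_oddSer, if_pos rfl, mul_one]
  · intro i _ hi
    refine sum_eq_zero fun k _ => ?_
    rw [yDer_oddSer, mul_zero, zero_add, contractSer_oddSer, if_neg (by simpa using hi), mul_zero,
      smul_zero]
  · simp

lemma frameDer_negDTMSer (x : Ser N 0 1) : frameDer Γ (negDTMSer x) = negDTMSer (frameDer Γ x) := by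
  have h : ∑ m, (∑ k, Γ m k • oddSer 𝕪 k) * (yDer N).d m x =
      ∑ m, oddSer 𝕪 m * ∑ i, Γ i m • (yDer N).d i x := by
    simp only [sum_mul, mul_sum, smul_mul_assoc, mul_smul_comm]
    exact sum_comm
  rw [negDTMSer_eq, negDTMSer_eq, map_neg, map_sum]
  simp only [frameDer_mul, frameDer_dy, frameDer_d, mul_sub, sum_add_distrib, sum_sub_distrib]
  rw [h, add_sub_cancel]

lemma HasBidegree.frameDer {g : Ser N 0 1} (hg : HasBidegree 1 0 g) :
    HasBidegree 1 0 (FedosovBV.frameDer Γ g) := by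
  rw [frameDer_apply]
  refine HasBidegree.sum fun i _ => HasBidegree.sum fun k _ => HasBidegree.smul _ ?_
  rw [contractSer_dy_eq_zero hg, mul_zero, add_zero]
  exact hasBidegree_ySer_mul (hg.d i) k

end FrameDerivation

section PolynomialFamilies

variable {N : ℕ} {M : Type*} [TopologicalSpace M] [ChartedSpace (Model N) M]
  [IsManifold 𝓘(ℝ, Model N) ∞ M] {R R' : Type*} [CommRing R] [Algebra ℝ R] [CommRing R']
  [Algebra ℝ R']

/-- The function `f` with values in the algebra `R` is a finite sum of constants multiplied with
functions which are smooth at `x₀`, and its derivative along `v` is `c`. -/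
inductive HasSmoothDerivP (x₀ : M) (v : 𝒯 N x₀) : (M → R) → R → Prop
  | smul (p : M → ℝ) (p' : ℝ) (g : R) (h : HasSmoothDeriv x₀ v p p') :
      HasSmoothDerivP x₀ v (fun x => p x • g) (p' • g)
  | add (f g : M → R) (c d : R) (hf : HasSmoothDerivP x₀ v f c) (hg : HasSmoothDerivP x₀ v g d) :
      HasSmoothDerivP x₀ v (fun x => f x + g x) (c + d)

namespace HasSmoothDerivP

variable {x₀ : M} {v : 𝒯 N x₀} {f g : M → R} {c d : R}

lemma const (r : R) : HasSmoothDerivP x₀ v (fun _ => r) 0 := by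
  have h := smul (x₀ := x₀) (v := v) (fun _ => 1) 0 r (HasSmoothDeriv.const 1)
  simpa only [one_smul, zero_smul] using h

lemma sum {ι : Type*} (s : Finset ι) {f : ι → M → R} {c : ι → R}
    (h : ∀ i ∈ s, HasSmoothDerivP x₀ v (f i) (c i)) :
    HasSmoothDerivP x₀ v (fun x => ∑ i ∈ s, f i x) (∑ i ∈ s, c i) := by
  classical
  induction s using Finset.induction_on with
  | empty => simpa only [sum_empty] using const 0
  | insert i s hi ih =>
    simp only [sum_insert hi]
    exact add _ _ _ _ (h i (Finset.mem_insert_self _ _))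
      (ih fun j hj => h j (Finset.mem_insert_of_mem hj))

lemma map (L : R →ₗ[ℝ] R') (hf : HasSmoothDerivP x₀ v f c) :
    HasSmoothDerivP x₀ v (fun x => L (f x)) (L c) := by
  induction hf with
  | smul p p' g h =>
    simp only [map_smul]
    exact smul p p' _ h
  | add f g c d _ _ hf hg =>
    simp only [map_add]
    exact add _ _ _ _ hf hg

lemma const_smul (r : ℝ) (hf : HasSmoothDerivP x₀ v f c) :
    HasSmoothDerivP x₀ v (fun x => r • f x) (r • c) :=
  hf.map (r • (LinearMap.id : R →ₗ[ℝ] R))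

lemma mul (hf : HasSmoothDerivP x₀ v f c) (hg : HasSmoothDerivP x₀ v g d) :
    HasSmoothDerivP x₀ v (fun x => f x * g x) (c * g x₀ + f x₀ * d) := by
  induction hf with
  | smul p p' a h =>
    induction hg with
    | smul q q' b h' =>
      have h1 := smul (x₀ := x₀) (v := v) _ _ (a * b) (h.mul h')
      simpa only [smul_mul_smul_comm, add_smul] using h1
    | add g₁ g₂ c₁ c₂ _ _ h₁ h₂ =>
      have h3 := add _ _ _ _ h₁ h₂
      simp only [mul_add]
      convert h3 using 1
      abel
  | add f₁ f₂ c₁ c₂ _ _ h₁ h₂ =>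
    have h3 := add _ _ _ _ h₁ h₂
    simp only [add_mul]
    convert h3 using 1
    abel

/-- If the derivatives of all the factors are given by a derivation, so is the derivative of the
product. -/
lemma prod_derivation (δ : Derivation ℝ R R) {ι : Type*} (s : Finset ι) {f : ι → M → R}
    (h : ∀ i ∈ s, HasSmoothDerivP x₀ v (f i) (δ (f i x₀))) :
    HasSmoothDerivP x₀ v (fun x => ∏ i ∈ s, f i x) (δ (∏ i ∈ s, f i x₀)) := by
  classical
  induction s using Finset.induction_on with
  | empty => simpa only [Finset.prod_empty, Derivation.map_one_eq_zero] using const 1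
  | insert i s hi ih =>
    simp only [prod_insert hi]
    have h1 := (h i (Finset.mem_insert_self _ _)).mul
      (ih fun j hj => h j (Finset.mem_insert_of_mem hj))
    convert h1 using 1
    rw [Derivation.leibniz, smul_eq_mul, smul_eq_mul, add_comm, mul_comm _ (δ (f i x₀))]

end HasSmoothDerivP

end PolynomialFamilies

section WickDerivative

variable {N : ℕ} {M : Type*} [TopologicalSpace M] [ChartedSpace (Model N) M]
  [IsManifold 𝓘(ℝ, Model N) ∞ M] {U : Type*} (Γ : 𝕄 N)

/-- The derivation of the symbols which corresponds to the commutator of the partial derivatives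
with `frameDer Γ`. -/
def symbolDer (U : Type*) : Derivation ℝ (𝒫[U, N]) (𝒫[U, N]) :=
  MvPolynomial.mkDerivation ℝ fun p => ∑ i, Γ i p.2 • X (p.1, i)

lemma symbolDer_X (u : U) (l : Fin N) : symbolDer Γ U (X (u, l)) = ∑ i, Γ i l • X (u, i) :=
  MvPolynomial.mkDerivation_X _ _ _

lemma symbolDer_contrSymbol (ϖ : 𝕄 N) (u w : U) : symbolDer Γ U (CommDer.contrSymbol ϖ u w) =
      CommDer.contrSymbol (Γ * ϖ + ϖ * Γ.transpose) u w := by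
  have h1 : ∑ i, ∑ j, ∑ k, (ϖ i j * Γ k i) • (X (u, k) * X (w, j) : 𝒫[U, N]) =
      ∑ i, ∑ j, ∑ k, (Γ i k * ϖ k j) • (X (u, i) * X (w, j)) := by
    rw [sum_comm, sum_comm (s := univ (α := Fin N))
      (f := fun i j => ∑ k, (Γ i k * ϖ k j) • (X (u, i) * X (w, j) : 𝒫[U, N]))]
    refine sum_congr rfl fun j _ => ?_
    rw [sum_comm]
    simp only [mul_comm]
  have h2 : ∑ i, ∑ j, ∑ k, (ϖ i j * Γ k j) • (X (u, i) * X (w, k) : 𝒫[U, N]) =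
      ∑ i, ∑ j, ∑ k, (ϖ i k * Γ j k) • (X (u, i) * X (w, j)) :=
    sum_congr rfl fun i _ => sum_comm
  rw [CommDer.contrSymbol, CommDer.contrSymbol, map_sum]
  simp only [map_sum, Derivation.map_smul, Derivation.leibniz, symbolDer_X, smul_eq_mul,
    mul_sum, mul_smul_comm, smul_add, smul_sum, smul_smul, sum_add_distrib,
    Matrix.add_apply, Matrix.mul_apply, Matrix.transpose_apply, add_smul, sum_smul]
  rw [h2, add_comm, ← h1]
  simp only [mul_comm (X (w, _))]

variable {x₀ : M} {v : 𝒯 N x₀}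

lemma hasSmoothDerivP_contrSymbol {ϖ : M → 𝕄 N} (hϖ : ∀ i j, HasSmoothDeriv x₀ v (fun x => ϖ x i j)
      (-(Γ * ϖ x₀ + ϖ x₀ * Γ.transpose) i j)) (u w : U) :
    HasSmoothDerivP x₀ v (fun x => CommDer.contrSymbol (ϖ x) u w)
      ((-symbolDer Γ U) (CommDer.contrSymbol (ϖ x₀) u w)) := by
  rw [Derivation.neg_apply, symbolDer_contrSymbol]
  simp only [CommDer.contrSymbol]
  rw [← sum_neg_distrib]
  refine HasSmoothDerivP.sum _ fun i _ => ?_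
  rw [← sum_neg_distrib]
  refine HasSmoothDerivP.sum _ fun j _ => ?_
  rw [← neg_smul]
  exact HasSmoothDerivP.smul _ _ _ (hϖ i j)

/-- The symbol of the Feynman integral as a sum over the words in the edges. -/
lemma wickSymbol_eq_sum (ϖ : 𝕄 N) [Fintype U] [DecidableEq U] (r : ℕ) :
    wickSymbol ϖ U r = ∑ e : Fin r → U × U, ((r.factorial : ℝ)⁻¹ * circleMean U (∏ s, X (e s))) •
        ∏ s, (1 / 2 : ℝ) • CommDer.contrSymbol ϖ (e s).1 (e s).2 := by
  have h1 : edgeSum ϖ U = ∑ e : U × U, X e * C ((1 / 2 : ℝ) • CommDer.contrSymbol ϖ e.1 e.2) := by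
    rw [edgeSum, Fintype.sum_prod_type]
  have h2 (c : ℝ) (z : MvPolynomial (U × U) (𝒫[U, N])) :
      meanOver U _ (c • z) = c • meanOver U _ z := by
    rw [← algebraMap_smul (𝒫[U, N]) c z, map_smul, algebraMap_smul]
  rw [wickSymbol, divPow, h2, h1, Fintype.sum_pow, map_sum, smul_sum]
  refine sum_congr rfl fun e _ => ?_
  have h3 : (∏ s, X (e s) : MvPolynomial (U × U) (𝒫[U, N])) =
      MvPolynomial.map (algebraMap ℝ _) (∏ s, X (e s)) := by
    rw [map_prod]
    simp only [map_X]
  rw [prod_mul_distrib, ← map_prod, mul_comm, meanOver_C_mul, h3, meanOver_map_algebraMap,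
    mul_smul, mul_comm, ← Algebra.smul_def]

lemma hasSmoothDerivP_wickSymbol {ϖ : M → 𝕄 N} (hϖ : ∀ i j, HasSmoothDeriv x₀ v (fun x => ϖ x i j)
      (-(Γ * ϖ x₀ + ϖ x₀ * Γ.transpose) i j)) [Fintype U] [DecidableEq U] (r : ℕ) :
    HasSmoothDerivP x₀ v (fun x => wickSymbol (ϖ x) U r)
      (-symbolDer Γ U (wickSymbol (ϖ x₀) U r)) := by
  rw [← Derivation.neg_apply]
  simp only [wickSymbol_eq_sum, map_sum]
  refine HasSmoothDerivP.sum _ fun e _ => ?_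
  rw [Derivation.map_smul]
  refine HasSmoothDerivP.const_smul _ ?_
  refine HasSmoothDerivP.prod_derivation (-symbolDer Γ U) _ fun s _ => ?_
  rw [Derivation.map_smul]
  exact HasSmoothDerivP.const_smul _ (hasSmoothDerivP_contrSymbol Γ hϖ _ _)

open CommDer

variable {V : Type*} [Fintype V] [DecidableEq V] {Γ}

lemma hasSmoothDerivS_prod {a : M → V → 𝒵 (Ser N 0 1)} {δ : V → 𝒵 (Ser N 0 1)}
    (ha : ∀ w, HasSmoothDerivS x₀ v (fun x => (a x w : Ser N 0 1))
      (δ w + frameDer Γ (a x₀ w))) (s : Finset V) :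
    HasSmoothDerivS x₀ v (fun x => ((∏ w ∈ s, a x w : 𝒵 (Ser N 0 1)) : Ser N 0 1))
      ((∑ w ∈ s, ∏ u ∈ s, update (a x₀) w (δ w) u : 𝒵 (Ser N 0 1)) +
        frameDer Γ (∏ w ∈ s, a x₀ w : 𝒵 (Ser N 0 1))) := by
  induction s using Finset.induction with
  | empty =>
    simp only [Finset.prod_empty, sum_empty, OneMemClass.coe_one, frameDer_one,
      ZeroMemClass.coe_zero, add_zero]
    exact HasSmoothDerivS.const 1
  | insert w s hw ih =>
    have h1 := (ha w).mul ih
    simp only [prod_insert hw, MulMemClass.coe_mul]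
    refine h1.of_eq ?_
    have h2 : (∑ u ∈ insert w s, update (a x₀) u (δ u) w * ∏ u' ∈ s, update (a x₀) u (δ u) u') =
        δ w * ∏ u ∈ s, a x₀ u + a x₀ w * ∑ u ∈ s, ∏ u' ∈ s, update (a x₀) u (δ u) u' := by
      rw [sum_insert hw, update_self, mul_sum]
      congr 1
      · congr 1
        refine prod_congr rfl fun u hu => ?_
        rw [update_of_ne (by rintro rfl; exact hw hu)]
      · refine sum_congr rfl fun u hu => ?_
        rw [update_of_ne (by rintro rfl; exact hw hu)]
    rw [h2, frameDer_mul, AddMemClass.coe_add, MulMemClass.coe_mul, MulMemClass.coe_mul, add_mul,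
      mul_add]
    abel

/-- The total derivative of a polydifferential operator with constant coefficients, applied to
functions of the base point. -/
lemma hasSmoothDerivS_polyDiff_const (g : 𝒫[Option V, N])
    {a : M → V → 𝒵 (Ser N 0 1)} {δ : V → 𝒵 (Ser N 0 1)}
    (ha : ∀ w, HasSmoothDerivS x₀ v (fun x => (a x w : Ser N 0 1)) (δ w + frameDer Γ (a x₀ w))) :
    HasSmoothDerivS x₀ v (fun x => (yDer N).polyDiff g 1 (a x))
      (∑ w, (yDer N).polyDiff g 1 (update (a x₀) w (δ w)) +
        frameDer Γ ((yDer N).polyDiff g 1 (a x₀)) +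
        (yDer N).polyDiff (symbolDer Γ _ g) 1 (a x₀)) := by
  induction g using symbol_induction generalizing a δ with
  | one =>
    have h := hasSmoothDerivS_prod ha univ
    simp only [polyDiff_one, one_mul, Derivation.map_one_eq_zero, polyDiff_zero, add_zero]
    refine h.of_eq ?_
    rw [AddSubmonoidClass.coe_finsetSum]
  | add g h hg hh =>
    simp only [polyDiff_add, map_add, sum_add_distrib]
    refine ((hg ha).add (hh ha)).of_eq ?_
    abel
  | smul r g hg =>
    simp only [polyDiff_smul, Derivation.map_smul, map_smul, ← smul_sum, ← smul_add]
    exact (hg ha).const_smul r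
  | X_mul s g hg =>
    obtain ⟨u, l⟩ := s
    have hder : symbolDer Γ _ (X (u, l) * g) = X (u, l) *
        symbolDer Γ _ g + ∑ i, Γ i l • (X (u, i) * g) := by
      rw [Derivation.leibniz, symbolDer_X, smul_eq_mul, smul_eq_mul, mul_sum]
      simp only [mul_smul_comm, mul_comm g, smul_mul_assoc]
    rw [hder, polyDiff_add, polyDiff_sum]
    cases u with
    | none =>
      simp only [polyDiff_smul, polyDiff_X_none, d_one, polyDiff_zero_left, map_zero, smul_zero,
        sum_const_zero, add_zero]
      exact HasSmoothDerivS.const 0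
    | some u =>
      simp only [polyDiff_smul, polyDiff_X_some]
      set δ' : V → 𝒵 (Ser N 0 1) := update δ u
        ((yDer N).dZ l (δ u) + ∑ i, Γ i l • (yDer N).dZ i (a x₀ u)) with hδ'
      have ha' (w : V) : HasSmoothDerivS x₀ v
          (fun x => (update (a x) u ((yDer N).dZ l (a x u)) w : Ser N 0 1))
          (δ' w + frameDer Γ (update (a x₀) u ((yDer N).dZ l (a x₀ u)) w)) := by
        by_cases hw : w = u
        · subst hw
          simp only [hδ', update_self]
          refine ((ha w).pderiv l).of_eq ?_
          change _ = _ + frameDer Γ ((yDer N).d l (a x₀ w))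
          rw [frameDer_d, map_add, AddMemClass.coe_add, AddSubmonoidClass.coe_finsetSum]
          change _ = (yDer N).d l (δ w) + ∑ i, Γ i l • (yDer N).d i (a x₀ w) + _
          abel
        · simp only [hδ', update_of_ne hw]
          exact ha w
      refine (hg ha').of_eq ?_
      have h1 : ∑ w, (yDer N).polyDiff g 1 (update (update (a x₀) u
          ((yDer N).dZ l (a x₀ u))) w (δ' w)) =
          ∑ w, (yDer N).polyDiff g 1 (update (update (a x₀) w (δ w)) u
            ((yDer N).dZ l (update (a x₀) w (δ w) u))) +
          ∑ i, Γ i l • (yDer N).polyDiff g 1 (update (a x₀) u ((yDer N).dZ i (a x₀ u))) := by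
        rw [← add_sum_erase _ _ (mem_univ u),
          ← add_sum_erase (a := u) _ (fun w => (yDer N).polyDiff g 1
            (update (update (a x₀) w (δ w)) u
            ((yDer N).dZ l (update (a x₀) w (δ w) u)))) (mem_univ u)]
        have h2 : ∑ w ∈ univ.erase u, (yDer N).polyDiff g 1 (update
            (update (a x₀) u ((yDer N).dZ l (a x₀ u))) w (δ' w)) =
            ∑ w ∈ univ.erase u, (yDer N).polyDiff g 1
            (update (update (a x₀) w (δ w)) u
            ((yDer N).dZ l (update (a x₀) w (δ w) u))) := by
          refine sum_congr rfl fun w hw => ?_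
          have hwu := Finset.ne_of_mem_erase hw
          rw [hδ', update_of_ne hwu, update_of_ne hwu.symm, update_comm hwu]
        rw [h2, hδ', update_self, update_idem, update_idem, update_self, polyDiff_slot_add]
        have h3 : (yDer N).polyDiff g 1 (update (a x₀) u
            (∑ i, Γ i l • (yDer N).dZ i (a x₀ u))) = ∑ i, Γ i l •
            (yDer N).polyDiff g 1 (update (a x₀) u ((yDer N).dZ i (a x₀ u))) := by
          refine (map_sum ((yDer N).polyDiffSlot g 1 (a x₀) u) _ _).trans ?_
          exact sum_congr rfl fun i _ => map_smul ((yDer N).polyDiffSlot g 1 (a x₀) u) _ _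
        rw [h3]
        abel
      rw [h1]
      abel

lemma hasSmoothDerivS_polyDiff {g : M → 𝒫[Option V, N]}
    {g' : 𝒫[Option V, N]} (hg : HasSmoothDerivP x₀ v g g')
    {a : M → V → 𝒵 (Ser N 0 1)} {δ : V → 𝒵 (Ser N 0 1)}
    (ha : ∀ w, HasSmoothDerivS x₀ v (fun x => (a x w : Ser N 0 1)) (δ w + frameDer Γ (a x₀ w))) :
    HasSmoothDerivS x₀ v (fun x => (yDer N).polyDiff (g x) 1 (a x))
      (∑ w, (yDer N).polyDiff (g x₀) 1 (update (a x₀) w (δ w)) +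
        frameDer Γ ((yDer N).polyDiff (g x₀) 1 (a x₀)) +
        (yDer N).polyDiff (g' + symbolDer Γ _ (g x₀)) 1 (a x₀)) := by
  induction hg with
  | smul p p' g hp =>
    have h := HasSmoothDerivS.smul hp (hasSmoothDerivS_polyDiff_const g ha)
    simp only [polyDiff_add, polyDiff_smul, Derivation.map_smul, map_smul, ← smul_sum]
    refine h.of_eq ?_
    simp only [smul_add]
    abel
  | add g₁ g₂ c₁ c₂ _ _ h₁ h₂ =>
    simp only [polyDiff_add, map_add, sum_add_distrib] at h₁ h₂ ⊢
    refine (h₁.add h₂).of_eq ?_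
    abel

/-- The total derivative of a Feynman integral, if the Poisson tensor is parallel. -/
lemma hasSmoothDerivS_wick {ϖ : M → 𝕄 N} (hϖ : ∀ i j, HasSmoothDeriv x₀ v (fun x => ϖ x i j)
      (-(Γ * ϖ x₀ + ϖ x₀ * Γ.transpose) i j))
    {a : M → V → 𝒵 (Ser N 0 1)} {δ : V → 𝒵 (Ser N 0 1)}
    (ha : ∀ w, HasSmoothDerivS x₀ v (fun x => (a x w : Ser N 0 1)) (δ w + frameDer Γ (a x₀ w))) :
    HasSmoothDerivS x₀ v (fun x => wick (yDer N) (ϖ x) 1 (a x))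
      (∑ w, wick (yDer N) (ϖ x₀) 1 (update (a x₀) w (δ w)) +
        frameDer Γ (wick (yDer N) (ϖ x₀) 1 (a x₀))) := by
  have h := HasSmoothDerivS.hs fun r =>
    hasSmoothDerivS_polyDiff (hasSmoothDerivP_wickSymbol Γ hϖ r) ha
  refine h.of_eq ?_
  simp only [neg_add_cancel, polyDiff_zero, add_zero]
  rw [hs_add, hs_sum, ← frameDer_hs]
  rfl

end WickDerivative

/-! ### Naturality under linear changes of the frame -/

section FrameChange

open CommDer

variable {N : ℕ} (A : 𝕄 N)

/-- `frameChange A` on formal power series. -/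
def frameHom : Formal N 0 1 →+* Formal N 0 1 := linSubstHom (Matrix.of fun p => fun q => A p.2 q.2)
    (Matrix.of (Sum.elim (fun t => t.elim0)
      (Sum.elim (fun i => Sum.elim 0 (Sum.elim (fun j => A i j) 0))
        (fun p => Sum.elim 0 (Sum.elim 0 (fun q => A p.2 q.2))))))

/-- `frameChange A` on power series in `ħ`. -/
def frameSer : Ser N 0 1 →+* Ser N 0 1 := PowerSeries.map (frameHom A)

lemma frameChange_emb (x : Ser N 0 1) : frameChange A (emb x) = emb (frameSer A x) := by
  rw [frameSer, ← cmap_ringHom]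
  exact mapCoeff_emb _ _

lemma frameChange_hbarPow_mul (m : ℤ) (s : BV N) :
    frameChange A (hbarPow m * s) = hbarPow m * frameChange A s :=
  mapCoeff_hbarPow_mul _ m s

lemma frameSer_smul (c : ℝ) (x : Ser N 0 1) : frameSer A (c • x) = c • frameSer A x :=
  map_real_smul (fun c x => linSubst_smul _ _ c x) c x

lemma frameSer_one_matrix (x : Ser N 0 1) : frameSer 1 x = x := by
  refine PowerSeries.ext fun n => ?_
  rw [frameSer, coeff_map]
  have h1 : (Matrix.of fun (p q : Fin 1 × Fin N) => (1 : 𝕄 N) p.2 q.2) = 1 := by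
    ext p q
    rw [Matrix.of_apply, Matrix.one_apply, Matrix.one_apply]
    exact if_congr ⟨fun h => Prod.ext (Subsingleton.elim _ _) h, fun h => h ▸ rfl⟩ rfl rfl
  have h2 : (Matrix.of (Sum.elim (fun t => t.elim0)
      (Sum.elim (fun i => Sum.elim 0 (Sum.elim (fun j => (1 : 𝕄 N) i j) 0))
        (fun p => Sum.elim 0 (Sum.elim 0 (fun q => (1 : 𝕄 N) p.2 q.2))))) :
      Matrix (OddIdx N 0 1) (OddIdx N 0 1) ℝ) = 1 := by
    ext p q
    rcases p with p | p | ⟨p, i⟩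
    · exact p.elim0
    · rcases q with q | q | q
      · exact q.elim0
      · simp [Matrix.one_apply]
      · simp [Matrix.one_apply]
    · rcases q with q | q | ⟨q, j⟩
      · exact q.elim0
      · simp [Matrix.one_apply]
      · have : p = q := Subsingleton.elim _ _
        subst this
        simp [Matrix.one_apply]
  change linSubst _ _ _ = _
  rw [h1, h2, linSubst_id]

lemma yDer_frameSer (j : Fin N) (x : Ser N 0 1) :
    (yDer N).d j (frameSer A x) = ∑ i, A i j • frameSer A ((yDer N).d i x) := by
  refine PowerSeries.ext fun n => ?_
  simp only [← frameSer_smul]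
  rw [coeff_yDer, map_sum, frameSer, coeff_map]
  refine (pderivHom_linSubst _ _ (0, j) _).trans ?_
  rw [Fintype.sum_prod_type, Fin.sum_univ_one]
  refine sum_congr rfl fun i _ => ?_
  rw [coeff_map]
  exact (linSubst_smul _ _ _ _).symm

lemma frameHom_oddFormal_dy (i : Fin N) : frameHom A (oddFormal 𝕪 i) =
    ∑ j, A i j • oddFormal 𝕪 j := by
  refine (linSubst_C _ _ _).trans ?_
  rw [oddGen, ExteriorAlgebra.map_apply_ι, Matrix.vecMulLinear_apply, Matrix.single_one_vecMul]
  have h (c : ℝ) (z : Grassmann N 0 1) : c • (MvPowerSeries.C z : Formal N 0 1) =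
      MvPowerSeries.C (c • z) := by
    refine MvPowerSeries.ext fun β => ?_
    rw [coeff_real_smul, MvPowerSeries.coeff_C, MvPowerSeries.coeff_C, smul_ite, smul_zero]
  simp only [oddFormal, h, ← map_sum, oddGen, ← map_smul]
  refine congrArg _ (congrArg _ ?_)
  funext q
  rw [Finset.sum_apply]
  rcases q with q | q | ⟨q, j⟩
  · exact q.elim0
  · simp
  · have : q = 0 := Subsingleton.elim _ _
    subst this
    simp [Pi.single_apply]

lemma frameSer_oddSer_dy (i : Fin N) : frameSer A (oddSer 𝕪 i) = ∑ j, A i j • oddSer 𝕪 j := by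
  refine PowerSeries.ext fun n => ?_
  have h (c : ℝ) (z : Ser N 0 1) : coeff n (c • z) = c • coeff n z := rfl
  rw [frameSer, coeff_map, map_sum]
  simp only [h, oddSer, PowerSeries.coeff_C]
  split_ifs
  · exact frameHom_oddFormal_dy A i
  · simp only [map_zero, smul_zero, sum_const_zero]

lemma frameSer_negDTMSer (x : Ser N 0 1) : frameSer A (negDTMSer x) = negDTMSer (frameSer A x) := by
  simp only [negDTMSer_eq, map_neg, map_sum, map_mul, frameSer_oddSer_dy, yDer_frameSer,
    sum_mul, mul_sum, smul_mul_assoc, mul_smul_comm]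
  rw [sum_comm]

lemma frameSer_hs (ψ : ℕ → Ser N 0 1) :
    frameSer A (hs ψ) = hs fun r => frameSer A (ψ r) := hs_map _ _

lemma frameSer_shiftDown (k : ℕ) (x : Ser N 0 1) :
    frameSer A (shiftDown k x) = shiftDown k (frameSer A x) := by
  refine PowerSeries.ext fun n => ?_
  rw [frameSer, coeff_map, shiftDown, shiftDown, coeff_mk, coeff_mk, coeff_map]

lemma HasBidegree.frameSer {x : Ser N 0 1} (hx : HasBidegree 1 0 x) :
    HasBidegree 1 0 (FedosovBV.frameSer A x) := by
  intro n β
  rw [FedosovBV.frameSer, coeff_map]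
  change MvPowerSeries.coeff β (linSubst _ _ _) ∈ _
  rw [coeff_linSubst]
  refine sum_mem fun α _ => Submodule.smul_mem _ _ ?_
  have h := hx n α
  rw [bidegree, pow_one, pow_zero, mul_one] at h ⊢
  generalize MvPowerSeries.coeff α (coeff n x) = z at h ⊢
  induction h using Submodule.span_induction with
  | mem z hz =>
    obtain ⟨i, rfl⟩ := hz
    change ExteriorAlgebra.map _ (ExteriorAlgebra.ι ℝ (Pi.single 𝕩 i 1)) ∈ _
    rw [ExteriorAlgebra.map_apply_ι, Matrix.vecMulLinear_apply, Matrix.single_one_vecMul]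
    have h1 : (Matrix.of (Sum.elim (fun t => t.elim0)
      (Sum.elim (fun i => Sum.elim 0 (Sum.elim (fun j => A i j) 0))
        (fun p => Sum.elim 0 (Sum.elim 0 (fun q => A p.2 q.2))))) :
      Matrix (OddIdx N 0 1) (OddIdx N 0 1) ℝ) 𝕩 i = ∑ j, A i j • Pi.single 𝕩 j 1 := by
      funext q
      rw [Finset.sum_apply]
      rcases q with q | q | q
      · exact q.elim0
      · simp [Pi.single_apply]
      · simp
    have h2 := congrArg (ExteriorAlgebra.ι ℝ) h1
    rw [map_sum] at h2
    refine (congrArg (· ∈ _) h2).mpr (sum_mem fun j _ => ?_)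
    rw [map_smul]
    exact Submodule.smul_mem _ _ (Submodule.subset_span ⟨j, rfl⟩)
  | zero => rw [map_zero]; exact zero_mem _
  | add y z _ _ hy hz => rw [map_add]; exact add_mem hy hz
  | smul c z _ hz => rw [map_smul]; exact Submodule.smul_mem _ _ hz

/-- The effect of a change of the frame on the symbols. -/
def frameSymbol (U : Type*) : 𝒫[U, N] →ₐ[ℝ] 𝒫[U, N] := aeval fun p => ∑ i, A i p.2 • X (p.1, i)

variable {U : Type*}

lemma frameSymbol_X (u : U) (l : Fin N) : frameSymbol A U (X (u, l)) = ∑ i, A i l • X (u, i) :=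
  aeval_X _ _

lemma frameSymbol_contrSymbol (ϖ : 𝕄 N) (u w : U) :
    frameSymbol A U (contrSymbol ϖ u w) = contrSymbol (A * ϖ * A.transpose) u w := by
  simp only [contrSymbol, map_sum, map_smul, map_mul, frameSymbol_X, sum_mul, mul_sum,
    smul_mul_smul_comm, smul_sum, smul_smul, Matrix.mul_apply, Matrix.transpose_apply,
    sum_smul]
  refine (sum_congr rfl fun i _ => sum_comm.trans ((sum_congr rfl fun l _ =>
    sum_comm).trans sum_comm)).trans (sum_comm.trans
      (sum_congr rfl fun k _ => sum_comm.trans (sum_congr rfl fun l _ =>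
        sum_comm.trans (sum_congr rfl fun j _ => sum_congr rfl fun i _ => ?_))))
  rw [mul_left_comm, mul_assoc]

lemma frameSymbol_wickSymbol (ϖ : 𝕄 N) [Fintype U] [DecidableEq U] (r : ℕ) :
    frameSymbol A U (wickSymbol ϖ U r) = wickSymbol (A * ϖ * A.transpose) U r := by
  simp only [wickSymbol_eq_sum, map_sum, map_smul, map_prod, frameSymbol_contrSymbol]

variable {V : Type*} [Fintype V] [DecidableEq V]

lemma frameSer_polyDiff (g : 𝒫[Option V, N]) (x : Ser N 0 1)
    (a a' : V → 𝒵 (Ser N 0 1)) (ha : ∀ v, (a' v : Ser N 0 1) = frameSer A (a v)) :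
    frameSer A ((yDer N).polyDiff (frameSymbol A _ g) x a) =
      (yDer N).polyDiff g (frameSer A x) a' := by
  induction g using symbol_induction generalizing x a a' with
  | one =>
    have h (s : Finset V) : ((∏ v ∈ s, a' v : 𝒵 (Ser N 0 1)) : Ser N 0 1) =
        frameSer A (∏ v ∈ s, a v : 𝒵 (Ser N 0 1)) := by
      induction s using Finset.induction with
      | empty => simp only [Finset.prod_empty, OneMemClass.coe_one, map_one]
      | insert v s hv ih => simp only [prod_insert hv, MulMemClass.coe_mul, map_mul, ih, ha]
    rw [map_one, polyDiff_one, polyDiff_one, map_mul, h]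
  | add g h hg hh => simp only [map_add, polyDiff_add, hg _ _ _ ha, hh _ _ _ ha]
  | smul r g hg => simp only [map_smul, polyDiff_smul, frameSer_smul, hg _ _ _ ha]
  | X_mul s g hg =>
    obtain ⟨u, l⟩ := s
    rw [map_mul, frameSymbol_X, sum_mul, polyDiff_sum]
    simp only [smul_mul_assoc, polyDiff_smul]
    cases u with
    | none =>
      simp only [polyDiff_X_none, map_sum, frameSer_smul]
      rw [yDer_frameSer]
      refine Eq.trans ?_ (map_sum ((yDer N).polyDiffLeft g a') _ _).symm
      refine sum_congr rfl fun i _ => ?_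
      change _ = (yDer N).polyDiff g _ a'
      rw [← frameSer_smul, ← frameSer_smul, ← hg _ a a' ha]
      refine congrArg _ ?_
      rw [Algebra.smul_def (A i l) ((yDer N).d i x), polyDiff_const_mul_left, ← Algebra.smul_def]
      intro j
      rw [Algebra.algebraMap_eq_smul_one, map_smul, d_one, smul_zero]
    | some w =>
      simp only [polyDiff_X_some]
      have h1 : ∑ i, A i l • (yDer N).polyDiff (frameSymbol A _ g) x
          (update a w ((yDer N).dZ i (a w))) =
          (yDer N).polyDiff (frameSymbol A _ g) x
            (update a w (∑ i, A i l • (yDer N).dZ i (a w))) := by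
        refine Eq.trans ?_ (map_sum ((yDer N).polyDiffSlot (frameSymbol A _ g) x a w) _ _).symm
        exact sum_congr rfl fun i _ =>
          (map_smul ((yDer N).polyDiffSlot (frameSymbol A _ g) x a w) _ _).symm
      rw [h1]
      refine hg _ _ _ fun v => ?_
      by_cases hv : v = w
      · subst hv
        rw [update_self, update_self]
        change (yDer N).d l (a' v) = _
        rw [ha, yDer_frameSer, AddSubmonoidClass.coe_finsetSum, map_sum]
        refine sum_congr rfl fun i _ => ?_
        rw [← frameSer_smul]
        rfl
      · rw [update_of_ne hv, update_of_ne hv, ha]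

/-- Naturality of the Feynman integral. -/
lemma frameSer_wick (ϖ : 𝕄 N) (x : Ser N 0 1)
    (a a' : V → 𝒵 (Ser N 0 1)) (ha : ∀ v, (a' v : Ser N 0 1) = frameSer A (a v)) :
    frameSer A (wick (yDer N) (A * ϖ * A.transpose) x a) = wick (yDer N) ϖ (frameSer A x) a' := by
  rw [wick, frameSer_hs]
  simp only [← frameSymbol_wickSymbol, frameSer_polyDiff A _ _ a a' ha]
  rfl

variable {A} {b b' : 𝒵 (Ser N 0 1)}

lemma frameSer_wick_one (ϖ : 𝕄 N) (hb : (b' : Ser N 0 1) = frameSer A b)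
    (k : ℕ) : frameSer A (wick (yDer N) (A * ϖ * A.transpose) 1 (fun _ : Fin k => b)) =
      wick (yDer N) ϖ 1 (fun _ : Fin k => b') := by
  rw [frameSer_wick A ϖ 1 _ (fun _ => b') fun _ => hb, map_one]

lemma frameSer_connectedWick (ϖ : 𝕄 N) (hb : (b' : Ser N 0 1) = frameSer A b) (k : ℕ) :
    frameSer A (connectedWick (A * ϖ * A.transpose) (yDer N) b k) =
      connectedWick ϖ (yDer N) b' k := by
  induction k using Nat.strong_induction_on with
  | _ k ih =>
    rw [connectedWick_eq, connectedWick_eq, map_sub, map_sum, frameSer_wick_one ϖ hb]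
    refine congrArg _ (sum_congr rfl fun j hj => ?_)
    rw [map_nsmul, map_mul, ih j (mem_range.1 hj), frameSer_wick_one ϖ hb]

lemma frameSer_connectedSum (ϖ : 𝕄 N) (hb : (b' : Ser N 0 1) = frameSer A b) :
    frameSer A (connectedSum (A * ϖ * A.transpose) b) = connectedSum ϖ b' := by
  rw [connectedSum, connectedSum, map_sum]
  refine sum_congr rfl fun j _ => ?_
  rw [frameSer_smul, frameSer_shiftDown, frameSer_connectedWick ϖ hb]

lemma frameChange_wickSum (ϖ : 𝕄 N) (hb : (b' : Ser N 0 1) = frameSer A b) :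
    frameChange A (wickSum (A * ϖ * A.transpose) b) = wickSum ϖ b' := by
  rw [wickSum, wickSum, frameChange, mapCoeff_sum]
  refine sum_congr rfl fun k _ => ?_
  refine (frameChange_hbarPow_mul A _ _).trans ?_
  rw [frameChange_emb, frameSer_smul, frameSer_wick_one ϖ hb]

end FrameChange

/-! ### The coordinate frame and the Poisson tensor -/

section Frame

variable {N : ℕ} {M : Type*} [TopologicalSpace M] [ChartedSpace (Model N) M]
  [IsManifold 𝓘(ℝ, Model N) ∞ M]

/-- The matrix of the coordinate frame of the chart at `x₀` in the coordinate frame of the chart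
at `x`. -/
def frameMatrix (x₀ x : M) : 𝕄 N := Matrix.of fun i j => coords (coordField x₀ j x) i

lemma localRep_eq (x₀ : M) (s : M → BV N) (x : M) :
    localRep x₀ s x = frameChange (frameMatrix x₀ x) (s x) := rfl

lemma sum_coords_smul_frameVec (x : M) (v : 𝒯 N x) : ∑ i, coords v i • frameVec x i = v := by
  have h (w : Model N) : ∑ i, w i • EuclideanSpace.single i (1 : ℝ) = w := by
    ext j
    simp [Pi.single_apply]
  exact h v

lemma coordField_of_mem {x₀ x : M} (hx : x ∈ (chartTriv N x₀).baseSet) (i : Fin N) :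
    coordField x₀ i x = (chartTriv N x₀).symm x (EuclideanSpace.single i 1) := by
  rw [coordField, Trivialization.localFrame_apply_of_mem_baseSet _ _ hx]
  simp [Trivialization.basisAt, hx]

lemma coordField_self (x : M) (i : Fin N) : coordField x i x = frameVec x i := by
  rw [coordField_of_mem (FiberBundle.mem_baseSet_trivializationAt' x)]
  have h := TangentBundle.symmL_trivializationAt_eq_core (I := 𝓘(ℝ, Model N))
    (mem_chart_source (Model N) x)
  have h2 := DFunLike.congr_fun h (EuclideanSpace.single i (1 : ℝ))
  rw [Trivialization.symmL_apply _ (FiberBundle.mem_baseSet_trivializationAt' x)] at h2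
  refine h2.trans ?_
  exact (tangentBundleCore 𝓘(ℝ, Model N) M).coordChange_self _ _ (mem_chart_source (Model N) x) _

lemma frameMatrix_self (x : M) : frameMatrix x x = (1 : 𝕄 N) := by
  ext i j
  rw [frameMatrix, Matrix.of_apply, coordField_self, Matrix.one_apply]
  change (EuclideanSpace.single j (1 : ℝ) : Model N) i = _
  simp [PiLp.single_apply]

lemma isUnit_frameMatrix {x₀ x : M} (hx : x ∈ (chartTriv N x₀).baseSet) :
    IsUnit (frameMatrix (N := N) x₀ x) := by
  rw [← Matrix.mulVec_injective_iff_isUnit]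
  intro a b hab
  have h (a : Fin N → ℝ) : ∑ j, a j • coordField x₀ j x =
      ∑ i, (frameMatrix (N := N) x₀ x).mulVec a i • frameVec x i := by
    have h1 (j : Fin N) := sum_coords_smul_frameVec x (coordField x₀ j x)
    simp only [Matrix.mulVec, dotProduct, sum_smul, mul_comm, frameMatrix, Matrix.of_apply]
    rw [sum_comm]
    refine sum_congr rfl fun j _ => ?_
    conv_lhs => rw [← h1 j]
    rw [smul_sum]
    exact sum_congr rfl fun i _ => smul_smul _ _ _
  have h2 : ∑ j, (a j - b j) • coordField x₀ j x = 0 := by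
    simp only [sub_smul, sum_sub_distrib]
    rw [h a, h b, hab, sub_self]
  have h3 := ((Trivialization.isLocalFrameOn_localFrame_baseSet 𝓘(ℝ, Model N) ∞ (chartTriv N x₀)
    (EuclideanSpace.basisFun (Fin N) ℝ).toBasis).linearIndependent hx)
  funext j
  exact sub_eq_zero.1 (Fintype.linearIndependent_iff.1 h3 _ h2 j)

lemma contMDiffAt_coordField (x₀ : M) (i : Fin N) :
    ContMDiffAt 𝓘(ℝ, Model N) 𝓘(ℝ, Model N).tangent ∞
      (fun x => (⟨x, coordField x₀ i x⟩ : TangentBundle 𝓘(ℝ, Model N) M)) x₀ :=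
  contMDiffAt_localFrame_of_mem ∞ _ _ i (FiberBundle.mem_baseSet_trivializationAt' x₀)

/-- The components of a form in the coordinates of the chart at `x₀`. -/
def ClosedTwoForm.compAt (η : ClosedTwoForm N M) (x₀ x : M) : 𝕄 N :=
  Matrix.of fun i j => η.toFun x (coordField x₀ i x) (coordField x₀ j x)

lemma ClosedTwoForm.toFun_eq_sum (η : ClosedTwoForm N M) (x : M) (v w : 𝒯 N x) :
    η.toFun x v w = ∑ i, ∑ j, coords v i * coords w j * η.comp x i j := by
  conv_lhs => rw [← sum_coords_smul_frameVec x v, ← sum_coords_smul_frameVec x w]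
  simp only [map_sum, map_smul, _root_.sum_apply, _root_.smul_apply, smul_eq_mul, comp,
    Matrix.of_apply, mul_assoc, mul_sum]
  rw [sum_comm]
  refine sum_congr rfl fun i _ => sum_congr rfl fun j _ => ?_
  ring

lemma ClosedTwoForm.compAt_eq (η : ClosedTwoForm N M) (x₀ x : M) :
    η.compAt x₀ x = (frameMatrix (N := N) x₀ x).transpose * η.comp x * frameMatrix x₀ x := by
  ext a b
  rw [compAt, Matrix.of_apply, toFun_eq_sum]
  simp only [Matrix.mul_apply, Matrix.transpose_apply, frameMatrix, Matrix.of_apply, sum_mul]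
  rw [sum_comm]
  refine sum_congr rfl fun i _ => sum_congr rfl fun j _ => ?_
  ring

lemma ClosedTwoForm.compAt_self (η : ClosedTwoForm N M) (x : M) : η.compAt x x = η.comp x := by
  rw [compAt_eq, frameMatrix_self, Matrix.transpose_one, one_mul, mul_one]

lemma ClosedTwoForm.contMDiffAt_compAt (η : ClosedTwoForm N M) (x₀ : M) (i j : Fin N) :
    CMD N (fun x => η.compAt x₀ x i j) x₀ := by
  have h := ContMDiffAt.clm_bundle_apply₂ (E₃ := fun _ : M => ℝ) (F₃ := ℝ) (η.smooth x₀)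
    (contMDiffAt_coordField x₀ i) (contMDiffAt_coordField x₀ j)
  exact (contMDiffAt_section _).1 h

lemma HasSmoothDeriv.of_contMDiffAt {x₀ : M} {f : M → ℝ} (hf : CMD N f x₀) (v : 𝒯 N x₀) :
    HasSmoothDeriv x₀ v f (mvfderiv 𝓘(ℝ, Model N) f x₀ v) := ⟨hf, rfl⟩

lemma contMDiffAt_det {x₀ : M} {n : ℕ} {A : M → Matrix (Fin n) (Fin n) ℝ}
    (hA : ∀ i j, CMD N (fun x => A x i j) x₀) :
    CMD N (fun x => (A x).det) x₀ := by
  simp only [Matrix.det_apply']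
  exact contMDiffAt_finsetSum fun σ _ =>
    contMDiffAt_const.mul (contMDiffAt_finsetProd fun i _ => hA _ _)

lemma contMDiffAt_inv {x₀ : M} {n : ℕ} {A : M → Matrix (Fin n) (Fin n) ℝ}
    (hA : ∀ i j, CMD N (fun x => A x i j) x₀)
    (h0 : (A x₀).det ≠ 0) (i j : Fin n) :
    CMD N (fun x => (A x)⁻¹ i j) x₀ := by
  simp only [Matrix.inv_def, Ring.inverse_eq_inv', Matrix.smul_apply, smul_eq_mul]
  refine ((contMDiffAt_det hA).inv₀ h0).mul ?_
  simp only [Matrix.adjugate_apply]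
  refine contMDiffAt_det fun k l => ?_
  simp only [Matrix.updateRow_apply]
  split_ifs
  · exact contMDiffAt_const
  · exact hA k l

lemma SymplecticForm.isUnit_comp (Ω : SymplecticForm N M) (x : M) : IsUnit (Ω.comp x) := by
  rw [← Matrix.isUnit_transpose, ← Matrix.mulVec_injective_iff_isUnit]
  refine (injective_iff_map_eq_zero (Matrix.mulVecLin (Ω.comp x).transpose)).2 fun a ha => ?_
  have h : (show 𝒯 N x from WithLp.toLp 2 a) = 0 := by
    refine Ω.nondegenerate x _ fun w => ?_
    rw [ClosedTwoForm.toFun_eq_sum, sum_comm]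
    refine sum_eq_zero fun j _ => ?_
    have h1 := congrFun ha j
    simp only [Matrix.mulVecLin_apply, Matrix.mulVec, dotProduct, Matrix.transpose_apply,
      Pi.zero_apply] at h1
    calc _ = coords w j * ∑ i, Ω.comp x i j * a i := by
          rw [mul_sum]
          refine sum_congr rfl fun i _ => ?_
          change a i * _ * _ = _
          ring
      _ = 0 := by rw [h1, mul_zero]
  exact congrArg (fun w : Model N => w.ofLp) h

lemma SymplecticForm.poisson_antisymm (Ω : SymplecticForm N M) (x : M) (i j : Fin N) :
    Ω.poisson x j i = -Ω.poisson x i j := by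
  have h : (Ω.comp x).transpose = -Ω.comp x := by
    ext a b
    have h1 := Ω.alternating x (frameVec x a + frameVec x b)
    simp only [map_add, _root_.add_apply, Ω.alternating, zero_add, add_zero] at h1
    exact eq_neg_of_add_eq_zero_left h1
  have h2 := congrArg Inv.inv h
  have h3 : (-Ω.comp x)⁻¹ = -(Ω.comp x)⁻¹ := by
    refine Matrix.inv_eq_left_inv ?_
    rw [neg_mul_neg, Matrix.nonsing_inv_mul _ ((Matrix.isUnit_iff_isUnit_det _).1 (Ω.isUnit_comp x))]
  rw [h3, ← Matrix.transpose_nonsing_inv] at h2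
  exact congrFun (congrFun h2 i) j

/-- The Poisson tensor in the coordinates of the chart at `x₀`. -/
def SymplecticForm.poissonAt (Ω : SymplecticForm N M) (x₀ x : M) : 𝕄 N := (Ω.compAt x₀ x)⁻¹

lemma SymplecticForm.poissonAt_self (Ω : SymplecticForm N M) (x : M) :
    Ω.poissonAt x x = Ω.poisson x := by
  rw [poissonAt, ClosedTwoForm.compAt_self, poisson]

lemma SymplecticForm.isUnit_compAt (Ω : SymplecticForm N M) {x₀ x : M}
    (hx : x ∈ (chartTriv N x₀).baseSet) :
    IsUnit (Ω.compAt x₀ x) := by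
  have h := isUnit_frameMatrix hx
  rw [ClosedTwoForm.compAt_eq]
  exact (((Matrix.isUnit_transpose _).2 h).mul (Ω.isUnit_comp x)).mul h

/-- The Poisson tensor is a contravariant tensor. -/
lemma SymplecticForm.frameMatrix_poissonAt (Ω : SymplecticForm N M) {x₀ x : M}
    (hx : x ∈ (chartTriv N x₀).baseSet) :
    frameMatrix x₀ x * Ω.poissonAt x₀ x * (frameMatrix x₀ x).transpose = Ω.poisson x := by
  have h := (Matrix.isUnit_iff_isUnit_det _).1 (isUnit_frameMatrix hx)
  have h2 : IsUnit (frameMatrix (N := N) x₀ x).transpose.det := by rwa [Matrix.det_transpose]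
  rw [poissonAt, ClosedTwoForm.compAt_eq, Matrix.mul_inv_rev, Matrix.mul_inv_rev, poisson,
    ← mul_assoc, Matrix.mul_nonsing_inv _ h, one_mul, mul_assoc, Matrix.nonsing_inv_mul _ h2,
    mul_one]

/-- The matrix of Christoffel symbols for the derivative along `∂_j`. -/
def christoffelMatrix (cov : Connection N M) (x : M) (j : Fin N) : 𝕄 N :=
  Matrix.of fun i k => christoffel cov x i j k

/-- In coordinates, `∇ω = 0` determines the derivative of the components of the symplectic form. -/
lemma SymplecticForm.hasSmoothDeriv_compAt {Ω : SymplecticForm N M} {cov : Connection N M}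
    (hcov : IsSymplecticConnection Ω cov) (x₀ : M) (j a b : Fin N) :
    HasSmoothDeriv x₀ (frameVec x₀ j) (fun x => Ω.compAt x₀ x a b)
      (((christoffelMatrix cov x₀ j).transpose * Ω.comp x₀ +
        Ω.comp x₀ * christoffelMatrix cov x₀ j) a b) := by
  refine ⟨Ω.contMDiffAt_compAt x₀ a b, ?_⟩
  refine (hcov.compatible _ _ x₀ ((contMDiffAt_coordField x₀ a).mdifferentiableAt (by simp))
    ((contMDiffAt_coordField x₀ b).mdifferentiableAt (by simp)) (frameVec x₀ j)).trans ?_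
  have h1 (i k : Fin N) : coords (frameVec x₀ i) k = if k = i then 1 else 0 := by
    change (EuclideanSpace.single i (1 : ℝ) : Model N) k = _
    simp [Pi.single_apply]
  rw [coordField_self, coordField_self, ClosedTwoForm.toFun_eq_sum, ClosedTwoForm.toFun_eq_sum]
  simp only [h1, mul_ite, ite_mul, mul_one, one_mul, mul_zero, zero_mul, Finset.sum_ite_eq',
    mem_univ, if_true, Matrix.add_apply, Matrix.mul_apply, Matrix.transpose_apply]
  rw [sum_comm]
  simp only [Finset.sum_ite_eq', mem_univ, if_true, mul_comm (coords _ _)]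
  exact congrArg₂ _ (sum_congr rfl fun i _ => mul_comm _ _) rfl

lemma SymplecticForm.hasSmoothDeriv_poissonAt {Ω : SymplecticForm N M} {cov : Connection N M}
    (hcov : IsSymplecticConnection Ω cov) (x₀ : M) (j a b : Fin N) :
    HasSmoothDeriv x₀ (frameVec x₀ j) (fun x => Ω.poissonAt x₀ x a b)
      (-(christoffelMatrix cov x₀ j * Ω.poissonAt x₀ x₀ +
        Ω.poissonAt x₀ x₀ * (christoffelMatrix cov x₀ j).transpose) a b) := by
  have hd (x : M) (hx : x ∈ (chartTriv N x₀).baseSet) :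
      IsUnit (Ω.compAt x₀ x).det := (Matrix.isUnit_iff_isUnit_det _).1 (Ω.isUnit_compAt hx)
  have h0 := FiberBundle.mem_baseSet_trivializationAt' (F := Model N)
    (E := TangentSpace 𝓘(ℝ, Model N) (M := M)) x₀
  have hs (i k : Fin N) := HasSmoothDeriv.of_contMDiffAt (contMDiffAt_inv
    (fun i k => Ω.contMDiffAt_compAt x₀ i k) (hd x₀ h0).ne_zero i k) (frameVec x₀ j)
  set P' : 𝕄 N := Matrix.of fun i k => mvfderiv 𝓘(ℝ, Model N)
    (fun x => (Ω.compAt x₀ x)⁻¹ i k) x₀ (frameVec x₀ j) with hP'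
  -- Differentiate the product of the matrix with its inverse.
  have h1 : ((christoffelMatrix cov x₀ j).transpose * Ω.comp x₀ +
      Ω.comp x₀ * christoffelMatrix cov x₀ j) * (Ω.comp x₀)⁻¹ + Ω.comp x₀ * P' = 0 := by
    ext i k
    have h2 := HasSmoothDeriv.sum univ fun l _ => (hasSmoothDeriv_compAt hcov x₀ j i l).mul (hs l k)
    have h3 := (HasSmoothDeriv.const (x₀ := x₀) (v := frameVec x₀ j) ((1 : 𝕄 N) i k)).congr
      (g := fun x => ∑ l, Ω.compAt x₀ x i l * (Ω.compAt x₀ x)⁻¹ l k) (by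
        filter_upwards [(chartTriv N x₀).open_baseSet.mem_nhds h0] with x hx
        rw [← Matrix.mul_apply, Matrix.mul_nonsing_inv _ (hd x hx)])
    have h4 := h2.unique h3
    rw [sum_add_distrib] at h4
    rw [Matrix.add_apply, Matrix.mul_apply, Matrix.mul_apply, Matrix.zero_apply, ← h4,
      ClosedTwoForm.compAt_self]
    rfl
  have hu := (Matrix.isUnit_iff_isUnit_det _).1 (Ω.isUnit_comp x₀)
  have h5 := congrArg ((Ω.comp x₀)⁻¹ * ·) h1
  simp only [mul_add, add_mul, mul_zero] at h5
  have h6 : (Ω.comp x₀)⁻¹ * (Ω.comp x₀ * P') = P' := by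
    rw [← mul_assoc, Matrix.nonsing_inv_mul _ hu, one_mul]
  have h7 : (Ω.comp x₀)⁻¹ * ((christoffelMatrix cov x₀ j).transpose * Ω.comp x₀ *
      (Ω.comp x₀)⁻¹) = (Ω.comp x₀)⁻¹ * (christoffelMatrix cov x₀ j).transpose := by
    rw [mul_assoc (christoffelMatrix cov x₀ j).transpose, Matrix.mul_nonsing_inv _ hu, mul_one]
  have h8 : (Ω.comp x₀)⁻¹ * (Ω.comp x₀ * christoffelMatrix cov x₀ j * (Ω.comp x₀)⁻¹) =
      christoffelMatrix cov x₀ j * (Ω.comp x₀)⁻¹ := by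
    rw [← mul_assoc, ← mul_assoc, Matrix.nonsing_inv_mul _ hu, one_mul]
  rw [h6, h7, h8] at h5
  refine (hs a b).of_eq ?_
  have h9 : P' = -(christoffelMatrix cov x₀ j * Ω.poissonAt x₀ x₀ +
      Ω.poissonAt x₀ x₀ * (christoffelMatrix cov x₀ j).transpose) := by
    rw [Ω.poissonAt_self, SymplecticForm.poisson, add_comm (christoffelMatrix cov x₀ j * _)]
    exact eq_neg_of_add_eq_zero_right h5
  exact congrFun (congrFun h9 a) b

end Frame

/-! ### Covariant derivatives of sections -/

section Sections

variable {N : ℕ} {M : Type*} [TopologicalSpace M] [ChartedSpace (Model N) M]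
  [IsManifold 𝓘(ℝ, Model N) ∞ M] {x₀ : M} {v : 𝒯 N x₀}

/-- All the coefficients of the function `f` with values in the fibre are smooth at `x₀`, with
derivative along `v` the coefficient of `c`. -/
def HasSmoothDerivL (x₀ : M) (v : 𝒯 N x₀) (f : M → BV N) (c : BV N) : Prop :=
  ∀ m β, HasSmoothDerivV x₀ v (fun x => cf (f x) m β) (cf c m β)

namespace HasSmoothDerivL

lemma emb {f : M → Ser N 0 1} {c : Ser N 0 1} (hf : HasSmoothDerivS x₀ v f c) :
    HasSmoothDerivL x₀ v (fun x => FedosovBV.emb (f x)) (FedosovBV.emb c) := fun m β => by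
  rcases lt_or_ge m 0 with hm | hm
  · simp only [cf, coeff_emb_of_neg _ hm, map_zero]
    exact HasSmoothDerivV.const _
  · obtain ⟨n, rfl⟩ := Int.eq_ofNat_of_zero_le hm
    simp only [cf, coeff_emb_natCast]
    exact hf n β

lemma hbarPow_mul (k : ℤ) {f : M → BV N} {c : BV N} (hf : HasSmoothDerivL x₀ v f c) :
    HasSmoothDerivL x₀ v (fun x => hbarPow k * f x) (hbarPow k * c) := fun m β => by
  simp only [cf, coeff_hbarPow_mul]
  exact hf _ _

lemma sum {ι : Type*} (s : Finset ι) {f : ι → M → BV N} {c : ι → BV N}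
    (h : ∀ i ∈ s, HasSmoothDerivL x₀ v (f i) (c i)) :
    HasSmoothDerivL x₀ v (fun x => ∑ i ∈ s, f i x) (∑ i ∈ s, c i) := fun m β => by
  simp only [cf, HahnSeries.coeff_sum, map_sum]
  exact HasSmoothDerivV.sum s fun i hi => h i hi m β

lemma congr {f g : M → BV N} {c : BV N} (hf : HasSmoothDerivL x₀ v f c)
    (h : f =ᶠ[nhds x₀] g) : HasSmoothDerivL x₀ v g c := fun m β =>
  (hf m β).congr (h.mono fun x hx => by dsimp only; rw [hx])

lemma partialXSection_eq {j : Fin N} {s : M → BV N} {c : BV N}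
    (h : HasSmoothDerivL x₀ (frameVec x₀ j) (localRep x₀ s) c) : partialXSection x₀ j s = c := by
  refine mkLaurent_eq fun m => MvPowerSeries.ext fun β => ?_
  refine Eq.trans ?_ ((grBasis N 0 1).sum_repr (cf c m β))
  change ∑ b, partialX x₀ j (fun x => (grBasis N 0 1).repr (cf (localRep x₀ s x) m β) b) •
    grBasis N 0 1 b = _
  refine sum_congr rfl fun b _ => ?_
  exact congrArg (· • _) (h m β ((grBasis N 0 1).coord b)).2

end HasSmoothDerivL

/-- The infinitesimal change of the frame on the fibres. -/
def frameDerBV (Γ : 𝕄 N) (s : BV N) : BV N :=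
  ∑ i, ∑ k, Γ i k • (yvar 0 k * partialY 0 i s + dy 0 k * iotaY 0 i s)

lemma frameDerBV_emb (Γ : 𝕄 N) (z : Ser N 0 1) : frameDerBV Γ (emb z) = emb (frameDer Γ z) := by
  simp only [frameDer_apply, map_sum, emb_smul, map_add, map_mul, frameDerBV, yvar_eq_emb,
    dy_eq_emb, partialY_emb, iotaY, contract_emb]
  rfl

lemma frameDerBV_hbarPow_mul (Γ : 𝕄 N) (m : ℤ) (s : BV N) :
    frameDerBV Γ (hbarPow m * s) = hbarPow m * frameDerBV Γ s := by
  have h (c : ℝ) (t : BV N) : c • (hbarPow m * t) = hbarPow m * (c • t) := by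
    ext1; funext n
    rw [coeff_real_smul_fib, coeff_hbarPow_mul, coeff_hbarPow_mul, coeff_real_smul_fib]
  simp only [frameDerBV, partialY, iotaY, contract, mapCoeff_hbarPow_mul, ← mul_assoc,
    ← hbarPow_mul_comm m]
  simp only [mul_assoc, ← mul_add, h, ← mul_sum]

lemma frameDerBV_sum (Γ : 𝕄 N) {ι : Type*} (t : Finset ι) (s : ι → BV N) :
    frameDerBV Γ (∑ c ∈ t, s c) = ∑ c ∈ t, frameDerBV Γ (s c) := by
  simp only [frameDerBV, partialY, iotaY, contract, mapCoeff_sum, mul_sum,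
    ← sum_add_distrib, smul_sum]
  symm
  rw [sum_comm]
  exact sum_congr rfl fun i _ => sum_comm

lemma nabla_eq (cov : Connection N M) {s : M → BV N} {c : Fin N → BV N}
    (h : ∀ j, HasSmoothDerivL x₀ (frameVec x₀ j) (localRep x₀ s) (c j)) :
    nabla cov s x₀ = ∑ j, dx j * (c j - frameDerBV (christoffelMatrix cov x₀ j) (s x₀)) := by
  simp only [nabla, (h _).partialXSection_eq]
  rfl

/-- A section without negative powers of `ħ` as a power series in `ħ`. -/
def serOf (s : BV N) : Ser N 0 1 := PowerSeries.mk fun n => s.coeff n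

lemma emb_serOf {s : BV N} (h : ∀ m < 0, s.coeff m = 0) : emb (serOf s) = s := by
  ext1; funext m
  rcases lt_or_ge m 0 with hm | hm
  · rw [coeff_emb_of_neg _ hm, h m hm]
  · obtain ⟨n, rfl⟩ := Int.eq_ofNat_of_zero_le hm
    rw [coeff_emb_natCast, serOf, coeff_mk]

variable {γ : M → BV N}

lemma IsWeylForm.emb_serOf {p : ℕ} (hγ : IsWeylForm p γ) (x : M) : emb (serOf (γ x)) = γ x :=
  FedosovBV.emb_serOf fun m hm => hγ.hbar_nonneg x m hm

lemma IsWeylForm.hasBidegree {p : ℕ} (hγ : IsWeylForm p γ) (x : M) :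
    HasBidegree p 0 (serOf (γ x)) := fun n β => by
  rw [serOf, coeff_mk]
  exact hγ.degree x n β

/-- The coefficients of a section in the coordinates of the chart at `x₀`. -/
def serAt (x₀ : M) (γ : M → BV N) (x : M) : Ser N 0 1 := frameSer (frameMatrix x₀ x) (serOf (γ x))

lemma serAt_self (x₀ : M) (γ : M → BV N) : serAt x₀ γ x₀ = serOf (γ x₀) := by
  rw [serAt, frameMatrix_self, frameSer_one_matrix]

lemma IsWeylForm.localRep_eq {p : ℕ} (hγ : IsWeylForm p γ) (x₀ x : M) :
    localRep x₀ γ x = emb (serAt x₀ γ x) := by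
  conv_lhs => rw [FedosovBV.localRep_eq, ← hγ.emb_serOf x, frameChange_emb]
  rfl

/-- The derivative of the coefficients of a section along a vector, coefficient by coefficient. -/
def serAtDeriv (x₀ : M) (v : 𝒯 N x₀) (γ : M → BV N) : Ser N 0 1 :=
  PowerSeries.mk fun n => fun β => ∑ b, mvfderiv 𝓘(ℝ, Model N) (fun x =>
    (grBasis N 0 1).repr (MvPowerSeries.coeff β (coeff n (serAt x₀ γ x))) b) x₀ v • grBasis N 0 1 b

lemma IsWeylForm.hasSmoothDerivS {p : ℕ} (hγ : IsWeylForm p γ) (x₀ : M) (v : 𝒯 N x₀) :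
    HasSmoothDerivS x₀ v (serAt x₀ γ) (serAtDeriv x₀ v γ) := fun n β => by
  refine HasSmoothDerivV.of_basis (grBasis N 0 1) fun i => ?_
  have h1 := hγ.smooth x₀ n β ((grBasis N 0 1).coord i)
  simp only [hγ.localRep_eq, cf, coeff_emb_natCast] at h1
  refine (HasSmoothDeriv.of_contMDiffAt h1 v).of_eq ?_
  have h2 : MvPowerSeries.coeff β (coeff n (serAtDeriv x₀ v γ)) =
      ∑ b, mvfderiv 𝓘(ℝ, Model N) (fun x => (grBasis N 0 1).repr
        (MvPowerSeries.coeff β (coeff n (serAt x₀ γ x))) b) x₀ v • grBasis N 0 1 b :=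
    congrArg (MvPowerSeries.coeff β) (coeff_mk _ _)
  rw [h2, Basis.repr_sum_self]
  rfl

/-- The covariant derivative of a Weyl form along `∂_j`. -/
def covDeriv (cov : Connection N M) (γ : M → BV N) (x₀ : M) (j : Fin N) : Ser N 0 1 :=
  serAtDeriv x₀ (frameVec x₀ j) γ - frameDer (christoffelMatrix cov x₀ j) (serOf (γ x₀))

lemma IsWeylForm.nabla_eq {p : ℕ} (hγ : IsWeylForm p γ) (cov : Connection N M) (x₀ : M) :
    nabla cov γ x₀ = emb (∑ j, oddSer 𝕩 j * covDeriv cov γ x₀ j) := by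
  have h (j : Fin N) : HasSmoothDerivL x₀ (frameVec x₀ j) (localRep x₀ γ)
      (emb (serAtDeriv x₀ (frameVec x₀ j) γ)) := by
    have h1 := HasSmoothDerivL.emb (hγ.hasSmoothDerivS x₀ (frameVec x₀ j))
    exact h1.congr (Filter.Eventually.of_forall fun x => (hγ.localRep_eq x₀ x).symm)
  rw [FedosovBV.nabla_eq cov h, map_sum]
  refine sum_congr rfl fun j _ => ?_
  rw [dx_eq_emb, map_mul, covDeriv, map_sub, ← frameDerBV_emb, hγ.emb_serOf]

lemma IsWeylForm.hasBidegree_covDeriv (hγ : IsWeylForm 1 γ) (cov : Connection N M) (x₀ : M)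
    (j : Fin N) : HasBidegree 1 0 (covDeriv cov γ x₀ j) := by
  refine HasBidegree.sub ?_ ((hγ.hasBidegree x₀).frameDer _)
  exact (hγ.hasSmoothDerivS x₀ (frameVec x₀ j)).hasBidegree fun x => (hγ.hasBidegree x).frameSer _

/-- The central element `-d_TM g`, the common argument of the Feynman integral. -/
def vertex {g : Ser N 0 1} (hg : HasBidegree 1 0 g) : 𝒵 (Ser N 0 1) :=
  ⟨negDTMSer g, hg.negDTMSer.mem_center⟩

/-- The derivative of the summands of the Feynman integral. -/
lemma IsWeylForm.hasSmoothDerivS_wick {Ω : SymplecticForm N M} {cov : Connection N M}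
    (hcov : IsSymplecticConnection Ω cov) (hγ : IsWeylForm 1 γ) (x₀ : M) (j : Fin N) (k : ℕ) :
    HasSmoothDerivS x₀ (frameVec x₀ j)
      (fun x => wick (yDer N) (Ω.poissonAt x₀ x) 1 (fun _ : Fin k =>
        vertex ((hγ.hasBidegree x).frameSer (frameMatrix x₀ x))))
      (∑ w : Fin k, wick (yDer N) (Ω.poisson x₀) 1 (update
        (fun _ => vertex (hγ.hasBidegree x₀)) w (vertex (hγ.hasBidegree_covDeriv cov x₀ j))) +
        frameDer (christoffelMatrix cov x₀ j) (wick (yDer N) (Ω.poisson x₀) 1 (fun _ : Fin k =>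
          vertex (hγ.hasBidegree x₀)))) := by
  have h0 : vertex ((hγ.hasBidegree x₀).frameSer (frameMatrix x₀ x₀)) =
      vertex (hγ.hasBidegree x₀) := by
    refine Subtype.ext ?_
    change negDTMSer (serAt x₀ γ x₀) = negDTMSer (serOf (γ x₀))
    rw [serAt_self]
  have h := FedosovBV.hasSmoothDerivS_wick (Γ := christoffelMatrix cov x₀ j) (V := Fin k)
    (ϖ := Ω.poissonAt x₀) (fun a b => SymplecticForm.hasSmoothDeriv_poissonAt hcov x₀ j a b)
    (a := fun x _ => vertex ((hγ.hasBidegree x).frameSer (frameMatrix x₀ x)))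
    (δ := fun _ => vertex (hγ.hasBidegree_covDeriv cov x₀ j)) (fun w => by
      refine ((hγ.hasSmoothDerivS x₀ (frameVec x₀ j)).negDTMSer).of_eq ?_
      rw [h0]
      change _ = negDTMSer (covDeriv cov γ x₀ j) + frameDer _ (negDTMSer (serOf (γ x₀)))
      rw [frameDer_negDTMSer, covDeriv, negDTMSer, negDTMSer, negDTMSer, map_sub, sub_add_cancel])
  rw [h0, Ω.poissonAt_self] at h
  exact h

end Sections

/-! ### The quantum master equation -/

section Main

variable {N : ℕ}

/-- Every argument can be exchanged with the first one, because the mean over all the configurations of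
points on the circle is symmetric. -/
lemma wick_update_swap (ϖ : 𝕄 N) {k : ℕ}
    (a : Fin k → 𝒵 (Ser N 0 1)) (w : Fin k) (z : 𝒵 (Ser N 0 1)) :
    wick (yDer N) ϖ 1 (update a w z) = wick (yDer N) ϖ z (update a w 1) := by
  refine congrArg hs (funext fun r => ?_)
  have h := CommDer.polyDiff_swap (D := yDer N) (wickSymbol ϖ (Option (Fin k)) r) w 1 z a
  rw [rename_wickSymbol_equiv] at h
  exact h

lemma sum_oddSer_mul_wick_update (ϖ : 𝕄 N) {k : ℕ} (a : Fin k → 𝒵 (Ser N 0 1)) (w : Fin k)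
    (z : Fin N → 𝒵 (Ser N 0 1)) :
    ∑ j, oddSer 𝕩 j * wick (yDer N) ϖ 1 (update a w (z j)) =
      wick (yDer N) ϖ (∑ j, oddSer 𝕩 j * (z j : Ser N 0 1)) (update a w 1) := by
  refine Eq.trans (sum_congr rfl fun j _ => ?_)
    (map_sum (wickLeft (yDer N) ϖ (update a w 1)) _ _).symm
  rw [wick_update_swap]
  exact (wick_const_mul (yDer_oddSer _) _ _).symm

lemma sum_oddSer_mul_negDTMSer (z : Fin N → Ser N 0 1) : ∑ j, oddSer 𝕩 j * negDTMSer (z j) =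
      -negDTMSer (∑ j, oddSer 𝕩 j * z j) := by
  have h (j : Fin N) : negDTMSer (oddSer 𝕩 j * z j) = -(oddSer 𝕩 j * negDTMSer (z j)) := by
    simp only [negDTMSer_eq, yDer_oddSer_mul, mul_neg, neg_neg, mul_sum]
    rw [← sum_neg_distrib]
    refine sum_congr rfl fun i _ => ?_
    have h1 := congrArg (PowerSeries.C (R := Formal N 0 1))
      (oddFormal_mul_comm (N := N) (T := 0) (k := 1) 𝕪 i 𝕩 j)
    rw [map_neg, map_mul, map_mul] at h1
    have h2 : oddSer 𝕪 i * oddSer 𝕩 j = -(oddSer 𝕩 j * oddSer 𝕪 i : Ser N 0 1) := h1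
    rw [← mul_assoc, h2, neg_mul, neg_neg, mul_assoc]
  have h2 : negDTMSer (∑ j, oddSer 𝕩 j * z j) =
      ∑ j, negDTMSer (oddSer 𝕩 j * z j) := map_sum (cmapLin (negDTM N)) _ _
  rw [h2, sum_congr rfl fun j _ => h j, sum_neg_distrib, neg_neg]

variable {M : Type*} [TopologicalSpace M] [ChartedSpace (Model N) M]
  [IsManifold 𝓘(ℝ, Model N) ∞ M] {Ω : SymplecticForm N M} {cov : Connection N M} {γ : M → BV N}

lemma IsWeylForm.localRep_wickSum (Ω : SymplecticForm N M) (hγ : IsWeylForm 1 γ) {x₀ x : M}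
    (hx : x ∈ (chartTriv N x₀).baseSet) :
    localRep x₀ (fun x => wickSum (Ω.poisson x) (vertex (hγ.hasBidegree x))) x =
      wickSum (Ω.poissonAt x₀ x) (vertex ((hγ.hasBidegree x).frameSer (frameMatrix x₀ x))) := by
  rw [FedosovBV.localRep_eq, ← Ω.frameMatrix_poissonAt hx]
  exact frameChange_wickSum _ (frameSer_negDTMSer _ _).symm

lemma eventually_mem_baseSet (x₀ : M) : ∀ᶠ x in nhds x₀, x ∈ (chartTriv N x₀).baseSet :=
  (chartTriv N x₀).open_baseSet.mem_nhds (FiberBundle.mem_baseSet_trivializationAt' x₀)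

/-- The exterior covariant derivative of the Feynman integral. -/
lemma IsWeylForm.nabla_wickSum (hcov : IsSymplecticConnection Ω cov) (hγ : IsWeylForm 1 γ)
    {x₀ : M} {y : Ser N 0 1} (hy : nabla cov γ x₀ = emb y) :
    nabla cov (fun x => wickSum (Ω.poisson x) (vertex (hγ.hasBidegree x))) x₀ =
      ∑ k ∈ range (N + 1), hbarPow (-(k : ℤ)) * emb (((k.factorial : ℝ)⁻¹) •
        ∑ v : Fin k, wick (yDer N) (Ω.poisson x₀) (-negDTMSer y)
          (update (fun _ => vertex (hγ.hasBidegree x₀)) v 1)) := by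
  have h (j : Fin N) := HasSmoothDerivL.congr (HasSmoothDerivL.sum (range (N + 1)) fun k _ =>
    HasSmoothDerivL.hbarPow_mul (-(k : ℤ)) (HasSmoothDerivL.emb
      ((hγ.hasSmoothDerivS_wick hcov x₀ j k).const_smul ((k.factorial : ℝ)⁻¹))))
    ((eventually_mem_baseSet x₀).mono fun x hx => (hγ.localRep_wickSum Ω hx).symm)
  have hy' : y = ∑ j, oddSer 𝕩 j * covDeriv cov γ x₀ j :=
    emb_injective (hy.symm.trans (hγ.nabla_eq cov x₀))
  rw [FedosovBV.nabla_eq cov h, wickSum]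
  simp only [frameDerBV_sum, frameDerBV_hbarPow_mul, frameDerBV_emb, ← sum_sub_distrib,
    ← mul_sub, ← map_sub, map_smul, ← smul_sub, add_sub_cancel_right, mul_sum, dx_eq_emb]
  rw [sum_comm]
  refine sum_congr rfl fun k _ => ?_
  have h1 (j : Fin N) (z : Ser N 0 1) : emb (oddSer 𝕩 j) *
      (hbarPow (-(k : ℤ)) * emb z) = hbarPow (-(k : ℤ)) * emb (oddSer 𝕩 j * z) := by
    rw [← mul_assoc, ← hbarPow_mul_comm, mul_assoc, ← map_mul]
  simp only [h1, ← mul_sum, ← map_sum, mul_smul_comm, ← smul_sum]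
  congr 3
  simp only [mul_sum]
  rw [sum_comm]
  refine sum_congr rfl fun v _ => ?_
  rw [sum_oddSer_mul_wick_update]
  refine congrArg (fun z => wick (yDer N) (Ω.poisson x₀) z _) ?_
  rw [hy', ← sum_oddSer_mul_negDTMSer]
  rfl

lemma negDTMSer_eq_zero {z : Ser N 0 1} (h : ∀ i, (yDer N).d i z = 0) : negDTMSer z = 0 := by
  simp only [negDTMSer_eq, h, mul_zero, sum_const_zero, neg_zero]

/-- The curvature as a power series. -/
def curvatureSer (Ω : SymplecticForm N M) (cov : Connection N M) (x : M) : Ser N 0 1 :=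
  (1 / 4 : ℝ) • ∑ i, ∑ j, ∑ k, ∑ l, (∑ m, Ω.comp x i m * curvature cov x m j k l) •
    (ySer i * (ySer j * (oddSer 𝕩 k * oddSer 𝕩 l)))

lemma curvatureForm_eq_emb (x : M) : curvatureForm Ω cov x = emb (curvatureSer Ω cov x) := by
  simp only [curvatureForm, curvatureSer, emb_smul, map_sum, map_mul, yvar_eq_emb, dx_eq_emb,
    mul_assoc]

lemma hasBidegree_oddSer_dx (k : Fin N) : HasBidegree 1 0 (oddSer 𝕩 k) := by
  intro n β
  classical
  rw [oddSer, PowerSeries.coeff_C]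
  split_ifs
  · rw [oddFormal, MvPowerSeries.coeff_C]
    split_ifs
    · rw [bidegree, pow_one, pow_zero, mul_one]
      exact Submodule.subset_span ⟨k, rfl⟩
    · exact zero_mem _
  · rw [map_zero]
    exact zero_mem _

lemma hasBidegree_curvatureSer (x : M) : HasBidegree 2 0 (curvatureSer Ω cov x) :=
  HasBidegree.smul _ (HasBidegree.sum fun _ _ => HasBidegree.sum fun _ _ =>
    HasBidegree.sum fun k _ => HasBidegree.sum fun l _ => HasBidegree.smul _
      (hasBidegree_ySer_mul (hasBidegree_ySer_mul (((hasBidegree_oddSer_dx k).mul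
        (hasBidegree_oddSer_dx l)).of_eq one_add_one_eq_two (zero_add 0)) _) _))

lemma yDer_yDer_yDer_curvatureSer (x : M) (a b c : Fin N) :
    (yDer N).d a ((yDer N).d b ((yDer N).d c (curvatureSer Ω cov x))) = 0 := by
  have h (i k : Fin N) (p : Fin N) : (yDer N).d p (if i = k then (1 : Ser N 0 1) else 0) = 0 := by
    split_ifs
    · exact CommDer.d_one _ _
    · exact map_zero _
  simp only [curvatureSer, map_smul, map_sum, CommDer.leibniz, map_add, yDer_ySer, h,
    yDer_oddSer, zero_mul, mul_zero, add_zero, zero_add, smul_zero, sum_const_zero]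

/-- `ω_ħ` as a power series. -/
def omegaSer (Ω : SymplecticForm N M) (ηs : ℕ+ → ClosedTwoForm N M) (x : M) : Ser N 0 1 :=
  PowerSeries.mk fun m => if h : 0 < m then (ηs ⟨m, h⟩).toSection x else - Ω.toSection x

lemma omegaHbar_eq_emb (ηs : ℕ+ → ClosedTwoForm N M) (x : M) :
    omegaHbar Ω ηs x = emb (omegaSer Ω ηs x) := rfl

lemma yDer_omegaSer (ηs : ℕ+ → ClosedTwoForm N M) (x : M) (i : Fin N) :
    (yDer N).d i (omegaSer Ω ηs x) = 0 := by
  have h (η : ClosedTwoForm N M) : pderivLin (0, i) (η.toSection x) = 0 := by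
    simp only [ClosedTwoForm.toSection, map_smul, map_sum, map_mul]
    refine (congrArg _ (sum_eq_zero fun j _ => sum_eq_zero fun k _ => ?_)).trans (smul_zero _)
    change _ • pderivLin (0, i) (oddFormal _ * oddFormal _) = 0
    rw [pderivLin_mul, pderivLin_oddFormal, pderivLin_oddFormal, zero_mul, mul_zero, add_zero,
      smul_zero]
  refine PowerSeries.ext fun n => ?_
  rw [coeff_yDer, omegaSer, coeff_mk, map_zero]
  split_ifs
  · exact h _
  · rw [map_neg, h, neg_zero]

lemma half_smul_sub_neg_one_pow_smul {E : Type*} [AddCommGroup E] [Module ℝ E] (z : E) :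
    (1 / 2 : ℝ) • (z - ((-1 : ℝ) ^ (1 * 1)) • z) = z := by
  rw [mul_one, pow_one, neg_one_smul, sub_neg_eq_add, ← two_smul ℝ z, smul_smul]
  norm_num

lemma FedosovEquation.emb_eq {ηs : ℕ+ → ClosedTwoForm N M} (hF : FedosovEquation Ω cov ηs γ)
    (hγ : IsWeylForm 1 γ) {x : M} {y : Ser N 0 1} (hy : nabla cov γ x = emb y) :
    PowerSeries.X * y + starProd (yDer N) (Ω.poisson x) (serOf (γ x)) (serOf (γ x)) +
      PowerSeries.X * curvatureSer Ω cov x = PowerSeries.X * omegaSer Ω ηs x := by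
  have h := congrArg (hbarPow 1 * ·) (hF x)
  have hm : moyal (Ω.poisson x) (γ x) (γ x) =
      emb (starProd (yDer N) (Ω.poisson x) (serOf (γ x)) (serOf (γ x))) := by
    rw [← moyal_emb, hγ.emb_serOf]
  have h2 : (1 / 2 : ℝ) • (hbarPow (-1) * starComm (Ω.poisson x) 1 1 (γ x) (γ x)) =
      hbarPow (-1) * moyal (Ω.poisson x) (γ x) (γ x) := by
    ext1; funext n
    rw [coeff_real_smul_fib, coeff_hbarPow_mul, coeff_hbarPow_mul, starComm, HahnSeries.coeff_sub,
      coeff_real_smul_fib]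
    exact half_smul_sub_neg_one_pow_smul _
  simp only [hy, h2, hm, curvatureForm_eq_emb, omegaHbar_eq_emb, mul_add] at h
  rw [← mul_assoc (hbarPow 1) (hbarPow (-1)), hbarPow_mul_hbarPow, add_neg_cancel, hbarPow_zero,
    one_mul] at h
  simp only [← emb_X, ← map_mul, ← map_add] at h
  exact emb_injective h

lemma nabla_wickSum_add_eq_zero {ηs : ℕ+ → ClosedTwoForm N M}
    (hcov : IsSymplecticConnection Ω cov) (hγ : IsWeylForm 1 γ) (hF : FedosovEquation Ω cov ηs γ)
    (x : M) :
    nabla cov (fun x => wickSum (Ω.poisson x) (vertex (hγ.hasBidegree x))) x +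
      hbarPow 1 * bvDelta (Ω.poisson x) (wickSum (Ω.poisson x) (vertex (hγ.hasBidegree x))) +
      hbarPow (-1) * dTM 0 (curvatureForm Ω cov x) *
        wickSum (Ω.poisson x) (vertex (hγ.hasBidegree x)) = 0 := by
  have hy := hγ.nabla_eq cov x
  have h := X_mul_negDTMSer_of_fedosov (hγ.hasBidegree x) rfl
    (negDTMSer_eq_zero (yDer_omegaSer ηs x)) (hF.emb_eq hγ hy)
  rw [hγ.nabla_wickSum hcov hy, curvatureForm_eq_emb, dTM_emb, ← map_neg]
  refine masterEquation_of_fedosov (Ω.poisson_antisymm x) (hγ.hasBidegree x) _ rfl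
    ((hasBidegree_curvatureSer x).negDTMSer.neg) (fun i j => ?_) h
  rw [map_neg, map_neg, ← negDTMSer_d, ← negDTMSer_d, negDTMSer_eq_zero fun a =>
    yDer_yDer_yDer_curvatureSer x a i j, neg_zero]

lemma SymplecticForm.contMDiffAt_poissonAt (Ω : SymplecticForm N M) (x₀ : M) (i j : Fin N) :
    CMD N (fun x => Ω.poissonAt x₀ x i j) x₀ :=
  contMDiffAt_inv (fun i k => Ω.contMDiffAt_compAt x₀ i k)
    ((Matrix.isUnit_iff_isUnit_det _).1 (Ω.isUnit_compAt
      (FiberBundle.mem_baseSet_trivializationAt' x₀))).ne_zero i j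

lemma IsWeylForm.exists_hasSmoothDerivS_wick (Ω : SymplecticForm N M) (hγ : IsWeylForm 1 γ)
    (x₀ : M) (k : ℕ) : ∃ c, HasSmoothDerivS x₀ 0
      (fun x => wick (yDer N) (Ω.poissonAt x₀ x) 1 (fun _ : Fin k =>
        vertex ((hγ.hasBidegree x).frameSer (frameMatrix x₀ x)))) c := by
  have hs := hγ.hasSmoothDerivS x₀ 0
  refine ⟨_, FedosovBV.hasSmoothDerivS_wick (Γ := 0) (V := Fin k) (ϖ := Ω.poissonAt x₀)
    (fun i j => ⟨Ω.contMDiffAt_poissonAt x₀ i j, ?_⟩)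
    (a := fun x _ => vertex ((hγ.hasBidegree x).frameSer (frameMatrix x₀ x)))
    (δ := fun _ => vertex (hs.hasBidegree fun x => (hγ.hasBidegree x).frameSer _)) fun w => ?_⟩
  · rw [map_zero, zero_mul, Matrix.transpose_zero, mul_zero, add_zero]
    exact neg_zero.symm
  · refine hs.negDTMSer.of_eq ?_
    rw [frameDer_apply]
    simp only [Matrix.zero_apply, zero_smul, sum_const_zero, add_zero]
    rfl

lemma IsWeylForm.exists_hasSmoothDerivS_connectedWick (Ω : SymplecticForm N M)
    (hγ : IsWeylForm 1 γ) (x₀ : M) (k : ℕ) : ∃ c, HasSmoothDerivS x₀ 0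
      (fun x => connectedWick (Ω.poissonAt x₀ x) (yDer N)
        (vertex ((hγ.hasBidegree x).frameSer (frameMatrix x₀ x))) k) c := by
  induction k using Nat.strong_induction_on with
  | _ k ih =>
    choose! c hc using ih
    choose d hd using hγ.exists_hasSmoothDerivS_wick Ω x₀
    have h := (hd (k + 1)).add ((HasSmoothDerivS.sum (range k) fun j hj =>
      ((hc j (mem_range.1 hj)).mul (hd (k - j))).const_smul (k.choose j : ℝ)).const_smul (-1))
    refine ⟨_, h.congr (Filter.Eventually.of_forall fun x => ?_)⟩
    dsimp only
    rw [connectedWick_eq, neg_one_smul, ← sub_eq_add_neg]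
    simp only [Nat.cast_smul_eq_nsmul]

lemma IsWeylForm.isSmoothSection_connectedSum (Ω : SymplecticForm N M) (hγ : IsWeylForm 1 γ) :
    IsSmoothSection fun x =>
      (emb (connectedSum (Ω.poisson x) (vertex (hγ.hasBidegree x))) : BV N) := by
  intro x₀ m β ℓ
  choose c hc using hγ.exists_hasSmoothDerivS_connectedWick Ω x₀
  have h := HasSmoothDerivL.emb (HasSmoothDerivS.sum (range N) fun j _ =>
    ((hc j).shiftDown j).const_smul (((j + 1).factorial : ℝ)⁻¹))
  refine (h.congr (g := localRep x₀ fun x =>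
    (emb (connectedSum (Ω.poisson x) (vertex (hγ.hasBidegree x))) : BV N))
    ((eventually_mem_baseSet (N := N) x₀).mono fun x hx => ?_) m β ℓ).1
  dsimp only
  rw [FedosovBV.localRep_eq, ← Ω.frameMatrix_poissonAt hx, frameChange_emb]
  exact congrArg emb (frameSer_connectedSum _ (frameSer_negDTMSer _ _).symm).symm

lemma IsWeylForm.gammaInfty_eq (Ω : SymplecticForm N M) (hγ : IsWeylForm 1 γ) (x : M) :
    gammaInfty (Ω.poisson x) (γ x) =
      emb (connectedSum (Ω.poisson x) (vertex (hγ.hasBidegree x))) := by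
  conv_lhs => rw [← hγ.emb_serOf x]
  exact gammaInfty_emb (Ω.poisson_antisymm x) (hγ.hasBidegree x) _ rfl

lemma IsWeylForm.exp_gammaInfty (Ω : SymplecticForm N M) (hγ : IsWeylForm 1 γ) (x : M) :
    IsNilpotent.exp (hbarPow (-1) * gammaInfty (Ω.poisson x) (γ x)) =
      wickSum (Ω.poisson x) (vertex (hγ.hasBidegree x)) := by
  rw [hγ.gammaInfty_eq]
  exact exp_connectedSum (Ω.poisson_antisymm x) (hγ.hasBidegree x).negDTMSer

lemma IsWeylForm.feynmanIntegral_eq (Ω : SymplecticForm N M) (hγ : IsWeylForm 1 γ) (x : M) :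
    feynmanIntegral (Ω.poisson x) (γ x) = wickSum (Ω.poisson x) (vertex (hγ.hasBidegree x)) := by
  conv_lhs => rw [← hγ.emb_serOf x]
  exact feynmanIntegral_emb (Ω.poisson_antisymm x) (hγ.hasBidegree x) _ rfl

end Main

end FedosovBV

end

theorem mainTheorem3 {n : ℕ} {M : Type*} [TopologicalSpace M] [T2Space M] [SigmaCompactSpace M]
    [ChartedSpace (Model (2 * n)) M] [IsManifold 𝓘(ℝ, Model (2 * n)) ∞ M]
    (Ω : SymplecticForm (2 * n) M) (cov : Connection (2 * n) M)
    (hcov : IsSymplecticConnection Ω cov)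
    (ηs : ℕ+ → ClosedTwoForm (2 * n) M)
    (γ : M → BV (2 * n)) (hγ : IsWeylForm 1 γ) (hF : FedosovEquation Ω cov ηs γ) :
    (∀ x, IsNilpotent.exp (hbarPow (-1) * gammaInfty (Ω.poisson x) (γ x)) =
      feynmanIntegral (Ω.poisson x) (γ x)) ∧
    IsNilpotentSolutionQME Ω cov (fun x => gammaInfty (Ω.poisson x) (γ x)) := by
  have hb (x : M) := (hγ.hasBidegree x).negDTMSer
  have hΓ : (fun x => gammaInfty (Ω.poisson x) (γ x)) = fun x =>
      (emb (connectedSum (Ω.poisson x) (vertex (hγ.hasBidegree x))) : BV (2 * n)) :=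
    funext (hγ.gammaInfty_eq Ω)
  refine ⟨fun x => ?_, ?_, fun x m hm => ?_, fun x m β => ?_, ⟨2 * n + 1, fun x => ?_⟩, fun x => ?_⟩
  · rw [hγ.exp_gammaInfty, ← hγ.feynmanIntegral_eq]
  · rw [hΓ]
    exact hγ.isSmoothSection_connectedSum Ω
  · rw [hγ.gammaInfty_eq, coeff_emb_of_neg _ hm]
  · rw [hγ.gammaInfty_eq]
    rcases lt_or_ge m 0 with hm | hm
    · rw [cf, coeff_emb_of_neg _ hm, map_zero]
      exact zero_mem _
    · obtain ⟨m, rfl⟩ := Int.eq_ofNat_of_zero_le hm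
      rw [cf, coeff_emb_natCast]
      exact iSup_le (fun r => le_iSup (fun p => bidegree (2 * n) p p) (r + 1))
        (coeff_connectedSum_mem (hb x) m β)
  · rw [hγ.gammaInfty_eq, ← map_pow, connectedSum_pow_eq_zero (hb x), map_zero]
  · simp only [hγ.exp_gammaInfty]
    exact nabla_wickSum_add_eq_zero hcov hγ hF x
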